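/- **Setting.** Let $A$ be a complex $n\times n$ matrix with zero diagonal whose eigenvalues $\mu_1,\dots,\mu_n$ satisfy $\operatorname{Re}\mu_1<\dots<\operatorname{Re}\mu_n$, $\operatorname{Re}\mu_k\ne0$, and $\mu_j-\mu_k\notin\mathbb Z$ for $j\neq k$. Let $B=\operatorname{diag}(b_1,\dots,b_n)$, where $b_1,\dots,b_n$ are nonzero and distinct, no three of them lie on a line, and $\sum_j b_j=0$. Let $S$ be an open sector with vertex $0$ on which $\operatorname{Re}(xb_j)\ne\operatorname{Re}(xb_k)$ for all $j\ne k$. Let $R_1,\dots,R_n$ be the ordering of $b_1,\dots,b_n$ with $\operatorname{Re}(R_1x)<\dots<\operatorname{Re}(R_nx)$ on $S$, and let $\mathfrak f_k$ be the standard basis vector $\mathfrak e_j$ with $b_j=R_k$. Powers $x^{\mu}$ on $\overline S\setminus\{0\}$ are formed with a fixed continuous branch of the logarithm. Let $c_1,\dots,c_n$ and $e_1,\dots,e_n$ be solutions of $y'=x^{-1}Ay+By$ on $\overline S\setminus\{0\}$ such that * $c_k(x)=x^{\mu_k}\hat c_k(x)$ with $\hat c_k$ entire, $\hat c_k(0)=\mathfrak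 h_k$ an eigenvector of $A$ for $\mu_k$, and $\det(c_1(x),\dots,c_n(x))\equiv1$; * $e_k(x)=\exp(xR_k)\bigl(\mathfrak f_k+O(x^{-1})\bigr)$ for $x\in\overline S$, $|x|\ge1$. Put $C_k(x,\rho)=c_k(\rho x)$ and $E_k(x,\rho)=e_k(\rho x)$. Give $\wedge^m\mathbb C^n$ the $l_1$ norm of the coordinates in the standard basis. For an increasing multi-index $\alpha=(\alpha_1,\dots,\alpha_m)$ let $\alpha'$ be the complementary increasing multi-index and $u_\alpha=u_{\alpha_1}\wedge\dots\wedge u_{\alpha_m}$. For $h\in\wedge^n\mathbb C^n$ define $|h|\in\mathbb C$ by $h=|h|\,\mathfrak e_1\wedge\dots\wedge\mathfrak e_n$. For a matrix $V$ let $$V^{(m)}(v_1\wedge\dots\wedge v_m)=\sum_{j}v_1\wedge\dots\wedge Vv_j\wedge\dots\wedge v_m ,$$ and put $$G_m(x,t,\rho)f=\sum_{\alpha}|\mathfrak h_\alpha\wedge\mathfrak h_{\alpha'}|\,|f\wedge C_{\alpha'}(t,\rho)|\,C_\alpha(x,\rho).$$ Let $\mathcal X_p$ be the Banach space of matrix functions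 $q$ on $(0,\infty)$ with zero diagonal and entries in $L_1(0,\infty)\cap L_p(0,\infty)$. For $q\in\mathcal X_p$, $\rho\in\overline S\setminus\{0\}$ and $1\le k\le n$, let $T_k(q,\cdot,\rho)$ and $F_k(q,\cdot,\rho)$ denote the solutions on $(0,\infty)$ of $$Y(x)=T_k^0(x,\rho)+\int_0^xG_{n-k+1}(x,t,\rho)\,q^{(n-k+1)}(t)Y(t)\,dt,\qquad T_k^0=C_k\wedge\dots\wedge C_n,$$ $$Y(x)=F_k^0(x,\rho)-\int_x^\infty G_k(x,t,\rho)\,q^{(k)}(t)Y(t)\,dt,\qquad F_k^0=E_1\wedge\dots\wedge E_k,$$ (the integrands being integrable) that satisfy, for some constant $M$ and all $x>0$, $$\|Y(x)\|\le M\,|(\rho x)^{\sum_{j\in\alpha}\mu_j}|\ \text{ if } |\rho x|\le1,\qquad \|Y(x)\|\le M\,\bigl|\exp\bigl(\rho x\textstyle\sum_{j\in\alpha}R_j\bigr)\bigr|\ \text{ if } |\rho x|>1,$$ with $\alpha=(k,\dots,n)$ for $T_k$ and $\alpha=(1,\dots,k)$ for $F_k$. Let $W_1,\dots,W_n$ be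 weights: continuous zero-free functions on $\overline S\setminus\{0\}$ with $W_k(\xi)/\xi^{\mu_k}\to1$ as $\xi\to0$ and $W_k(\xi)=\exp(R_k\xi)$ for $|\xi|>1$. (For instance the functions $W_k(\xi)=W_0(\xi^{\mu_k})\exp(R_k\xi)$ for $|\xi|\le1$, $W_k(\xi)=\exp(R_k\xi)$ for $|\xi|>1$, where $W_0(z)=(1-|z|)z+|z|^2$ for $|z|\le1$ and $W_0(z)=1/W_0(1/z)$ for $|z|>1$, whenever these are continuous and zero-free on $\overline S\setminus\{0\}$.) Put $\overleftarrow W^k=\prod_{j=k}^nW_j$ and $\overrightarrow W^k=\prod_{j=1}^kW_j$. For a closed set $L$ let $C_0(L)$ be the continuous functions on $L$ vanishing at infinity, with the sup norm. For a ray $l=\{zt:t\ge0\}$ let $\mathcal H(l)=C_0(l)\cap L_2(l)$. $BC$ denotes bounded continuous functions and $C(X,Y)$ continuous maps. **Theorem 1.** Suppose $p>2$. Then for every $k=1,\dots,n$: I. For all $q\in\mathcal X_p$ and $\rho\in\overline S\setminus\{0\}$ the tensor $T_k(q,\cdot,\rho)$ exists, is unique, and has the form $$T_k(q,x,\rho)=T_k^0(x,\rho)+\overleftarrow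 W^k(\rho x)\,\hat T_k(q,x,\rho),\qquad x>0,$$ where $\hat T_k\in C\bigl(\mathcal X_p,BC([0,\infty),C_0(\overline S))\bigr)$. Moreover, for every ray $l=\{zt:t\ge0\}$ with $z\in\overline S\setminus\{0\}$ the restriction $\hat T_k|_l$ belongs to $C\bigl(\mathcal X_p,BC([0,\infty),\mathcal H(l))\bigr)$. II. For all $q\in\mathcal X_p$ and $\rho\in\overline S\setminus\{0\}$ the tensor $F_k(q,\cdot,\rho)$ exists, is unique, and has the form $$F_k(q,x,\rho)=F_k^0(x,\rho)+\overrightarrow W^k(\rho x)\,\hat F_k(q,x,\rho),\qquad x>0,$$ where $\hat F_k\in C\bigl(\mathcal X_p,BC([0,\infty),C_0(\overline S))\bigr)$. Moreover, for every ray $l=\{zt:t\ge0\}$ with $z\in\overline S\setminus\{0\}$ the restriction $\hat F_k|_l$ belongs to $C\bigl(\mathcal X_p,BC([0,\infty),\mathcal H(l))\bigr)$. -/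

import Mathlib

open Set Filter Topology MeasureTheory
open scoped NNReal ENNReal BoundedContinuousFunction ZeroAtInfty Matrix

namespace WeylTensor

noncomputable section

/-! ### Exterior powers of `ℂⁿ` -/

/-- The space `∧^m ℂ^n`. -/
abbrev Tensor (n m : ℕ) : Type := ⋀[ℂ]^m (Fin n → ℂ)

/-- The coordinates of an `m`-vector with respect to the standard basis `𝔢_α`, where `α` runs over
the increasing multi-indices (equivalently the subsets) of length `m`. -/
def tensorCoord (n m : ℕ) :
    Tensor n m →ₗ[ℂ] PiLp 1 (fun _ : Set.powersetCard (Fin n) m => ℂ) :=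
  (WithLp.linearEquiv 1 ℂ (Set.powersetCard (Fin n) m → ℂ)).symm.toLinearMap ∘ₗ
    ((Pi.basisFun ℂ (Fin n)).exteriorPower m).equivFun.toLinearMap

theorem tensorCoord_injective (n m : ℕ) : Function.Injective (tensorCoord n m) :=
  (WithLp.linearEquiv 1 ℂ (Set.powersetCard (Fin n) m → ℂ)).symm.injective.comp
    ((Pi.basisFun ℂ (Fin n)).exteriorPower m).equivFun.injective

/-- `∧^m ℂ^n` carries the `l₁` norm of the coordinates. -/
instance (n m : ℕ) : NormedAddCommGroup (Tensor n m) :=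
  NormedAddCommGroup.induced (Tensor n m) (PiLp 1 (fun _ : Set.powersetCard (Fin n) m => ℂ))
    (tensorCoord n m) (tensorCoord_injective n m)

instance (n m : ℕ) : NormedSpace ℂ (Tensor n m) :=
  NormedSpace.induced ℂ (Tensor n m) (PiLp 1 (fun _ : Set.powersetCard (Fin n) m => ℂ))
    (tensorCoord n m)

theorem tensor_norm_eq {n m : ℕ} (f : Tensor n m) :
    ‖f‖ = ∑ α, ‖((Pi.basisFun ℂ (Fin n)).exteriorPower m).repr f α‖ := by
  change ‖tensorCoord n m f‖ = _
  rw [PiLp.norm_eq_of_nat 1 (by norm_num)]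
  simp [tensorCoord]

/-- `u_α = u_{α₁} ∧ ⋯ ∧ u_{α_m}`. -/
abbrev wedge {n m : ℕ} (u : Fin n → Fin n → ℂ) (α : Set.powersetCard (Fin n) m) : Tensor n m :=
  exteriorPower.ιMulti_family ℂ m u α

/-- `u_{α'}`, where `α'` is the increasing multi-index complementary to `α`. -/
abbrev wedgeCompl {n m : ℕ} (u : Fin n → Fin n → ℂ) (α : Set.powersetCard (Fin n) m) :
    Tensor n (α : Finset (Fin n))ᶜ.card :=
  wedge u (Set.powersetCard.ofCard (rfl : (α : Finset (Fin n))ᶜ.card = _))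

/-- The number `|h|` with `h = |h| 𝔢₁ ∧ ⋯ ∧ 𝔢_n`, for `h` of degree `n`. -/
def topCoeff {n : ℕ} (h : ExteriorAlgebra ℂ (Fin n → ℂ)) : ℂ :=
  (Pi.basisFun ℂ (Fin n)).ExteriorAlgebra.repr h Finset.univ

theorem eq_topCoeff_smul {n : ℕ} (h : Tensor n n) :
    h = topCoeff (h : ExteriorAlgebra ℂ (Fin n → ℂ)) •
      exteriorPower.ιMulti ℂ n (Pi.basisFun ℂ (Fin n)) := by
  have hc : (Finset.univ : Finset (Fin n)).card = n := by simp
  have hw : exteriorPower.ιMulti_family ℂ n (Pi.basisFun ℂ (Fin n)) (Set.powersetCard.ofCard hc) =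
      exteriorPower.ιMulti ℂ n (Pi.basisFun ℂ (Fin n)) := by
    rw [exteriorPower.ιMulti_family]
    congr 1
    funext i
    have hi := congrFun (Finset.orderEmbOfFin_unique hc (f := id) (fun x => Finset.mem_univ x)
      strictMono_id) i
    simp only [Function.comp, Set.powersetCard.ofFinEmbEquiv_symm_apply]
    exact congrArg _ hi.symm
  have hu : (Pi.basisFun ℂ (Fin n)).ExteriorAlgebra Finset.univ =
      exteriorPower.ιMulti ℂ n (Pi.basisFun ℂ (Fin n)) := by
    rw [ExteriorAlgebra.basis_apply_ofCard _ hc, ← hw]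
    rfl
  have hsum := ((Pi.basisFun ℂ (Fin n)).exteriorPower n).sum_repr h
  have huniq : ∀ α : Set.powersetCard (Fin n) n, α = Set.powersetCard.ofCard hc := fun α =>
    Subtype.ext (Finset.eq_univ_of_card _ (by simp))
  rw [Finset.sum_eq_single (Set.powersetCard.ofCard hc) (fun α _ hα => (hα (huniq α)).elim)
    (by simp), exteriorPower.basis_apply, hw] at hsum
  rw [← hsum]
  simp [topCoeff, ← hu]

/-- The alternating map `(v₁, …, v_m) ↦ ∑ⱼ v₁ ∧ ⋯ ∧ V vⱼ ∧ ⋯ ∧ v_m`. -/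
def derivAlt {n : ℕ} (V : Matrix (Fin n) (Fin n) ℂ) (m : ℕ) :
    (Fin n → ℂ) [⋀^Fin m]→ₗ[ℂ] Tensor n m :=
  { (∑ j : Fin m, (exteriorPower.ιMulti ℂ m).toMultilinearMap.compLinearMap
      (fun i => if i = j then V.mulVecLin else LinearMap.id) :
      MultilinearMap ℂ (fun _ : Fin m => Fin n → ℂ) (Tensor n m)) with
    map_eq_zero_of_eq' := by
      intro v i i' hv hne
      have hz : ∀ j, j ≠ i → j ≠ i' → exteriorPower.ιMulti ℂ m
          (fun l => (if l = j then V.mulVecLin else LinearMap.id) (v l)) = 0 := fun j hj hj' =>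
        (exteriorPower.ιMulti ℂ m).map_eq_zero_of_eq _
          (by simp [Ne.symm hj, Ne.symm hj', hv]) hne
      have hs : exteriorPower.ιMulti ℂ m
            (fun l => (if l = i' then V.mulVecLin else LinearMap.id) (v l)) =
          -exteriorPower.ιMulti ℂ m
            (fun l => (if l = i then V.mulVecLin else LinearMap.id) (v l)) := by
        rw [← (exteriorPower.ιMulti ℂ m).map_swap _ hne]
        congr 1
        funext l
        rcases eq_or_ne l i with rfl | h1
        · simp [hne, hne.symm, hv]
        rcases eq_or_ne l i' with rfl | h2
        · simp [hv]
        · simp [h1, h2, Equiv.swap_apply_of_ne_of_ne]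
      change (∑ j : Fin m, (exteriorPower.ιMulti ℂ m).toMultilinearMap.compLinearMap
        (fun i => if i = j then V.mulVecLin else LinearMap.id)) v = 0
      rw [sum_apply]
      change (∑ j, exteriorPower.ιMulti ℂ m
        (fun l => (if l = j then V.mulVecLin else LinearMap.id) (v l))) = 0
      rw [Finset.sum_eq_add i i' hne (fun j _ hj => hz j hj.1 hj.2) (by simp) (by simp), hs,
        add_neg_cancel] }

theorem derivAlt_apply {n m : ℕ} (V : Matrix (Fin n) (Fin n) ℂ) (v : Fin m → Fin n → ℂ) :
    derivAlt V m v = ∑ j, exteriorPower.ιMulti ℂ m (Function.update v j (V *ᵥ v j)) := by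
  change (∑ j : Fin m, (exteriorPower.ιMulti ℂ m).toMultilinearMap.compLinearMap
        (fun i => if i = j then V.mulVecLin else LinearMap.id)) v = _
  rw [sum_apply]
  refine Finset.sum_congr rfl fun j _ => ?_
  change exteriorPower.ιMulti ℂ m
    (fun l => (if l = j then V.mulVecLin else LinearMap.id) (v l)) = _
  congr 1
  funext l
  rcases eq_or_ne l j with rfl | h
  · simp
  · simp [h]

/-- The operator `V^{(m)}` acting in `∧^m ℂ^n`. -/
def tensorDeriv {n : ℕ} (V : Matrix (Fin n) (Fin n) ℂ) (m : ℕ) : Tensor n m →ₗ[ℂ] Tensor n m :=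
  exteriorPower.alternatingMapLinearEquiv (derivAlt V m)

theorem tensorDeriv_ιMulti {n m : ℕ} (V : Matrix (Fin n) (Fin n) ℂ) (v : Fin m → Fin n → ℂ) :
    tensorDeriv V m (exteriorPower.ιMulti ℂ m v) =
      ∑ j, exteriorPower.ιMulti ℂ m (Function.update v j (V *ᵥ v j)) := by
  rw [tensorDeriv, exteriorPower.alternatingMapLinearEquiv_apply_ιMulti, derivAlt_apply]

/-! ### The unperturbed system -/

/-- The conditions on the matrix `A` and its eigenvalues `μ₁, …, μ_n`. -/
structure ConditionA {n : ℕ} (A : Matrix (Fin n) (Fin n) ℂ) (μ : Fin n → ℂ) : Prop where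
  offDiag : ∀ i, A i i = 0
  eigenvalue : ∀ j, Module.End.HasEigenvalue (Matrix.toLin' A) (μ j)
  sub_notInt : ∀ j k, j ≠ k → ∀ z : ℤ, μ j - μ k ≠ z
  re_strictMono : StrictMono fun j => (μ j).re
  re_ne_zero : ∀ j, (μ j).re ≠ 0

/-- The conditions on the diagonal entries of `B = diag(b₁, …, b_n)`. -/
structure ConditionB {n : ℕ} (b : Fin n → ℂ) : Prop where
  ne_zero : ∀ j, b j ≠ 0
  injective : Function.Injective b
  notCollinear : ∀ i j k, i ≠ j → j ≠ k → i ≠ k → ¬ Collinear ℝ {b i, b j, b k}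
  sum_eq_zero : ∑ j, b j = 0

/-- The union `Σ` of the lines `Re (x bⱼ) = Re (x b_k)`, `j ≠ k`. -/
def stokesLines {n : ℕ} (b : Fin n → ℂ) : Set ℂ :=
  {x | ∃ j k, j ≠ k ∧ (x * b j).re = (x * b k).re}

/-- Open sectors with vertex at the origin. -/
def IsOpenSector (S : Set ℂ) : Prop :=
  ∃ θ₁ θ₂ : ℝ, θ₁ < θ₂ ∧ θ₂ ≤ θ₁ + 2 * Real.pi ∧
    S = {z | ∃ r θ : ℝ, 0 < r ∧ θ₁ < θ ∧ θ < θ₂ ∧ z = r * Complex.exp (θ * Complex.I)}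

/-- `ℓ` is a continuous branch of the logarithm on `S̄ ∖ {0}`; the powers `x^μ` are
`exp (μ ℓ(x))`. -/
structure IsLogBranch (S : Set ℂ) (ℓ : ℂ → ℂ) : Prop where
  continuousOn : ContinuousOn ℓ (closure S \ {0})
  exp_eq : ∀ x ∈ closure S \ {0}, Complex.exp (ℓ x) = x

theorem IsOpenSector.smul_mem_closure {S : Set ℂ} (hS : IsOpenSector S) {r : ℝ} (hr : 0 < r)
    {z : ℂ} (hz : z ∈ closure S) : (r : ℂ) * z ∈ closure S := by
  obtain ⟨θ₁, θ₂, -, -, rfl⟩ := hS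
  refine map_mem_closure (f := fun w => (r : ℂ) * w) (by fun_prop) hz ?_
  rintro w ⟨s, θ, hs, h1, h2, rfl⟩
  exact ⟨r * s, θ, mul_pos hr hs, h1, h2, by push_cast; ring⟩

theorem IsLogBranch.im_bounded {S : Set ℂ} {ℓ : ℂ → ℂ} (hS : IsOpenSector S)
    (hℓ : IsLogBranch S ℓ) : ∃ C : ℝ, ∀ x ∈ closure S \ {0}, |(ℓ x).im| ≤ C := by
  have hK : IsCompact (closure S ∩ Metric.sphere 0 1) :=
    (isCompact_sphere 0 1).inter_left isClosed_closure
  have hsub : closure S ∩ Metric.sphere 0 1 ⊆ closure S \ {0} := by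
    rintro x ⟨h1, h2⟩
    refine ⟨h1, ?_⟩
    rintro rfl
    simp at h2
  obtain ⟨C, hC⟩ := hK.exists_bound_of_continuousOn
    (Complex.continuous_im.comp_continuousOn (hℓ.continuousOn.mono hsub))
  refine ⟨C, fun x hx => ?_⟩
  have hx0 : x ≠ 0 := hx.2
  have hmem : ∀ s : ℝ, ((Real.exp s : ℝ) : ℂ) * x ∈ closure S \ {0} := fun s =>
    ⟨hS.smul_mem_closure (Real.exp_pos s) hx.1, by simp [hx0]⟩
  let f : ℝ → ℂ := fun s => ℓ ((Real.exp s : ℝ) * x) - s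
  have hf : Continuous f := by
    refine Continuous.sub ?_ (by fun_prop)
    exact hℓ.continuousOn.comp_continuous (by fun_prop) hmem
  have hexp : ∀ s, Complex.exp (f s) = x := by
    intro s
    simp only [f, Complex.exp_sub, hℓ.exp_eq _ (hmem s)]
    rw [Complex.ofReal_exp]
    field_simp
  let g : ℝ → ℝ := fun s => ((f s).im - (f 0).im) / (2 * Real.pi)
  have hg : Continuous g := by fun_prop
  have hgz : MapsTo g univ (range ((↑) : ℤ → ℝ)) := by
    intro s _
    obtain ⟨N, hN⟩ := Complex.exp_eq_exp_iff_exists_int.1 ((hexp s).trans (hexp 0).symm)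
    refine ⟨N, ?_⟩
    have := congrArg Complex.im hN
    simp at this
    simp only [g]
    rw [this]
    field_simp
    ring
  have hconst : ∀ s, (f s).im = (f 0).im := by
    intro s
    have h0 : g s = g 0 := by
      have hd : DiscreteTopology (range ((↑) : ℤ → ℝ)) :=
        (Int.isClosedEmbedding_coe_real.toIsEmbedding.toHomeomorph.discreteTopology)
      exact isPreconnected_univ.constant_of_mapsTo ⟨hd⟩ hg.continuousOn hgz (mem_univ s)
        (mem_univ 0)
    have hpi := Real.pi_pos
    simp only [g] at h0
    field_simp at h0
    linarith
  have h1 := hconst (-Real.log ‖x‖)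
  have hnx : 0 < ‖x‖ := norm_pos_iff.2 hx0
  have h2 := hC ((Real.exp (-Real.log ‖x‖) : ℝ) * x) ⟨(hmem _).1, by
    rw [Real.exp_neg, Real.exp_log hnx]
    simp [hx0]⟩
  simp only [Function.comp, Real.norm_eq_abs] at h2
  simp only [f] at h1
  simp at h1
  simp at h2
  rwa [← h1]

theorem tendsto_power {S : Set ℂ} {ℓ : ℂ → ℂ} (hS : IsOpenSector S)
    (hℓ : IsLogBranch S ℓ) {μ : ℂ} (hμ : 0 < μ.re) :
    Tendsto (fun ξ => Complex.exp (μ * ℓ ξ)) (𝓝[closure S \ {0}] 0) (𝓝 0) := by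
  obtain ⟨C, hC⟩ := hℓ.im_bounded hS
  have hb : Tendsto (fun ξ : ℂ => ‖ξ‖ ^ μ.re * Real.exp (|μ.im| * C))
      (𝓝[closure S \ {0}] 0) (𝓝 0) := by
    have : Tendsto (fun ξ : ℂ => ‖ξ‖ ^ μ.re * Real.exp (|μ.im| * C)) (𝓝 0)
        (𝓝 (‖(0:ℂ)‖ ^ μ.re * Real.exp (|μ.im| * C))) :=
      ((continuous_norm.tendsto _).rpow_const (Or.inr hμ.le)).mul_const _
    rw [norm_zero, Real.zero_rpow hμ.ne', zero_mul] at this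
    exact this.mono_left nhdsWithin_le_nhds
  refine squeeze_zero_norm' ?_ hb
  filter_upwards [self_mem_nhdsWithin] with ξ hξ
  have hre : (ℓ ξ).re = Real.log ‖ξ‖ := by
    conv_rhs => rw [← hℓ.exp_eq ξ hξ, Complex.norm_exp, Real.log_exp]
  have hn : 0 < ‖ξ‖ := norm_pos_iff.2 hξ.2
  rw [Complex.norm_exp, Complex.mul_re, hre, Real.rpow_def_of_pos hn, ← Real.exp_add]
  apply Real.exp_le_exp.2
  have h1 : -(μ.im * (ℓ ξ).im) ≤ |μ.im| * C := by
    refine (neg_le_abs _).trans ?_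
    rw [abs_mul]
    exact mul_le_mul_of_nonneg_left (hC ξ hξ) (abs_nonneg _)
  linarith [mul_comm μ.re (Real.log ‖ξ‖)]

/-- `y` solves `y' = x⁻¹ A y + B y` on `S̄ ∖ {0}`. -/
def IsSolution {n : ℕ} (A : Matrix (Fin n) (Fin n) ℂ) (b : Fin n → ℂ) (S : Set ℂ)
    (y : ℂ → Fin n → ℂ) : Prop :=
  ∀ x ∈ closure S \ {0},
    HasDerivWithinAt y ((x⁻¹ • A + Matrix.diagonal b) *ᵥ y x) (closure S) x

/-- The columns `c₁, …, c_n` form the fundamental matrix normalized at the origin: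
`c_k(x) = x^{μ_k} ĉ_k(x)`, `ĉ_k` entire, `ĉ_k(0) = 𝔥_k` an eigenvector, `det c(x) = 1`. -/
structure IsZeroSystem {n : ℕ} (A : Matrix (Fin n) (Fin n) ℂ) (μ b : Fin n → ℂ) (S : Set ℂ)
    (ℓ : ℂ → ℂ) (h : Fin n → Fin n → ℂ) (c : Fin n → ℂ → Fin n → ℂ) : Prop where
  solution : ∀ k, IsSolution A b S (c k)
  eigenvector : ∀ k, h k ≠ 0 ∧ A *ᵥ h k = μ k • h k
  power : ∀ k, ∃ chat : ℂ → Fin n → ℂ, Differentiable ℂ chat ∧ chat 0 = h k ∧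
    ∀ x ∈ closure S \ {0}, c k x = Complex.exp (μ k * ℓ x) • chat x
  det_eq_one : ∀ x ∈ closure S \ {0}, (Matrix.of fun i k => c k x i).det = 1

/-- The columns `e₁, …, e_n` form the fundamental matrix normalized at infinity:
`e_k(x) = exp(x R_k)(𝔣_k + O(x⁻¹))` for `|x| ≥ 1`, `x ∈ S̄`, where `R_k = b_{σ(k)}` and `𝔣_k` is
the standard basis vector with index `σ(k)`. -/
structure IsInftySystem {n : ℕ} (A : Matrix (Fin n) (Fin n) ℂ) (b : Fin n → ℂ) (S : Set ℂ)
    (σ : Equiv.Perm (Fin n)) (e : Fin n → ℂ → Fin n → ℂ) : Prop where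
  solution : ∀ k, IsSolution A b S (e k)
  asymp : ∀ k, ∃ M : ℝ, ∀ x ∈ closure S, 1 ≤ ‖x‖ →
    ‖Complex.exp (-(x * b (σ k))) • e k x - Pi.single (σ k) 1‖ ≤ M * ‖x‖⁻¹

/-- Weights: continuous functions without zeros on `S̄ ∖ {0}` that are equivalent to `ξ^{μ_k}` at
the origin and equal to `exp(R_k ξ)` for `|ξ| > 1`. -/
structure IsWeight {n : ℕ} (μ b : Fin n → ℂ) (S : Set ℂ) (σ : Equiv.Perm (Fin n)) (ℓ : ℂ → ℂ)
    (W : Fin n → ℂ → ℂ) : Prop where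
  continuousOn : ∀ k, ContinuousOn (W k) (closure S \ {0})
  ne_zero : ∀ k, ∀ ξ ∈ closure S \ {0}, W k ξ ≠ 0
  at_zero : ∀ k, Tendsto (fun ξ => W k ξ / Complex.exp (μ k * ℓ ξ)) (𝓝[closure S \ {0}] 0) (𝓝 1)
  at_infty : ∀ k, ∀ ξ ∈ closure S, 1 < ‖ξ‖ → W k ξ = Complex.exp (b (σ k) * ξ)

/-- `W₀(z) = (1 - |z|) z + |z|²` for `|z| ≤ 1`, `W₀(z) = W₀(z⁻¹)⁻¹` for `|z| > 1`. -/
def weight₀ (z : ℂ) : ℂ :=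
  if ‖z‖ ≤ 1 then (1 - ‖z‖) * z + ‖z‖ ^ 2 else ((1 - ‖z⁻¹‖) * z⁻¹ + ‖z⁻¹‖ ^ 2)⁻¹

/-- The explicit weight `W_k(ξ) = W₀(ξ^{μ_k}) exp(R_k ξ)` for `|ξ| ≤ 1`, `W_k(ξ) = exp(R_k ξ)` for
`|ξ| > 1`. It may have zeros (where `ξ^{μ_k} = -1/2` or `-2`) and, for non-real `μ_k`, jumps on
`|ξ| = 1`. -/
def weight {n : ℕ} (μ b : Fin n → ℂ) (σ : Equiv.Perm (Fin n)) (ℓ : ℂ → ℂ) (k : Fin n)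
    (ξ : ℂ) : ℂ :=
  if ‖ξ‖ ≤ 1 then weight₀ (Complex.exp (μ k * ℓ ξ)) * Complex.exp (b (σ k) * ξ)
  else Complex.exp (b (σ k) * ξ)

theorem tendsto_weight₀ :
    Tendsto (fun z : ℂ => ((1 - ‖z‖) * z + ‖z‖ ^ 2) / z) (𝓝[≠] 0) (𝓝 1) := by
  have h1 : Tendsto (fun z : ℂ => ((1 : ℂ) - ‖z‖)) (𝓝[≠] 0) (𝓝 1) := by
    have : Continuous (fun z : ℂ => ((1 : ℂ) - ‖z‖)) := by fun_prop
    have h := this.tendsto 0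
    simp only [norm_zero, Complex.ofReal_zero, sub_zero] at h
    exact h.mono_left nhdsWithin_le_nhds
  have h2 : Tendsto (fun z : ℂ => (‖z‖ : ℂ) ^ 2 / z) (𝓝[≠] 0) (𝓝 0) := by
    refine squeeze_zero_norm (a := fun z : ℂ => ‖z‖) (fun z => ?_) ?_
    · rcases eq_or_ne z 0 with rfl | hz
      · simp
      · have := norm_pos_iff.2 hz
        simp only [norm_div, norm_pow, Complex.norm_real, norm_norm]
        rw [div_le_iff₀ this, sq]
    · exact (continuous_norm.tendsto' (0 : ℂ) 0 norm_zero).mono_left nhdsWithin_le_nhds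
  have h3 := h1.add h2
  rw [add_zero] at h3
  refine h3.congr' ?_
  filter_upwards [self_mem_nhdsWithin] with z hz
  have hz : z ≠ 0 := hz
  field_simp

/-- The explicit weight is admissible as soon as it is continuous and has no zeros. -/
theorem isWeight_weight {n : ℕ} {μ b : Fin n → ℂ} {S : Set ℂ} {σ : Equiv.Perm (Fin n)} {ℓ : ℂ → ℂ}
    (hS : IsOpenSector S) (hℓ : IsLogBranch S ℓ) (hμ : ∀ j, (μ j).re ≠ 0)
    (hcont : ∀ k, ContinuousOn (weight μ b σ ℓ k) (closure S \ {0}))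
    (hne : ∀ k, ∀ ξ ∈ closure S \ {0}, weight μ b σ ℓ k ξ ≠ 0) :
    IsWeight μ b S σ ℓ (weight μ b σ ℓ) := by
  refine ⟨hcont, hne, fun k => ?_, fun k ξ _ h => by simp [weight, h.not_ge]⟩
  have hexp : Tendsto (fun ξ : ℂ => Complex.exp (b (σ k) * ξ)) (𝓝[closure S \ {0}] 0) (𝓝 1) := by
    have : Continuous (fun ξ : ℂ => Complex.exp (b (σ k) * ξ)) := by fun_prop
    have h := this.tendsto 0
    simp only [mul_zero, Complex.exp_zero] at h
    exact h.mono_left nhdsWithin_le_nhds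
  have hsmall : ∀ᶠ ξ : ℂ in 𝓝[closure S \ {0}] 0, ‖ξ‖ ≤ 1 := by
    refine nhdsWithin_le_nhds ?_
    filter_upwards [Metric.closedBall_mem_nhds (0 : ℂ) one_pos] with ξ hξ
    simpa using hξ
  rcases (hμ k).lt_or_gt with hk | hk
  · have ht := tendsto_power hS hℓ (μ := -μ k) (by simpa using hk)
    have ht' : Tendsto (fun ξ => Complex.exp (-μ k * ℓ ξ)) (𝓝[closure S \ {0}] 0) (𝓝[≠] 0) :=
      tendsto_nhdsWithin_iff.2 ⟨ht, Eventually.of_forall fun ξ => Complex.exp_ne_zero _⟩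
    have h1 := ((tendsto_weight₀.comp ht').inv₀ one_ne_zero).mul hexp
    rw [inv_one, one_mul] at h1
    refine h1.congr' ?_
    filter_upwards [hsmall, ht.eventually (Metric.ball_mem_nhds 0 one_pos)] with ξ h2 h3
    have h3 : ‖Complex.exp (-μ k * ℓ ξ)‖ < 1 := by simpa using h3
    have he : Complex.exp (μ k * ℓ ξ) = (Complex.exp (-μ k * ℓ ξ))⁻¹ := by
      rw [← Complex.exp_neg]; congr 1; ring
    have h4 : ¬ ‖(Complex.exp (-μ k * ℓ ξ))⁻¹‖ ≤ 1 := by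
      rw [norm_inv, not_le]
      exact (one_lt_inv₀ (norm_pos_iff.2 (Complex.exp_ne_zero _))).2 h3
    simp only [Function.comp, weight, if_pos h2, he, weight₀, if_neg h4, inv_inv, div_eq_mul_inv,
      mul_inv]
    ring
  · have ht := tendsto_power hS hℓ hk
    have ht' : Tendsto (fun ξ => Complex.exp (μ k * ℓ ξ)) (𝓝[closure S \ {0}] 0) (𝓝[≠] 0) :=
      tendsto_nhdsWithin_iff.2 ⟨ht, Eventually.of_forall fun ξ => Complex.exp_ne_zero _⟩
    have h1 := (tendsto_weight₀.comp ht').mul hexp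
    rw [one_mul] at h1
    refine h1.congr' ?_
    filter_upwards [hsmall, ht.eventually (Metric.ball_mem_nhds 0 one_pos)] with ξ h2 h3
    have h3 : ‖Complex.exp (μ k * ℓ ξ)‖ < 1 := by simpa using h3
    simp only [Function.comp, weight, if_pos h2, weight₀, if_pos h3.le]
    ring

/-- Admissible weights exist for all data. -/
theorem exists_isWeight {n : ℕ} (μ b : Fin n → ℂ) {S : Set ℂ} (σ : Equiv.Perm (Fin n)) {ℓ : ℂ → ℂ}
    (hS : IsOpenSector S) (hℓ : IsLogBranch S ℓ) : ∃ W, IsWeight μ b S σ ℓ W := by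
  refine ⟨fun k ξ => Complex.exp (((max (1 - ‖ξ‖) 0 : ℝ) : ℂ) * (μ k * ℓ ξ) + b (σ k) * ξ),
    fun k => ?_, fun k ξ _ => Complex.exp_ne_zero _, fun k => ?_, fun k ξ _ h => ?_⟩
  · have h1 : Continuous fun ξ : ℂ => ((max (1 - ‖ξ‖) 0 : ℝ) : ℂ) := by fun_prop
    exact ((h1.continuousOn.mul (continuousOn_const.mul hℓ.continuousOn)).add
      (by fun_prop)).cexp
  · obtain ⟨C, hC⟩ := hℓ.im_bounded hS
    have hlog : Tendsto (fun ξ => (‖ξ‖ : ℂ) * ℓ ξ) (𝓝[closure S \ {0}] 0) (𝓝 0) := by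
      have hb : Tendsto (fun ξ : ℂ => |Real.log ‖ξ‖ * ‖ξ‖| + ‖ξ‖ * C)
          (𝓝[closure S \ {0}] 0) (𝓝 0) := by
        have h1 : Continuous fun ξ : ℂ => |Real.log ‖ξ‖ * ‖ξ‖| + ‖ξ‖ * C := by
          have := Real.continuous_mul_log.comp (continuous_norm (E := ℂ))
          simp only [Function.comp_def] at this
          simp only [mul_comm (Real.log _)]
          fun_prop
        exact (h1.tendsto' 0 0 (by simp)).mono_left nhdsWithin_le_nhds
      refine squeeze_zero_norm' ?_ hb
      filter_upwards [self_mem_nhdsWithin] with ξ hξ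
      have hre : (ℓ ξ).re = Real.log ‖ξ‖ := by
        conv_rhs => rw [← hℓ.exp_eq ξ hξ, Complex.norm_exp, Real.log_exp]
      have h2 := Complex.norm_le_abs_re_add_abs_im (ℓ ξ)
      rw [hre] at h2
      rw [norm_mul, Complex.norm_real, norm_norm, abs_mul, abs_norm]
      nlinarith [norm_nonneg ξ, hC ξ hξ]
    have h3 : Tendsto (fun ξ => -μ k * ((‖ξ‖ : ℂ) * ℓ ξ) + b (σ k) * ξ)
        (𝓝[closure S \ {0}] 0) (𝓝 (-μ k * 0 + b (σ k) * 0)) :=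
      (hlog.const_mul _).add ((tendsto_id.const_mul _).mono_left nhdsWithin_le_nhds)
    have h4 := h3.cexp
    simp only [mul_zero, add_zero, Complex.exp_zero] at h4
    refine h4.congr' ?_
    have h5 : ∀ᶠ ξ : ℂ in 𝓝[closure S \ {0}] 0, ‖ξ‖ ≤ 1 := by
      refine nhdsWithin_le_nhds ?_
      filter_upwards [Metric.closedBall_mem_nhds (0 : ℂ) one_pos] with ξ hξ
      simpa using hξ
    filter_upwards [h5] with ξ hξ
    rw [max_eq_left (by linarith), ← Complex.exp_sub]
    congr 1
    push_cast
    ring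
  · rw [max_eq_right (by linarith)]
    simp

/-- The products of the weights over a multi-index. -/
def prodWeight {n m : ℕ} (W : Fin n → ℂ → ℂ) (α : Set.powersetCard (Fin n) m) (ξ : ℂ) : ℂ :=
  ∏ j ∈ (α : Finset (Fin n)), W j ξ

/-- The multi-index `(k, k+1, …, n)`. -/
def tailIndex {n : ℕ} (k : Fin n) : Set.powersetCard (Fin n) (n - k) :=
  Set.powersetCard.ofCard (Fin.card_Ici k)

/-- The multi-index `(1, 2, …, k)`. -/
def headIndex {n : ℕ} (k : Fin n) : Set.powersetCard (Fin n) (k + 1) :=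
  Set.powersetCard.ofCard (Fin.card_Iic k)

/-- The kernel `G_m(x,t,ρ) f = ∑_α σ_α |f ∧ C_{α'}(t,ρ)| C_α(x,ρ)` with
`σ_α = |𝔥_α ∧ 𝔥_{α'}|`, `C(x,ρ) = c(ρx)`. -/
def green {n m : ℕ} (h : Fin n → Fin n → ℂ) (c : Fin n → ℂ → Fin n → ℂ) (ρ : ℂ) (x t : ℝ)
    (f : Tensor n m) : Tensor n m :=
  ∑ α : Set.powersetCard (Fin n) m,
    (topCoeff ((wedge h α).1 * (wedgeCompl h α).1) *
      topCoeff (f.1 * (wedgeCompl (fun j => c j (ρ * t)) α).1)) •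
      wedge (fun j => c j (ρ * x)) α

/-! ### Potentials -/

/-- Lebesgue measure on `(0,∞)`. -/
abbrev halfLine : Measure ℝ := volume.restrict (Ioi 0)

/-- The Banach space `𝒳_p` of off-diagonal matrix functions with entries in
`L₁(0,∞) ∩ L_p(0,∞)`; every entry is an element of `L₁` together with the same function as an
element of `L_p`. -/
def Xp (n : ℕ) (p : ℝ≥0∞) [Fact (1 ≤ p)] :
    Submodule ℂ (Fin n → Fin n → Lp ℂ 1 halfLine × Lp ℂ p halfLine) where
  carrier := {q | (∀ i j, (q i j).1 =ᵐ[halfLine] (q i j).2) ∧ ∀ i, q i i = 0}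
  zero_mem' := by
    refine ⟨fun i j => ?_, fun i => rfl⟩
    exact (Lp.coeFn_zero ℂ 1 halfLine).trans (Lp.coeFn_zero ℂ p halfLine).symm
  add_mem' := by
    rintro a b ⟨ha, ha'⟩ ⟨hb, hb'⟩
    refine ⟨fun i j => ?_, fun i => by simp [ha' i, hb' i]⟩
    exact (Lp.coeFn_add _ _).trans (((ha i j).add (hb i j)).trans (Lp.coeFn_add _ _).symm)
  smul_mem' := by
    rintro r a ⟨ha, ha'⟩
    refine ⟨fun i j => ?_, fun i => by simp [ha' i]⟩
    exact (Lp.coeFn_smul _ _).trans (((ha i j).const_smul r).trans (Lp.coeFn_smul _ _).symm)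

/-- The values of a potential. -/
def potential {n : ℕ} {p : ℝ≥0∞} [Fact (1 ≤ p)] (q : Xp n p) (t : ℝ) : Matrix (Fin n) (Fin n) ℂ :=
  Matrix.of fun i j => ((q : Fin n → Fin n → Lp ℂ 1 halfLine × Lp ℂ p halfLine) i j).1 t

/-! ### Fundamental tensors -/

/-- `Y` satisfies `‖Y(x)‖ ≤ M |(ρx)^{μ_α}|` for `|ρx| ≤ 1` and `‖Y(x)‖ ≤ M |exp(ρx R_α)|` for
`|ρx| > 1`, with `μ_α = ∑_{j ∈ α} μⱼ`, `R_α = ∑_{j ∈ α} Rⱼ`. -/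
def HasGrowth {n m : ℕ} (μ b : Fin n → ℂ) (σ : Equiv.Perm (Fin n)) (ℓ : ℂ → ℂ)
    (α : Set.powersetCard (Fin n) m) (ρ : ℂ) (Y : ℝ → Tensor n m) : Prop :=
  ∃ M : ℝ, ∀ x : ℝ, 0 < x →
    (‖ρ * x‖ ≤ 1 →
      ‖Y x‖ ≤ M * ‖Complex.exp ((∑ j ∈ (α : Finset (Fin n)), μ j) * ℓ (ρ * x))‖) ∧
    (1 < ‖ρ * x‖ →
      ‖Y x‖ ≤ M * ‖Complex.exp (ρ * x * ∑ j ∈ (α : Finset (Fin n)), b (σ j))‖)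

/-- `Y = T_k(q, ·, ρ)`: on `(0,∞)`, `Y` solves the Volterra equation
`Y(x) = T_k⁰(x,ρ) + ∫_0^x G_{n-k+1}(x,t,ρ)(q^{(n-k+1)}(t) Y(t)) dt`,
`T_k⁰ = C_k ∧ ⋯ ∧ C_n`, within the growth class that makes the solution unique. -/
structure IsTensorT {n : ℕ} {p : ℝ≥0∞} [Fact (1 ≤ p)] (μ b : Fin n → ℂ)
    (σ : Equiv.Perm (Fin n)) (ℓ : ℂ → ℂ) (h : Fin n → Fin n → ℂ) (c : Fin n → ℂ → Fin n → ℂ)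
    (k : Fin n) (q : Xp n p) (ρ : ℂ) (Y : ℝ → Tensor n (n - k)) : Prop where
  integrable : ∀ x : ℝ, 0 < x → IntegrableOn
    (fun t => green h c ρ x t (tensorDeriv (potential q t) (n - k) (Y t))) (Ioo 0 x)
  equation : ∀ x : ℝ, 0 < x → Y x = wedge (fun j => c j (ρ * x)) (tailIndex k) +
    ∫ t in Ioo 0 x, green h c ρ x t (tensorDeriv (potential q t) (n - k) (Y t))
  growth : HasGrowth μ b σ ℓ (tailIndex k) ρ Y

/-- `Y = F_k(q, ·, ρ)`: on `(0,∞)`, `Y` solves the Volterra equation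
`Y(x) = F_k⁰(x,ρ) - ∫_x^∞ G_k(x,t,ρ)(q^{(k)}(t) Y(t)) dt`,
`F_k⁰ = E_1 ∧ ⋯ ∧ E_k`, within the growth class that makes the solution unique. -/
structure IsTensorF {n : ℕ} {p : ℝ≥0∞} [Fact (1 ≤ p)] (μ b : Fin n → ℂ)
    (σ : Equiv.Perm (Fin n)) (ℓ : ℂ → ℂ) (h : Fin n → Fin n → ℂ) (c e : Fin n → ℂ → Fin n → ℂ)
    (k : Fin n) (q : Xp n p) (ρ : ℂ) (Y : ℝ → Tensor n (k + 1)) : Prop where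
  integrable : ∀ x : ℝ, 0 < x → IntegrableOn
    (fun t => green h c ρ x t (tensorDeriv (potential q t) (k + 1) (Y t))) (Ioi x)
  equation : ∀ x : ℝ, 0 < x → Y x = wedge (fun j => e j (ρ * x)) (headIndex k) -
    ∫ t in Ioi x, green h c ρ x t (tensorDeriv (potential q t) (k + 1) (Y t))
  growth : HasGrowth μ b σ ℓ (headIndex k) ρ Y

/-! ### The spaces of remainders -/

/-- The closed ray `l = {zt : t ∈ [0,∞)}`. -/
def ray (z : ℂ) : Set ℂ := {ρ | ∃ t : ℝ≥0, ρ = z * (t : ℝ)}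

/-- The arc length parametrization of the ray through `z ≠ 0` (constant for `t ≤ 0`). -/
def rayParam (z : ℂ) (t : ℝ) : ray z := ⟨z * ((Real.toNNReal (t / ‖z‖) : ℝ≥0) : ℝ), _, rfl⟩

/-- Arc length on the ray through `z ≠ 0`. -/
def rayMeasure (z : ℂ) : Measure (ray z) := (volume.restrict (Ici (0 : ℝ))).map (rayParam z)

/-- The space `ℋ(l) = C₀(l) ∩ L₂(l)` of `V`-valued functions on the ray through `z`; an element is
an element of `C₀(l)` together with the same function as an element of `L₂(l)`. -/
def RayH (z : ℂ) (V : Type) [NormedAddCommGroup V] [NormedSpace ℂ V] :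
    Submodule ℂ (C₀(ray z, V) × Lp V 2 (rayMeasure z)) where
  carrier := {f | f.1 =ᵐ[rayMeasure z] f.2}
  zero_mem' := (Lp.coeFn_zero V 2 (rayMeasure z)).symm
  add_mem' := by
    intro a b ha hb
    have ha' : ⇑a.1 =ᵐ[rayMeasure z] a.2 := ha
    have hb' : ⇑b.1 =ᵐ[rayMeasure z] b.2 := hb
    exact (ha'.add hb').trans (Lp.coeFn_add _ _).symm
  smul_mem' := by
    intro r a ha
    have ha' : ⇑a.1 =ᵐ[rayMeasure z] a.2 := ha
    exact (ha'.const_smul r).trans (Lp.coeFn_smul _ _).symm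

/-- `f ∈ C(𝒳_p, BC([0,∞), C₀(S̄)))`, and for every ray `l` in `S̄` the restriction of `f` to `l`
belongs to `C(𝒳_p, BC([0,∞), ℋ(l)))`. -/
def IsRemainder {n : ℕ} {p : ℝ≥0∞} [Fact (1 ≤ p)] {V : Type} [NormedAddCommGroup V]
    [NormedSpace ℂ V] {S : Set ℂ} (f : Xp n p → ℝ≥0 →ᵇ C₀(closure S, V)) : Prop :=
  Continuous f ∧ ∀ z ∈ closure S \ {0}, ∃ g : Xp n p → ℝ≥0 →ᵇ RayH z V, Continuous g ∧
    ∀ (q : Xp n p) (x : ℝ≥0) (ρ : ℂ) (hl : ρ ∈ ray z) (hS : ρ ∈ closure S),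
      (g q x : C₀(ray z, V) × Lp V 2 (rayMeasure z)).1 ⟨ρ, hl⟩ = f q x ⟨ρ, hS⟩

end

end WeylTensor

/-!
Both families of tensors are treated by one argument about Volterra equations. Write `c(ξ)` for the
fundamental matrix normalized at the origin. Expansion in the basis `C_α(t,ρ)` shows that the kernel
`G_m(x,t,ρ)` is the propagator `∧^m (c(ρx) c(ρt)⁻¹)` (`green_eq`). After division by the weight
`w(ρx)`, the equation for `Y = w(ρx) u` becomes `u = H v₀ + ∫ κ(x,t,ρ) q^{(m)}(t) u(t) dt`, where
the integral extends over `(0,x)` for `T_k` and over `(x,∞)` for `F_k`, and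
`κ = H(ρx) H(ρt)⁻¹` with `H = w⁻¹ ∧^m c`. The multi-indices `(k,…,n)` and `(1,…,k)` are extremal
both for the exponents `Re μ_α` at the origin and for the exponents `Re (x R_α)` at infinity, and
in each case the direction of integration is the one for which this extremality makes `κ` bounded
and continuous, up to `ρ = 0` and `x = 0` (`exists_isVolterraKernel`). The free term `H v₀` is
bounded and continuous on `S̄` as well. These facts are all that is used of the unperturbed system,
and the structure `TensorModel` collects the data from which they follow; `exists_tensorModel`
produces it, the transition matrix between the two fundamental systems being invertible because, by
`∑ bⱼ = 0`, its determinant is the limit at infinity of that of `e(ξ) exp(-ξR)`, a permutation matrix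
in the limit.

The Volterra equation with bounded kernel is uniquely solvable for integrable `q`, by contraction in
an exponentially weighted norm and Grönwall's inequality (`IsVolterraKernel.exists_solution`,
`volterra_gronwall`). Existence and uniqueness of the tensors follow (`isTensorSolution_iff`). The
remainder `T = u - H v₀` solves `T = P_q (H v₀) + P_q T` with the Volterra operator `P_q`, so it
inherits from the first iterate `P_q (H v₀)` the properties of vanishing at infinity, uniformly in
`x`, and of square integrability along rays, and it depends continuously on `q`
(`IsVolterraKernel.exists_family`).

The first iterate is where the off-diagonal form of `q` and the condition `p > 2` enter. Replacing
the factor `e(ξ) exp(-ξR)` by its limit at infinity, a permutation matrix, costs an error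
`∫ min(1, 1/|ρt|) |q(t)| dt`, and leaves finitely many oscillating integrals
`∫ q_{ij}(t) exp(ρ((x-t) a' + t a)) dt` with nonpositive real parts in the exponents and with
`a - a' = R_j - R_i ≠ 0`, since `q` has zero diagonal (`exists_firstIterate_le`). Along a ray such an
integral is either a Fourier transform, to which Plancherel's theorem applies, or dominated by a
Laplace transform, which is bounded in `L₂` by Schur's test (`exists_phaseIntegral_sq_le`). The
error is square integrable by Minkowski's inequality when `t^{-1/2} q(t)` is integrable
(`lintegral_remainder_sq_le`). Both `q ∈ L₂` and `t^{-1/2} q ∈ L₁` follow from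
`q ∈ L₁ ∩ L_p` with `p > 2` (`exists_potentialSize_le`). For smooth `q` integration by parts gives a
decay like `1/|ρ|`, uniformly in `x`; approximation by smooth potentials then yields that the first
iterate vanishes at infinity and is continuous in `x` with values in `L₂` of a ray
(`firstIterate_vanishing`, `firstIterate_continuous_right`).
-/

namespace WeylTensor

noncomputable section

/-! ### Compound matrices and diagonal operators -/

/-- The standard basis `𝔢_α` of `∧^m ℂ^n`. -/
def tensorBasis (n m : ℕ) : Module.Basis (Set.powersetCard (Fin n) m) ℂ (Tensor n m) :=
  (Pi.basisFun ℂ (Fin n)).exteriorPower m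

theorem tensorBasis_apply {n m : ℕ} (α : Set.powersetCard (Fin n) m) :
    tensorBasis n m α = wedge (Pi.basisFun ℂ (Fin n)) α :=
  exteriorPower.basis_apply ℂ m (Pi.basisFun ℂ (Fin n)) α

theorem norm_eq_sum_repr {n m : ℕ} (f : Tensor n m) :
    ‖f‖ = ∑ α, ‖(tensorBasis n m).repr f α‖ :=
  tensor_norm_eq f

instance (n m : ℕ) : FiniteDimensional ℂ (Tensor n m) :=
  Module.Basis.finiteDimensional_of_finite (tensorBasis n m)

/-- The `m`-th compound `∧^m X` of the matrix `X`. -/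
def compound {n : ℕ} (m : ℕ) (X : Matrix (Fin n) (Fin n) ℂ) : Tensor n m →L[ℂ] Tensor n m :=
  LinearMap.toContinuousLinearMap (exteriorPower.map m (Matrix.toLin' X))

variable {n m : ℕ}

theorem compound_ιMulti (X : Matrix (Fin n) (Fin n) ℂ) (v : Fin m → Fin n → ℂ) :
    compound m X (exteriorPower.ιMulti ℂ m v) = exteriorPower.ιMulti ℂ m fun i => X *ᵥ v i := by
  simp only [compound, LinearMap.coe_toContinuousLinearMap', exteriorPower.map_apply_ιMulti]
  rfl

theorem compound_wedge (X : Matrix (Fin n) (Fin n) ℂ) (u : Fin n → Fin n → ℂ)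
    (α : Set.powersetCard (Fin n) m) :
    compound m X (wedge u α) = wedge (fun j => X *ᵥ u j) α :=
  compound_ιMulti X _

theorem compound_one : compound m (1 : Matrix (Fin n) (Fin n) ℂ) = 1 := by
  ext f : 1
  simp [compound]

theorem compound_mul (X Y : Matrix (Fin n) (Fin n) ℂ) :
    compound m (X * Y) = compound m X * compound m Y := by
  ext f : 1
  simp [compound, Matrix.toLin'_mul, exteriorPower.map_comp]

/-- The matrix with columns `u₁, …, u_n`. -/
def colMatrix (u : Fin n → Fin n → ℂ) : Matrix (Fin n) (Fin n) ℂ := Matrix.of fun i k => u k i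

theorem wedge_eq_compound (u : Fin n → Fin n → ℂ) (α : Set.powersetCard (Fin n) m) :
    wedge u α = compound m (colMatrix u) (tensorBasis n m α) := by
  rw [tensorBasis_apply, compound_wedge]
  congr 1
  funext j
  ext i
  simp [colMatrix, Pi.basisFun_apply]

theorem tensor_ext {E : Type*} [AddCommGroup E] [Module ℂ E] [TopologicalSpace E]
    {f g : Tensor n m →L[ℂ] E} (h : ∀ α, f (tensorBasis n m α) = g (tensorBasis n m α)) :
    f = g :=
  ContinuousLinearMap.coe_injective ((tensorBasis n m).ext h)

/-- The operator `𝔢_α ↦ d_α 𝔢_α`. -/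
def diagOp (d : Set.powersetCard (Fin n) m → ℂ) : Tensor n m →L[ℂ] Tensor n m :=
  LinearMap.toContinuousLinearMap ((tensorBasis n m).constr ℂ fun α => d α • tensorBasis n m α)

@[simp]
theorem diagOp_basis (d : Set.powersetCard (Fin n) m → ℂ) (α : Set.powersetCard (Fin n) m) :
    diagOp d (tensorBasis n m α) = d α • tensorBasis n m α := by
  simp [diagOp]

theorem diagOp_mul (d d' : Set.powersetCard (Fin n) m → ℂ) :
    diagOp (d * d') = diagOp d * diagOp d' := by
  refine tensor_ext fun α => ?_
  simp [smul_smul, mul_comm]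

theorem diagOp_one : diagOp (1 : Set.powersetCard (Fin n) m → ℂ) = 1 := by
  refine tensor_ext fun α => ?_
  simp

theorem diagOp_smul (s : ℂ) (d : Set.powersetCard (Fin n) m → ℂ) :
    diagOp (s • d) = s • diagOp d := by
  refine tensor_ext fun α => ?_
  simp [smul_smul]

theorem repr_diagOp (d : Set.powersetCard (Fin n) m → ℂ) (f : Tensor n m)
    (α : Set.powersetCard (Fin n) m) :
    (tensorBasis n m).repr (diagOp d f) α = d α * (tensorBasis n m).repr f α := by
  conv_lhs => rw [← (tensorBasis n m).sum_repr f]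
  simp only [map_sum, map_smul, diagOp_basis, Finsupp.coe_finsetSum, Finset.sum_apply,
    Finsupp.coe_smul, Pi.smul_apply, smul_eq_mul, Module.Basis.repr_self]
  rw [Finset.sum_eq_single α]
  · simp [mul_comm]
  · intro β _ hβ
    simp [hβ]
  · simp

theorem norm_diagOp_apply_le {d : Set.powersetCard (Fin n) m → ℂ} {K : ℝ} {f : Tensor n m}
    (h : ∀ α, (tensorBasis n m).repr f α = 0 ∨ ‖d α‖ ≤ K) : ‖diagOp d f‖ ≤ K * ‖f‖ := by
  rw [norm_eq_sum_repr, norm_eq_sum_repr, Finset.mul_sum]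
  refine Finset.sum_le_sum fun α _ => ?_
  rw [repr_diagOp, norm_mul]
  rcases h α with h | h
  · simp [h]
  · gcongr

theorem norm_diagOp_le {d : Set.powersetCard (Fin n) m → ℂ} {K : ℝ} (hK : 0 ≤ K)
    (h : ∀ α, ‖d α‖ ≤ K) : ‖diagOp d‖ ≤ K :=
  ContinuousLinearMap.opNorm_le_bound _ hK fun _ => norm_diagOp_apply_le fun α => Or.inr (h α)

theorem continuous_diagOp :
    Continuous (diagOp : (Set.powersetCard (Fin n) m → ℂ) → Tensor n m →L[ℂ] Tensor n m) := by
  let L : (Set.powersetCard (Fin n) m → ℂ) →ₗ[ℂ] Tensor n m →L[ℂ] Tensor n m :=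
    { toFun := diagOp
      map_add' := fun d d' => tensor_ext fun α => by simp [add_smul]
      map_smul' := fun s d => diagOp_smul s d }
  exact L.continuous_of_finiteDimensional

theorem compound_diagonal (d : Fin n → ℂ) :
    compound m (Matrix.diagonal d) = diagOp fun α => ∏ j ∈ (α : Finset (Fin n)), d j := by
  refine tensor_ext fun α => ?_
  rw [diagOp_basis, tensorBasis_apply]
  have h1 : (fun j => Matrix.diagonal d *ᵥ (Pi.basisFun ℂ (Fin n)) j) =
      fun j => d j • (Pi.basisFun ℂ (Fin n)) j := by
    funext j
    ext i
    by_cases hij : i = j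
    · subst hij; simp [Matrix.mulVec_diagonal]
    · simp [Matrix.mulVec_diagonal, hij]
  have h2 : compound m (Matrix.diagonal d) (wedge (Pi.basisFun ℂ (Fin n)) α) =
      wedge (fun j => d j • (Pi.basisFun ℂ (Fin n)) j) α := by
    rw [compound_wedge, h1]
  refine h2.trans ?_
  have h3 := (exteriorPower.ιMulti ℂ m (M := Fin n → ℂ)).toMultilinearMap.map_smul_univ
    (fun i => d (Set.powersetCard.ofFinEmbEquiv.symm α i))
    (fun i => Pi.basisFun ℂ (Fin n) (Set.powersetCard.ofFinEmbEquiv.symm α i))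
  refine Eq.trans h3 ?_
  congr 1
  have h4 : (Finset.univ.map (Set.powersetCard.ofFinEmbEquiv.symm α).toEmbedding) =
      (α : Finset (Fin n)) := by
    ext i
    rw [Set.powersetCard.mem_coe_iff, ← Set.powersetCard.mem_range_ofFinEmbEquiv_symm_iff_mem]
    simp
  rw [← h4, Finset.prod_map]
  rfl

theorem repr_compound_basis (X : Matrix (Fin n) (Fin n) ℂ) (α β : Set.powersetCard (Fin n) m) :
    (tensorBasis n m).repr (compound m X (tensorBasis n m α)) β =
      (Matrix.of fun i j => X (Set.powersetCard.ofFinEmbEquiv.symm β j)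
        (Set.powersetCard.ofFinEmbEquiv.symm α i)).det := by
  rw [tensorBasis_apply, tensorBasis, exteriorPower.basis_repr_apply]
  have h : compound m X (wedge (Pi.basisFun ℂ (Fin n)) α) =
    exteriorPower.ιMulti ℂ m (fun i => X *ᵥ (Pi.basisFun ℂ (Fin n))
      (Set.powersetCard.ofFinEmbEquiv.symm α i)) := compound_wedge _ _ _
  refine (congrArg _ h).trans ?_
  rw [exteriorPower.ιMultiDual_apply_ιMulti]
  congr 1
  ext i j
  simp

theorem contDiff_compound :
    ContDiff ℝ 1 (fun X : Fin n → Fin n → ℂ => compound m (Matrix.of X)) := by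
  have h : (fun X : Fin n → Fin n → ℂ => compound m (Matrix.of X)) = fun X =>
      ∑ α, ∑ β, (Matrix.of fun i j => X (Set.powersetCard.ofFinEmbEquiv.symm β j)
        (Set.powersetCard.ofFinEmbEquiv.symm α i)).det •
        (LinearMap.toContinuousLinearMap ((tensorBasis n m).constr ℂ
          (Pi.single α (tensorBasis n m β))) : Tensor n m →L[ℂ] Tensor n m) := by
    funext X
    refine tensor_ext fun γ => ?_
    rw [← (tensorBasis n m).sum_repr (compound m (Matrix.of X) (tensorBasis n m γ))]
    simp only [repr_compound_basis, sum_apply, smul_apply,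
      LinearMap.coe_toContinuousLinearMap', Module.Basis.constr_basis]
    symm
    rw [Finset.sum_eq_single γ]
    · simp
    · intro α _ hα
      simp [Pi.single_eq_of_ne' hα]
    · simp
  rw [h]
  refine ContDiff.sum fun α _ => ContDiff.sum fun β _ => ContDiff.fun_smul ?_ contDiff_const
  simp only [Matrix.det_apply, Matrix.of_apply]
  refine ContDiff.sum fun τ _ => ContDiff.const_smul _ (contDiff_prod fun i _ => ?_)
  fun_prop

theorem continuous_compound :
    Continuous (compound m : Matrix (Fin n) (Fin n) ℂ → Tensor n m →L[ℂ] Tensor n m) :=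
  (contDiff_compound (n := n) (m := m)).continuous

/-- Compound matrices are bounded and Lipschitz continuous on bounded sets of matrices. -/
theorem exists_compound_bound (n m : ℕ) (K : ℝ) : ∃ L : ℝ, 0 ≤ L ∧
    (∀ X : Matrix (Fin n) (Fin n) ℂ, (∀ i j, ‖X i j‖ ≤ K) → ‖compound m X‖ ≤ L) ∧
    ∀ X Y : Matrix (Fin n) (Fin n) ℂ, (∀ i j, ‖X i j‖ ≤ K) → (∀ i j, ‖Y i j‖ ≤ K) →
      ∀ δ : ℝ, 0 ≤ δ → (∀ i j, ‖X i j - Y i j‖ ≤ δ) → ‖compound m X - compound m Y‖ ≤ L * δ := by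
  rcases lt_or_ge K 0 with hK | hK
  · by_cases hn : Nonempty (Fin n)
    · obtain ⟨i⟩ := hn
      exact ⟨0, le_rfl, fun X hX => absurd ((norm_nonneg _).trans (hX i i)) hK.not_ge,
        fun X Y hX => absurd ((norm_nonneg _).trans (hX i i)) hK.not_ge⟩
    · have hsub : ∀ X Y : Matrix (Fin n) (Fin n) ℂ, X = Y := fun X Y => by
        ext i; exact absurd ⟨i⟩ hn
      refine ⟨‖compound m (0 : Matrix (Fin n) (Fin n) ℂ)‖, norm_nonneg _,
        fun X _ => by rw [hsub X 0], fun X Y _ _ δ hδ _ => ?_⟩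
      rw [hsub X Y, sub_self, norm_zero]
      positivity
  have hc : IsCompact (Metric.closedBall (0 : Fin n → Fin n → ℂ) K) := isCompact_closedBall _ _
  obtain ⟨L, hL⟩ := ((contDiff_compound (n := n) (m := m)).locallyLipschitz.locallyLipschitzOn
    (s := Metric.closedBall 0 K)).exists_lipschitzOnWith_of_compact hc
  obtain ⟨L', hL'⟩ := hc.exists_bound_of_continuousOn
    (contDiff_compound (n := n) (m := m)).continuous.continuousOn
  have hmem : ∀ X : Fin n → Fin n → ℂ, (∀ i j, ‖X i j‖ ≤ K) →
      X ∈ Metric.closedBall (0 : Fin n → Fin n → ℂ) K := fun X hX => by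
    rw [mem_closedBall_zero_iff]
    exact (pi_norm_le_iff_of_nonneg hK).2 fun i => (pi_norm_le_iff_of_nonneg hK).2 fun j => hX i j
  refine ⟨max L L', le_max_of_le_left L.2, fun X hX => (hL' X (hmem X hX)).trans (le_max_right _ _),
    fun X Y hX hY δ hδ h => ?_⟩
  have h1 := hL.norm_sub_le (hmem X hX) (hmem Y hY)
  refine h1.trans ?_
  refine mul_le_mul (le_max_left _ _) ?_ (norm_nonneg _) (le_max_of_le_left L.2)
  exact (pi_norm_le_iff_of_nonneg hδ).2 fun i => (pi_norm_le_iff_of_nonneg hδ).2 fun j => h i j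

/-! ### The derivation `V^{(m)}` -/

/-- `V^{(m)}` as a continuous operator, linear in `V`. -/
def derivation (m : ℕ) : Matrix (Fin n) (Fin n) ℂ →ₗ[ℂ] Tensor n m →L[ℂ] Tensor n m where
  toFun V := LinearMap.toContinuousLinearMap (tensorDeriv V m)
  map_add' V V' := by
    refine tensor_ext fun α => ?_
    simp only [tensorBasis_apply, wedge, exteriorPower.ιMulti_family,
      LinearMap.coe_toContinuousLinearMap', tensorDeriv_ιMulti, add_apply,
      Matrix.add_mulVec, AlternatingMap.map_update_add, Finset.sum_add_distrib]
  map_smul' s V := by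
    refine tensor_ext fun α => ?_
    simp only [tensorBasis_apply, wedge, exteriorPower.ιMulti_family,
      LinearMap.coe_toContinuousLinearMap', tensorDeriv_ιMulti, smul_apply,
      Matrix.smul_mulVec, AlternatingMap.map_update_smul, Finset.smul_sum, RingHom.id_apply]

@[simp]
theorem derivation_apply (V : Matrix (Fin n) (Fin n) ℂ) (f : Tensor n m) :
    derivation m V f = tensorDeriv V m f := rfl

/-- `∧^m` of a change of basis intertwines the derivations of conjugate matrices. -/
theorem compound_mul_derivation {g g' : Matrix (Fin n) (Fin n) ℂ} (hg : g' * g = 1)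
    (V : Matrix (Fin n) (Fin n) ℂ) :
    compound m g * derivation m V = derivation m (g * V * g') * compound m g := by
  refine tensor_ext fun α => ?_
  simp only [tensorBasis_apply, wedge, exteriorPower.ιMulti_family,
    mul_apply_eq_comp, derivation_apply, tensorDeriv_ιMulti, compound_ιMulti, map_sum]
  refine Finset.sum_congr rfl fun j _ => ?_
  congr 1
  funext i
  rcases eq_or_ne i j with rfl | hij
  · simp only [Function.update_self, Matrix.mulVec_mulVec]
    rw [Matrix.mul_assoc (g * V), hg, Matrix.mul_one]
  · simp [hij]

theorem derivation_eq_sum (V : Matrix (Fin n) (Fin n) ℂ) :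
    derivation m V = ∑ i, ∑ j, V i j • derivation m (Matrix.single i j 1) := by
  conv_lhs => rw [Matrix.matrix_eq_sum_single V]
  simp only [map_sum]
  refine Finset.sum_congr rfl fun i _ => Finset.sum_congr rfl fun j _ => ?_
  rw [← map_smul, Matrix.smul_single, smul_eq_mul, mul_one]

/-! ### The kernel `G_m` as a propagator -/

theorem topCoeff_ιMulti_family {k : ℕ} (u : Fin n → Fin n → ℂ) (s : Set.powersetCard (Fin n) k)
    (hs : (s : Finset (Fin n)) = Finset.univ) :
    topCoeff (ExteriorAlgebra.ιMulti_family ℂ k u s) = (colMatrix u).det := by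
  obtain rfl : k = n := by
    have := Set.powersetCard.card_eq s
    rw [hs] at this
    simpa using this.symm
  let T : ExteriorAlgebra ℂ (Fin k → ℂ) →ₗ[ℂ] ℂ :=
    (Pi.basisFun ℂ (Fin k)).ExteriorAlgebra.coord Finset.univ
  let f : (Fin k → ℂ) [⋀^Fin k]→ₗ[ℂ] ℂ := T.compAlternatingMap (ExteriorAlgebra.ιMulti ℂ k)
  have hid : ∀ v : Fin k → Fin k → ℂ, ExteriorAlgebra.ιMulti_family ℂ k v s =
      ExteriorAlgebra.ιMulti ℂ k v := by
    intro v
    rw [ExteriorAlgebra.ιMulti_family]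
    congr 1
    funext i
    have hc : (Finset.univ : Finset (Fin k)).card = k := by simp
    have hs' : s = Set.powersetCard.ofCard hc := Subtype.ext hs
    have hi := congrFun (Finset.orderEmbOfFin_unique hc (f := id) (fun x => Finset.mem_univ x)
      strictMono_id) i
    subst hs'
    simp only [Function.comp, Set.powersetCard.ofFinEmbEquiv_symm_apply]
    exact congrArg _ hi.symm
  have h1 : f (Pi.basisFun ℂ (Fin k)) = 1 := by
    change T (ExteriorAlgebra.ιMulti ℂ k (Pi.basisFun ℂ (Fin k))) = 1
    rw [← hid, ← ExteriorAlgebra.basis_apply_powersetCard, hs]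
    simp [T]
  have h2 := f.eq_smul_basis_det (Pi.basisFun ℂ (Fin k))
  have h3 : f u = (Pi.basisFun ℂ (Fin k)).det u := by
    conv_lhs => rw [h2, h1]
    simp
  rw [hid, Pi.basisFun_det_apply] at *
  rw [← Matrix.det_transpose]
  exact h3

/-- The sign of the shuffle `(α, α')` is the same for all systems of vectors, so it cancels in the
definition of `G_m` when `det (𝔥₁, …, 𝔥_n) = 1`. -/
theorem topCoeff_wedge_mul_self (α : Set.powersetCard (Fin n) m) :
    ∃ s : ℤˣ, ∀ u : Fin n → Fin n → ℂ, topCoeff ((wedge u α).1 * (wedgeCompl u α).1) =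
      ((s : ℤ) : ℂ) * (colMatrix u).det := by
  have hd : Disjoint (α : Finset (Fin n)) ((Set.powersetCard.ofCard
      (rfl : (α : Finset (Fin n))ᶜ.card = _) : Set.powersetCard (Fin n) _) : Finset (Fin n)) :=
    disjoint_compl_right
  refine ⟨(Set.powersetCard.permOfDisjoint hd).sign, fun u => ?_⟩
  have h1 := ExteriorAlgebra.ιMulti_family_mul_of_disjoint ℂ u α _ hd
  have h2 : ((Set.powersetCard.disjUnion hd : Set.powersetCard (Fin n) _) : Finset (Fin n)) =
      Finset.univ := by
    rw [Set.powersetCard.coe_disjUnion, Finset.disjUnion_eq_union]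
    exact Finset.union_compl _
  simp only [exteriorPower.ιMulti_family_apply_coe]
  rw [h1, ← topCoeff_ιMulti_family u _ h2, Units.smul_def, topCoeff, map_zsmul]
  simp [topCoeff]

theorem wedge_mul_wedgeCompl_of_ne (u : Fin n → Fin n → ℂ) {α β : Set.powersetCard (Fin n) m}
    (h : α ≠ β) : (wedge u β).1 * (wedgeCompl u α).1 = 0 := by
  refine ExteriorAlgebra.ιMulti_family_mul_of_not_disjoint ℂ u β _ fun hd => h ?_
  have h1 : (β : Finset (Fin n)) ⊆ α := by
    have := Disjoint.le_compl_right hd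
    simpa using this
  exact (Set.powersetCard.eq_iff_subset.2 h1).symm

/-- The kernel `G_m(x,t,ρ)` is the propagator `∧^m (c(ρx) c(ρt)⁻¹)` of the system satisfied by the
`m`-fold wedge products of solutions. -/
theorem green_eq {h : Fin n → Fin n → ℂ} {c : Fin n → ℂ → Fin n → ℂ} {ρ : ℂ} {x t : ℝ}
    (hh : (colMatrix h).det = 1) (hc : (colMatrix fun j => c j (ρ * t)).det = 1)
    (f : Tensor n m) :
    green h c ρ x t f = compound m (colMatrix fun j => c j (ρ * x))
      (compound m (colMatrix fun j => c j (ρ * t)).adjugate f) := by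
  set Ct := colMatrix fun j => c j (ρ * t) with hCt
  obtain ⟨g, rfl⟩ : ∃ g, f = compound m Ct g := by
    refine ⟨compound m Ct.adjugate f, ?_⟩
    rw [← mul_apply_eq_comp, ← compound_mul, Matrix.mul_adjugate, hc, one_smul, compound_one]
    rfl
  have h1 : compound m Ct.adjugate (compound m Ct g) = g := by
    rw [← mul_apply_eq_comp, ← compound_mul, Matrix.adjugate_mul, hc, one_smul, compound_one]
    rfl
  rw [h1]
  have hlin : ∀ g : Tensor n m, green h c ρ x t (compound m Ct g) =
      ∑ β, (tensorBasis n m).repr g β • green h c ρ x t (wedge (fun j => c j (ρ * t)) β) := by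
    intro g
    have hg : compound m Ct g =
        ∑ β, (tensorBasis n m).repr g β • wedge (fun j => c j (ρ * t)) β := by
      conv_lhs => rw [← (tensorBasis n m).sum_repr g]
      simp only [map_sum, map_smul, wedge_eq_compound (fun j => c j (ρ * t)), ← hCt]
    rw [hg]
    have : ∀ (r : Set.powersetCard (Fin n) m → ℂ) (w : Set.powersetCard (Fin n) m → Tensor n m),
        green h c ρ x t (∑ β, r β • w β) = ∑ β, r β • green h c ρ x t (w β) := by
      intro r w
      simp only [green, topCoeff, Submodule.coe_sum, Submodule.coe_smul, Finset.sum_mul,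
        smul_mul_assoc, map_sum, map_smul, Finsupp.coe_finsetSum, Finset.sum_apply,
        Finsupp.coe_smul, Pi.smul_apply, smul_eq_mul, Finset.mul_sum, Finset.sum_smul,
        Finset.smul_sum, smul_smul]
      rw [Finset.sum_comm]
      refine Finset.sum_congr rfl fun i _ => Finset.sum_congr rfl fun j _ => ?_
      congr 1
      ring
    exact this _ _
  rw [hlin]
  conv_rhs => rw [← (tensorBasis n m).sum_repr g]
  simp only [map_sum, map_smul]
  refine Finset.sum_congr rfl fun β _ => ?_
  congr 1
  rw [← wedge_eq_compound, green, Finset.sum_eq_single β]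
  · obtain ⟨s, hs⟩ := topCoeff_wedge_mul_self β
    rw [hs, hs, hh, hc]
    have : ((s : ℤ) : ℂ) * ((s : ℤ) : ℂ) = 1 := by
      rw [← Int.cast_mul, ← Units.val_mul, Int.units_mul_self]
      simp
    rw [mul_one, this, one_smul]
  · intro α _ hα
    rw [wedge_mul_wedgeCompl_of_ne _ hα]
    simp [topCoeff]
  · simp

/-! ### Volterra sets and exponential weights -/

/-- The domain of integration of the Volterra equations: `(0,x)` for `ε = 1` (the tensors `T_k`)
and `(x,∞)` for `ε = -1` (the tensors `F_k`). -/
def volterraSet (ε x : ℝ) : Set ℝ := {t | 0 < t ∧ ε * t < ε * x}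

theorem volterraSet_one (x : ℝ) : volterraSet 1 x = Ioo 0 x := by
  ext t; simp [volterraSet]

theorem volterraSet_neg_one {x : ℝ} (hx : 0 ≤ x) : volterraSet (-1) x = Ioi x := by
  ext t
  simp only [volterraSet, mem_ofPred_eq, mem_Ioi]
  constructor
  · rintro ⟨_, h⟩; linarith
  · intro h; exact ⟨by linarith, by linarith⟩

theorem volterraSet_subset (ε x : ℝ) : volterraSet ε x ⊆ Ioi 0 := fun _ h => h.1

theorem isOpen_volterraSet (ε x : ℝ) : IsOpen (volterraSet ε x) :=
  (isOpen_lt continuous_const continuous_id).inter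
    (isOpen_lt (continuous_const.mul continuous_id) continuous_const)

theorem measurableSet_volterraSet (ε x : ℝ) : MeasurableSet (volterraSet ε x) :=
  (isOpen_volterraSet ε x).measurableSet

/-- Exponential weights `Θ = exp (λ ∫_{J(x)} m)` turn a Volterra operator with kernel bounded by
`m` into a contraction with constant `λ⁻¹`. -/
theorem exists_volterra_weight {ε : ℝ} (hε : ε = 1 ∨ ε = -1) {m : ℝ → ℝ} (hm : ∀ t, 0 ≤ m t)
    (hint : IntegrableOn m (Ioi 0)) {l : ℝ} (hl : 0 < l) :
    ∃ Θ : ℝ → ℝ, Continuous Θ ∧ (∀ x, 1 ≤ Θ x) ∧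
      (∀ x, Θ x ≤ Real.exp (l * ∫ t in Ioi 0, m t)) ∧
      ∀ x, 0 ≤ x → ∫ t in volterraSet ε x, m t * Θ t ≤ Θ x / l := by
  set m' : ℝ → ℝ := (Ioi 0).indicator m with hm'
  have hm'0 : ∀ t, 0 ≤ m' t := fun t => indicator_nonneg (fun t _ => hm t) t
  have hi : Integrable m' := (integrable_indicator_iff measurableSet_Ioi).2 hint
  have hI : ∫ t, m' t = ∫ t in Ioi 0, m t := integral_indicator measurableSet_Ioi
  set q : ℝ → ℝ := fun x => ∫ t in (0 : ℝ)..x, m' t with hq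
  have hqc : Continuous q := intervalIntegral.continuous_primitive (fun a b => hi.intervalIntegrable) 0
  have hqsub : ∀ a b, q b - q a = ∫ t in a..b, m' t := fun a b =>
    intervalIntegral.integral_interval_sub_left hi.intervalIntegrable hi.intervalIntegrable
  have hqm : Monotone q := by
    intro a b hab
    have := intervalIntegral.integral_nonneg hab (fun t _ => hm'0 t) (μ := volume)
    linarith [hqsub a b]
  have hqle : ∀ x, q x ≤ ∫ t, m' t := by
    intro x
    rcases le_total 0 x with hx | hx
    · simp only [hq]
      rw [intervalIntegral.integral_of_le hx]
      exact setIntegral_le_integral hi (Eventually.of_forall hm'0)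
    · have h1 : q x ≤ q 0 := hqm hx
      have h2 : q 0 = 0 := by simp [hq]
      have h3 : 0 ≤ ∫ t, m' t := integral_nonneg hm'0
      linarith
  have hq0 : ∀ x, 0 ≤ q x := by
    intro x
    rcases le_total 0 x with hx | hx
    · have h1 : q 0 ≤ q x := hqm hx
      simpa [hq] using h1
    · have h1 : q x = 0 := by
        simp only [hq]
        rw [intervalIntegral.integral_congr_ae (g := fun _ => (0 : ℝ))]
        · simp
        · refine Eventually.of_forall fun t ht => ?_
          rw [uIoc_of_ge hx] at ht
          exact indicator_of_notMem (by simpa using ht.2) _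
      rw [h1]
  have hqd : ∀ᵐ x, HasDerivAt q (m' x) x := by
    filter_upwards [LocallyIntegrable.ae_hasDerivAt_integral hi.locallyIntegrable] with x hx using hx 0
  -- `q` is differentiable only almost everywhere; for a monotone function the integral of the
  -- derivative is still at most the increment
  have key : ∀ f : ℝ → ℝ, Monotone f → ∀ φ : ℝ → ℝ, (∀ᵐ x, HasDerivAt f (l * (m' x * φ x)) x) →
      ∀ a b, a ≤ b → ∫ x in a..b, m' x * φ x ≤ (f b - f a) / l := by
    intro f hf φ hφ a b hab
    have h1 := (hf.monotoneOn (uIcc a b)).intervalIntegral_deriv_mem_uIcc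
    rw [uIcc_of_le (sub_nonneg.2 (hf hab))] at h1
    have h2 : ∫ x in a..b, deriv f x = ∫ x in a..b, l * (m' x * φ x) :=
      intervalIntegral.integral_congr_ae (by
        filter_upwards [hφ] with x hx _ using hx.deriv)
    rw [h2, intervalIntegral.integral_const_mul] at h1
    rw [le_div_iff₀ hl]
    linarith [h1.2]
  rcases hε with rfl | rfl
  · refine ⟨fun x => Real.exp (l * q x), by fun_prop, fun x => ?_, fun x => ?_, fun x hx => ?_⟩
    · exact Real.one_le_exp (mul_nonneg hl.le (hq0 x))
    · rw [← hI]
      exact Real.exp_le_exp.2 (mul_le_mul_of_nonneg_left (hqle x) hl.le)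
    · have h1 := key (fun x => Real.exp (l * q x)) (fun a b hab =>
        Real.exp_le_exp.2 (mul_le_mul_of_nonneg_left (hqm hab) hl.le)) (fun x => Real.exp (l * q x))
        (by
          filter_upwards [hqd] with x hx
          convert (hx.const_mul l).exp using 1
          ring) 0 x hx
      rw [volterraSet_one, ← integral_Ioc_eq_integral_Ioo]
      rw [intervalIntegral.integral_of_le hx] at h1
      have h2 : ∫ t in Ioc 0 x, m t * Real.exp (l * q t) =
          ∫ t in Ioc 0 x, m' t * Real.exp (l * q t) :=
        setIntegral_congr_fun measurableSet_Ioc fun t ht => by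
          have h3 : m' t = m t := indicator_of_mem (show t ∈ Ioi (0 : ℝ) from ht.1) m
          change m t * _ = m' t * _
          rw [h3]
      rw [h2]
      refine h1.trans ?_
      gcongr
      linarith [Real.exp_pos (l * q 0)]
  · set Q : ℝ → ℝ := fun x => (∫ t, m' t) - q x with hQ
    have hΘc : Continuous fun x => Real.exp (l * Q x) := by fun_prop
    have hΘle : ∀ x, Real.exp (l * Q x) ≤ Real.exp (l * ∫ t, m' t) := fun x =>
      Real.exp_le_exp.2 (mul_le_mul_of_nonneg_left (by simp only [hQ]; linarith [hq0 x]) hl.le)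
    refine ⟨fun x => Real.exp (l * Q x), hΘc, fun x => ?_, fun x => ?_, fun x hx => ?_⟩
    · exact Real.one_le_exp (mul_nonneg hl.le (sub_nonneg.2 (hqle x)))
    · rw [← hI]; exact hΘle x
    · have h1 : ∀ b, x ≤ b → ∫ t in x..b, m' t * Real.exp (l * Q t) ≤ Real.exp (l * Q x) / l := by
        intro b hb
        refine (key (fun x => -Real.exp (l * Q x)) (fun a b hab => ?_)
          (fun x => Real.exp (l * Q x)) ?_ x b hb).trans ?_
        · refine neg_le_neg (Real.exp_le_exp.2 (mul_le_mul_of_nonneg_left ?_ hl.le))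
          exact sub_le_sub_left (hqm hab) _
        · filter_upwards [hqd] with x hx
          refine HasDerivAt.congr_deriv (f := fun x => -Real.exp (l * Q x))
            ((hx.const_sub (∫ t, m' t)).const_mul l).exp.neg ?_
          simp only [hQ]
          ring
        · gcongr
          linarith [Real.exp_pos (l * Q b)]
      have hi2 : Integrable fun t => m' t * Real.exp (l * Q t) := by
        refine hi.mul_bdd (c := Real.exp (l * ∫ t, m' t)) hΘc.aestronglyMeasurable
          (Eventually.of_forall fun t => ?_)
        rw [Real.norm_eq_abs, Real.abs_exp]
        exact hΘle t
      have h2 := le_of_tendsto (intervalIntegral_tendsto_integral_Ioi x hi2.integrableOn tendsto_id)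
        (eventually_atTop.2 ⟨x, h1⟩)
      rw [volterraSet_neg_one hx]
      have h3 : ∫ t in Ioi x, m t * Real.exp (l * Q t) =
          ∫ t in Ioi x, m' t * Real.exp (l * Q t) :=
        setIntegral_congr_fun measurableSet_Ioi fun t ht => by
          have h3 : m' t = m t := indicator_of_mem (show t ∈ Ioi (0 : ℝ) from hx.trans_lt ht) m
          change m t * _ = m' t * _
          rw [h3]
      rw [h3]
      exact h2

/-! ### Inequalities in `L₂` -/

/-- Minkowski's integral inequality in `L₂`. -/
theorem lintegral_sq_lintegral_le {α β : Type*} [MeasurableSpace α] [MeasurableSpace β]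
    {μ : Measure α} {ν : Measure β} [SFinite μ] [SFinite ν] {h : α → β → ℝ≥0∞}
    (hh : AEMeasurable (Function.uncurry h) (μ.prod ν)) :
    ∫⁻ s, (∫⁻ t, h t s ∂μ) ^ 2 ∂ν ≤ (∫⁻ t, (∫⁻ s, h t s ^ 2 ∂ν) ^ (1 / 2 : ℝ) ∂μ) ^ 2 := by
  wlog hmeas : Measurable (Function.uncurry h) generalizing h
  · have h1 := this (h := fun t s => hh.mk _ (t, s)) hh.measurable_mk.aemeasurable
      hh.measurable_mk
    have hae : ∀ᵐ p ∂(μ.prod ν), h p.1 p.2 = hh.mk _ p := hh.ae_eq_mk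
    have hae1 := Measure.ae_ae_of_ae_prod hae
    have hae2 : ∀ᵐ s ∂ν, ∀ᵐ t ∂μ, h t s = hh.mk _ (t, s) := by
      refine Measure.ae_ae_of_ae_prod (p := fun q : β × α => h q.2 q.1 = hh.mk _ (q.2, q.1)) ?_
      exact (Measure.measurePreserving_swap (μ := ν) (ν := μ)).quasiMeasurePreserving.ae hae
    calc _ = ∫⁻ s, (∫⁻ t, hh.mk _ (t, s) ∂μ) ^ 2 ∂ν := by
          refine lintegral_congr_ae ?_
          filter_upwards [hae2] with s hs
          rw [lintegral_congr_ae hs]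
      _ ≤ _ := h1
      _ = _ := by
          congr 1
          refine lintegral_congr_ae ?_
          filter_upwards [hae1] with t ht
          congr 1
          refine lintegral_congr_ae ?_
          filter_upwards [ht] with s hs
          rw [hs]
  have hm1 : ∀ t, Measurable (h t) := fun t => hmeas.comp measurable_prodMk_left
  have hm2 : ∀ s, Measurable fun t => h t s := fun s => hmeas.comp measurable_prodMk_right
  have hN : Measurable fun t => (∫⁻ s, h t s ^ 2 ∂ν) ^ (1 / 2 : ℝ) :=
    ((hmeas.pow_const 2).lintegral_prod_right').pow_const _
  have hcs : ∀ t t', ∫⁻ s, h t s * h t' s ∂ν ≤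
      (∫⁻ s, h t s ^ 2 ∂ν) ^ (1 / 2 : ℝ) * (∫⁻ s, h t' s ^ 2 ∂ν) ^ (1 / 2 : ℝ) := by
    intro t t'
    have := ENNReal.lintegral_mul_le_Lp_mul_Lq ν Real.HolderConjugate.two_two
      (hm1 t).aemeasurable (hm1 t').aemeasurable
    simpa using this
  calc ∫⁻ s, (∫⁻ t, h t s ∂μ) ^ 2 ∂ν
      = ∫⁻ s, ∫⁻ t, ∫⁻ t', h t s * h t' s ∂μ ∂μ ∂ν := by
        refine lintegral_congr fun s => ?_
        rw [sq, ← lintegral_mul_const _ (hm2 s)]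
        refine lintegral_congr fun t => ?_
        rw [lintegral_const_mul _ (hm2 s)]
    _ = ∫⁻ t, ∫⁻ s, ∫⁻ t', h t s * h t' s ∂μ ∂ν ∂μ := by
        rw [lintegral_lintegral_swap]
        refine Measurable.aemeasurable ?_
        refine Measurable.lintegral_prod_right' (f := fun p : (β × α) × α =>
          h p.1.2 p.1.1 * h p.2 p.1.1) ?_
        exact (hmeas.comp (measurable_fst.snd.prodMk measurable_fst.fst)).mul
          (hmeas.comp (measurable_snd.prodMk measurable_fst.fst))
    _ = ∫⁻ t, ∫⁻ t', ∫⁻ s, h t s * h t' s ∂ν ∂μ ∂μ := by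
        refine lintegral_congr fun t => ?_
        rw [lintegral_lintegral_swap]
        exact (((hm1 t).comp measurable_fst).mul
          (hmeas.comp (measurable_snd.prodMk measurable_fst))).aemeasurable
    _ ≤ ∫⁻ t, ∫⁻ t', (∫⁻ s, h t s ^ 2 ∂ν) ^ (1 / 2 : ℝ) *
          (∫⁻ s, h t' s ^ 2 ∂ν) ^ (1 / 2 : ℝ) ∂μ ∂μ :=
        lintegral_mono fun t => lintegral_mono fun t' => hcs t t'
    _ = _ := by
        rw [sq, ← lintegral_mul_const _ hN]
        refine lintegral_congr fun t => ?_
        rw [lintegral_const_mul _ hN]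

open scoped FourierTransform SchwartzMap in
/-- Plancherel's theorem for the Fourier integral of a function in `L₁ ∩ L₂`. -/
theorem eLpNorm_fourier_eq {f : ℝ → ℂ} (hf : Integrable f) (hf2 : MemLp f 2) :
    eLpNorm (𝓕 f) 2 = eLpNorm f 2 := by
  set g : Lp ℂ 2 (volume : Measure ℝ) := hf2.toLp f with hg
  have hcont : Continuous (𝓕 f) :=
    VectorFourier.fourierIntegral_continuous Real.continuous_fourierChar
      (by exact continuous_inner) hf
  have h1 : ∀ φ : 𝓢(ℝ, ℂ), ∫ x, φ x • (𝓕 g : Lp ℂ 2 (volume : Measure ℝ)) x = ∫ x, φ x • 𝓕 f x := by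
    intro φ
    have h2 := congrArg (fun T : TemperedDistribution ℝ ℂ => T φ)
      (Lp.fourier_toTemperedDistribution_eq g)
    simp only [TemperedDistribution.fourier_apply, Lp.toTemperedDistribution_apply] at h2
    rw [← h2]
    have h3 : ∫ x, (𝓕 φ) x • g x = ∫ x, (𝓕 φ) x • f x := by
      refine integral_congr_ae ?_
      filter_upwards [hf2.coeFn_toLp] with x hx
      rw [hg, hx]
    rw [h3]
    have h4 := VectorFourier.integral_fourierIntegral_smul_eq_flip (L := innerₗ ℝ)
      Real.continuous_fourierChar (by exact continuous_inner) (φ.integrable (μ := volume)) hf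
    rw [flip_innerₗ] at h4
    exact h4
  have hae : ∀ᵐ x, (𝓕 g : Lp ℂ 2 (volume : Measure ℝ)) x = 𝓕 f x := by
    refine ae_eq_of_integral_contDiff_smul_eq ((Lp.memLp _).locallyIntegrable (by norm_num))
      hcont.locallyIntegrable fun φ hφ hφc => ?_
    have hc : HasCompactSupport fun x => (φ x : ℂ) := hφc.comp_left Complex.ofReal_zero
    have hd : ContDiff ℝ (⊤ : ℕ∞) fun x => (φ x : ℂ) := Complex.ofRealCLM.contDiff.comp hφ
    have := h1 (hc.toSchwartzMap hd)
    simpa using this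
  rw [← eLpNorm_congr_ae hae]
  have h5 : ‖(𝓕 g : Lp ℂ 2 (volume : Measure ℝ))‖ = ‖g‖ := Lp.norm_fourier_eq g
  rw [Lp.norm_def, Lp.norm_def, ENNReal.toReal_eq_toReal_iff' (Lp.eLpNorm_ne_top _)
    (Lp.eLpNorm_ne_top _)] at h5
  rw [h5]
  exact eLpNorm_congr_ae hf2.coeFn_toLp

/-! ### The Laplace transform in `L₂` -/

theorem lintegral_comp_abs {F : ℝ → ℝ≥0∞} (hF : Measurable F) :
    ∫⁻ u, F |u| = 2 * ∫⁻ u in Ioi 0, F u := by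
  have h1 : ∫⁻ u in Ioi 0, F |u| = ∫⁻ u in Ioi 0, F u :=
    setLIntegral_congr_fun measurableSet_Ioi fun u hu => by
      simp only [abs_of_pos (show (0 : ℝ) < u from hu)]
  have h2 : ∫⁻ u in Iic 0, F |u| = ∫⁻ u in Ioi 0, F |u| := by
    have h3 := (Measure.measurePreserving_neg (volume : Measure ℝ)).setLIntegral_comp_preimage
      (s := Ici (0 : ℝ)) measurableSet_Ici (f := fun u => F |u|) (hF.comp continuous_abs.measurable)
    simp only [abs_neg, neg_preimage, neg_Ici, neg_zero] at h3
    rw [h3]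
    exact setLIntegral_congr Ioi_ae_eq_Ici.symm
  rw [← lintegral_add_compl _ (measurableSet_Ioi (a := (0 : ℝ))), compl_Ioi, h2, h1, two_mul]

theorem lintegral_rpow_mul_exp {c : ℝ} (hc : 0 < c) :
    ∫⁻ u in Ioi 0, ENNReal.ofReal (u ^ (-(1 / 2) : ℝ) * Real.exp (-(c * u))) =
      ENNReal.ofReal (c ^ (-(1 / 2) : ℝ)) * ENNReal.ofReal (Real.Gamma (1 / 2)) := by
  have h1 : IntegrableOn (fun u : ℝ => u ^ (-(1 / 2) : ℝ) * Real.exp (-(c * u))) (Ioi 0) := by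
    have := integrableOn_rpow_mul_exp_neg_mul_rpow (s := -(1 / 2)) (p := 1) (by norm_num)
      one_pos hc
    simpa using this
  rw [← ofReal_integral_eq_lintegral_ofReal h1]
  · have h2 := Real.integral_rpow_mul_exp_neg_mul_Ioi (a := 1 / 2) (by norm_num) hc
    norm_num at h2
    norm_num
    rw [h2, ENNReal.ofReal_mul (by positivity), Real.rpow_neg hc.le, Real.inv_rpow hc.le]
  · filter_upwards [self_mem_ae_restrict measurableSet_Ioi] with u hu
    have : (0 : ℝ) < u := hu
    simp only [Pi.zero_apply]
    positivity

/-- The Laplace transform, centred at an arbitrary point, is bounded in `L₂` (Schur's test with the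
weight `|t - t₀|^{1/2}`). -/
theorem lintegral_laplace_sq_le {f : ℝ → ℝ≥0∞} (hf : AEMeasurable f)
    (hf' : ∀ t, f t ≠ ⊤) {δ : ℝ} (hδ : 0 < δ)
    (t₀ : ℝ) :
    ∫⁻ s in Ioi 0, (∫⁻ t, f t * ENNReal.ofReal (Real.exp (-(s * δ * |t - t₀|)))) ^ 2 ≤
      2 * ENNReal.ofReal (Real.Gamma (1 / 2)) ^ 2 * ENNReal.ofReal δ⁻¹ * ∫⁻ t, f t ^ 2 := by
  set B := ENNReal.ofReal (Real.Gamma (1 / 2)) with hB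
  have hne : ∀ᵐ t : ℝ, t ≠ t₀ := by simp [ae_iff, measure_singleton]
  have hL : ∀ c : ℝ, 0 < c →
      ∫⁻ t, ENNReal.ofReal (|t - t₀| ^ (-(1 / 2) : ℝ) * Real.exp (-(c * |t - t₀|))) =
        2 * (ENNReal.ofReal (c ^ (-(1 / 2) : ℝ)) * B) := by
    intro c hc
    rw [lintegral_sub_right_eq_self
      (fun t => ENNReal.ofReal (|t| ^ (-(1 / 2) : ℝ) * Real.exp (-(c * |t|)))) t₀,
      ← lintegral_rpow_mul_exp hc]
    exact lintegral_comp_abs (F := fun u => ENNReal.ofReal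
      (u ^ (-(1 / 2) : ℝ) * Real.exp (-(c * u)))) (by fun_prop)
  -- Cauchy-Schwarz for fixed `s`, with the factors `|t - t₀|^{1/4}` and `|t - t₀|^{-1/4}`
  have hcs : ∀ s : ℝ, 0 < s → (∫⁻ t, f t * ENNReal.ofReal (Real.exp (-(s * δ * |t - t₀|)))) ^ 2 ≤
      2 * B * ∫⁻ t, f t ^ 2 * ENNReal.ofReal (|t - t₀| ^ (1 / 2 : ℝ)) *
        (ENNReal.ofReal ((s * δ) ^ (-(1 / 2) : ℝ) * Real.exp (-(s * δ * |t - t₀|)))) := by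
    intro s hs
    set F : ℝ → ℝ≥0∞ := fun t => f t * ENNReal.ofReal
      (|t - t₀| ^ (1 / 4 : ℝ) * Real.exp (-(s * δ * |t - t₀|) / 2)) with hF
    set G : ℝ → ℝ≥0∞ := fun t => ENNReal.ofReal
      (|t - t₀| ^ (-(1 / 4) : ℝ) * Real.exp (-(s * δ * |t - t₀|) / 2)) with hG
    have hFm : AEMeasurable F := hf.mul (by fun_prop)
    have hGm : AEMeasurable G := by fun_prop
    have h1 := ENNReal.lintegral_mul_le_Lp_mul_Lq volume Real.HolderConjugate.two_two hFm hGm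
    have h2 : ∫⁻ t, (F * G) t = ∫⁻ t, f t * ENNReal.ofReal (Real.exp (-(s * δ * |t - t₀|))) := by
      refine lintegral_congr_ae ?_
      filter_upwards [hne] with t ht
      have h0 : 0 < |t - t₀| := abs_pos.2 (sub_ne_zero.2 ht)
      simp only [Pi.mul_apply, hF, hG]
      rw [mul_assoc, ← ENNReal.ofReal_mul (by positivity)]
      congr 2
      rw [mul_mul_mul_comm, ← Real.rpow_add h0, ← Real.exp_add]
      norm_num
    have hsq : ∀ a b : ℝ, (a * Real.exp (-b / 2)) ^ 2 = a ^ 2 * Real.exp (-b) := by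
      intro a b
      rw [mul_pow, ← Real.exp_nat_mul]
      congr 2
      push_cast
      ring
    have h3 : ∫⁻ t, F t ^ (2 : ℝ) = ∫⁻ t, f t ^ 2 * ENNReal.ofReal (|t - t₀| ^ (1 / 2 : ℝ)) *
        ENNReal.ofReal (Real.exp (-(s * δ * |t - t₀|))) := by
      refine lintegral_congr fun t => ?_
      simp only [hF, ENNReal.rpow_two]
      rw [mul_pow, mul_assoc, ← ENNReal.ofReal_pow (by positivity), hsq,
        ENNReal.ofReal_mul (by positivity), ← Real.rpow_natCast, ← Real.rpow_mul (abs_nonneg _),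
        ← mul_assoc]
      norm_num
    have h4 : ∫⁻ t, G t ^ (2 : ℝ) = 2 * (ENNReal.ofReal ((s * δ) ^ (-(1 / 2) : ℝ)) * B) := by
      rw [← hL _ (mul_pos hs hδ)]
      refine lintegral_congr fun t => ?_
      simp only [hG, ENNReal.rpow_two]
      rw [← ENNReal.ofReal_pow (by positivity), hsq, ← Real.rpow_natCast,
        ← Real.rpow_mul (abs_nonneg _)]
      norm_num
    rw [h2, h3, h4] at h1
    have h5 := pow_le_pow_left₀ zero_le h1 2
    refine h5.trans (le_of_eq ?_)
    rw [mul_pow, ← ENNReal.rpow_natCast, ← ENNReal.rpow_natCast, ← ENNReal.rpow_mul,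
      ← ENNReal.rpow_mul]
    norm_num
    have h6 : ∀ t, f t ^ 2 * ENNReal.ofReal (|t - t₀| ^ (1 / 2 : ℝ)) *
        (ENNReal.ofReal ((s * δ) ^ (-(1 / 2) : ℝ) * Real.exp (-(s * δ * |t - t₀|)))) =
        ENNReal.ofReal ((s * δ) ^ (-(1 / 2) : ℝ)) * (f t ^ 2 *
          ENNReal.ofReal (|t - t₀| ^ (1 / 2 : ℝ)) *
          ENNReal.ofReal (Real.exp (-(s * δ * |t - t₀|)))) := by
      intro t
      rw [ENNReal.ofReal_mul (by positivity)]
      ring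
    norm_num at h6
    simp only [h6]
    rw [lintegral_const_mul' _ _ ENNReal.ofReal_ne_top]
    ring
  calc ∫⁻ s in Ioi 0, (∫⁻ t, f t * ENNReal.ofReal (Real.exp (-(s * δ * |t - t₀|)))) ^ 2
      ≤ ∫⁻ s in Ioi 0, 2 * B * ∫⁻ t, f t ^ 2 * ENNReal.ofReal (|t - t₀| ^ (1 / 2 : ℝ)) *
        (ENNReal.ofReal ((s * δ) ^ (-(1 / 2) : ℝ) * Real.exp (-(s * δ * |t - t₀|)))) :=
        setLIntegral_mono' measurableSet_Ioi fun s hs => hcs s hs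
    _ = 2 * B * ∫⁻ t, ∫⁻ s in Ioi 0, f t ^ 2 * ENNReal.ofReal (|t - t₀| ^ (1 / 2 : ℝ)) *
        (ENNReal.ofReal ((s * δ) ^ (-(1 / 2) : ℝ) * Real.exp (-(s * δ * |t - t₀|)))) := by
        rw [lintegral_const_mul' _ _ (by finiteness), lintegral_lintegral_swap]
        refine AEMeasurable.mul (AEMeasurable.mul ?_ (by fun_prop)) (by fun_prop)
        exact ((hf.comp_quasiMeasurePreserving
          Measure.quasiMeasurePreserving_snd).pow_const 2)
    _ = 2 * B * ∫⁻ t, f t ^ 2 * (ENNReal.ofReal δ⁻¹ * B) := by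
        congr 1
        refine lintegral_congr_ae ?_
        filter_upwards [hne] with t ht
        have h0 : 0 < |t - t₀| := abs_pos.2 (sub_ne_zero.2 ht)
        simp only [mul_assoc]
        have hft : f t ^ 2 ≠ ⊤ := ENNReal.pow_ne_top (hf' t)
        rw [lintegral_const_mul' _ _ hft, lintegral_const_mul' _ _ ENNReal.ofReal_ne_top]
        congr 1
        have h1 : ∫⁻ s in Ioi 0, ENNReal.ofReal ((s * δ) ^ (-(1 / 2) : ℝ) *
            Real.exp (-(s * (δ * |t - t₀|)))) = ENNReal.ofReal (δ ^ (-(1 / 2) : ℝ)) *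
            (ENNReal.ofReal ((δ * |t - t₀|) ^ (-(1 / 2) : ℝ)) * B) := by
          rw [← lintegral_rpow_mul_exp (mul_pos hδ h0),
            ← lintegral_const_mul' _ _ ENNReal.ofReal_ne_top]
          refine setLIntegral_congr_fun measurableSet_Ioi fun s hs => ?_
          have hs : (0 : ℝ) < s := hs
          rw [← ENNReal.ofReal_mul (by positivity), Real.mul_rpow hs.le hδ.le,
            mul_comm s (δ * _)]
          congr 1
          ring
        rw [h1, ← mul_assoc, ← mul_assoc, ← ENNReal.ofReal_mul (by positivity),
          ← ENNReal.ofReal_mul (by positivity)]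
        congr 2
        rw [Real.mul_rpow hδ.le h0.le]
        have h2 : |t - t₀| ^ (1 / 2 : ℝ) * |t - t₀| ^ (-(1 / 2) : ℝ) = 1 := by
          rw [← Real.rpow_add h0]; norm_num
        have h3 : δ ^ (-(1 / 2) : ℝ) * δ ^ (-(1 / 2) : ℝ) = δ⁻¹ := by
          rw [← Real.rpow_add hδ, ← Real.rpow_neg_one]; norm_num
        linear_combination h3 * (|t - t₀| ^ (1 / 2 : ℝ) * |t - t₀| ^ (-(1 / 2) : ℝ)) + δ⁻¹ * h2
    _ = _ := by
        rw [lintegral_mul_const' _ _ (by finiteness)]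
        ring

/-! ### Oscillatory and decaying phase integrals -/

theorem eLpNorm_two_sq {α E : Type*} [MeasurableSpace α] [NormedAddCommGroup E] (f : α → E)
    (μ : Measure α) : eLpNorm f 2 μ ^ 2 = ∫⁻ x, ‖f x‖ₑ ^ 2 ∂μ := by
  rw [eLpNorm_eq_lintegral_rpow_enorm_toReal two_ne_zero ENNReal.ofNat_ne_top,
    ← ENNReal.rpow_natCast, ← ENNReal.rpow_mul]
  norm_num

/-- The integral of `f(t) exp (ρ((x - t) a' + t a))` over the Volterra set of `x`. -/
def phaseIntegral (ε : ℝ) (a' a ρ : ℂ) (f : ℝ → ℂ) (x : ℝ) : ℂ :=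
  ∫ t in volterraSet ε x, f t * Complex.exp (ρ * ((x - t) * a' + t * a))

theorem re_phase (ρ a' a : ℂ) (x t : ℝ) : (ρ * ((x - t) * a' + t * a)).re =
    (x - t) * (ρ * a').re + t * (ρ * a).re := by
  simp
  ring

theorem norm_exp_phase_le_one {ε : ℝ} (hε : ε = 1 ∨ ε = -1) {ρ a' a : ℂ}
    (h1 : ε * (ρ * a').re ≤ 0) (h2 : (ρ * a).re ≤ 0) {x t : ℝ} (ht : 0 ≤ t) (hxt : ε * t ≤ ε * x) :
    ‖Complex.exp (ρ * ((x - t) * a' + t * a))‖ ≤ 1 := by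
  rw [Complex.norm_exp, re_phase, Real.exp_le_one_iff]
  rcases hε with rfl | rfl <;> nlinarith

theorem norm_phaseIntegral_le {ε : ℝ} (hε : ε = 1 ∨ ε = -1) {ρ a' a : ℂ}
    (h1 : ε * (ρ * a').re ≤ 0) (h2 : (ρ * a).re ≤ 0) {f : ℝ → ℂ} (hf : IntegrableOn f (Ioi 0))
    (x : ℝ) : ‖phaseIntegral ε a' a ρ f x‖ ≤ ∫ t in Ioi 0, ‖f t‖ := by
  refine (norm_integral_le_of_norm_le (g := fun t => ‖f t‖)
    (IntegrableOn.mono_set hf.norm (volterraSet_subset ε x)) ?_).trans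
    (setIntegral_mono_set hf.norm (Eventually.of_forall fun _ => norm_nonneg _)
      (volterraSet_subset ε x).eventuallyLE)
  filter_upwards [self_mem_ae_restrict (measurableSet_volterraSet ε x)] with t ht
  rw [norm_mul]
  exact mul_le_of_le_one_right (norm_nonneg _) (norm_exp_phase_le_one hε h1 h2 ht.1.le ht.2.le)

open scoped FourierTransform in
/-- `L₂` estimate of the phase integrals along a ray: an oscillating phase is a Fourier transform,
otherwise the phase decays exponentially away from one end point of the Volterra set. -/
theorem exists_phaseIntegral_sq_le {ε : ℝ} (hε : ε = 1 ∨ ε = -1) {z a' a : ℂ} (hz : z ≠ 0)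
    (ha : a' ≠ a) (h1 : ε * (z * a').re ≤ 0) (h2 : (z * a).re ≤ 0) :
    ∃ C : ℝ≥0, ∀ f : ℝ → ℂ, IntegrableOn f (Ioi 0) → MemLp f 2 halfLine → ∀ x : ℝ, 0 ≤ x →
      ∫⁻ s : ℝ in Ioi 0, ‖phaseIntegral ε a' a (s * z) f x‖ₑ ^ 2 ≤ C * ∫⁻ t in Ioi 0, ‖f t‖ₑ ^ 2 := by
  have hsub : ∀ (f : ℝ → ℂ) x, ∫⁻ t in volterraSet ε x, ‖f t‖ₑ ^ 2 ≤ ∫⁻ t in Ioi 0, ‖f t‖ₑ ^ 2 :=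
    fun f x => lintegral_mono_set (volterraSet_subset ε x)
  rcases eq_or_ne (z * a').re (z * a).re with heq | hne
  · -- equal decay: the phase is a bounded factor times `exp (i κ s t)`
    set κ := (z * (a - a')).im with hκ
    have hre : (z * (a - a')).re = 0 := by rw [mul_sub, Complex.sub_re, heq, sub_self]
    have hzκ : z * (a - a') = κ * Complex.I := Complex.ext (by simp [hre]) (by simp [hκ])
    have hκ0 : κ ≠ 0 := by
      intro h
      rw [h, Complex.ofReal_zero, zero_mul] at hzκ
      exact mul_ne_zero hz (sub_ne_zero.2 ha.symm) hzκ
    have hx1 : ∀ x : ℝ, 0 ≤ x → ∀ s : ℝ, 0 < s → ‖Complex.exp (s * z * (x * a'))‖ ≤ 1 := by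
      intro x hx s hs
      have hza : (z * a').re ≤ 0 := by rw [heq]; exact h2
      have h3 : (s * z * (x * a')).re = s * x * (z * a').re := by
        simp; ring
      rw [Complex.norm_exp, Real.exp_le_one_iff, h3]
      exact mul_nonpos_of_nonneg_of_nonpos (by positivity) hza
    set w : ℝ := -κ / (2 * Real.pi) with hw
    have hw0 : w ≠ 0 := by
      have := Real.pi_pos
      exact div_ne_zero (neg_ne_zero.2 hκ0) (by positivity)
    refine ⟨Real.toNNReal |w⁻¹|, fun f hf hf2 x hx => ?_⟩
    set F : ℝ → ℂ := (volterraSet ε x).indicator f with hF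
    have hms := measurableSet_volterraSet ε x
    have hFi : Integrable F :=
      (integrable_indicator_iff hms).2 (hf.mono_set (volterraSet_subset ε x))
    have hF2 : MemLp F 2 := (memLp_indicator_iff_restrict hms).2
      (hf2.mono_measure (Measure.restrict_mono (volterraSet_subset ε x) le_rfl))
    have hb : ∀ s : ℝ, 0 < s → ‖phaseIntegral ε a' a (s * z) f x‖ₑ ≤ ‖𝓕 F (w * s)‖ₑ := by
      intro s hs
      have h3 : phaseIntegral ε a' a (s * z) f x = Complex.exp (s * z * (x * a')) * 𝓕 F (w * s) := by
        rw [Real.fourier_eq', ← integral_const_mul, phaseIntegral, ← integral_indicator hms]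
        refine integral_congr_ae (Eventually.of_forall fun t => ?_)
        by_cases ht : t ∈ volterraSet ε x
        · simp only [hF, indicator_of_mem ht, smul_eq_mul]
          rw [mul_comm (f t), ← mul_assoc, ← Complex.exp_add]
          congr 2
          have h4 : (((-2 * Real.pi * inner ℝ t (w * s) : ℝ)) : ℂ) * Complex.I =
              s * t * (z * (a - a')) := by
            have h5 : -2 * Real.pi * inner ℝ t (w * s) = s * t * κ := by
              simp only [hw, RCLike.inner_apply, conj_trivial]
              field_simp
            rw [h5, hzκ]
            push_cast
            ring
          rw [h4]
          ring
        · simp [hF, ht]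
      rw [h3, enorm_mul]
      refine mul_le_of_le_one_left zero_le ?_
      rw [← ofReal_norm, ENNReal.ofReal_le_one]
      exact hx1 x hx s hs
    have hcont : Continuous (𝓕 F) :=
      VectorFourier.fourierIntegral_continuous Real.continuous_fourierChar
        (by exact continuous_inner) hFi
    calc ∫⁻ s : ℝ in Ioi 0, ‖phaseIntegral ε a' a (s * z) f x‖ₑ ^ 2
        ≤ ∫⁻ s : ℝ in Ioi 0, ‖𝓕 F (w * s)‖ₑ ^ 2 :=
          setLIntegral_mono' measurableSet_Ioi fun s hs => pow_le_pow_left₀ zero_le (hb s hs) 2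
      _ ≤ ∫⁻ s : ℝ, ‖𝓕 F (w * s)‖ₑ ^ 2 := setLIntegral_le_lintegral _ _
      _ = ENNReal.ofReal |w⁻¹| * ∫⁻ s : ℝ, ‖𝓕 F s‖ₑ ^ 2 := by
          rw [← lintegral_map (f := fun s => ‖𝓕 F s‖ₑ ^ 2) (hcont.enorm.measurable.pow_const 2)
            (measurable_const_mul w), Real.map_volume_mul_left hw0, lintegral_smul_measure,
            smul_eq_mul]
      _ = ENNReal.ofReal |w⁻¹| * ∫⁻ t in volterraSet ε x, ‖f t‖ₑ ^ 2 := by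
          rw [← eLpNorm_two_sq, eLpNorm_fourier_eq hFi hF2, eLpNorm_two_sq,
            ← lintegral_indicator hms]
          congr 1
          refine lintegral_congr fun t => ?_
          by_cases ht : t ∈ volterraSet ε x <;> simp [hF, ht]
      _ ≤ _ := mul_le_mul' le_rfl (hsub f x)
  · -- different decay: Laplace transform
    set δ := |(z * a').re - (z * a).re| with hδ
    have hδ0 : 0 < δ := abs_pos.2 (sub_ne_zero.2 hne)
    -- the exponent is linear in `t` with slope `±δ` and nonpositive, so it decays at the rate `δ` away
    -- from the end point `t₀` where it is largest
    have hdec : ∀ x : ℝ, 0 ≤ x → ∃ t₀ : ℝ, ∀ s : ℝ, 0 < s → ∀ t ∈ volterraSet ε x,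
        ‖Complex.exp (s * z * ((x - t) * a' + t * a))‖ ≤ Real.exp (-(s * δ * |t - t₀|)) := by
      intro x hx
      have hgen : ∀ t₀ : ℝ, (∀ t ∈ volterraSet ε x,
          (x - t) * (z * a').re + t * (z * a).re ≤ -(δ * |t - t₀|)) → ∀ s : ℝ, 0 < s →
          ∀ t ∈ volterraSet ε x,
          ‖Complex.exp (s * z * ((x - t) * a' + t * a))‖ ≤ Real.exp (-(s * δ * |t - t₀|)) := by
        intro t₀ h s hs t ht
        rw [Complex.norm_exp, mul_assoc, Complex.re_ofReal_mul, re_phase]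
        apply Real.exp_le_exp.2
        have := mul_le_mul_of_nonneg_left (h t ht) hs.le
        linarith
      rcases hε with rfl | rfl
      · rcases hne.lt_or_gt with hlt | hlt
        · refine ⟨x, hgen x fun t ht => ?_⟩
          rw [volterraSet_one] at ht
          rw [hδ, abs_of_neg (sub_neg.2 hlt), abs_of_neg (sub_neg.2 ht.2)]
          nlinarith [ht.1, ht.2]
        · refine ⟨0, hgen 0 fun t ht => ?_⟩
          rw [volterraSet_one] at ht
          rw [hδ, abs_of_pos (sub_pos.2 hlt), sub_zero, abs_of_pos ht.1]
          nlinarith [ht.1, ht.2]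
      · refine ⟨x, hgen x fun t ht => ?_⟩
        have ht0 : 0 < t := ht.1
        rw [volterraSet_neg_one hx] at ht
        have hlt : (z * a).re < (z * a').re := lt_of_le_of_ne (by linarith) hne.symm
        have ht' : x < t := ht
        rw [hδ, abs_of_pos (sub_pos.2 hlt), abs_of_pos (sub_pos.2 ht')]
        nlinarith
    refine ⟨2 * Real.toNNReal (Real.Gamma (1 / 2)) ^ 2 * Real.toNNReal δ⁻¹,
      fun f hf hf2 x hx => ?_⟩
    obtain ⟨t₀, ht₀⟩ := hdec x hx
    have hms := measurableSet_volterraSet ε x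
    set F : ℝ → ℝ≥0∞ := (volterraSet ε x).indicator fun t => ‖f t‖ₑ with hF
    have hFm : AEMeasurable F := (aemeasurable_indicator_iff hms).2
      ((hf.mono_set (volterraSet_subset ε x)).aestronglyMeasurable.enorm)
    have hFt : ∀ t, F t ≠ ⊤ := by
      intro t
      by_cases ht : t ∈ volterraSet ε x <;> simp [hF, ht]
    have h3 := lintegral_laplace_sq_le hFm hFt hδ0 t₀
    have h4 : ∫⁻ t, F t ^ 2 = ∫⁻ t in volterraSet ε x, ‖f t‖ₑ ^ 2 := by
      rw [← lintegral_indicator hms]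
      refine lintegral_congr fun t => ?_
      by_cases ht : t ∈ volterraSet ε x <;> simp [hF, ht]
    rw [h4] at h3
    refine le_trans (setLIntegral_mono' measurableSet_Ioi fun s hs => ?_) (h3.trans ?_)
    · refine pow_le_pow_left₀ zero_le ?_ 2
      rw [phaseIntegral]
      refine (enorm_integral_le_lintegral_enorm _).trans ?_
      rw [← lintegral_indicator hms]
      refine lintegral_mono fun t => ?_
      by_cases ht : t ∈ volterraSet ε x
      · simp only [hF, indicator_of_mem ht]
        rw [enorm_mul]
        gcongr
        rw [← ofReal_norm]
        exact ENNReal.ofReal_le_ofReal (ht₀ s hs t ht)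
      · simp [ht]
    · push_cast
      exact mul_le_mul' le_rfl (hsub f x)

/-- For a smooth amplitude cut off to a bounded interval, integration by parts bounds the phase
integrals by a multiple of `|ρ|⁻¹`, uniformly in `x`. -/
theorem exists_phaseIntegral_le_inv {ε : ℝ} (hε : ε = 1 ∨ ε = -1) {a' a : ℂ} (ha : a' ≠ a)
    {g : ℝ → ℂ} (hg : ContDiff ℝ 1 g) {c d : ℝ} (hc : 0 ≤ c) :
    ∃ C : ℝ, 0 ≤ C ∧ ∀ ρ : ℂ, ρ ≠ 0 → ε * (ρ * a').re ≤ 0 → (ρ * a).re ≤ 0 →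
      ∀ x : ℝ, 0 ≤ x → ‖phaseIntegral ε a' a ρ ((Icc c d).indicator g) x‖ ≤ C * ‖ρ‖⁻¹ := by
  have hg' : Continuous (deriv g) := hg.continuous_deriv le_rfl
  obtain ⟨K, hK⟩ := isCompact_Icc.exists_bound_of_continuousOn (s := Icc c d) hg.continuous.continuousOn
  obtain ⟨K', hK'⟩ := isCompact_Icc.exists_bound_of_continuousOn (s := Icc c d) hg'.continuousOn
  refine ⟨(2 * |K| + |K'| * |d - c|) * ‖a - a'‖⁻¹, by positivity, fun ρ hρ h1 h2 x hx => ?_⟩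
  -- the integral over an interval contained in `[c,d]` and in the closure of the Volterra set
  have key : ∀ u v : ℝ, u ≤ v → c ≤ u → v ≤ d → (∀ t ∈ Icc u v, ε * t ≤ ε * x) →
      ‖∫ t in u..v, g t * Complex.exp (ρ * ((x - t) * a' + t * a))‖ ≤
        (2 * |K| + |K'| * |d - c|) * ‖a - a'‖⁻¹ * ‖ρ‖⁻¹ := by
    intro u v huv hu hv hsub
    set w := ρ * (a - a') with hw
    have hw0 : w ≠ 0 := mul_ne_zero hρ (sub_ne_zero.2 ha.symm)
    set E : ℝ → ℂ := fun t => Complex.exp (ρ * ((x - t) * a' + t * a)) with hE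
    have hE1 : ∀ t ∈ Icc u v, ‖E t‖ ≤ 1 := fun t ht =>
      norm_exp_phase_le_one hε h1 h2 (hc.trans (hu.trans ht.1)) (hsub t ht)
    have hEd : ∀ t : ℝ, HasDerivAt (fun t => w⁻¹ * E t) (E t) t := by
      intro t
      have h3 : HasDerivAt (fun t : ℝ => ρ * (((x : ℂ) - t) * a' + t * a)) w t := by
        have h4 : HasDerivAt (fun t : ℝ => (t : ℂ)) 1 t := Complex.ofRealCLM.hasDerivAt
        refine ((((h4.const_sub (x : ℂ)).mul_const a').add (h4.mul_const a)).const_mul ρ).congr_deriv ?_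
        rw [hw]; ring
      refine (h3.cexp.const_mul w⁻¹).congr_deriv ?_
      field_simp
      rfl
    have hEc : Continuous E := by simp only [hE]; fun_prop
    have h3 := intervalIntegral.integral_mul_deriv_eq_deriv_mul (a := u) (b := v)
      (u := g) (u' := deriv g) (v := fun t => w⁻¹ * E t) (v' := E)
      (fun t _ => (hg.differentiable one_ne_zero t).hasDerivAt) (fun t _ => hEd t)
      (hg'.intervalIntegrable _ _) (hEc.intervalIntegrable _ _)
    have hgK : ∀ t ∈ Icc u v, ‖g t‖ ≤ |K| := fun t ht =>
      (hK t ⟨hu.trans ht.1, ht.2.trans hv⟩).trans (le_abs_self _)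
    have hgK' : ∀ t ∈ Icc u v, ‖deriv g t‖ ≤ |K'| := fun t ht =>
      (hK' t ⟨hu.trans ht.1, ht.2.trans hv⟩).trans (le_abs_self _)
    have hterm : ∀ t ∈ Icc u v, ‖g t * (w⁻¹ * E t)‖ ≤ |K| * ‖w‖⁻¹ := by
      intro t ht
      rw [norm_mul, norm_mul, norm_inv]
      refine mul_le_mul (hgK t ht) (mul_le_of_le_one_right (by positivity) (hE1 t ht))
        (by positivity) (abs_nonneg _)
    have hint : ‖∫ t in u..v, deriv g t * (w⁻¹ * E t)‖ ≤ |K'| * ‖w‖⁻¹ * |v - u| := by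
      refine intervalIntegral.norm_integral_le_of_norm_le_const fun t ht => ?_
      rw [uIoc_of_le huv] at ht
      have ht' : t ∈ Icc u v := ⟨ht.1.le, ht.2⟩
      rw [norm_mul, norm_mul, norm_inv]
      refine mul_le_mul (hgK' t ht') (mul_le_of_le_one_right (by positivity) (hE1 t ht'))
        (by positivity) (abs_nonneg _)
    rw [h3]
    have h4 := norm_sub_le (g v * (w⁻¹ * E v) - g u * (w⁻¹ * E u))
      (∫ t in u..v, deriv g t * (w⁻¹ * E t))
    have h5 := norm_sub_le (g v * (w⁻¹ * E v)) (g u * (w⁻¹ * E u))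
    have h6 := hterm v ⟨huv, le_rfl⟩
    have h7 := hterm u ⟨le_rfl, huv⟩
    have h8 : |v - u| ≤ |d - c| := by
      rw [abs_of_nonneg (by linarith), abs_of_nonneg (by linarith)]; linarith
    have h9 : |K'| * ‖w‖⁻¹ * |v - u| ≤ |K'| * ‖w‖⁻¹ * |d - c| := by gcongr
    have h10 : (2 * |K| + |K'| * |d - c|) * ‖a - a'‖⁻¹ * ‖ρ‖⁻¹ =
        2 * (|K| * ‖w‖⁻¹) + |K'| * ‖w‖⁻¹ * |d - c| := by
      rw [hw, norm_mul, mul_inv]; ring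
    rw [h10]
    linarith
  have hnn : 0 ≤ (2 * |K| + |K'| * |d - c|) * ‖a - a'‖⁻¹ * ‖ρ‖⁻¹ := by positivity
  rw [phaseIntegral]
  have hcongr : ∀ u v : ℝ, (volterraSet ε x ∩ Icc c d : Set ℝ) =ᵐ[volume] (Ioc u v : Set ℝ) →
      ∫ t in volterraSet ε x, (Icc c d).indicator g t *
        Complex.exp (ρ * ((x - t) * a' + t * a)) =
      ∫ t in Ioc u v, g t * Complex.exp (ρ * ((x - t) * a' + t * a)) := by
    intro u v huv
    rw [← setIntegral_congr_set huv, ← setIntegral_indicator measurableSet_Icc]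
    refine setIntegral_congr_fun (measurableSet_volterraSet ε x) fun t _ => ?_
    simp only [indicator_apply]
    split_ifs <;> simp
  rcases hε with rfl | rfl
  · have hset : (volterraSet 1 x ∩ Icc c d : Set ℝ) =ᵐ[volume] (Ioc c (min x d) : Set ℝ) := by
      have h3 : Icc 0 x ∩ Icc c d = Icc c (min x d) := by
        rw [Icc_inter_Icc, sup_eq_right.2 hc]
      rw [volterraSet_one]
      refine (Ioo_ae_eq_Icc.inter (ae_eq_refl _)).trans ?_
      rw [h3]
      exact Ioc_ae_eq_Icc.symm
    rw [hcongr _ _ hset]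
    rcases le_total c (min x d) with h | h
    · rw [← intervalIntegral.integral_of_le h]
      exact key _ _ h le_rfl (min_le_right _ _) fun t ht => by
        linarith [ht.2, min_le_left x d]
    · rw [Ioc_eq_empty (not_lt.2 h)]
      simpa using hnn
  · have hset : (volterraSet (-1) x ∩ Icc c d : Set ℝ) =ᵐ[volume] (Ioc (max x c) d : Set ℝ) := by
      have h3 : Ici x ∩ Icc c d = Icc (max x c) d := by
        rw [← Ici_inter_Iic, ← inter_assoc, Ici_inter_Ici, Ici_inter_Iic]
      rw [volterraSet_neg_one hx]
      refine (Ioi_ae_eq_Ici.inter (ae_eq_refl _)).trans ?_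
      rw [h3]
      exact Ioc_ae_eq_Icc.symm
    rw [hcongr _ _ hset]
    rcases le_total (max x c) d with h | h
    · rw [← intervalIntegral.integral_of_le h]
      exact key _ _ h (le_max_right _ _) le_rfl fun t ht => by
        linarith [ht.1, le_max_left x c]
    · rw [Ioc_eq_empty (not_lt.2 h)]
      simpa using hnn

/-! ### The remainder integrals and the size of a potential -/

theorem lintegral_min_sq_le {c : ℝ} (hc : 0 < c) :
    ∫⁻ s : ℝ in Ioi 0, ENNReal.ofReal (min 1 (s * c)⁻¹) ^ 2 ≤ 2 * ENNReal.ofReal c⁻¹ := by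
  have hc' : 0 < c⁻¹ := inv_pos.2 hc
  rw [← Ioc_union_Ioi_eq_Ioi hc'.le, lintegral_union measurableSet_Ioi (by
    rw [Set.disjoint_left]; rintro x ⟨_, h⟩ h'; exact absurd h' (not_lt.2 h)), two_mul]
  refine add_le_add ?_ ?_
  · calc _ ≤ ∫⁻ s : ℝ in Ioc 0 c⁻¹, 1 := by
          refine lintegral_mono fun s => pow_le_one₀ zero_le ?_
          rw [ENNReal.ofReal_le_one]
          exact min_le_left _ _
      _ = _ := by simp
  · have hi : IntegrableOn (fun s : ℝ => c⁻¹ ^ 2 * s ^ (-2 : ℝ)) (Ioi c⁻¹) :=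
      (integrableOn_Ioi_rpow_of_lt (by norm_num) hc').const_mul _
    calc _ ≤ ∫⁻ s : ℝ in Ioi c⁻¹, ENNReal.ofReal (c⁻¹ ^ 2 * s ^ (-2 : ℝ)) := by
          refine setLIntegral_mono' measurableSet_Ioi fun s hs => ?_
          have hs0 : 0 < s := hc'.trans hs
          rw [← ENNReal.ofReal_pow (by positivity)]
          refine ENNReal.ofReal_le_ofReal ?_
          refine (pow_le_pow_left₀ (by positivity) (min_le_right _ _) 2).trans (le_of_eq ?_)
          rw [mul_inv, mul_pow, Real.rpow_neg hs0.le, Real.rpow_two]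
          field_simp
      _ = ENNReal.ofReal c⁻¹ := by
          rw [← ofReal_integral_eq_lintegral_ofReal hi]
          · rw [integral_const_mul, integral_Ioi_rpow_of_lt (by norm_num) hc']
            congr 1
            norm_num
            rw [Real.rpow_neg_one]
            field_simp
          · filter_upwards [self_mem_ae_restrict measurableSet_Ioi] with s hs
            have hs0 : 0 < s := hc'.trans hs
            simp only [Pi.zero_apply]
            positivity

/-- `L₂` estimate in `s` of `∫ min(1, (sκt)⁻¹) F(t) dt`, by Minkowski's inequality: the function
`min(1, (sκt)⁻¹)` of `s` has `L₂` norm comparable to `(κt)^{-1/2}`. -/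
theorem lintegral_remainder_sq_le {F : ℝ → ℝ≥0∞} (hF : AEMeasurable F halfLine)
    {κ : ℝ} (hκ : 0 < κ) :
    ∫⁻ s : ℝ in Ioi 0, (∫⁻ t in Ioi 0, ENNReal.ofReal (min 1 (s * (κ * t))⁻¹) * F t) ^ 2 ≤
      2 * ENNReal.ofReal κ⁻¹ *
        (∫⁻ t in Ioi 0, ENNReal.ofReal (t ^ (-(1 / 2) : ℝ)) * F t) ^ 2 := by
  have h1 := lintegral_sq_lintegral_le (μ := halfLine) (ν := halfLine)
    (h := fun t s => ENNReal.ofReal (min 1 (s * (κ * t))⁻¹) * F t) (by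
      refine AEMeasurable.mul ?_ (hF.comp_quasiMeasurePreserving
        Measure.quasiMeasurePreserving_fst)
      fun_prop)
  refine h1.trans ?_
  have hK : 2 * ENNReal.ofReal κ⁻¹ = ((2 * ENNReal.ofReal κ⁻¹) ^ (1 / 2 : ℝ)) ^ 2 := by
    rw [← ENNReal.rpow_natCast, ← ENNReal.rpow_mul]
    norm_num
  rw [hK, ← mul_pow]
  refine pow_le_pow_left₀ zero_le ?_ 2
  rw [← lintegral_const_mul' _ _ (by finiteness)]
  refine setLIntegral_mono' measurableSet_Ioi fun t ht => ?_
  have ht : (0 : ℝ) < t := ht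
  have hm : Measurable fun s : ℝ => ENNReal.ofReal (min 1 (s * (κ * t))⁻¹) ^ 2 := by fun_prop
  simp only [mul_pow]
  have h2 : (F t ^ 2) ^ (1 / 2 : ℝ) = F t := by
    rw [← ENNReal.rpow_natCast (F t), ← ENNReal.rpow_mul]
    norm_num
  rw [lintegral_mul_const _ hm, ENNReal.mul_rpow_of_nonneg _ _ (show (0 : ℝ) ≤ 1 / 2 by norm_num),
    h2, ← mul_assoc]
  refine mul_le_mul_left ?_ _
  refine (ENNReal.rpow_le_rpow (lintegral_min_sq_le (mul_pos hκ ht))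
    (show (0 : ℝ) ≤ 1 / 2 by norm_num)).trans (le_of_eq ?_)
  have h3 : ENNReal.ofReal (t ^ (-(1 / 2) : ℝ)) = ENNReal.ofReal t⁻¹ ^ (1 / 2 : ℝ) := by
    rw [ENNReal.ofReal_rpow_of_pos (by positivity), Real.inv_rpow ht.le, Real.rpow_neg ht.le]
  rw [h3, mul_inv, ENNReal.ofReal_mul (by positivity), ← mul_assoc,
    ENNReal.mul_rpow_of_nonneg _ _ (show (0 : ℝ) ≤ 1 / 2 by norm_num)]

theorem tendsto_remainder {F : ℝ → ℝ} (hF : IntegrableOn F (Ioi 0)) :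
    Tendsto (fun r : ℝ => ∫ t in Ioi 0, min 1 (r * t)⁻¹ * |F t|) atTop (𝓝 0) := by
  have h := tendsto_integral_filter_of_dominated_convergence (μ := halfLine) (l := atTop)
    (F := fun (r : ℝ) t => min 1 (r * t)⁻¹ * |F t|) (f := fun _ => 0) (fun t => |F t|) ?_ ?_
    hF.abs ?_
  · simpa using h
  · refine Eventually.of_forall fun r => AEStronglyMeasurable.mul ?_ hF.abs.aestronglyMeasurable
    exact Measurable.aestronglyMeasurable (by fun_prop)
  · filter_upwards [eventually_ge_atTop 0] with r hr
    filter_upwards [self_mem_ae_restrict measurableSet_Ioi] with t ht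
    have ht : (0 : ℝ) < t := ht
    rw [norm_mul, Real.norm_eq_abs, Real.norm_eq_abs, abs_abs, abs_of_nonneg (by positivity)]
    exact mul_le_of_le_one_left (abs_nonneg _) (min_le_left _ _)
  · filter_upwards [self_mem_ae_restrict measurableSet_Ioi] with t ht
    have ht : (0 : ℝ) < t := ht
    have h1 : Tendsto (fun r : ℝ => (r * t)⁻¹) atTop (𝓝 0) :=
      tendsto_inv_atTop_zero.comp (tendsto_id.atTop_mul_const ht)
    have h2 := (tendsto_const_nhds (x := (1 : ℝ))).min h1
    rw [min_eq_right zero_le_one] at h2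
    simpa using h2.mul_const |F t|

/-- The size of a scalar potential that controls the first iterate: the norm in
`L₁((1 + t^{-1/2}) dt)` plus the norm in `L₂`. -/
def potentialSize (f : ℝ → ℂ) : ℝ≥0∞ :=
  (∫⁻ t in Ioi 0, ENNReal.ofReal (1 + t ^ (-(1 / 2) : ℝ)) * ‖f t‖ₑ) + eLpNorm f 2 halfLine

theorem potentialSize_add_le {f g : ℝ → ℂ} (hf : AEStronglyMeasurable f halfLine)
    (hg : AEStronglyMeasurable g halfLine) :
    potentialSize (f + g) ≤ potentialSize f + potentialSize g := by
  have h1 : ∫⁻ t in Ioi 0, ENNReal.ofReal (1 + t ^ (-(1 / 2) : ℝ)) * ‖(f + g) t‖ₑ ≤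
      (∫⁻ t in Ioi 0, ENNReal.ofReal (1 + t ^ (-(1 / 2) : ℝ)) * ‖f t‖ₑ) +
      ∫⁻ t in Ioi 0, ENNReal.ofReal (1 + t ^ (-(1 / 2) : ℝ)) * ‖g t‖ₑ := by
    have hmeas : AEMeasurable
        (fun t => ENNReal.ofReal (1 + t ^ (-(1 / 2) : ℝ)) * ‖f t‖ₑ) halfLine :=
      AEMeasurable.mul (by fun_prop) hf.enorm
    rw [← lintegral_add_left' hmeas]
    refine lintegral_mono fun t => ?_
    rw [← mul_add]
    gcongr
    exact enorm_add_le _ _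
  have h2 := eLpNorm_add_le hf hg (one_le_two : (1 : ℝ≥0∞) ≤ 2)
  unfold potentialSize
  calc _ ≤ _ := add_le_add h1 h2
    _ = _ := by ring

theorem integrableOn_of_potentialSize {f : ℝ → ℂ} (hf : AEStronglyMeasurable f halfLine)
    (h : potentialSize f ≠ ⊤) : IntegrableOn f (Ioi 0) := by
  refine ⟨hf, lt_of_le_of_lt ?_ (lt_top_iff_ne_top.2 h)⟩
  refine le_add_right (setLIntegral_mono' measurableSet_Ioi fun t ht => ?_)
  have ht : (0 : ℝ) < t := ht
  refine le_mul_of_one_le_left zero_le ?_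
  rw [ENNReal.one_le_ofReal]
  have : 0 ≤ t ^ (-(1 / 2) : ℝ) := by positivity
  linarith

theorem memLp_two_of_potentialSize {f : ℝ → ℂ} (hf : AEStronglyMeasurable f halfLine)
    (h : potentialSize f ≠ ⊤) : MemLp f 2 halfLine :=
  ⟨hf, lt_of_le_of_lt (le_add_left le_rfl) (lt_top_iff_ne_top.2 h)⟩

/-- Smooth functions cut off to a bounded interval are dense for `potentialSize`. -/
theorem exists_smooth_approx {f : ℝ → ℂ} (hf : AEStronglyMeasurable f halfLine)
    (h : potentialSize f ≠ ⊤) {η : ℝ≥0∞} (hη : η ≠ 0) :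
    ∃ (g : ℝ → ℂ) (c d : ℝ), ContDiff ℝ 1 g ∧ 0 < c ∧
      potentialSize (f - (Icc c d).indicator g) ≤ η := by
  have hf2 := memLp_two_of_potentialSize hf h
  set K : ℕ → Set ℝ := fun N => Icc (1 / (N + 1 : ℝ)) (N + 1) with hK
  have hKm : ∀ N, MeasurableSet (K N) := fun N => measurableSet_Icc
  have hev : ∀ t : ℝ, 0 < t → ∀ᶠ N in atTop, t ∈ K N := by
    intro t ht
    have h1 := (tendsto_one_div_add_atTop_nhds_zero_nat (𝕜 := ℝ)).eventually (gt_mem_nhds ht)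
    have h2 := (tendsto_natCast_atTop_atTop (R := ℝ)).eventually (eventually_ge_atTop t)
    filter_upwards [h1, h2] with N h3 h4
    exact ⟨h3.le, by linarith⟩
  -- truncation to a compact subinterval of the half-line
  have htail : ∀ F : ℝ → ℝ≥0∞, AEMeasurable F halfLine → ∫⁻ t in Ioi 0, F t ≠ ⊤ →
      Tendsto (fun N => ∫⁻ t in Ioi 0, (K N)ᶜ.indicator F t) atTop (𝓝 0) := by
    intro F hFm hF
    have := tendsto_lintegral_of_dominated_convergence' (μ := halfLine)
      (F := fun N => (K N)ᶜ.indicator F) (f := fun _ => 0) F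
      (fun N => hFm.indicator (hKm N).compl)
      (fun N => Eventually.of_forall fun t => indicator_le_self _ _ t) hF ?_
    · simpa using this
    · filter_upwards [self_mem_ae_restrict measurableSet_Ioi] with t ht
      refine tendsto_const_nhds.congr' ?_
      filter_upwards [hev t ht] with N hN
      rw [indicator_of_notMem (by simpa using hN)]
  have ht1 := htail (fun t => ENNReal.ofReal (1 + t ^ (-(1 / 2) : ℝ)) * ‖f t‖ₑ)
    (AEMeasurable.mul (by fun_prop) hf.enorm) (fun h' => h (by rw [potentialSize, h', top_add]))
  have ht2 := htail (fun t => ‖f t‖ₑ ^ 2) (hf.enorm.pow_const 2) (by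
    rw [← eLpNorm_two_sq]; exact ENNReal.pow_ne_top hf2.eLpNorm_ne_top)
  have hη4 : 0 < η / 4 := ENNReal.div_pos hη (by norm_num)
  have hη4' : 0 < (η / 4) ^ 2 := ENNReal.pow_pos hη4 2
  obtain ⟨N, hN1, hN2⟩ := ((ht1.eventually (gt_mem_nhds hη4)).and
    (ht2.eventually (gt_mem_nhds hη4'))).exists
  have hsplit1 : potentialSize (f - (K N).indicator f) ≤ η / 2 := by
    have h1 : f - (K N).indicator f = (K N)ᶜ.indicator f := by
      rw [indicator_compl]
    rw [h1, potentialSize, ← ENNReal.add_halves (η / 2)]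
    have h2 : η / 2 / 2 = η / 4 := by
      rw [div_eq_mul_inv, div_eq_mul_inv, div_eq_mul_inv, mul_assoc,
        ← ENNReal.mul_inv (by norm_num) (by norm_num)]
      norm_num
    rw [h2]
    refine add_le_add ?_ ?_
    · refine le_trans (le_of_eq (lintegral_congr fun t => ?_)) hN1.le
      by_cases ht : t ∈ (K N)ᶜ <;> simp [ht]
    · have h3 : eLpNorm ((K N)ᶜ.indicator f) 2 halfLine ^ 2 ≤ (η / 4) ^ 2 := by
        rw [eLpNorm_two_sq]
        refine le_trans (le_of_eq (lintegral_congr fun t => ?_)) hN2.le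
        by_cases ht : t ∈ (K N)ᶜ <;> simp [ht]
      exact (ENNReal.pow_le_pow_left_iff two_ne_zero).1 h3
  -- smooth approximation in `L₂` on the compact subinterval
  set w : ℝ := 1 + (1 / (N + 1 : ℝ)) ^ (-(1 / 2) : ℝ) with hw
  set V : ℝ≥0∞ := ENNReal.ofReal w * volume (K N) ^ (1 / 2 : ℝ) + 1 with hV
  have hVt : V ≠ ⊤ := by
    simp only [hV, hK, Real.volume_Icc]
    finiteness
  have hV0 : V ≠ 0 := by simp [hV]
  set f0 : ℝ → ℂ := (Ioi 0).indicator f with hf0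
  have hf02 : MemLp f0 2 := (memLp_indicator_iff_restrict measurableSet_Ioi).2 hf2
  have hθ : 0 < η / 2 / V := ENNReal.div_pos (ENNReal.div_pos hη (by norm_num)).ne' hVt
  obtain ⟨θ, hθ0, hθ1⟩ : ∃ θ : ℝ, 0 < θ ∧ ENNReal.ofReal θ ≤ η / 2 / V := by
    obtain ⟨r, hr0, hr⟩ := ENNReal.lt_iff_exists_nnreal_btwn.1 hθ
    exact ⟨r, by exact_mod_cast hr0, by simpa using hr.le⟩
  obtain ⟨g, -, hg, hgθ⟩ := hf02.exist_eLpNorm_sub_le (by norm_num) (by norm_num) hθ0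
  refine ⟨g, 1 / (N + 1 : ℝ), N + 1, hg.of_le (by exact_mod_cast le_top), by positivity, ?_⟩
  have hgm : AEStronglyMeasurable g halfLine := hg.continuous.aestronglyMeasurable
  set D : ℝ → ℂ := (K N).indicator (f0 - g) with hD
  have hfD : potentialSize (f - (Icc (1 / (N + 1 : ℝ)) (N + 1)).indicator g) =
      potentialSize ((f - (K N).indicator f) + D) := by
    congr 1
    funext t
    by_cases ht : t ∈ K N
    · have ht0 : 0 < t := lt_of_lt_of_le (by positivity) ht.1
      have ht' : t ∈ Icc (1 / (N + 1 : ℝ)) (N + 1) := ht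
      simp only [Pi.add_apply, Pi.sub_apply, hD, indicator_of_mem ht, indicator_of_mem ht', hf0,
        indicator_of_mem (show t ∈ Ioi (0 : ℝ) from ht0)]
      ring
    · have ht' : t ∉ Icc (1 / (N + 1 : ℝ)) (N + 1) := ht
      simp only [Pi.add_apply, Pi.sub_apply, hD, indicator_of_notMem ht, indicator_of_notMem ht']
      ring
  rw [hfD]
  have hDm : AEStronglyMeasurable D halfLine :=
    (hf02.aestronglyMeasurable.restrict.sub hgm).indicator (hKm N)
  refine (potentialSize_add_le (hf.sub (hf.indicator (hKm N))) hDm).trans ?_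
  rw [← ENNReal.add_halves η]
  refine add_le_add hsplit1 ?_
  have hL2 : eLpNorm (f0 - g) 2 (volume.restrict (K N)) ≤ η / 2 / V :=
    (eLpNorm_restrict_le _ _ _ _).trans (hgθ.trans hθ1)
  have hD2 : eLpNorm D 2 halfLine ≤ η / 2 / V := by
    refine (eLpNorm_mono_measure _ Measure.restrict_le_self).trans ?_
    rw [hD, eLpNorm_indicator_eq_eLpNorm_restrict (hKm N)]
    exact hL2
  have hD1 : ∫⁻ t in Ioi 0, ENNReal.ofReal (1 + t ^ (-(1 / 2) : ℝ)) * ‖D t‖ₑ ≤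
      ENNReal.ofReal w * volume (K N) ^ (1 / 2 : ℝ) * (η / 2 / V) := by
    calc _ ≤ ∫⁻ t, (K N).indicator (fun t => ENNReal.ofReal w * ‖(f0 - g) t‖ₑ) t := by
          refine (setLIntegral_le_lintegral _ _).trans (lintegral_mono fun t => ?_)
          by_cases ht : t ∈ K N
          · simp only [hD, indicator_of_mem ht]
            gcongr
            have h0 : (0 : ℝ) < 1 / (N + 1 : ℝ) := by positivity
            simp only [hw]
            gcongr 1 + ?_
            exact Real.rpow_le_rpow_of_nonpos h0 ht.1 (by norm_num)
          · simp [hD, ht]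
      _ = ENNReal.ofReal w * ∫⁻ t in K N, ‖(f0 - g) t‖ₑ := by
          rw [lintegral_indicator (hKm N), lintegral_const_mul' _ _ ENNReal.ofReal_ne_top]
      _ ≤ ENNReal.ofReal w * (eLpNorm (f0 - g) 2 (volume.restrict (K N)) *
            volume (K N) ^ (1 / 2 : ℝ)) := by
          gcongr
          have := eLpNorm_le_eLpNorm_mul_rpow_measure_univ (μ := volume.restrict (K N))
            (one_le_two : (1 : ℝ≥0∞) ≤ 2)
            (hf02.aestronglyMeasurable.sub hg.continuous.aestronglyMeasurable).restrict
          rw [eLpNorm_one_eq_lintegral_enorm] at this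
          refine this.trans (le_of_eq ?_)
          norm_num
      _ ≤ ENNReal.ofReal w * ((η / 2 / V) * volume (K N) ^ (1 / 2 : ℝ)) := by gcongr
      _ = _ := by ring
  calc potentialSize D ≤ ENNReal.ofReal w * volume (K N) ^ (1 / 2 : ℝ) * (η / 2 / V) +
        η / 2 / V := add_le_add hD1 hD2
    _ = V * (η / 2 / V) := by rw [hV]; ring
    _ = η / 2 := ENNReal.mul_div_cancel hV0 hVt

/-! ### Potentials in `L₁ ∩ L_p` -/

/-- `L₁ ∩ L_p ⊆ L₂` for `p ≥ 2`, with a linear bound. -/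
theorem eLpNorm_two_le_add {p : ℝ≥0∞} (hp : 2 ≤ p) {f : ℝ → ℂ} {ν : Measure ℝ}
    (hf : AEStronglyMeasurable f ν) :
    eLpNorm f 2 ν ≤ 2 * (eLpNorm f 1 ν + eLpNorm f p ν) := by
  have hp0 : p ≠ 0 := (lt_of_lt_of_le (by norm_num) hp).ne'
  set N := eLpNorm f 1 ν + eLpNorm f p ν with hN
  rcases eq_or_ne N 0 with h0 | h0
  · have h1 : f =ᵐ[ν] 0 := (eLpNorm_eq_zero_iff hf one_ne_zero).1 (add_eq_zero.1 h0).1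
    rw [eLpNorm_congr_ae h1]
    simp
  rcases eq_or_ne N ⊤ with ht | ht
  · rw [ht]; simp
  -- after normalization, `|g|² ≤ |g| + |g|^p`
  have key : ∀ g : ℝ → ℂ, AEStronglyMeasurable g ν → eLpNorm g 1 ν ≤ 1 → eLpNorm g p ν ≤ 1 →
      eLpNorm g 2 ν ≤ 2 := by
    intro g hg h1 h2
    have h3 : eLpNorm g 2 ν ^ 2 ≤ 2 ^ 2 := by
      rw [eLpNorm_two_sq]
      rw [eLpNorm_one_eq_lintegral_enorm] at h1
      rcases eq_or_ne p ⊤ with rfl | hpt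
      · rw [eLpNorm_exponent_top] at h2
        calc ∫⁻ t, ‖g t‖ₑ ^ 2 ∂ν ≤ ∫⁻ t, ‖g t‖ₑ ∂ν := by
              refine lintegral_mono_ae ?_
              filter_upwards [ae_le_eLpNormEssSup (f := g) (μ := ν)] with t ht
              rw [sq]
              exact mul_le_of_le_one_left zero_le (ht.trans h2)
          _ ≤ 1 := h1
          _ ≤ 2 ^ 2 := by norm_num
      · have hp2 : (2 : ℝ) ≤ p.toReal := by
          have := ENNReal.toReal_mono hpt hp
          simpa using this
        rw [eLpNorm_eq_lintegral_rpow_enorm_toReal hp0 hpt] at h2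
        have h4 : ∫⁻ t, ‖g t‖ₑ ^ p.toReal ∂ν ≤ 1 := by
          have := ENNReal.rpow_le_rpow h2 (show 0 ≤ p.toReal by linarith)
          rwa [← ENNReal.rpow_mul, one_div_mul_cancel (by linarith), ENNReal.rpow_one,
            ENNReal.one_rpow] at this
        calc ∫⁻ t, ‖g t‖ₑ ^ 2 ∂ν ≤ ∫⁻ t, (‖g t‖ₑ + ‖g t‖ₑ ^ p.toReal) ∂ν := by
              refine lintegral_mono fun t => ?_
              rcases le_total ‖g t‖ₑ 1 with h | h
              · refine le_add_right ?_
                rw [sq]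
                exact mul_le_of_le_one_left zero_le h
              · refine le_add_left ?_
                rw [← ENNReal.rpow_natCast]
                exact ENNReal.rpow_le_rpow_of_exponent_le h (by exact_mod_cast hp2)
          _ = ∫⁻ t, ‖g t‖ₑ ∂ν + ∫⁻ t, ‖g t‖ₑ ^ p.toReal ∂ν := lintegral_add_left' hg.enorm _
          _ ≤ 1 + 1 := add_le_add h1 h4
          _ ≤ 2 ^ 2 := by norm_num
    exact (ENNReal.pow_le_pow_left_iff two_ne_zero).1 h3
  set r : ℝ := N.toReal with hr
  have hr0 : 0 < r := ENNReal.toReal_pos h0 ht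
  have hrN : ENNReal.ofReal r = N := ENNReal.ofReal_toReal ht
  have hsc : ∀ s, eLpNorm ((r : ℂ)⁻¹ • f) s ν = N⁻¹ * eLpNorm f s ν := by
    intro s
    rw [eLpNorm_const_smul, enorm_inv (by exact_mod_cast hr0.ne')]
    congr 2
    rw [← ofReal_norm, Complex.norm_real, Real.norm_of_nonneg hr0.le, hrN]
  have h5 := key ((r : ℂ)⁻¹ • f) (hf.const_smul _)
    (by rw [hsc, ← ENNReal.div_eq_inv_mul]
        exact ENNReal.div_le_of_le_mul (by rw [one_mul]; exact le_self_add))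
    (by rw [hsc, ← ENNReal.div_eq_inv_mul]
        exact ENNReal.div_le_of_le_mul (by rw [one_mul]; exact le_add_self))
  rw [hsc, ← ENNReal.div_eq_inv_mul, ENNReal.div_le_iff h0 ht] at h5
  exact h5

theorem memLp_rpow_neg_half {s : ℝ≥0∞} (hs0 : s ≠ 0) (hs : s < 2) :
    MemLp (fun t : ℝ => ((t ^ (-(1 / 2) : ℝ) : ℝ) : ℂ)) s (volume.restrict (Ioo 0 1)) := by
  have hst : s ≠ ⊤ := (hs.trans (by norm_num)).ne
  have hs2 : s.toReal < 2 := by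
    have := (ENNReal.toReal_lt_toReal hst (by norm_num)).2 hs
    simpa using this
  refine ⟨Measurable.aestronglyMeasurable (by fun_prop), ?_⟩
  refine (eLpNorm_lt_top_iff_lintegral_rpow_enorm_lt_top hs0 hst).2 ?_
  have h1 : IntegrableOn (fun t : ℝ => t ^ (-(s.toReal / 2))) (Ioo 0 1) :=
    (intervalIntegral.integrableOn_Ioo_rpow_iff one_pos).2 (by linarith)
  refine lt_of_le_of_lt (setLIntegral_mono' measurableSet_Ioo fun t ht => ?_) h1.2
  rw [← ofReal_norm, ← ofReal_norm, Complex.norm_real,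
    ENNReal.ofReal_rpow_of_nonneg (norm_nonneg _) (by positivity),
    Real.norm_of_nonneg (Real.rpow_nonneg ht.1.le _),
    Real.norm_of_nonneg (Real.rpow_nonneg ht.1.le _), ← Real.rpow_mul ht.1.le]
  apply ENNReal.ofReal_le_ofReal
  apply le_of_eq
  congr 1
  ring

/-- For `p > 2` the size of a potential is controlled by its norm in `L₁ ∩ L_p`: the weight
`t^{-1/2}` belongs to `L_{p'}(0,1)`. -/
theorem exists_potentialSize_le {p : ℝ≥0∞} (hp : 2 < p) :
    ∃ C : ℝ≥0∞, C ≠ ⊤ ∧ ∀ f : ℝ → ℂ, AEStronglyMeasurable f halfLine →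
      potentialSize f ≤ C * (eLpNorm f 1 halfLine + eLpNorm f p halfLine) := by
  set s := ENNReal.conjExponent p with hs
  have : Fact (1 ≤ p) := ⟨le_trans (by norm_num) hp.le⟩
  have hs2 : s < 2 := by
    rw [hs, ENNReal.conjExponent, ← one_add_one_eq_two]
    refine ENNReal.add_lt_add_left ENNReal.one_ne_top ?_
    rw [ENNReal.inv_lt_one]
    exact lt_tsub_iff_left.2 (by rwa [one_add_one_eq_two])
  have hs0 : s ≠ 0 := by simp [hs, ENNReal.conjExponent]
  have hφ := memLp_rpow_neg_half hs0 hs2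
  set φ : ℝ → ℂ := fun t : ℝ => ((t ^ (-(1 / 2) : ℝ) : ℝ) : ℂ) with hφd
  refine ⟨2 + eLpNorm φ s (volume.restrict (Ioo 0 1)) + 2,
    by have := hφ.2; finiteness, fun f hf => ?_⟩
  have : ENNReal.HolderTriple s p 1 := inferInstanceAs (ENNReal.HolderConjugate s p)
  have hle : (volume.restrict (Ioo (0 : ℝ) 1)) ≤ halfLine :=
    Measure.restrict_mono Ioo_subset_Ioi_self le_rfl
  have h1 : ∫⁻ t in Ioo 0 1, ‖φ t‖ₑ * ‖f t‖ₑ ≤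
      eLpNorm φ s (volume.restrict (Ioo 0 1)) * eLpNorm f p halfLine := by
    have := eLpNorm_smul_le_mul_eLpNorm (p := s) (q := p) (r := 1) (f := f) (φ := φ)
      (hf.mono_measure hle) hφ.1
    rw [eLpNorm_one_eq_lintegral_enorm] at this
    simp only [Pi.smul_apply', enorm_smul] at this
    refine this.trans ?_
    gcongr
  have h2 : ∫⁻ t in Ioi 0, ENNReal.ofReal (1 + t ^ (-(1 / 2) : ℝ)) * ‖f t‖ₑ ≤
      2 * eLpNorm f 1 halfLine +
        eLpNorm φ s (volume.restrict (Ioo 0 1)) * eLpNorm f p halfLine := by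
    refine le_trans ?_ (add_le_add_right h1 _)
    rw [eLpNorm_one_eq_lintegral_enorm, ← lintegral_const_mul' _ _ (by norm_num),
      ← lintegral_indicator measurableSet_Ioo]
    have h3 : ∫⁻ t, (Ioo (0 : ℝ) 1).indicator (fun t => ‖φ t‖ₑ * ‖f t‖ₑ) t =
        ∫⁻ t in Ioi 0, (Ioo (0 : ℝ) 1).indicator (fun t => ‖φ t‖ₑ * ‖f t‖ₑ) t := by
      rw [← lintegral_indicator measurableSet_Ioi]
      refine lintegral_congr fun t => ?_
      by_cases ht : t ∈ Ioi (0 : ℝ)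
      · rw [indicator_of_mem ht]
      · rw [indicator_of_notMem ht, indicator_of_notMem (fun h => ht h.1)]
    rw [h3, ← lintegral_add_left' (hf.enorm.const_mul 2)]
    refine setLIntegral_mono' measurableSet_Ioi fun t ht => ?_
    have ht : (0 : ℝ) < t := ht
    have hr : 0 ≤ t ^ (-(1 / 2) : ℝ) := by positivity
    by_cases h4 : t < 1
    · rw [indicator_of_mem (show t ∈ Ioo (0 : ℝ) 1 from ⟨ht, h4⟩), ← add_mul]
      gcongr
      rw [ENNReal.ofReal_add zero_le_one hr, ENNReal.ofReal_one, ← ofReal_norm]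
      simp only [hφd, Complex.norm_real, Real.norm_of_nonneg hr]
      gcongr
      norm_num
    · rw [indicator_of_notMem (fun h => h4 h.2), add_zero]
      gcongr
      rw [← ENNReal.ofReal_ofNat]
      apply ENNReal.ofReal_le_ofReal
      have := Real.rpow_le_one_of_one_le_of_nonpos (not_lt.1 h4)
        (show (-(1 / 2) : ℝ) ≤ 0 by norm_num)
      linarith
  have h5 := eLpNorm_two_le_add hp.le hf
  calc potentialSize f ≤ _ := add_le_add h2 h5
    _ ≤ 2 * (eLpNorm f 1 halfLine + eLpNorm f p halfLine) +
        eLpNorm φ s (volume.restrict (Ioo 0 1)) *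
          (eLpNorm f 1 halfLine + eLpNorm f p halfLine) +
        2 * (eLpNorm f 1 halfLine + eLpNorm f p halfLine) := by
          gcongr
          · exact le_self_add
          · exact le_add_self
    _ = _ := by ring

variable {n : ℕ} {p : ℝ≥0∞} [Fact (1 ≤ p)]

theorem aestronglyMeasurable_potential (q : Xp n p) (i j : Fin n) :
    AEStronglyMeasurable (fun t => potential q t i j) halfLine :=
  Lp.aestronglyMeasurable _

theorem potential_diag (q : Xp n p) (i : Fin n) :
    (fun t => potential q t i i) =ᵐ[halfLine] 0 := by
  have h := q.2.2 i
  have h1 : ((q : Fin n → Fin n → Lp ℂ 1 halfLine × Lp ℂ p halfLine) i i).1 = 0 := by rw [h]; rfl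
  have := Lp.coeFn_zero ℂ 1 halfLine
  rw [← h1] at this
  exact this

theorem potential_sub (q q' : Xp n p) :
    ∀ᵐ t ∂halfLine, potential (q - q') t = potential q t - potential q' t := by
  have h : ∀ i j, ∀ᵐ t ∂halfLine, potential (q - q') t i j = potential q t i j - potential q' t i j :=
    fun i j => Lp.coeFn_sub _ _
  have h' : ∀ᵐ t ∂halfLine, ∀ i j,
      potential (q - q') t i j = potential q t i j - potential q' t i j :=
    ae_all_iff.2 fun i => ae_all_iff.2 (h i)
  filter_upwards [h'] with t ht
  ext i j
  exact ht i j

theorem exists_potentialSize_potential_le (hp : 2 < p) :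
    ∃ C : ℝ≥0∞, C ≠ ⊤ ∧ ∀ (q : Xp n p) (i j : Fin n),
      potentialSize (fun t => potential q t i j) ≤ C * ‖q‖ₑ := by
  obtain ⟨C, hC, h⟩ := exists_potentialSize_le hp
  refine ⟨C * 2, by finiteness, fun q i j => ?_⟩
  refine (h _ (aestronglyMeasurable_potential q i j)).trans ?_
  rw [mul_assoc, two_mul]
  have hn : ‖(q : Fin n → Fin n → Lp ℂ 1 halfLine × Lp ℂ p halfLine) i j‖ ≤ ‖q‖ :=
    (norm_le_pi_norm _ j).trans (norm_le_pi_norm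
      (q : Fin n → Fin n → Lp ℂ 1 halfLine × Lp ℂ p halfLine) i)
  have h1 : eLpNorm (fun t => potential q t i j) 1 halfLine ≤ ‖q‖ₑ := by
    refine le_trans (le_of_eq (Lp.enorm_def _).symm) ?_
    exact enorm_le_iff_norm_le.2 ((norm_fst_le _).trans hn)
  have h2 : eLpNorm (fun t => potential q t i j) p halfLine ≤ ‖q‖ₑ := by
    refine (eLpNorm_congr_ae (q.2.1 i j)).trans_le ?_
    refine le_trans (le_of_eq (Lp.enorm_def _).symm) ?_
    exact enorm_le_iff_norm_le.2 ((norm_snd_le _).trans hn)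
  gcongr

theorem potentialSize_potential_ne_top (hp : 2 < p) (q : Xp n p) (i j : Fin n) :
    potentialSize (fun t => potential q t i j) ≠ ⊤ := by
  obtain ⟨C, hC, h⟩ := exists_potentialSize_potential_le (n := n) hp
  exact ne_top_of_le_ne_top (by finiteness) (h q i j)

/-! ### Volterra operators with bounded kernels -/

section Volterra

set_option linter.unusedSectionVars false

variable {X V : Type*} [MetricSpace X] [ProperSpace X] [NormedAddCommGroup V] [NormedSpace ℂ V]

theorem isCountablyGenerated_cocompact : (cocompact X).IsCountablyGenerated := by
  rcases isEmpty_or_nonempty X with h | ⟨⟨c⟩⟩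
  · rw [Filter.filter_eq_bot_of_isEmpty (cocompact X)]
    infer_instance
  · rw [← Metric.cobounded_eq_cocompact, ← Metric.comap_dist_right_atTop c]
    infer_instance

/-- Families `U(x, ·)`, `x ≥ 0`, of functions on `X` that are jointly continuous, bounded, and
vanish at infinity uniformly in `x`. -/
structure IsVanishingFamily (U : ℝ≥0 → X → V) : Prop where
  continuous : Continuous fun z : ℝ≥0 × X => U z.1 z.2
  bounded : ∃ B : ℝ, ∀ x ρ, ‖U x ρ‖ ≤ B
  vanishing : ∀ η : ℝ, 0 < η → ∀ᶠ ρ in cocompact X, ∀ x, ‖U x ρ‖ ≤ η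

/-- A vanishing family defines an element of `BC([0,∞), C₀(X))`. -/
theorem IsVanishingFamily.exists_eq {U : ℝ≥0 → X → V} (hU : IsVanishingFamily U) :
    ∃ f : ℝ≥0 →ᵇ C₀(X, V), ∀ x ρ, f x ρ = U x ρ := by
  obtain ⟨B, hB⟩ := hU.bounded
  let F : ℝ≥0 → C₀(X, V) := fun x =>
    { toFun := U x
      continuous_toFun := hU.continuous.comp (Continuous.prodMk_right x)
      zero_at_infty' := by
        rw [Metric.tendsto_nhds]
        intro η hη
        filter_upwards [hU.vanishing (η / 2) (half_pos hη)] with ρ hρ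
        rw [dist_zero_right]
        exact lt_of_le_of_lt (hρ x) (half_lt_self hη) }
  have hnorm : ∀ (f : C₀(X, V)) (C : ℝ), 0 ≤ C → (∀ ρ, ‖f ρ‖ ≤ C) → ‖f‖ ≤ C := by
    intro f C hC h
    rw [← ZeroAtInftyContinuousMap.norm_toBCF_eq_norm]
    exact (BoundedContinuousFunction.norm_le hC).2 h
  have hF : Continuous F := by
    rw [continuous_iff_continuousAt]
    intro x
    rw [ContinuousAt, Metric.tendsto_nhds]
    intro η hη
    have hη3 : 0 < η / 3 := by positivity
    obtain ⟨K, hK, hKs⟩ := mem_cocompact.1 (hU.vanishing (η / 3) hη3)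
    obtain ⟨v, hv, hvu⟩ := hK.mem_uniformity_of_prod (f := U) (s := univ) (q := x)
      (u := {z | dist z.1 z.2 < η / 3}) hU.continuous.continuousOn (mem_univ _)
      (Metric.dist_mem_uniformity hη3)
    rw [nhdsWithin_univ] at hv
    filter_upwards [hv] with y hy
    rw [dist_eq_norm]
    refine lt_of_le_of_lt (hnorm _ (2 * (η / 3)) (by positivity) fun ρ => ?_) (by linarith)
    change ‖U y ρ - U x ρ‖ ≤ _
    by_cases hρ : ρ ∈ K
    · have h1 := hvu y hy ρ hρ
      rw [mem_ofPred_eq, dist_eq_norm] at h1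
      linarith
    · have h1 := hKs hρ
      have h2 := norm_sub_le (U y ρ) (U x ρ)
      linarith [h1 x, h1 y]
  refine ⟨BoundedContinuousFunction.ofNormedAddCommGroup F hF (max B 0) fun x =>
    hnorm _ _ (le_max_right _ _) fun ρ => (hB x ρ).trans (le_max_left _ _), fun x ρ => rfl⟩

theorem continuous_eval_zeroAtInfty (f : ℝ≥0 →ᵇ C₀(X, V)) :
    Continuous fun z : ℝ≥0 × X => f z.1 z.2 := by
  have h : Continuous fun z : ℝ≥0 × X => ((f z.1).toBCF) z.2 := by
    have h1 : Continuous fun x : ℝ≥0 => (f x).toBCF :=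
      (ZeroAtInftyContinuousMap.isometry_toBCF).continuous.comp f.continuous
    exact (h1.comp continuous_fst).eval continuous_snd
  exact h

theorem norm_eval_zeroAtInfty_le (f : ℝ≥0 →ᵇ C₀(X, V)) (x : ℝ≥0) (ρ : X) :
    ‖f x ρ‖ ≤ ‖f‖ := by
  refine le_trans ?_ (f.norm_coe_le_norm x)
  rw [← ZeroAtInftyContinuousMap.norm_toBCF_eq_norm]
  exact (f x).toBCF.norm_coe_le_norm ρ

/-- Kernels on `{(x,t) : t ∈ J(x)}`, where `J(x) = (0,x)` or `J(x) = (x,∞)`, depending on a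
parameter `ρ ∈ X`, with norm bounded by `C`. -/
structure IsVolterraKernel (ε : ℝ) (C : ℝ) (κ : ℝ≥0 → ℝ → X → V →L[ℂ] V) : Prop where
  sign : ε = 1 ∨ ε = -1
  pos : 0 < C
  bound : ∀ (x : ℝ≥0) (t : ℝ) (ρ : X), t ∈ volterraSet ε x → ‖κ x t ρ‖ ≤ C
  continuousAt : ∀ (x : ℝ≥0) (t : ℝ) (ρ : X), t ∈ volterraSet ε x →
    ContinuousAt (fun z : ℝ≥0 × X => κ z.1 t z.2) (x, ρ)
  continuousOn : ∀ (x : ℝ≥0) (ρ : X), ContinuousOn (fun t => κ x t ρ) (volterraSet ε x)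

/-- The operator `w ↦ ∫_{J(x)} κ(x,t,ρ) 𝔮(t) w(t,ρ) dt`. -/
def volterraOp (ε : ℝ) (κ : ℝ≥0 → ℝ → X → V →L[ℂ] V) (Q : ℝ → V →L[ℂ] V) (w : ℝ≥0 → X → V)
    (x : ℝ≥0) (ρ : X) : V :=
  ∫ t in volterraSet ε x, κ x t ρ (Q t (w t.toNNReal ρ))

variable {ε C : ℝ} {κ : ℝ≥0 → ℝ → X → V →L[ℂ] V} {Q : ℝ → V →L[ℂ] V} {w : ℝ≥0 → X → V}

theorem IsVolterraKernel.norm_apply_le (hκ : IsVolterraKernel ε C κ) {x : ℝ≥0} {t : ℝ}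
    (ht : t ∈ volterraSet ε x) (ρ : X) (v : V) : ‖κ x t ρ (Q t v)‖ ≤ C * (‖Q t‖ * ‖v‖) := by
  refine ((κ x t ρ).le_opNorm _).trans ?_
  exact mul_le_mul (hκ.bound x t ρ ht) ((Q t).le_opNorm v) (norm_nonneg _) hκ.pos.le

theorem IsVolterraKernel.aestronglyMeasurable (hκ : IsVolterraKernel ε C κ)
    (hQ : AEStronglyMeasurable Q halfLine) {g : ℝ → V} (hg : AEStronglyMeasurable g halfLine)
    (x : ℝ≥0) (ρ : X) :
    AEStronglyMeasurable (fun t => κ x t ρ (Q t (g t))) (volume.restrict (volterraSet ε x)) := by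
  have hle : volume.restrict (volterraSet ε (x : ℝ)) ≤ halfLine :=
    Measure.restrict_mono (volterraSet_subset ε x) le_rfl
  have h1 := (hκ.continuousOn x ρ).aestronglyMeasurable (measurableSet_volterraSet ε x)
    (μ := volume)
  have hb : Continuous fun z : (V →L[ℂ] V) × V => z.1 z.2 :=
    isBoundedBilinearMap_apply.continuous
  exact hb.comp_aestronglyMeasurable (h1.prodMk
    (hb.comp_aestronglyMeasurable ((hQ.mono_measure hle).prodMk (hg.mono_measure hle))))

theorem IsVolterraKernel.integrableOn (hκ : IsVolterraKernel ε C κ) (hQ : IntegrableOn Q (Ioi 0))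
    {g : ℝ → V} (hg : AEStronglyMeasurable g halfLine) {B : ℝ} (hB : ∀ t, 0 < t → ‖g t‖ ≤ B)
    (x : ℝ≥0) (ρ : X) : IntegrableOn (fun t => κ x t ρ (Q t (g t))) (volterraSet ε x) := by
  have h1 : IntegrableOn (fun t => C * (‖Q t‖ * B)) (volterraSet ε (x : ℝ)) :=
    IntegrableOn.mono_set ((hQ.norm.mul_const B).const_mul C) (volterraSet_subset ε x)
  refine Integrable.mono' h1 (hκ.aestronglyMeasurable hQ.1 hg x ρ) ?_
  filter_upwards [self_mem_ae_restrict (measurableSet_volterraSet ε x)] with t ht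
  refine (hκ.norm_apply_le ht ρ _).trans ?_
  have := hκ.pos
  gcongr
  exact hB t (volterraSet_subset _ _ ht)

theorem aestronglyMeasurable_family (hw : Continuous fun z : ℝ≥0 × X => w z.1 z.2) (ρ : X)
    (ν : Measure ℝ) : AEStronglyMeasurable (fun t : ℝ => w t.toNNReal ρ) ν := by
  have : Continuous fun t : ℝ => w t.toNNReal ρ :=
    hw.comp (continuous_real_toNNReal.prodMk continuous_const)
  exact this.aestronglyMeasurable

theorem integrableOn_mul_norm_family (hQ : IntegrableOn Q (Ioi 0))
    (hw : Continuous fun z : ℝ≥0 × X => w z.1 z.2) {B : ℝ} (hB : ∀ x ρ, ‖w x ρ‖ ≤ B) (ρ : X) :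
    IntegrableOn (fun t => ‖Q t‖ * ‖w t.toNNReal ρ‖) (Ioi 0) := by
  refine Integrable.mono' (hQ.norm.mul_const B)
    (hQ.1.norm.mul (aestronglyMeasurable_family hw ρ _).norm) ?_
  refine Eventually.of_forall fun t => ?_
  rw [norm_mul, norm_norm, norm_norm]
  exact mul_le_mul_of_nonneg_left (hB _ _) (norm_nonneg _)

theorem IsVolterraKernel.norm_volterraOp_le (hκ : IsVolterraKernel ε C κ)
    (hQ : IntegrableOn Q (Ioi 0)) {ρ : X} {ψ : ℝ → ℝ} (hψ : Continuous ψ) {B : ℝ}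
    (hψB : ∀ t, 0 < t → ψ t ≤ B) (hw : ∀ t : ℝ≥0, 0 < t → ‖w t ρ‖ ≤ ψ t) (x : ℝ≥0) :
    ‖volterraOp ε κ Q w x ρ‖ ≤ C * ∫ t in volterraSet ε x, ‖Q t‖ * ψ t := by
  have hw' : ∀ t : ℝ, 0 < t → ‖w t.toNNReal ρ‖ ≤ ψ t := fun t ht => by
    have := hw t.toNNReal (Real.toNNReal_pos.2 ht)
    rwa [Real.coe_toNNReal _ ht.le] at this
  have hi : IntegrableOn (fun t => C * (‖Q t‖ * ψ t)) (volterraSet ε (x : ℝ)) := by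
    refine Integrable.const_mul ?_ C
    refine IntegrableOn.mono_set ?_ (volterraSet_subset ε x)
    refine Integrable.mono' (hQ.norm.mul_const B)
      (hQ.1.norm.mul hψ.aestronglyMeasurable) ?_
    filter_upwards [self_mem_ae_restrict measurableSet_Ioi] with t ht
    have h0 : 0 ≤ ψ t := (norm_nonneg _).trans (hw' t ht)
    rw [norm_mul, norm_norm, Real.norm_of_nonneg h0]
    exact mul_le_mul_of_nonneg_left (hψB t ht) (norm_nonneg _)
  rw [← integral_const_mul]
  refine norm_integral_le_of_norm_le hi ?_
  filter_upwards [self_mem_ae_restrict (measurableSet_volterraSet ε x)] with t ht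
  refine (hκ.norm_apply_le ht ρ _).trans ?_
  have := hκ.pos
  gcongr
  exact hw' t (volterraSet_subset _ _ ht)

theorem IsVolterraKernel.norm_volterraOp_le_integral (hκ : IsVolterraKernel ε C κ)
    (hQ : IntegrableOn Q (Ioi 0)) (hw : Continuous fun z : ℝ≥0 × X => w z.1 z.2) {B : ℝ}
    (hB : ∀ x ρ, ‖w x ρ‖ ≤ B) (x : ℝ≥0) (ρ : X) :
    ‖volterraOp ε κ Q w x ρ‖ ≤ C * ∫ t in Ioi 0, ‖Q t‖ * ‖w t.toNNReal ρ‖ := by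
  refine (hκ.norm_volterraOp_le hQ (ψ := fun t => ‖w t.toNNReal ρ‖) ?_ (fun t _ => hB _ _)
    (fun t _ => by rw [Real.toNNReal_coe]) x).trans ?_
  · exact (hw.comp (continuous_real_toNNReal.prodMk continuous_const)).norm
  · refine mul_le_mul_of_nonneg_left ?_ hκ.pos.le
    exact setIntegral_mono_set (integrableOn_mul_norm_family hQ hw hB ρ)
      (Eventually.of_forall fun t => by positivity)
      (Eventually.of_forall (volterraSet_subset ε x))

theorem IsVolterraKernel.norm_volterraOp_le_bound (hκ : IsVolterraKernel ε C κ)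
    (hQ : IntegrableOn Q (Ioi 0)) (hw : Continuous fun z : ℝ≥0 × X => w z.1 z.2) {B : ℝ}
    (hB : ∀ x ρ, ‖w x ρ‖ ≤ B) (x : ℝ≥0) (ρ : X) :
    ‖volterraOp ε κ Q w x ρ‖ ≤ C * ((∫ t in Ioi 0, ‖Q t‖) * B) := by
  refine (hκ.norm_volterraOp_le_integral hQ hw hB x ρ).trans ?_
  refine mul_le_mul_of_nonneg_left ?_ hκ.pos.le
  rw [← integral_mul_const]
  exact integral_mono (integrableOn_mul_norm_family hQ hw hB ρ) (hQ.norm.mul_const B)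
    fun t => mul_le_mul_of_nonneg_left (hB _ _) (norm_nonneg _)

theorem IsVolterraKernel.continuous_volterraOp (hκ : IsVolterraKernel ε C κ)
    (hQ : IntegrableOn Q (Ioi 0)) (hw : Continuous fun z : ℝ≥0 × X => w z.1 z.2) {B : ℝ}
    (hB : ∀ x ρ, ‖w x ρ‖ ≤ B) :
    Continuous fun z : ℝ≥0 × X => volterraOp ε κ Q w z.1 z.2 := by
  have heq : (fun z : ℝ≥0 × X => volterraOp ε κ Q w z.1 z.2) = fun z => ∫ t,
      (volterraSet ε z.1).indicator (fun t => κ z.1 t z.2 (Q t (w t.toNNReal z.2))) t ∂halfLine := by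
    funext z
    rw [integral_indicator (measurableSet_volterraSet ε z.1), Measure.restrict_restrict
      (measurableSet_volterraSet ε z.1), inter_eq_left.2 (volterraSet_subset ε z.1)]
    rfl
  rw [heq, continuous_iff_continuousAt]
  rintro ⟨x, ρ⟩
  refine continuousAt_of_dominated (bound := fun t => C * (‖Q t‖ * B)) ?_ ?_
    ((hQ.norm.mul_const B).const_mul C) ?_
  · refine Eventually.of_forall fun z => ?_
    have h1 := hκ.aestronglyMeasurable hQ.1
      (aestronglyMeasurable_family hw z.2 halfLine) z.1 z.2
    refine (aestronglyMeasurable_indicator_iff (measurableSet_volterraSet ε z.1)).2 ?_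
    rwa [Measure.restrict_restrict (measurableSet_volterraSet ε z.1),
      inter_eq_left.2 (volterraSet_subset ε z.1)]
  · refine Eventually.of_forall fun z => Eventually.of_forall fun t => ?_
    have hB0 : 0 ≤ B := (norm_nonneg _).trans (hB z.1 z.2)
    have := hκ.pos
    by_cases ht : t ∈ volterraSet ε z.1
    · rw [indicator_of_mem ht]
      refine (hκ.norm_apply_le ht z.2 _).trans ?_
      gcongr
      exact hB _ _
    · rw [indicator_of_notMem ht, norm_zero]
      positivity
  -- the indicator of the Volterra set is continuous in `x` except at `x = t`
  · have hne : ∀ᵐ t : ℝ ∂halfLine, t ≠ x :=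
      ae_restrict_of_ae (Measure.ae_ne volume (x : ℝ))
    filter_upwards [hne, self_mem_ae_restrict measurableSet_Ioi] with t ht ht0
    have ht0 : 0 < t := ht0
    have hcx : Continuous fun z : ℝ≥0 × X => ε * (z.1 : ℝ) := by fun_prop
    by_cases htJ : t ∈ volterraSet ε x
    · have hev : ∀ᶠ z : ℝ≥0 × X in 𝓝 (x, ρ), t ∈ volterraSet ε z.1 := by
        filter_upwards [(hcx.tendsto (x, ρ)).eventually (lt_mem_nhds htJ.2)] with z hz
        exact ⟨ht0, hz⟩
      have hc : ContinuousAt (fun z : ℝ≥0 × X => κ z.1 t z.2 (Q t (w t.toNNReal z.2))) (x, ρ) := by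
        refine ContinuousAt.clm_apply (hκ.continuousAt x t ρ htJ) ?_
        exact ((Q t).continuous.comp (hw.comp (continuous_const.prodMk
          continuous_snd))).continuousAt
      refine hc.congr ?_
      filter_upwards [hev] with z hz
      rw [indicator_of_mem hz]
    · have hlt : ε * (x : ℝ) < ε * t := by
        refine lt_of_le_of_ne (not_lt.1 fun h => htJ ⟨ht0, h⟩) fun h => ht ?_
        have hε0 : ε ≠ 0 := by rcases hκ.sign with h | h <;> simp [h]
        exact (mul_left_cancel₀ hε0 h).symm
      refine continuousAt_const.congr (f := fun _ => (0 : V)) ?_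
      filter_upwards [(hcx.tendsto (x, ρ)).eventually (gt_mem_nhds hlt)] with z hz
      rw [indicator_of_notMem (fun h => lt_asymm hz h.2)]

theorem IsVolterraKernel.isVanishingFamily (hκ : IsVolterraKernel ε C κ)
    (hQ : IntegrableOn Q (Ioi 0)) (hw : Continuous fun z : ℝ≥0 × X => w z.1 z.2) {B : ℝ}
    (hB : ∀ x ρ, ‖w x ρ‖ ≤ B) (h0 : ∀ x, Tendsto (w x) (cocompact X) (𝓝 0)) :
    IsVanishingFamily (volterraOp ε κ Q w) := by
  refine ⟨hκ.continuous_volterraOp hQ hw hB, ⟨_, hκ.norm_volterraOp_le_bound hQ hw hB⟩,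
    fun η hη => ?_⟩
  have : (cocompact X).IsCountablyGenerated := isCountablyGenerated_cocompact
  have h1 : Tendsto (fun ρ => C * ∫ t in Ioi 0, ‖Q t‖ * ‖w t.toNNReal ρ‖) (cocompact X)
      (𝓝 (C * ∫ t in Ioi (0 : ℝ), (0 : ℝ))) := by
    refine Tendsto.const_mul C ?_
    refine tendsto_integral_filter_of_dominated_convergence (fun t => ‖Q t‖ * B) ?_ ?_
      (hQ.norm.mul_const B) ?_
    · exact Eventually.of_forall fun ρ => (integrableOn_mul_norm_family hQ hw hB ρ).1
    · refine Eventually.of_forall fun ρ => Eventually.of_forall fun t => ?_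
      rw [norm_mul, norm_norm, norm_norm]
      exact mul_le_mul_of_nonneg_left (hB _ _) (norm_nonneg _)
    · refine Eventually.of_forall fun t => ?_
      simpa using ((h0 t.toNNReal).norm).const_mul ‖Q t‖
  rw [integral_zero, mul_zero] at h1
  filter_upwards [h1.eventually (gt_mem_nhds hη)] with ρ hρ x
  exact (hκ.norm_volterraOp_le_integral hQ hw hB x ρ).trans hρ.le

theorem volterraOp_add (hκ : IsVolterraKernel ε C κ) (hQ : IntegrableOn Q (Ioi 0))
    {w' : ℝ≥0 → X → V} (hw : Continuous fun z : ℝ≥0 × X => w z.1 z.2)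
    (hw' : Continuous fun z : ℝ≥0 × X => w' z.1 z.2) {B B' : ℝ}
    (hB : ∀ x ρ, ‖w x ρ‖ ≤ B) (hB' : ∀ x ρ, ‖w' x ρ‖ ≤ B') (x : ℝ≥0) (ρ : X) :
    volterraOp ε κ Q (w + w') x ρ = volterraOp ε κ Q w x ρ + volterraOp ε κ Q w' x ρ := by
  unfold volterraOp
  rw [← integral_add (hκ.integrableOn hQ (aestronglyMeasurable_family hw ρ _)
    (fun t _ => hB _ _) x ρ) (hκ.integrableOn hQ (aestronglyMeasurable_family hw' ρ _)
    (fun t _ => hB' _ _) x ρ)]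
  simp

theorem volterraOp_sub (hκ : IsVolterraKernel ε C κ) (hQ : IntegrableOn Q (Ioi 0))
    {w' : ℝ≥0 → X → V} (hw : Continuous fun z : ℝ≥0 × X => w z.1 z.2)
    (hw' : Continuous fun z : ℝ≥0 × X => w' z.1 z.2) {B B' : ℝ}
    (hB : ∀ x ρ, ‖w x ρ‖ ≤ B) (hB' : ∀ x ρ, ‖w' x ρ‖ ≤ B') (x : ℝ≥0) (ρ : X) :
    volterraOp ε κ Q (w - w') x ρ = volterraOp ε κ Q w x ρ - volterraOp ε κ Q w' x ρ := by
  unfold volterraOp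
  rw [← integral_sub (hκ.integrableOn hQ (aestronglyMeasurable_family hw ρ _)
    (fun t _ => hB _ _) x ρ) (hκ.integrableOn hQ (aestronglyMeasurable_family hw' ρ _)
    (fun t _ => hB' _ _) x ρ)]
  simp

theorem volterraOp_sub_left (hκ : IsVolterraKernel ε C κ) (hQ : IntegrableOn Q (Ioi 0))
    {Q' : ℝ → V →L[ℂ] V} (hQ' : IntegrableOn Q' (Ioi 0))
    (hw : Continuous fun z : ℝ≥0 × X => w z.1 z.2) {B : ℝ}
    (hB : ∀ x ρ, ‖w x ρ‖ ≤ B) (x : ℝ≥0) (ρ : X) :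
    volterraOp ε κ (Q - Q') w x ρ = volterraOp ε κ Q w x ρ - volterraOp ε κ Q' w x ρ := by
  unfold volterraOp
  rw [← integral_sub (hκ.integrableOn hQ (aestronglyMeasurable_family hw ρ _)
    (fun t _ => hB _ _) x ρ) (hκ.integrableOn hQ' (aestronglyMeasurable_family hw ρ _)
    (fun t _ => hB _ _) x ρ)]
  simp

theorem volterraOp_congr_left {Q' : ℝ → V →L[ℂ] V} (h : Q =ᵐ[halfLine] Q') (x : ℝ≥0) (ρ : X) :
    volterraOp ε κ Q w x ρ = volterraOp ε κ Q' w x ρ := by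
  unfold volterraOp
  refine integral_congr_ae ?_
  filter_upwards [ae_restrict_of_ae_restrict_of_subset (volterraSet_subset ε x) h] with t ht
  rw [ht]

/-- **Grönwall's inequality** for Volterra operators on either side. The function `φ` need not be
measurable: the hypothesis is stated for continuous majorants `ψ` of `φ`, and the conclusion is
reached by improving the majorant `D Θ` step by step. -/
theorem volterra_gronwall (hε : ε = 1 ∨ ε = -1) (hC : 0 < C) {m : ℝ → ℝ} (hm : ∀ t, 0 ≤ m t)
    (hint : IntegrableOn m (Ioi 0)) {φ : ℝ≥0 → ℝ} {a B : ℝ} (ha : 0 ≤ a)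
    (hB : ∀ x, 0 < x → φ x ≤ B)
    (h : ∀ (ψ : ℝ → ℝ) (D : ℝ), Continuous ψ → (∀ t, ψ t ≤ D) → (∀ x, 0 < x → φ x ≤ ψ x) →
      ∀ x : ℝ≥0, 0 < x → φ x ≤ a + C * ∫ t in volterraSet ε x, m t * ψ t) (x : ℝ≥0) (hx : 0 < x) :
    φ x ≤ 2 * Real.exp (2 * C * ∫ t in Ioi 0, m t) * a := by
  obtain ⟨Θ, hΘc, hΘ1, hΘ2, hΘ⟩ := exists_volterra_weight hε hm hint
    (show 0 < 2 * C by positivity)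
  have key : ∀ N : ℕ, ∀ x, 0 < x → φ x ≤ (2 * a + |B| / 2 ^ N) * Θ x := by
    intro N
    induction N with
    | zero =>
      intro x hx
      have h1 := hΘ1 x
      have h2 := (hB x hx).trans (le_abs_self B)
      have h3 : 0 ≤ |B| := abs_nonneg B
      rw [pow_zero, div_one]
      nlinarith
    | succ N ih =>
      intro x hx
      set D := 2 * a + |B| / 2 ^ N with hD
      have hD0 : 0 ≤ D := by positivity
      have h1 := h (fun t => D * Θ t) (D * Real.exp (2 * C * ∫ t in Ioi 0, m t))
        (by fun_prop) (fun t => mul_le_mul_of_nonneg_left (hΘ2 t) hD0) ih x hx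
      have h2 : ∫ t in volterraSet ε x, m t * (D * Θ t) =
          D * ∫ t in volterraSet ε x, m t * Θ t := by
        rw [← integral_const_mul]
        congr 1
        funext t
        ring
      rw [h2] at h1
      have h3 : C * (D * ∫ t in volterraSet ε x, m t * Θ t) ≤ C * (D * (Θ x / (2 * C))) := by
        gcongr
        exact hΘ x x.2
      have h4 : C * (D * (Θ x / (2 * C))) = D / 2 * Θ x := by field_simp
      have h5 : a ≤ a * Θ x := le_mul_of_one_le_right ha (hΘ1 x)
      calc φ x ≤ a * Θ x + D / 2 * Θ x := by linarith
        _ = _ := by rw [hD, pow_succ]; field_simp; ring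
  have hlim : Tendsto (fun N : ℕ => (2 * a + |B| / 2 ^ N) * Θ x) atTop
      (𝓝 ((2 * a + 0) * Θ x)) := by
    refine Tendsto.mul_const _ (Tendsto.const_add _ ?_)
    have := (tendsto_pow_atTop_nhds_zero_of_lt_one (r := (1 / 2 : ℝ)) (by norm_num)
      (by norm_num)).const_mul |B|
    simpa [div_eq_mul_inv] using this
  have h1 := ge_of_tendsto' hlim fun N => key N x hx
  rw [add_zero] at h1
  refine h1.trans ?_
  have := mul_le_mul_of_nonneg_left (hΘ2 x) (show 0 ≤ 2 * a by positivity)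
  linarith

/-- The constant in Grönwall's inequality. -/
def gronwallConst (C : ℝ) (Q : ℝ → V →L[ℂ] V) : ℝ := 2 * Real.exp (2 * C * ∫ t in Ioi 0, ‖Q t‖)

theorem gronwallConst_nonneg (C : ℝ) (Q : ℝ → V →L[ℂ] V) : 0 ≤ gronwallConst C Q := by
  unfold gronwallConst; positivity

theorem IsVolterraKernel.norm_le_of_eq_add (hκ : IsVolterraKernel ε C κ)
    (hQ : IntegrableOn Q (Ioi 0)) {ρ : X} {δ v : ℝ≥0 → X → V} {a B : ℝ} (ha : 0 ≤ a)
    (hv : ∀ x, 0 < x → ‖v x ρ‖ ≤ a) (hδ : ∀ x, 0 < x → ‖δ x ρ‖ ≤ B)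
    (heq : ∀ x, 0 < x → δ x ρ = v x ρ + volterraOp ε κ Q δ x ρ) (x : ℝ≥0) (hx : 0 < x) :
    ‖δ x ρ‖ ≤ gronwallConst C Q * a := by
  refine volterra_gronwall (φ := fun x => ‖δ x ρ‖) hκ.sign hκ.pos
    (fun t => norm_nonneg (Q t)) hQ.norm ha hδ ?_ x hx
  intro ψ D hψ hD hle x hx
  rw [heq x hx]
  exact (norm_add_le _ _).trans (add_le_add (hv x hx)
    (hκ.norm_volterraOp_le hQ hψ (fun t _ => hD t) hle x))

end Volterra

/-! ### Solutions of Volterra equations -/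

section Volterra

set_option linter.unusedSectionVars false

variable {X V : Type*} [MetricSpace X] [ProperSpace X] [NormedAddCommGroup V] [NormedSpace ℂ V]

theorem IsVanishingFamily.add {U U' : ℝ≥0 → X → V} (h : IsVanishingFamily U)
    (h' : IsVanishingFamily U') : IsVanishingFamily (U + U') := by
  obtain ⟨B, hB⟩ := h.bounded
  obtain ⟨B', hB'⟩ := h'.bounded
  refine ⟨h.continuous.add h'.continuous, ⟨B + B', fun x ρ => ?_⟩, fun η hη => ?_⟩
  · exact (norm_add_le _ _).trans (add_le_add (hB x ρ) (hB' x ρ))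
  · filter_upwards [h.vanishing _ (half_pos hη), h'.vanishing _ (half_pos hη)] with ρ h1 h2 x
    refine (norm_add_le _ _).trans ?_
    linarith [h1 x, h2 x]

theorem norm_family_le {f : ℝ≥0 →ᵇ C₀(X, V)} {B : ℝ} (hB : 0 ≤ B) (h : ∀ x ρ, ‖f x ρ‖ ≤ B) :
    ‖f‖ ≤ B := by
  refine (BoundedContinuousFunction.norm_le hB).2 fun x => ?_
  rw [← ZeroAtInftyContinuousMap.norm_toBCF_eq_norm]
  exact (BoundedContinuousFunction.norm_le hB).2 (h x)

variable {ε C : ℝ} {κ : ℝ≥0 → ℝ → X → V →L[ℂ] V} {Q : ℝ → V →L[ℂ] V}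

/-- Volterra equations with a vanishing family on the right are solvable: after division by the
weight of `exists_volterra_weight` the equation is a fixed point problem for a contraction. -/
theorem IsVolterraKernel.exists_solution [CompleteSpace V] (hκ : IsVolterraKernel ε C κ)
    (hQ : IntegrableOn Q (Ioi 0)) {U : ℝ≥0 → X → V} (hU : IsVanishingFamily U) :
    ∃ δ : ℝ≥0 → X → V, IsVanishingFamily δ ∧
      ∀ x ρ, δ x ρ = U x ρ + volterraOp ε κ Q δ x ρ := by
  have hC := hκ.pos
  obtain ⟨Θ, hΘc, hΘ1, hΘ2, hΘ⟩ := exists_volterra_weight hκ.sign (fun t => norm_nonneg (Q t))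
    hQ.norm (show 0 < 2 * C by positivity)
  set T := Real.exp (2 * C * ∫ t in Ioi 0, ‖Q t‖) with hT
  have hΘ0 : ∀ x, 0 < Θ x := fun x => lt_of_lt_of_le one_pos (hΘ1 x)
  let w : (ℝ≥0 →ᵇ C₀(X, V)) → ℝ≥0 → X → V := fun η x ρ => ((Θ x : ℝ) : ℂ) • η x ρ
  have hΘc' : Continuous fun z : ℝ≥0 × X => ((Θ z.1 : ℝ) : ℂ) := by fun_prop
  have hwc : ∀ η, Continuous fun z : ℝ≥0 × X => w η z.1 z.2 := fun η =>
    hΘc'.smul (continuous_eval_zeroAtInfty η)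
  have hwn : ∀ η x ρ, ‖w η x ρ‖ = Θ x * ‖η x ρ‖ := fun η x ρ => by
    rw [norm_smul, Complex.norm_real, Real.norm_of_nonneg (hΘ0 x).le]
  have hwB : ∀ η x ρ, ‖w η x ρ‖ ≤ T * ‖η‖ := fun η x ρ => by
    rw [hwn]
    exact mul_le_mul (hΘ2 x) (norm_eval_zeroAtInfty_le η x ρ) (norm_nonneg _)
      (Real.exp_pos _).le
  have hw0 : ∀ η x, Tendsto (w η x) (cocompact X) (𝓝 0) := fun η x => by
    have := ((η x).zero_at_infty').const_smul ((Θ x : ℝ) : ℂ)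
    rw [smul_zero] at this
    exact this
  have hsum : ∀ η, IsVanishingFamily (U + volterraOp ε κ Q (w η)) := fun η =>
    hU.add (hκ.isVanishingFamily hQ (hwc η) (hwB η) (hw0 η))
  have hΨ : ∀ η, IsVanishingFamily
      (fun x ρ => (((Θ x)⁻¹ : ℝ) : ℂ) • (U x ρ + volterraOp ε κ Q (w η) x ρ)) := by
    intro η
    have hle : ∀ (x : ℝ≥0) (ρ : X), ‖(((Θ x)⁻¹ : ℝ) : ℂ) • (U x ρ + volterraOp ε κ Q (w η) x ρ)‖ ≤
        ‖U x ρ + volterraOp ε κ Q (w η) x ρ‖ := fun x ρ => by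
      rw [norm_smul, Complex.norm_real, Real.norm_of_nonneg (inv_nonneg.2 (hΘ0 x).le)]
      exact mul_le_of_le_one_left (norm_nonneg _) (inv_le_one_of_one_le₀ (hΘ1 x))
    obtain ⟨B, hB⟩ := (hsum η).bounded
    refine ⟨?_, ⟨B, fun x ρ => (hle x ρ).trans (hB x ρ)⟩, fun θ hθ => ?_⟩
    · refine Continuous.smul ?_ (hsum η).continuous
      have : Continuous fun x => (Θ x)⁻¹ := hΘc.inv₀ fun x => (hΘ0 x).ne'
      exact Complex.continuous_ofReal.comp
        (this.comp (NNReal.continuous_coe.comp continuous_fst))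
    · filter_upwards [(hsum η).vanishing θ hθ] with ρ hρ x
      exact (hle x ρ).trans (hρ x)
  choose F hF using fun η => (hΨ η).exists_eq
  have hcontr : ContractingWith (1 / 2) F := by
    refine ⟨by rw [← NNReal.coe_lt_coe]; norm_num, LipschitzWith.of_dist_le_mul fun η η' => ?_⟩
    rw [dist_eq_norm, dist_eq_norm]
    refine norm_family_le (by positivity) fun x ρ => ?_
    change ‖F η x ρ - F η' x ρ‖ ≤ _
    rw [hF, hF, ← smul_sub, add_sub_add_left_eq_sub,
      ← volterraOp_sub hκ hQ (hwc η) (hwc η') (hwB η) (hwB η'), norm_smul, Complex.norm_real,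
      Real.norm_of_nonneg (inv_nonneg.2 (hΘ0 x).le)]
    have h1 := hκ.norm_volterraOp_le hQ (w := w η - w η') (ρ := ρ)
      (ψ := fun t => Θ t * ‖η - η'‖) (B := T * ‖η - η'‖) (by fun_prop)
      (fun t _ => mul_le_mul_of_nonneg_right (hΘ2 t) (norm_nonneg _)) (fun t _ => by
        have : (w η - w η') t ρ = w (η - η') t ρ := (smul_sub _ _ _).symm
        rw [this, hwn]
        exact mul_le_mul_of_nonneg_left (norm_eval_zeroAtInfty_le _ _ _) (hΘ0 _).le) x
    have h2 : ∫ t in volterraSet ε x, ‖Q t‖ * (Θ t * ‖η - η'‖) =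
        (∫ t in volterraSet ε x, ‖Q t‖ * Θ t) * ‖η - η'‖ := by
      rw [← integral_mul_const]
      congr 1
      funext t
      ring
    rw [h2] at h1
    have h3 : C * ((∫ t in volterraSet ε x, ‖Q t‖ * Θ t) * ‖η - η'‖) ≤
        C * (Θ x / (2 * C) * ‖η - η'‖) := by
      gcongr
      exact hΘ x x.2
    calc (Θ x)⁻¹ * ‖volterraOp ε κ Q (w η - w η') x ρ‖
        ≤ (Θ x)⁻¹ * (C * (Θ x / (2 * C) * ‖η - η'‖)) :=
          mul_le_mul_of_nonneg_left (h1.trans h3) (inv_nonneg.2 (hΘ0 x).le)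
      _ = _ := by
          have := (hΘ0 x).ne'
          push_cast
          field_simp
  set η := ContractingWith.fixedPoint F hcontr with hη
  have hfix : F η = η := hcontr.fixedPoint_isFixedPt
  have heq : w η = U + volterraOp ε κ Q (w η) := by
    funext x ρ
    have h1 := hF η x ρ
    rw [hfix] at h1
    change ((Θ x : ℝ) : ℂ) • η x ρ = _
    rw [h1, smul_smul, ← Complex.ofReal_mul, mul_inv_cancel₀ (hΘ0 x).ne', Complex.ofReal_one,
      one_smul]
    rfl
  refine ⟨w η, ?_, fun x ρ => congrFun (congrFun heq x) ρ⟩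
  rw [heq]
  exact hsum η

/-- The solution differs from the free term by an amount controlled, for each parameter
separately, by the `L₁` norm of the potential applied to the free term. -/
theorem IsVolterraKernel.norm_sub_le_of_eq_add (hκ : IsVolterraKernel ε C κ)
    (hQ : IntegrableOn Q (Ioi 0)) {δ v : ℝ≥0 → X → V}
    (hv : Continuous fun z : ℝ≥0 × X => v z.1 z.2) (hδ : Continuous fun z : ℝ≥0 × X => δ z.1 z.2)
    {B B' : ℝ} (hvB : ∀ x ρ, ‖v x ρ‖ ≤ B) (hδB : ∀ x ρ, ‖δ x ρ‖ ≤ B')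
    (heq : ∀ x ρ, δ x ρ = v x ρ + volterraOp ε κ Q δ x ρ) (x : ℝ≥0) (ρ : X) :
    ‖δ x ρ - v x ρ‖ ≤ (gronwallConst C Q * C) * ∫ t in Ioi 0, ‖Q t‖ * ‖v t.toNNReal ρ‖ := by
  have hpos : ∀ y : ℝ≥0, 0 < y → ‖(δ - v) y ρ‖ ≤
      gronwallConst C Q * (C * ∫ t in Ioi 0, ‖Q t‖ * ‖v t.toNNReal ρ‖) := by
    refine fun y hy => hκ.norm_le_of_eq_add hQ (δ := δ - v) (v := volterraOp ε κ Q v)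
      (B := B' + B) ?_ ?_ ?_ ?_ y hy
    · exact mul_nonneg hκ.pos.le (integral_nonneg fun t => by positivity)
    · exact fun x _ => hκ.norm_volterraOp_le_integral hQ hv hvB x ρ
    · exact fun x _ => (norm_sub_le _ _).trans (add_le_add (hδB x ρ) (hvB x ρ))
    · intro x _
      rw [volterraOp_sub hκ hQ hδ hv hδB hvB]
      change δ x ρ - v x ρ = _
      rw [heq x ρ]
      abel
  rw [mul_assoc]
  -- the point `x = 0` follows by continuity
  have hcl : IsClosed {y : ℝ≥0 | ‖(δ - v) y ρ‖ ≤
      gronwallConst C Q * (C * ∫ t in Ioi 0, ‖Q t‖ * ‖v t.toNNReal ρ‖)} := by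
    refine isClosed_le ?_ continuous_const
    exact ((hδ.sub hv).comp (Continuous.prodMk_left ρ)).norm
  have hd : Dense (Ioi (0 : ℝ≥0)) := by
    rw [dense_iff_closure_eq, closure_Ioi]
    exact Set.eq_univ_of_forall fun y => mem_Ici.2 zero_le
  exact (hcl.closure_subset_iff.2 hpos) (hd x)

/-- Minkowski's inequality along a path in the parameter space: a function dominated by
`∫ |Q(t)| |w(t,ρ)| dt` inherits a bound in `L₂` that is uniform in `t`. -/
theorem eLpNorm_le_of_norm_le_integral (hQ : IntegrableOn Q (Ioi 0)) {w : ℝ≥0 → X → V}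
    (hw : Continuous fun z : ℝ≥0 × X => w z.1 z.2) {B : ℝ} (hB : ∀ x ρ, ‖w x ρ‖ ≤ B)
    {r : ℝ → X} (hr : Continuous r) {N : ℝ≥0∞}
    (hN : ∀ t, eLpNorm (fun s => w t (r s)) 2 halfLine ≤ N) {K : ℝ} {F : Type*}
    [NormedAddCommGroup F] {f : ℝ → F}
    (hf : ∀ s, ‖f s‖ ≤ K * ∫ t in Ioi 0, ‖Q t‖ * ‖w t.toNNReal (r s)‖) :
    eLpNorm f 2 halfLine ≤ ENNReal.ofReal K * ((∫⁻ t in Ioi 0, ‖Q t‖ₑ) * N) := by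
  have hmeas : AEMeasurable (Function.uncurry fun t s : ℝ => ‖Q t‖ₑ * ‖w t.toNNReal (r s)‖ₑ)
      (halfLine.prod halfLine) := by
    refine AEMeasurable.mul (f := fun z : ℝ × ℝ => ‖Q z.1‖ₑ)
      (g := fun z : ℝ × ℝ => ‖w z.1.toNNReal (r z.2)‖ₑ) ?_ ?_
    · exact (hQ.1.enorm).comp_quasiMeasurePreserving Measure.quasiMeasurePreserving_fst
    · have : Continuous fun z : ℝ × ℝ => ‖w z.1.toNNReal (r z.2)‖ₑ :=
        (hw.comp ((continuous_real_toNNReal.comp continuous_fst).prodMk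
          (hr.comp continuous_snd))).enorm
      exact this.aemeasurable
  have h1 : eLpNorm f 2 halfLine ^ 2 ≤
      (ENNReal.ofReal K * ((∫⁻ t in Ioi 0, ‖Q t‖ₑ) * N)) ^ 2 := by
    rw [eLpNorm_two_sq]
    calc ∫⁻ s, ‖f s‖ₑ ^ 2 ∂halfLine
        ≤ ∫⁻ s, ENNReal.ofReal K ^ 2 *
            (∫⁻ t, ‖Q t‖ₑ * ‖w t.toNNReal (r s)‖ₑ ∂halfLine) ^ 2 ∂halfLine := by
          refine lintegral_mono fun s => ?_
          rw [← mul_pow]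
          refine pow_le_pow_left₀ zero_le ?_ 2
          rw [← ofReal_norm]
          refine (ENNReal.ofReal_le_ofReal (hf s)).trans ?_
          rw [ENNReal.ofReal_mul' (integral_nonneg fun t => by positivity)]
          refine mul_le_mul_right (le_of_eq ?_) _
          rw [ofReal_integral_eq_lintegral_ofReal (integrableOn_mul_norm_family hQ hw hB (r s))
            (Eventually.of_forall fun t => by positivity)]
          refine lintegral_congr fun t => ?_
          rw [ENNReal.ofReal_mul (norm_nonneg _), ofReal_norm, ofReal_norm]
      _ = ENNReal.ofReal K ^ 2 * ∫⁻ s,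
            (∫⁻ t, ‖Q t‖ₑ * ‖w t.toNNReal (r s)‖ₑ ∂halfLine) ^ 2 ∂halfLine :=
          lintegral_const_mul' _ _ (by finiteness)
      _ ≤ ENNReal.ofReal K ^ 2 * ((∫⁻ t in Ioi 0, ‖Q t‖ₑ) * N) ^ 2 := by
          gcongr
          refine (lintegral_sq_lintegral_le hmeas).trans ?_
          refine pow_le_pow_left₀ zero_le ?_ 2
          calc ∫⁻ t, (∫⁻ s, (‖Q t‖ₑ * ‖w t.toNNReal (r s)‖ₑ) ^ 2 ∂halfLine) ^ (1 / 2 : ℝ)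
                ∂halfLine ≤ ∫⁻ t, ‖Q t‖ₑ * N ∂halfLine := by
                refine lintegral_mono fun t => ?_
                simp only [mul_pow]
                rw [lintegral_const_mul' _ _ (by finiteness), ← eLpNorm_two_sq,
                  ENNReal.mul_rpow_of_nonneg _ _ (show (0 : ℝ) ≤ 1 / 2 by norm_num),
                  ← ENNReal.rpow_natCast, ← ENNReal.rpow_natCast, ← ENNReal.rpow_mul,
                  ← ENNReal.rpow_mul]
                norm_num
                exact mul_le_mul_right (hN _) _
            _ = _ := lintegral_mul_const'' _ hQ.1.enorm
      _ = _ := by ring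
  exact (ENNReal.pow_le_pow_left_iff two_ne_zero).1 h1

theorem tendsto_eLpNorm_two_of_dominated {f : ℝ≥0 → ℝ → V} {x₀ : ℝ≥0} {G : ℝ → ℝ}
    (hf : ∀ x, AEStronglyMeasurable (f x) halfLine)
    (hfG : ∀ x, ∀ᵐ s ∂halfLine, ‖f x s‖ ≤ G s) (hG : eLpNorm G 2 halfLine ≠ ⊤)
    (hlim : ∀ᵐ s ∂halfLine, Tendsto (fun x => f x s) (𝓝 x₀) (𝓝 (f x₀ s))) :
    Tendsto (fun x => eLpNorm (fun s => f x s - f x₀ s) 2 halfLine) (𝓝 x₀) (𝓝 0) := by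
  have h1 : Tendsto (fun x => ∫⁻ s, ‖f x s - f x₀ s‖ₑ ^ 2 ∂halfLine) (𝓝 x₀)
      (𝓝 (∫⁻ s, 0 ∂halfLine)) := by
    refine tendsto_lintegral_filter_of_dominated_convergence'
      (fun s => (2 * ‖G s‖ₑ) ^ 2) ?_ ?_ ?_ ?_
    · exact Eventually.of_forall fun x => (((hf x).sub (hf x₀)).enorm).pow_const 2
    · refine Eventually.of_forall fun x => ?_
      filter_upwards [hfG x, hfG x₀] with s h1 h2
      refine pow_le_pow_left₀ zero_le ?_ 2
      refine (enorm_sub_le).trans ?_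
      rw [two_mul]
      have h3 : ∀ v : V, ‖v‖ ≤ G s → ‖v‖ₑ ≤ ‖G s‖ₑ := fun v hv => by
        rw [enorm_le_iff_norm_le]
        exact hv.trans (Real.le_norm_self _)
      exact add_le_add (h3 _ h1) (h3 _ h2)
    · simp only [mul_pow]
      rw [lintegral_const_mul' _ _ (by finiteness), ← eLpNorm_two_sq]
      finiteness
    · filter_upwards [hlim] with s hs
      have h2 : Tendsto (fun x => ‖f x s - f x₀ s‖ₑ ^ 2) (𝓝 x₀)
          (𝓝 (‖f x₀ s - f x₀ s‖ₑ ^ 2)) :=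
        ENNReal.Tendsto.pow ((hs.sub_const (f x₀ s)).enorm)
      simpa using h2
  rw [lintegral_zero] at h1
  rw [ENNReal.tendsto_nhds_zero]
  intro η hη
  filter_upwards [(ENNReal.tendsto_nhds_zero.1 h1) (η ^ 2) (ENNReal.pow_pos hη 2)] with x hx
  rw [← eLpNorm_two_sq] at hx
  exact (ENNReal.pow_le_pow_left_iff two_ne_zero).1 hx

end Volterra

/-! ### Families of Volterra equations -/

section Family

set_option linter.unusedSectionVars false

variable {X V P : Type*} [MetricSpace X] [ProperSpace X] [NormedAddCommGroup V] [NormedSpace ℂ V]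
  [SeminormedAddCommGroup P]

/-- Square integrability along a path `r` in the parameter space, with the uniformity needed for
a family over the potentials `q ∈ P`. -/
structure IsSquareFamily (T : P → ℝ≥0 → X → V) (r : ℝ → X) : Prop where
  bounded : ∀ q, ∃ N : ℝ≥0∞, N ≠ ⊤ ∧ ∀ x, eLpNorm (fun s => T q x (r s)) 2 halfLine ≤ N
  continuous_right : ∀ q x₀, Tendsto
    (fun x => eLpNorm (fun s => T q x (r s) - T q x₀ (r s)) 2 halfLine) (𝓝 x₀) (𝓝 0)
  continuous_left : ∀ q₀, ∀ η : ℝ≥0∞, 0 < η → ∀ᶠ q in 𝓝 q₀, ∀ x,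
    eLpNorm (fun s => T q x (r s) - T q₀ x (r s)) 2 halfLine ≤ η

variable {ε C : ℝ} {κ : ℝ≥0 → ℝ → X → V →L[ℂ] V}

/-- Solutions of a family of Volterra equations `δ = P_q (v + δ)` whose first iterates `P_q v`
vanish at infinity, and are square integrable along suitable paths. -/
theorem IsVolterraKernel.exists_family [CompleteSpace V] (hκ : IsVolterraKernel ε C κ)
    {Q : P → ℝ → V →L[ℂ] V} (hQ : ∀ q, IntegrableOn (Q q) (Ioi 0))
    (hQsub : ∀ q q', Q (q - q') =ᵐ[halfLine] Q q - Q q') {L : ℝ} (hL : 0 ≤ L)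
    (hQL : ∀ q, ∫ t in Ioi 0, ‖Q q t‖ ≤ L * ‖q‖) {v : ℝ≥0 → X → V}
    (hv : Continuous fun z : ℝ≥0 × X => v z.1 z.2) {Bv : ℝ} (hvB : ∀ x ρ, ‖v x ρ‖ ≤ Bv)
    (hvan : ∀ q, ∀ η : ℝ, 0 < η → ∀ᶠ ρ in cocompact X, ∀ x, ‖volterraOp ε κ (Q q) v x ρ‖ ≤ η) :
    ∃ T : P → ℝ≥0 →ᵇ C₀(X, V), Continuous T ∧
      (∀ q x ρ, T q x ρ =
        volterraOp ε κ (Q q) v x ρ + volterraOp ε κ (Q q) (fun x ρ => T q x ρ) x ρ) ∧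
      ∀ r : ℝ → X, Continuous r →
        (∃ K : ℝ≥0∞, K ≠ ⊤ ∧ ∀ q x,
          eLpNorm (fun s => volterraOp ε κ (Q q) v x (r s)) 2 halfLine ≤ K * ‖q‖ₑ) →
        (∀ q x₀, Tendsto (fun x => eLpNorm (fun s => volterraOp ε κ (Q q) v x (r s) -
          volterraOp ε κ (Q q) v x₀ (r s)) 2 halfLine) (𝓝 x₀) (𝓝 0)) →
        IsSquareFamily (fun q x ρ => T q x ρ) r := by
  have hC := hκ.pos
  have hU : ∀ q, IsVanishingFamily (volterraOp ε κ (Q q) v) := fun q =>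
    ⟨hκ.continuous_volterraOp (hQ q) hv hvB, ⟨_, hκ.norm_volterraOp_le_bound (hQ q) hv hvB⟩,
      hvan q⟩
  choose δ hδ heq using fun q => hκ.exists_solution (hQ q) (hU q)
  choose T hT using fun q => (hδ q).exists_eq
  have hTδ : ∀ q, (fun x ρ => T q x ρ) = δ q := fun q => by
    funext x ρ
    exact hT q x ρ
  have hTeq : ∀ q x ρ, T q x ρ =
      volterraOp ε κ (Q q) v x ρ + volterraOp ε κ (Q q) (fun x ρ => T q x ρ) x ρ := by
    intro q x ρ
    rw [hTδ, hT]
    exact heq q x ρ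
  have hTc : ∀ q, Continuous fun z : ℝ≥0 × X => T q z.1 z.2 := fun q =>
    continuous_eval_zeroAtInfty (T q)
  have hTB : ∀ q x ρ, ‖T q x ρ‖ ≤ ‖T q‖ := fun q => norm_eval_zeroAtInfty_le (T q)
  -- the equation for the difference of two solutions
  let w : P → P → ℝ≥0 → X → V := fun q₀ q =>
    volterraOp ε κ (Q (q - q₀)) v + volterraOp ε κ (Q (q - q₀)) (fun x ρ => T q₀ x ρ)
  let D : P → P → ℝ≥0 → X → V := fun q₀ q => (fun x ρ => T q x ρ) - fun x ρ => T q₀ x ρ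
  have hD : ∀ q₀ q x ρ, D q₀ q x ρ = w q₀ q x ρ + volterraOp ε κ (Q q) (D q₀ q) x ρ := by
    intro q₀ q x ρ
    change T q x ρ - T q₀ x ρ = (volterraOp ε κ (Q (q - q₀)) v x ρ +
      volterraOp ε κ (Q (q - q₀)) (fun x ρ => T q₀ x ρ) x ρ) + _
    rw [volterraOp_congr_left (hQsub q q₀), volterraOp_congr_left (hQsub q q₀),
      volterraOp_sub_left hκ (hQ q) (hQ q₀) hv hvB,
      volterraOp_sub_left hκ (hQ q) (hQ q₀) (hTc q₀) (hTB q₀),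
      volterraOp_sub hκ (hQ q) (hTc q) (hTc q₀) (hTB q) (hTB q₀), hTeq q, hTeq q₀]
    abel
  have hgr : ∀ q, gronwallConst C (Q q) ≤ 2 * Real.exp (2 * C * (L * ‖q‖)) := fun q => by
    unfold gronwallConst
    gcongr
    exact hQL q
  have hwB : ∀ q₀ q x ρ, ‖w q₀ q x ρ‖ ≤ C * (L * ‖q - q₀‖ * (Bv + ‖T q₀‖)) := by
    intro q₀ q x ρ
    have hBv : 0 ≤ Bv := (norm_nonneg _).trans (hvB x ρ)
    refine (norm_add_le _ _).trans ?_
    have h1 := hκ.norm_volterraOp_le_bound (hQ (q - q₀)) hv hvB x ρ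
    have h2 := hκ.norm_volterraOp_le_bound (hQ (q - q₀)) (hTc q₀) (hTB q₀) x ρ
    calc _ ≤ C * ((∫ t in Ioi 0, ‖Q (q - q₀) t‖) * Bv) +
          C * ((∫ t in Ioi 0, ‖Q (q - q₀) t‖) * ‖T q₀‖) := add_le_add h1 h2
      _ = C * ((∫ t in Ioi 0, ‖Q (q - q₀) t‖) * (Bv + ‖T q₀‖)) := by ring
      _ ≤ _ := by
        gcongr
        exact hQL _
  have hwc : ∀ q₀ q, Continuous fun z : ℝ≥0 × X => w q₀ q z.1 z.2 := fun q₀ q =>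
    (hκ.continuous_volterraOp (hQ _) hv hvB).add
      (hκ.continuous_volterraOp (hQ _) (hTc q₀) (hTB q₀))
  have hDc : ∀ q₀ q, Continuous fun z : ℝ≥0 × X => D q₀ q z.1 z.2 := fun q₀ q =>
    (hTc q).sub (hTc q₀)
  have hDB : ∀ q₀ q x ρ, ‖D q₀ q x ρ‖ ≤ ‖T q‖ + ‖T q₀‖ := fun q₀ q x ρ =>
    (norm_sub_le _ _).trans (add_le_add (hTB q x ρ) (hTB q₀ x ρ))
  refine ⟨T, ?_, hTeq, fun r hr ⟨K, hK, hUK⟩ hUx => ?_⟩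
  · rw [continuous_iff_continuousAt]
    intro q₀
    have hlim : Tendsto (fun q => (1 + 2 * Real.exp (2 * C * (L * ‖q‖)) * C * (L * ‖q‖)) *
        (C * (L * ‖q - q₀‖ * (|Bv| + ‖T q₀‖)))) (𝓝 q₀) (𝓝 0) := by
      have : Continuous fun q : P => (1 + 2 * Real.exp (2 * C * (L * ‖q‖)) * C * (L * ‖q‖)) *
        (C * (L * ‖q - q₀‖ * (|Bv| + ‖T q₀‖))) := by fun_prop
      exact this.tendsto' _ _ (by simp)
    rw [ContinuousAt, tendsto_iff_norm_sub_tendsto_zero]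
    refine squeeze_zero (fun _ => norm_nonneg _) (fun q => ?_) hlim
    refine norm_family_le (by positivity) fun x ρ => ?_
    have h1 := hκ.norm_sub_le_of_eq_add (hQ q) (hwc q₀ q) (hDc q₀ q) (hwB q₀ q) (hDB q₀ q)
      (hD q₀ q) x ρ
    set a := C * (L * ‖q - q₀‖ * (|Bv| + ‖T q₀‖)) with ha
    have hwa : ∀ x ρ, ‖w q₀ q x ρ‖ ≤ a := fun x ρ => by
      refine (hwB q₀ q x ρ).trans ?_
      rw [ha]
      gcongr
      exact le_abs_self _
    have h2 : ∫ t in Ioi 0, ‖Q q t‖ * ‖w q₀ q t.toNNReal ρ‖ ≤ L * ‖q‖ * a := by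
      calc _ ≤ ∫ t in Ioi 0, ‖Q q t‖ * a :=
            integral_mono (integrableOn_mul_norm_family (hQ q) (hwc q₀ q) (hwB q₀ q) ρ)
              ((hQ q).norm.mul_const a)
              fun t => mul_le_mul_of_nonneg_left (hwa _ _) (norm_nonneg _)
        _ = (∫ t in Ioi 0, ‖Q q t‖) * a := integral_mul_const _ _
        _ ≤ _ := mul_le_mul_of_nonneg_right (hQL q) (by positivity)
    change ‖D q₀ q x ρ‖ ≤ _
    calc ‖D q₀ q x ρ‖ ≤ ‖w q₀ q x ρ‖ + ‖D q₀ q x ρ - w q₀ q x ρ‖ := by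
          have := norm_add_le (w q₀ q x ρ) (D q₀ q x ρ - w q₀ q x ρ)
          simpa using this
      _ ≤ a + (2 * Real.exp (2 * C * (L * ‖q‖)) * C) * (L * ‖q‖ * a) := by
          refine add_le_add (hwa x ρ) (h1.trans ?_)
          have := hgr q
          exact mul_le_mul (mul_le_mul_of_nonneg_right this hC.le) h2
            (integral_nonneg fun t => by positivity) (by positivity)
      _ = _ := by ring
  · have hQL' : ∀ q, ∫⁻ t in Ioi 0, ‖Q q t‖ₑ ≤ ENNReal.ofReal (L * ‖q‖) := fun q => by
      rw [← ofReal_integral_norm_eq_lintegral_enorm (hQ q)]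
      exact ENNReal.ofReal_le_ofReal (hQL q)
    have hmeas : ∀ {f : ℝ≥0 → X → V}, (Continuous fun z : ℝ≥0 × X => f z.1 z.2) → ∀ x,
        AEStronglyMeasurable (fun s => f x (r s)) halfLine := fun hf x =>
      (hf.comp (continuous_const.prodMk hr)).aestronglyMeasurable
    have hsplit : ∀ (f g : ℝ≥0 → X → V), (Continuous fun z : ℝ≥0 × X => f z.1 z.2) →
        (Continuous fun z : ℝ≥0 × X => g z.1 z.2) → ∀ x,
        eLpNorm (fun s => f x (r s)) 2 halfLine ≤ eLpNorm (fun s => g x (r s)) 2 halfLine +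
          eLpNorm (fun s => f x (r s) - g x (r s)) 2 halfLine := by
      intro f g hf hg x
      have := eLpNorm_add_le (hmeas hg x) ((hmeas hf x).sub (hmeas hg x))
        (one_le_two : (1 : ℝ≥0∞) ≤ 2)
      refine le_trans (le_of_eq ?_) this
      congr 1
      funext s
      simp
    have hUc : ∀ q, Continuous fun z : ℝ≥0 × X => volterraOp ε κ (Q q) v z.1 z.2 := fun q =>
      (hU q).continuous
    have hUB := fun q => hκ.norm_volterraOp_le_bound (hQ q) hv hvB
    -- beyond the first iterate the solution is controlled by the first iterate
    have hRG : ∀ q x ρ, ‖T q x ρ - volterraOp ε κ (Q q) v x ρ‖ ≤ (gronwallConst C (Q q) * C) *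
        ∫ t in Ioi 0, ‖Q q t‖ * ‖volterraOp ε κ (Q q) v t.toNNReal ρ‖ := fun q =>
      hκ.norm_sub_le_of_eq_add (hQ q) (δ := fun x ρ => T q x ρ) (hUc q) (hTc q) (hUB q) (hTB q)
        (hTeq q)
    have hbdd : ∀ q, ∃ N : ℝ≥0∞, N ≠ ⊤ ∧
        ∀ x, eLpNorm (fun s => T q x (r s)) 2 halfLine ≤ N := by
      intro q
      refine ⟨K * ‖q‖ₑ + ENNReal.ofReal (gronwallConst C (Q q) * C) *
        (ENNReal.ofReal (L * ‖q‖) * (K * ‖q‖ₑ)), by finiteness, fun x => ?_⟩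
      refine (hsplit (fun x ρ => T q x ρ) _ (hTc q) (hUc q) x).trans
        (add_le_add (hUK q x) ?_)
      refine (eLpNorm_le_of_norm_le_integral (hQ q) (hUc q) (hUB q) hr (hUK q)
        (fun s => hRG q x (r s))).trans ?_
      gcongr
      exact hQL' q
    refine ⟨hbdd, fun q x₀ => ?_, fun q₀ η hη => ?_⟩
    · -- `T - U` is dominated by a square integrable function, uniformly in `x`
      set G : ℝ → ℝ := fun s => (gronwallConst C (Q q) * C) *
        ∫ t in Ioi 0, ‖Q q t‖ * ‖volterraOp ε κ (Q q) v t.toNNReal (r s)‖ with hG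
      have hG0 : ∀ s, 0 ≤ G s := fun s => mul_nonneg
        (mul_nonneg (gronwallConst_nonneg _ _) hC.le) (integral_nonneg fun t => by positivity)
      have hG2 : eLpNorm G 2 halfLine ≠ ⊤ := by
        refine ne_top_of_le_ne_top ?_ (eLpNorm_le_of_norm_le_integral (hQ q) (hUc q) (hUB q) hr
          (hUK q) (f := G) (K := gronwallConst C (Q q) * C)
          fun s => (Real.norm_of_nonneg (hG0 s)).le)
        have := ne_top_of_le_ne_top ENNReal.ofReal_ne_top (hQL' q)
        finiteness
      have hRc : Continuous fun z : ℝ≥0 × X => T q z.1 z.2 - volterraOp ε κ (Q q) v z.1 z.2 :=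
        (hTc q).sub (hUc q)
      have h1 := tendsto_eLpNorm_two_of_dominated (x₀ := x₀) (G := G)
        (f := fun x s => T q x (r s) - volterraOp ε κ (Q q) v x (r s))
        (hmeas (f := fun x ρ => T q x ρ - volterraOp ε κ (Q q) v x ρ) hRc)
        (fun x => Eventually.of_forall fun s => hRG q x (r s)) hG2
        (Eventually.of_forall fun s => (hRc.comp (Continuous.prodMk_left (r s))).tendsto x₀)
      have h2 := (hUx q x₀).add h1
      rw [add_zero] at h2
      refine tendsto_of_tendsto_of_tendsto_of_le_of_le tendsto_const_nhds h2
        (fun _ => zero_le) fun x => ?_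
      have h3 := eLpNorm_add_le ((hmeas (hUc q) x).sub (hmeas (hUc q) x₀))
        ((hmeas (f := fun x ρ => T q x ρ - volterraOp ε κ (Q q) v x ρ) hRc x).sub
          (hmeas (f := fun x ρ => T q x ρ - volterraOp ε κ (Q q) v x ρ) hRc x₀))
        (one_le_two : (1 : ℝ≥0∞) ≤ 2)
      refine le_trans (le_of_eq ?_) h3
      congr 1
      funext s
      simp only [Pi.add_apply, Pi.sub_apply]
      abel
    · obtain ⟨N, hN, hTN⟩ := hbdd q₀
      set A : ℝ≥0∞ := 1 + ENNReal.ofReal (2 * Real.exp (2 * C * (L * (‖q₀‖ + 1))) * C) *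
        ENNReal.ofReal (L * (‖q₀‖ + 1)) with hA
      have hAt : A ≠ ⊤ := by finiteness
      have hw2 : ∀ q x, eLpNorm (fun s => w q₀ q x (r s)) 2 halfLine ≤
          K * ‖q - q₀‖ₑ + ENNReal.ofReal C * (ENNReal.ofReal (L * ‖q - q₀‖) * N) := by
        intro q x
        refine (eLpNorm_add_le (hmeas (hUc (q - q₀)) x) (hmeas
          (hκ.continuous_volterraOp (hQ (q - q₀)) (hTc q₀) (hTB q₀)) x)
          (one_le_two : (1 : ℝ≥0∞) ≤ 2)).trans (add_le_add (hUK _ x) ?_)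
        refine (eLpNorm_le_of_norm_le_integral (hQ (q - q₀)) (hTc q₀) (hTB q₀) hr hTN
          fun s => hκ.norm_volterraOp_le_integral (hQ (q - q₀)) (hTc q₀) (hTB q₀) x (r s)).trans ?_
        gcongr
        exact hQL' _
      have hlim : Tendsto (fun q => A * (K * ‖q - q₀‖ₑ +
          ENNReal.ofReal C * (ENNReal.ofReal (L * ‖q - q₀‖) * N))) (𝓝 q₀)
          (𝓝 (A * (K * 0 + ENNReal.ofReal C * (0 * N)))) := by
        have h1 : Tendsto (fun q => ‖q - q₀‖ₑ) (𝓝 q₀) (𝓝 0) := by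
          have : Continuous fun q : P => ‖q - q₀‖ₑ := by fun_prop
          exact this.tendsto' _ _ (by rw [sub_self, ← ofReal_norm, norm_zero, ENNReal.ofReal_zero])
        have h2 : Tendsto (fun q => ENNReal.ofReal (L * ‖q - q₀‖)) (𝓝 q₀) (𝓝 0) := by
          have : Continuous fun q : P => ENNReal.ofReal (L * ‖q - q₀‖) :=
            ENNReal.continuous_ofReal.comp (by fun_prop)
          exact this.tendsto' _ _ (by simp)
        refine ENNReal.Tendsto.const_mul (Tendsto.add (ENNReal.Tendsto.const_mul h1 (Or.inr hK))
          (ENNReal.Tendsto.const_mul (ENNReal.Tendsto.mul_const h2 (Or.inr hN))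
            (Or.inr ENNReal.ofReal_ne_top))) (Or.inr hAt)
      simp only [zero_mul, mul_zero, add_zero] at hlim
      have hq1 : ∀ᶠ q in 𝓝 q₀, ‖q‖ ≤ ‖q₀‖ + 1 := by
        have : Continuous fun q : P => ‖q‖ := continuous_norm
        filter_upwards [(this.tendsto q₀).eventually (gt_mem_nhds (lt_add_one ‖q₀‖))] with q hq
        exact hq.le
      filter_upwards [(ENNReal.tendsto_nhds_zero.1 hlim) η hη, hq1] with q hq hq1 x
      refine le_trans ?_ hq
      set a := K * ‖q - q₀‖ₑ + ENNReal.ofReal C * (ENNReal.ofReal (L * ‖q - q₀‖) * N)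
      have h1 := hsplit _ _ (hDc q₀ q) (hwc q₀ q) x
      have h2 := eLpNorm_le_of_norm_le_integral (hQ q) (hwc q₀ q) (hwB q₀ q) hr (hw2 q)
        fun s => hκ.norm_sub_le_of_eq_add (hQ q) (hwc q₀ q) (hDc q₀ q) (hwB q₀ q) (hDB q₀ q)
          (hD q₀ q) x (r s)
      change eLpNorm (fun s => D q₀ q x (r s)) 2 halfLine ≤ _
      refine h1.trans ((add_le_add (hw2 q x) h2).trans ?_)
      calc _ ≤ a + ENNReal.ofReal (2 * Real.exp (2 * C * (L * (‖q₀‖ + 1))) * C) *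
            (ENNReal.ofReal (L * (‖q₀‖ + 1)) * a) := by
            gcongr
            · refine (hgr q).trans ?_
              gcongr
            · refine (hQL' q).trans (ENNReal.ofReal_le_ofReal ?_)
              gcongr
        _ = A * a := by rw [hA]; ring

end Family

/-! ### Restriction to rays -/

section Rays

set_option linter.unusedSectionVars false

theorem isClosed_ray {z : ℂ} (hz : z ≠ 0) : IsClosed (ray z) := by
  have h : ray z = {ρ : ℂ | (ρ / z).im = 0} ∩ {ρ : ℂ | 0 ≤ (ρ / z).re} := by
    ext ρ
    constructor
    · rintro ⟨t, rfl⟩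
      have h1 : z * ((t : ℝ) : ℂ) / z = ((t : ℝ) : ℂ) := by field_simp
      simp only [mem_inter_iff, mem_ofPred_eq, h1, Complex.ofReal_im, Complex.ofReal_re]
      exact ⟨trivial, t.2⟩
    · rintro ⟨h1, h2⟩
      refine ⟨⟨(ρ / z).re, h2⟩, ?_⟩
      have h3 : ρ / z = (((ρ / z).re : ℝ) : ℂ) := Complex.ext (by simp) (by simpa using h1)
      change ρ = z * (((ρ / z).re : ℝ) : ℂ)
      rw [← h3]
      field_simp
  rw [h]
  refine IsClosed.inter (isClosed_eq ?_ continuous_const) (isClosed_le continuous_const ?_)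
  · exact Complex.continuous_im.comp (continuous_id.div_const z)
  · exact Complex.continuous_re.comp (continuous_id.div_const z)

theorem zero_mem_closure {S : Set ℂ} (hS : IsOpenSector S) {z : ℂ} (hz : z ∈ closure S) :
    (0 : ℂ) ∈ closure S := by
  have h1 : Tendsto (fun r : ℝ => (r : ℂ) * z) (𝓝[>] 0) (𝓝 0) := by
    have : Continuous fun r : ℝ => (r : ℂ) * z := by fun_prop
    exact (this.tendsto' 0 0 (by simp)).mono_left nhdsWithin_le_nhds
  refine isClosed_closure.mem_of_tendsto h1 ?_
  filter_upwards [self_mem_nhdsWithin] with r hr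
  exact hS.smul_mem_closure hr hz

theorem ray_subset_closure {S : Set ℂ} (hS : IsOpenSector S) {z : ℂ} (hz : z ∈ closure S) :
    ray z ⊆ closure S := by
  rintro _ ⟨t, rfl⟩
  rcases eq_or_lt_of_le (zero_le (a := t)) with rfl | ht
  · simpa using zero_mem_closure hS hz
  · rw [mul_comm]
    exact hS.smul_mem_closure ht hz

theorem continuous_rayParam (z : ℂ) : Continuous (rayParam z) := by
  refine Continuous.subtype_mk ?_ _
  fun_prop

/-- The arc length parametrization of a ray as a path in the closed sector. -/
def rayPath {S : Set ℂ} (hS : IsOpenSector S) {z : ℂ} (hz : z ∈ closure S) (s : ℝ) : closure S :=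
  inclusion (ray_subset_closure hS hz) (rayParam z s)

theorem continuous_rayPath {S : Set ℂ} (hS : IsOpenSector S) {z : ℂ} (hz : z ∈ closure S) :
    Continuous (rayPath hS hz) :=
  (continuous_inclusion _).comp (continuous_rayParam z)

theorem rayPath_coe {S : Set ℂ} (hS : IsOpenSector S) {z : ℂ} (hz : z ∈ closure S) {s : ℝ}
    (hs : 0 ≤ s) : (rayPath hS hz s : ℂ) = s * (z / ‖z‖) := by
  change z * (((s / ‖z‖).toNNReal : ℝ≥0) : ℝ) = _
  rw [Real.coe_toNNReal _ (by positivity)]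
  push_cast
  ring

variable {V : Type} [NormedAddCommGroup V] [NormedSpace ℂ V]

/-- Restriction of functions on the closed sector to a ray. -/
def restrictRay {S : Set ℂ} (hS : IsOpenSector S) {z : ℂ} (hz : z ∈ closure S \ {0}) :
    C₀(closure S, V) → C₀(ray z, V) := fun f =>
  f.comp
    { toFun := inclusion (ray_subset_closure hS hz.1)
      continuous_toFun := continuous_inclusion _
      cocompact_tendsto' := (Topology.IsClosedEmbedding.inclusion _
        ((isClosed_ray hz.2).preimage continuous_subtype_val)).tendsto_cocompact }

theorem eLpNorm_rayMeasure (z : ℂ) {f : ray z → V} (hf : Continuous f) :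
    eLpNorm f 2 (rayMeasure z) = eLpNorm (fun s => f (rayParam z s)) 2 halfLine := by
  rw [rayMeasure, eLpNorm_map_measure hf.aestronglyMeasurable
    (continuous_rayParam z).aemeasurable, ← Measure.restrict_congr_set Ioi_ae_eq_Ici]
  rfl

variable {n : ℕ} {p : ℝ≥0∞} [Fact (1 ≤ p)]

/-- A continuous family with values in `BC([0,∞), C₀(S̄))` that is square integrable along the
rays, uniformly in the sense of `IsSquareFamily`, is a remainder. -/
theorem isRemainder_of_isSquareFamily {S : Set ℂ} (hS : IsOpenSector S)
    {T : Xp n p → ℝ≥0 →ᵇ C₀(closure S, V)} (hT : Continuous T)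
    (h : ∀ z (hz : z ∈ closure S \ {0}),
      IsSquareFamily (fun q x ρ => T q x ρ) (rayPath hS hz.1)) : IsRemainder T := by
  refine ⟨hT, fun z hz => ?_⟩
  have hz' := h z hz
  have hcont : ∀ q x, Continuous (restrictRay hS hz (T q x)) := fun q x => map_continuous _
  have hnorm : ∀ q x, eLpNorm (restrictRay hS hz (T q x)) 2 (rayMeasure z) =
      eLpNorm (fun s => T q x (rayPath hS hz.1 s)) 2 halfLine := fun q x =>
    eLpNorm_rayMeasure z (hcont q x)
  have hmem : ∀ q x, MemLp (restrictRay hS hz (T q x)) 2 (rayMeasure z) := by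
    intro q x
    obtain ⟨N, hN, hle⟩ := hz'.bounded q
    refine ⟨(hcont q x).aestronglyMeasurable, ?_⟩
    rw [hnorm]
    exact lt_of_le_of_lt (hle x) (lt_top_iff_ne_top.2 hN)
  let G : Xp n p → ℝ≥0 → RayH z V := fun q x =>
    ⟨(restrictRay hS hz (T q x), (hmem q x).toLp), (hmem q x).coeFn_toLp.symm⟩
  have hC0 : ∀ (f : C₀(ray z, V)) (B : ℝ), 0 ≤ B → (∀ ρ, ‖f ρ‖ ≤ B) → ‖f‖ ≤ B := by
    intro f B hB hf
    rw [← ZeroAtInftyContinuousMap.norm_toBCF_eq_norm]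
    exact (BoundedContinuousFunction.norm_le hB).2 hf
  have hpt : ∀ (f : C₀(closure S, V)) ρ, ‖f ρ‖ ≤ ‖f‖ := by
    intro f ρ
    rw [← ZeroAtInftyContinuousMap.norm_toBCF_eq_norm]
    exact f.toBCF.norm_coe_le_norm ρ
  have hsub : ∀ q x q' x' (η : ℝ), 0 ≤ η → ‖T q x - T q' x'‖ ≤ η →
      eLpNorm (fun s => T q x (rayPath hS hz.1 s) - T q' x' (rayPath hS hz.1 s)) 2 halfLine ≤
        ENNReal.ofReal η → ‖G q x - G q' x'‖ ≤ η := by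
    intro q x q' x' η hη h1 h2
    change max ‖restrictRay hS hz (T q x) - restrictRay hS hz (T q' x')‖
      ‖(hmem q x).toLp - (hmem q' x').toLp‖ ≤ η
    refine max_le (hC0 _ _ hη fun ρ => ?_) ?_
    · exact (hpt (T q x - T q' x') (inclusion (ray_subset_closure hS hz.1) ρ)).trans h1
    · rw [← MemLp.toLp_sub, Lp.norm_toLp]
      refine ENNReal.toReal_le_of_le_ofReal hη ?_
      rw [eLpNorm_rayMeasure z ((hcont q x).sub (hcont q' x'))]
      exact h2
  have hbdd : ∀ q, ∃ B, ∀ x, ‖G q x‖ ≤ B := by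
    intro q
    obtain ⟨N, hN, hle⟩ := hz'.bounded q
    refine ⟨max ‖T q‖ N.toReal, fun x => max_le_max (hC0 _ _ (norm_nonneg _) fun ρ => ?_) ?_⟩
    · exact (hpt _ _).trans ((T q).norm_coe_le_norm x)
    · change ‖(hmem q x).toLp‖ ≤ _
      rw [Lp.norm_toLp, hnorm]
      exact ENNReal.toReal_mono hN (hle x)
  have hGc : ∀ q, Continuous (G q) := by
    intro q
    rw [continuous_iff_continuousAt]
    intro x
    rw [ContinuousAt, Metric.tendsto_nhds]
    intro η hη
    have h1 := (Metric.tendsto_nhds.1 ((T q).continuous.tendsto x)) (η / 2) (half_pos hη)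
    have h2 := (ENNReal.tendsto_nhds_zero.1 (hz'.continuous_right q x)) (ENNReal.ofReal (η / 2))
      (ENNReal.ofReal_pos.2 (half_pos hη))
    filter_upwards [h1, h2] with y h3 h4
    rw [dist_eq_norm] at h3 ⊢
    exact lt_of_le_of_lt (hsub q y q x _ (half_pos hη).le h3.le h4) (half_lt_self hη)
  choose B hB using hbdd
  refine ⟨fun q => BoundedContinuousFunction.ofNormedAddCommGroup (G q) (hGc q) (B q) (hB q), ?_,
    fun q x ρ hl hS' => rfl⟩
  rw [continuous_iff_continuousAt]
  intro q
  rw [ContinuousAt, Metric.tendsto_nhds]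
  intro η hη
  have h1 := (Metric.tendsto_nhds.1 (hT.tendsto q)) (η / 2) (half_pos hη)
  have h2 := hz'.continuous_left q (ENNReal.ofReal (η / 2)) (ENNReal.ofReal_pos.2 (half_pos hη))
  filter_upwards [h1, h2] with q' h3 h4
  rw [dist_eq_norm] at h3
  refine lt_of_le_of_lt ((BoundedContinuousFunction.dist_le (half_pos hη).le).2 fun x => ?_)
    (half_lt_self hη)
  refine (dist_eq_norm (G q' x) (G q x)).trans_le ?_
  exact hsub q' x q x _ (half_pos hη).le
    (((T q' - T q).norm_coe_le_norm x).trans h3.le) (h4 x)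

end Rays

/-! ### Sectors and branches of the logarithm -/

theorem IsLogBranch.ofReal_mul {S : Set ℂ} {ℓ : ℂ → ℂ} (hS : IsOpenSector S)
    (hℓ : IsLogBranch S ℓ) {r : ℝ} (hr : 0 < r) {x : ℂ} (hx : x ∈ closure S \ {0}) :
    ℓ (r * x) = Real.log r + ℓ x := by
  have hmem : ∀ s : ℝ, ((Real.exp s : ℝ) : ℂ) * x ∈ closure S \ {0} := fun s =>
    ⟨hS.smul_mem_closure (Real.exp_pos s) hx.1, by
      have : x ≠ 0 := hx.2
      simp [this]⟩
  let f : ℝ → ℂ := fun s => ℓ ((Real.exp s : ℝ) * x) - s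
  have hf : Continuous f := by
    refine Continuous.sub ?_ (by fun_prop)
    exact hℓ.continuousOn.comp_continuous (by fun_prop) hmem
  have hexp : ∀ s, Complex.exp (f s) = x := by
    intro s
    simp only [f, Complex.exp_sub, hℓ.exp_eq _ (hmem s)]
    rw [Complex.ofReal_exp]
    field_simp
  let g : ℝ → ℝ := fun s => ((f s).im - (f 0).im) / (2 * Real.pi)
  have hg : Continuous g := by fun_prop
  have hN : ∀ s, ∃ N : ℤ, f s = f 0 + N * (2 * Real.pi * Complex.I) := fun s =>
    Complex.exp_eq_exp_iff_exists_int.1 ((hexp s).trans (hexp 0).symm)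
  have hgN : ∀ s, ∀ N : ℤ, f s = f 0 + N * (2 * Real.pi * Complex.I) → g s = N := by
    intro s N hN
    have := congrArg Complex.im hN
    simp at this
    simp only [g]
    rw [this]
    field_simp
    ring
  have hgz : MapsTo g univ (range ((↑) : ℤ → ℝ)) := by
    intro s _
    obtain ⟨N, hN⟩ := hN s
    exact ⟨N, (hgN s N hN).symm⟩
  obtain ⟨N, hN'⟩ := hN (Real.log r)
  have h0 : g (Real.log r) = g 0 := by
    have hd : DiscreteTopology (range ((↑) : ℤ → ℝ)) :=
      (Int.isClosedEmbedding_coe_real.toIsEmbedding.toHomeomorph.discreteTopology)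
    exact isPreconnected_univ.constant_of_mapsTo ⟨hd⟩ hg.continuousOn hgz (mem_univ _) (mem_univ 0)
  have h1 : g 0 = 0 := by simp [g]
  have h2 : (N : ℝ) = 0 := by rw [← hgN _ N hN', h0, h1]
  have h3 : N = 0 := by exact_mod_cast h2
  rw [h3] at hN'
  simp only [f, Int.cast_zero, zero_mul, add_zero, Real.exp_log hr, Real.exp_zero,
    Complex.ofReal_one, one_mul, Complex.ofReal_zero, sub_zero] at hN'
  rw [← hN']
  ring

theorem IsOpenSector.zero_notMem {S : Set ℂ} (hS : IsOpenSector S) : (0 : ℂ) ∉ S := by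
  obtain ⟨θ₁, θ₂, -, -, rfl⟩ := hS
  rintro ⟨r, θ, hr, -, -, h⟩
  have : (r : ℂ) * Complex.exp (θ * Complex.I) ≠ 0 :=
    mul_ne_zero (by exact_mod_cast hr.ne') (Complex.exp_ne_zero _)
  exact this h.symm

theorem IsOpenSector.nonempty {S : Set ℂ} (hS : IsOpenSector S) : S.Nonempty := by
  obtain ⟨θ₁, θ₂, h, -, rfl⟩ := hS
  exact ⟨_, 1, (θ₁ + θ₂) / 2, one_pos, by linarith, by linarith, rfl⟩

theorem IsOpenSector.subset_diff {S : Set ℂ} (hS : IsOpenSector S) : S ⊆ closure S \ {0} :=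
  fun x hx => ⟨subset_closure hx, fun h => hS.zero_notMem (by rwa [← mem_singleton_iff.1 h])⟩

theorem IsOpenSector.isPreconnected {S : Set ℂ} (hS : IsOpenSector S) : IsPreconnected S := by
  obtain ⟨θ₁, θ₂, -, -, rfl⟩ := hS
  have h : {z : ℂ | ∃ r θ : ℝ, 0 < r ∧ θ₁ < θ ∧ θ < θ₂ ∧ z = r * Complex.exp (θ * Complex.I)} =
      (fun z : ℝ × ℝ => (z.1 : ℂ) * Complex.exp (z.2 * Complex.I)) '' (Ioi 0 ×ˢ Ioo θ₁ θ₂) := by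
    ext z
    constructor
    · rintro ⟨r, θ, h1, h2, h3, rfl⟩
      exact ⟨(r, θ), ⟨h1, h2, h3⟩, rfl⟩
    · rintro ⟨⟨r, θ⟩, ⟨h1, h2, h3⟩, rfl⟩
      exact ⟨r, θ, h1, h2, h3, rfl⟩
  rw [h]
  exact (isPreconnected_Ioi.prod isPreconnected_Ioo).image _ (by fun_prop)

theorem IsOpenSector.isOpen {S : Set ℂ} (hS : IsOpenSector S) : IsOpen S := by
  obtain ⟨θ₁, θ₂, -, hθ, rfl⟩ := hS
  -- rotate the bisector of the sector to the positive half-line and use the argument there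
  set θ₀ := (θ₁ + θ₂) / 2 with hθ₀
  have h : {z : ℂ | ∃ r θ : ℝ, 0 < r ∧ θ₁ < θ ∧ θ < θ₂ ∧ z = r * Complex.exp (θ * Complex.I)} =
      (fun z => z * Complex.exp (-θ₀ * Complex.I)) ⁻¹'
        (Complex.slitPlane ∩ Complex.arg ⁻¹' Ioo (θ₁ - θ₀) (θ₂ - θ₀)) := by
    ext z
    simp only [mem_preimage, mem_inter_iff, mem_ofPred_eq, mem_Ioo]
    constructor
    · rintro ⟨r, θ, hr, h1, h2, rfl⟩
      have he : (r : ℂ) * Complex.exp (θ * Complex.I) * Complex.exp (-θ₀ * Complex.I) =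
          r * Complex.exp (((θ - θ₀ : ℝ) : ℂ) * Complex.I) := by
        rw [mul_assoc, ← Complex.exp_add]
        push_cast
        congr 2
        ring
      have harg : Complex.arg (r * Complex.exp (((θ - θ₀ : ℝ) : ℂ) * Complex.I)) = θ - θ₀ := by
        rw [Complex.arg_real_mul _ hr, Complex.arg_exp_mul_I, toIocMod_eq_self]
        constructor <;> linarith
      rw [he, Complex.mem_slitPlane_iff_arg, harg]
      refine ⟨⟨by linarith, mul_ne_zero (by exact_mod_cast hr.ne') (Complex.exp_ne_zero _)⟩,
        by linarith, by linarith⟩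
    · rintro ⟨h1, h2, h3⟩
      set y := z * Complex.exp (-θ₀ * Complex.I) with hy
      have hy0 : y ≠ 0 := Complex.slitPlane_ne_zero h1
      refine ⟨‖y‖, y.arg + θ₀, norm_pos_iff.2 hy0, by linarith, by linarith, ?_⟩
      push_cast
      rw [add_mul, Complex.exp_add, ← mul_assoc, Complex.norm_mul_exp_arg_mul_I, hy, mul_assoc,
        ← Complex.exp_add]
      simp
  rw [h]
  refine IsOpen.preimage (by fun_prop) ?_
  exact (Complex.continuousOn_arg).isOpen_inter_preimage Complex.isOpen_slitPlane isOpen_Ioo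

instance (S : Set ℂ) : ProperSpace (closure S) :=
  ⟨fun x r => by
    rw [Subtype.isCompact_iff]
    have : ((↑) : closure S → ℂ) '' Metric.closedBall x r = closure S ∩ Metric.closedBall ↑x r := by
      ext y
      simp [and_comm]
    rw [this]
    exact (isCompact_closedBall _ _).inter_left isClosed_closure⟩

/-! ### Pairs of fundamental matrices -/

/-- The data from which one of the tensors `T_k`, `F_k` is built: the direction `ε` of the Volterra
equation (`ε = 1` for integrals over `(0,x)`, `ε = -1` for integrals over `(x,∞)`), the multi-index
`α₀`, the holomorphic factor `chat` of the fundamental matrix `c(ξ) = chat(ξ) diag(ξ^{μ_j})`, the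
transition matrix `trans` with inverse `trans'`, the factor `ehat` of the fundamental matrix
`e(ξ) = c(ξ) trans = ehat(ξ) diag(exp(ξ R_j))`, the weight `w`, and the coefficients `v₀` of the
free term with respect to `c`.

The fields `μ_order` and `R_order` state that `α₀` is extremal at the origin and at infinity, in the
sense that matches the direction of integration. The fields `v₀_zero` and `v₀_infty` state that the
free term contains no component that grows faster than the weight at the origin and at infinity. -/
structure TensorModel (n m : ℕ) (S : Set ℂ) where
  ε : ℝ
  sign : ε = 1 ∨ ε = -1
  sector : IsOpenSector S
  μ : Fin n → ℂ
  ℓ : ℂ → ℂ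
  logBranch : IsLogBranch S ℓ
  α₀ : Set.powersetCard (Fin n) m
  chat : ℂ → Matrix (Fin n) (Fin n) ℂ
  chat_continuous : Continuous chat
  chat_det : ∀ ξ ∈ closure S, (chat ξ).det = 1
  R : Fin n → ℂ
  R_injective : Function.Injective R
  σ : Equiv.Perm (Fin n)
  trans : Matrix (Fin n) (Fin n) ℂ
  trans' : Matrix (Fin n) (Fin n) ℂ
  trans_mul : trans * trans' = 1
  ehat : ℂ → Matrix (Fin n) (Fin n) ℂ
  ehat_eq : ∀ ξ ∈ closure S \ {0},
    chat ξ * Matrix.diagonal (fun j => Complex.exp (μ j * ℓ ξ)) * trans =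
      ehat ξ * Matrix.diagonal fun j => Complex.exp (ξ * R j)
  d : ℂ
  d_ne_zero : d ≠ 0
  ehat_det : ∀ ξ ∈ closure S \ {0}, (ehat ξ).det = d
  K : ℝ
  ehat_sub_le : ∀ ξ ∈ closure S, 1 ≤ ‖ξ‖ → ∀ i j,
    ‖ehat ξ i j - (colMatrix fun k => Pi.single (σ k) 1) i j‖ ≤ K * ‖ξ‖⁻¹
  w : ℂ → ℂ
  w_continuousOn : ContinuousOn w (closure S \ {0})
  w_ne_zero : ∀ ξ ∈ closure S \ {0}, w ξ ≠ 0
  w_zero : Tendsto (fun ξ => w ξ / Complex.exp ((∑ j ∈ (α₀ : Finset (Fin n)), μ j) * ℓ ξ))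
    (𝓝[closure S \ {0}] 0) (𝓝 1)
  w_infty : ∀ ξ ∈ closure S, 1 < ‖ξ‖ →
    w ξ = Complex.exp (ξ * ∑ j ∈ (α₀ : Finset (Fin n)), R j)
  v₀ : Tensor n m
  μ_order : ∀ α, α ≠ α₀ → ε * ((∑ j ∈ (α : Finset (Fin n)), μ j) -
    ∑ j ∈ (α₀ : Finset (Fin n)), μ j).re < 0
  R_order : ∀ ξ ∈ closure S, ∀ α : Set.powersetCard (Fin n) m,
    ε * (ξ * ((∑ j ∈ (α : Finset (Fin n)), R j) - ∑ j ∈ (α₀ : Finset (Fin n)), R j)).re ≤ 0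
  v₀_zero : ε = -1 ∨ ∀ α, α ≠ α₀ → (tensorBasis n m).repr v₀ α = 0
  v₀_infty : ∀ ξ ∈ closure S, ∀ α : Set.powersetCard (Fin n) m,
    (tensorBasis n m).repr (compound m trans' v₀) α = 0 ∨
      (ξ * ((∑ j ∈ (α : Finset (Fin n)), R j) - ∑ j ∈ (α₀ : Finset (Fin n)), R j)).re ≤ 0

namespace TensorModel

variable {n m : ℕ} {S : Set ℂ} (N : TensorModel n m S)

/-- `μ_α - μ_{α₀}`. -/
def muDiff (α : Set.powersetCard (Fin n) m) : ℂ :=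
  (∑ j ∈ (α : Finset (Fin n)), N.μ j) - ∑ j ∈ (N.α₀ : Finset (Fin n)), N.μ j

/-- `R_α - R_{α₀}`. -/
def rDiff (α : Set.powersetCard (Fin n) m) : ℂ :=
  (∑ j ∈ (α : Finset (Fin n)), N.R j) - ∑ j ∈ (N.α₀ : Finset (Fin n)), N.R j

theorem muDiff_self : N.muDiff N.α₀ = 0 := sub_self _

/-- The fundamental matrix `c(ξ)`. -/
def cmat (ξ : ℂ) : Matrix (Fin n) (Fin n) ℂ :=
  N.chat ξ * Matrix.diagonal fun j => Complex.exp (N.μ j * N.ℓ ξ)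

/-- The inverse of the fundamental matrix `c(ξ)`. -/
def cinv (ξ : ℂ) : Matrix (Fin n) (Fin n) ℂ :=
  (Matrix.diagonal fun j => Complex.exp (-(N.μ j * N.ℓ ξ))) * (N.chat ξ).adjugate

/-- The quotient of the weight by `ξ^{μ_{α₀}}`, extended by continuity to the origin. -/
def omega (ξ : ℂ) : ℂ :=
  if ξ = 0 then 1 else w N ξ / Complex.exp ((∑ j ∈ (N.α₀ : Finset (Fin n)), N.μ j) * N.ℓ ξ)

theorem omega_ne_zero {ξ : ℂ} (hξ : ξ ∈ closure S) : N.omega ξ ≠ 0 := by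
  unfold omega
  split_ifs with h
  · exact one_ne_zero
  · exact div_ne_zero (N.w_ne_zero ξ ⟨hξ, h⟩) (Complex.exp_ne_zero _)

theorem continuousOn_omega : ContinuousOn N.omega (closure S) := by
  intro ξ hξ
  by_cases h : ξ = 0
  · subst h
    have h0 : N.omega 0 = 1 := if_pos rfl
    rw [← continuousWithinAt_sdiff_self, ContinuousWithinAt, h0]
    refine N.w_zero.congr' ?_
    filter_upwards [self_mem_nhdsWithin] with ζ hζ
    exact (if_neg hζ.2).symm
  · have h1 : ContinuousWithinAt (fun ξ => w N ξ /
        Complex.exp ((∑ j ∈ (N.α₀ : Finset (Fin n)), N.μ j) * N.ℓ ξ)) (closure S \ {0}) ξ :=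
      (N.w_continuousOn ξ ⟨hξ, h⟩).div
        ((continuousWithinAt_const.mul (N.logBranch.continuousOn ξ ⟨hξ, h⟩)).cexp)
        (Complex.exp_ne_zero _)
    have h2 : ContinuousWithinAt N.omega (closure S \ {0}) ξ :=
      h1.congr (fun ζ hζ => if_neg hζ.2) (if_neg h)
    refine h2.mono_of_mem_nhdsWithin ?_
    exact inter_mem self_mem_nhdsWithin
      (mem_nhdsWithin_of_mem_nhds (isOpen_compl_singleton.mem_nhds h))

theorem chat_adj {ξ : ℂ} (hξ : ξ ∈ closure S) :
    N.chat ξ * (N.chat ξ).adjugate = 1 ∧ (N.chat ξ).adjugate * N.chat ξ = 1 := by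
  rw [Matrix.mul_adjugate, Matrix.adjugate_mul, N.chat_det ξ hξ, one_smul]
  exact ⟨rfl, rfl⟩

theorem diag_mul_diag (a : Fin n → ℂ) :
    (Matrix.diagonal fun j => Complex.exp (a j)) *
      (Matrix.diagonal fun j => Complex.exp (-(a j))) = 1 := by
  rw [Matrix.diagonal_mul_diagonal, ← Matrix.diagonal_one]
  congr 1
  funext j
  rw [← Complex.exp_add]
  simp

theorem diag_mul_diag' (a : Fin n → ℂ) :
    (Matrix.diagonal fun j => Complex.exp (-(a j))) *
      (Matrix.diagonal fun j => Complex.exp (a j)) = 1 := by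
  rw [Matrix.diagonal_mul_diagonal, ← Matrix.diagonal_one]
  congr 1
  funext j
  rw [← Complex.exp_add]
  simp

theorem cmat_mul_cinv {ξ : ℂ} (hξ : ξ ∈ closure S) : N.cmat ξ * N.cinv ξ = 1 := by
  rw [cmat, cinv, Matrix.mul_assoc, ← Matrix.mul_assoc (Matrix.diagonal _), diag_mul_diag,
    Matrix.one_mul, (N.chat_adj hξ).1]

theorem cinv_mul_cmat {ξ : ℂ} (hξ : ξ ∈ closure S) : N.cinv ξ * N.cmat ξ = 1 :=
  mul_eq_one_comm.1 (N.cmat_mul_cinv hξ)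

theorem trans'_mul : N.trans' * N.trans = 1 := mul_eq_one_comm.1 N.trans_mul

/-- The operator `e_α ↦ exp(ζ (R_α - R_{α₀})) e_α`. -/
def expOp (ζ : ℂ) : Tensor n m →L[ℂ] Tensor n m := diagOp fun α => Complex.exp (ζ * N.rDiff α)

theorem expOp_add (ζ ζ' : ℂ) : N.expOp (ζ + ζ') = N.expOp ζ * N.expOp ζ' := by
  rw [expOp, expOp, expOp, ← diagOp_mul]
  congr 1
  funext α
  rw [Pi.mul_apply, ← Complex.exp_add]
  ring_nf

theorem compound_diagonal_exp (a : Fin n → ℂ) (s : ℂ) :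
    compound m (Matrix.diagonal fun j => Complex.exp (s * a j)) =
      diagOp fun α => Complex.exp (s * ∑ j ∈ (α : Finset (Fin n)), a j) := by
  rw [compound_diagonal]
  congr 1
  funext α
  rw [← Complex.exp_sum, Finset.mul_sum]

theorem compound_diagonal_exp' (a : Fin n → ℂ) (s : ℂ) :
    compound m (Matrix.diagonal fun j => Complex.exp (a j * s)) =
      diagOp fun α => Complex.exp ((∑ j ∈ (α : Finset (Fin n)), a j) * s) := by
  simp only [mul_comm _ s]
  exact compound_diagonal_exp a s

/-- `H(ξ) = w(ξ)⁻¹ ∧^m c(ξ)`. At the origin it is the limit for the component `α₀` and zero for the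
others, for which `H v₀` is continuous. -/
def hop (ξ : ℂ) : Tensor n m →L[ℂ] Tensor n m :=
  if ξ = 0 then compound m (N.chat 0) * diagOp (Pi.single N.α₀ 1)
  else (w N ξ)⁻¹ • compound m (N.cmat ξ)

/-- `w(ξ) ∧^m c(ξ)⁻¹`. -/
def hinv (ξ : ℂ) : Tensor n m →L[ℂ] Tensor n m := w N ξ • compound m (N.cinv ξ)

theorem hop_eq {ξ : ℂ} (h : ξ ≠ 0) : N.hop ξ = (N.omega ξ)⁻¹ •
    (compound m (N.chat ξ) * diagOp fun α => Complex.exp (N.muDiff α * N.ℓ ξ)) := by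
  have h1 : (diagOp fun α => Complex.exp ((∑ j ∈ (α : Finset (Fin n)), N.μ j) * N.ℓ ξ) :
      Tensor n m →L[ℂ] Tensor n m) =
      Complex.exp ((∑ j ∈ (N.α₀ : Finset (Fin n)), N.μ j) * N.ℓ ξ) •
        diagOp fun α => Complex.exp (N.muDiff α * N.ℓ ξ) := by
    rw [← diagOp_smul]
    congr 1
    funext α
    rw [Pi.smul_apply, smul_eq_mul, ← Complex.exp_add, muDiff]
    congr 1
    ring
  rw [hop, if_neg h, cmat, compound_mul, compound_diagonal_exp', h1, omega, if_neg h, inv_div,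
    mul_smul_comm, smul_smul]
  congr 1
  rw [div_eq_mul_inv, mul_comm]

theorem hinv_eq {ξ : ℂ} (h : ξ ≠ 0) : N.hinv ξ = N.omega ξ •
    (diagOp (fun α => Complex.exp (-(N.muDiff α * N.ℓ ξ))) * compound m (N.chat ξ).adjugate) := by
  have h0 : (fun j => Complex.exp (-(N.μ j * N.ℓ ξ))) =
      fun j => Complex.exp (N.μ j * (-N.ℓ ξ)) := by simp
  have h1 : (diagOp fun α => Complex.exp ((∑ j ∈ (α : Finset (Fin n)), N.μ j) * (-N.ℓ ξ)) :
      Tensor n m →L[ℂ] Tensor n m) =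
      (Complex.exp ((∑ j ∈ (N.α₀ : Finset (Fin n)), N.μ j) * N.ℓ ξ))⁻¹ •
        diagOp fun α => Complex.exp (-(N.muDiff α * N.ℓ ξ)) := by
    rw [← diagOp_smul]
    congr 1
    funext α
    rw [Pi.smul_apply, smul_eq_mul, ← Complex.exp_neg, ← Complex.exp_add, muDiff]
    congr 1
    ring
  rw [hinv, cinv, compound_mul, h0, compound_diagonal_exp', h1, omega, if_neg h, smul_mul_assoc,
    smul_smul]
  rfl

theorem hinv_mul_hop {ξ : ℂ} (hξ : ξ ∈ closure S \ {0}) : N.hinv ξ * N.hop ξ = 1 := by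
  rw [hinv, hop, if_neg (show ¬ ξ = 0 from hξ.2), smul_mul_smul_comm, ← compound_mul, N.cinv_mul_cmat hξ.1,
    compound_one, mul_inv_cancel₀ (N.w_ne_zero ξ hξ), one_smul]

/-- The inverse of `ehat`. -/
def einv (ξ : ℂ) : Matrix (Fin n) (Fin n) ℂ := N.d⁻¹ • (N.ehat ξ).adjugate

theorem einv_mul_ehat {ξ : ℂ} (hξ : ξ ∈ closure S \ {0}) : N.einv ξ * N.ehat ξ = 1 := by
  rw [einv, Matrix.smul_mul, Matrix.adjugate_mul, N.ehat_det ξ hξ, smul_smul,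
    inv_mul_cancel₀ N.d_ne_zero, one_smul]

theorem ehat_mul_einv {ξ : ℂ} (hξ : ξ ∈ closure S \ {0}) : N.ehat ξ * N.einv ξ = 1 :=
  mul_eq_one_comm.1 (N.einv_mul_ehat hξ)

theorem cmat_eq {ξ : ℂ} (hξ : ξ ∈ closure S \ {0}) :
    N.cmat ξ = N.ehat ξ * (Matrix.diagonal fun j => Complex.exp (ξ * N.R j)) * N.trans' := by
  rw [← N.ehat_eq ξ hξ, Matrix.mul_assoc _ N.trans, N.trans_mul, Matrix.mul_one]
  rfl

theorem cinv_eq {ξ : ℂ} (hξ : ξ ∈ closure S \ {0}) :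
    N.cinv ξ = N.trans * (Matrix.diagonal fun j => Complex.exp (-(ξ * N.R j))) * N.einv ξ := by
  have h1 : N.cmat ξ * (N.trans * (Matrix.diagonal fun j => Complex.exp (-(ξ * N.R j))) *
      N.einv ξ) = 1 := by
    rw [N.cmat_eq hξ]
    calc _ = N.ehat ξ * ((Matrix.diagonal fun j => Complex.exp (ξ * N.R j)) *
          (N.trans' * N.trans) * Matrix.diagonal fun j => Complex.exp (-(ξ * N.R j))) *
          N.einv ξ := by simp only [Matrix.mul_assoc]
      _ = 1 := by
        rw [N.trans'_mul, Matrix.mul_one, diag_mul_diag, Matrix.mul_one, N.ehat_mul_einv hξ]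
  calc N.cinv ξ = N.cinv ξ * (N.cmat ξ * (N.trans *
        (Matrix.diagonal fun j => Complex.exp (-(ξ * N.R j))) * N.einv ξ)) := by
          rw [h1, Matrix.mul_one]
    _ = _ := by rw [← Matrix.mul_assoc, N.cinv_mul_cmat hξ.1, Matrix.one_mul]

theorem ne_zero_of_one_lt {ξ : ℂ} (hξ : ξ ∈ closure S) (h : 1 < ‖ξ‖) : ξ ∈ closure S \ {0} :=
  ⟨hξ, fun h0 => by rw [mem_singleton_iff.1 h0, norm_zero] at h; linarith⟩

theorem hop_eq_expOp {ξ : ℂ} (hξ : ξ ∈ closure S) (h : 1 < ‖ξ‖) :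
    N.hop ξ = compound m (N.ehat ξ) * N.expOp ξ * compound m N.trans' := by
  have h0 := ne_zero_of_one_lt hξ h
  have h1 : (diagOp fun α => Complex.exp (ξ * ∑ j ∈ (α : Finset (Fin n)), N.R j) :
      Tensor n m →L[ℂ] Tensor n m) = w N ξ • N.expOp ξ := by
    rw [expOp, ← diagOp_smul, N.w_infty ξ hξ h]
    congr 1
    funext α
    rw [Pi.smul_apply, smul_eq_mul, ← Complex.exp_add, rDiff]
    congr 1
    ring
  rw [hop, if_neg (show ¬ ξ = 0 from h0.2), N.cmat_eq h0, compound_mul, compound_mul, compound_diagonal_exp, h1,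
    mul_smul_comm, smul_mul_assoc, smul_smul, inv_mul_cancel₀ (N.w_ne_zero ξ h0), one_smul]

theorem hinv_eq_expOp {ξ : ℂ} (hξ : ξ ∈ closure S) (h : 1 < ‖ξ‖) :
    N.hinv ξ = compound m N.trans * N.expOp (-ξ) * compound m (N.einv ξ) := by
  have h0 := ne_zero_of_one_lt hξ h
  have h2 : (fun j => Complex.exp (-(ξ * N.R j))) = fun j => Complex.exp (-ξ * N.R j) := by simp
  have h1 : w N ξ • (diagOp fun α => Complex.exp (-ξ * ∑ j ∈ (α : Finset (Fin n)), N.R j) :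
      Tensor n m →L[ℂ] Tensor n m) = N.expOp (-ξ) := by
    rw [expOp, ← diagOp_smul, N.w_infty ξ hξ h]
    congr 1
    funext α
    rw [Pi.smul_apply, smul_eq_mul, ← Complex.exp_add, rDiff]
    congr 1
    ring
  rw [hinv, N.cinv_eq h0, compound_mul, compound_mul, h2, compound_diagonal_exp, ← h1,
    mul_smul_comm, smul_mul_assoc]

/-- The kernel of the Volterra equation for the remainder: the Green kernel times the quotient of
the weights, written in a form that makes sense for `ρ = 0` and `x = 0`. On the Volterra set the
quotient `min(x,t) / max(x,t)` is `t / x` for `ε = 1` and `x / t` for `ε = -1`, so the power is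
`(x / t) ^ (μ_α - μ_{α₀})` in either case. -/
def kernel (x : ℝ≥0) (t : ℝ) (ρ : closure S) : Tensor n m →L[ℂ] Tensor n m :=
  (N.omega (ρ * t) / N.omega (ρ * (x : ℝ))) •
    (compound m (N.chat (ρ * (x : ℝ))) *
      diagOp (fun α => ((min (x : ℝ) t / max (x : ℝ) t : ℝ) : ℂ) ^ (-N.ε * N.muDiff α)) *
      compound m (N.chat (ρ * t)).adjugate)

theorem mul_mem (N : TensorModel n m S) {ρ : ℂ} (hρ : ρ ∈ closure S) {r : ℝ} (hr : 0 ≤ r) : ρ * r ∈ closure S := by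
  rcases hr.eq_or_lt with rfl | hr
  · simpa using zero_mem_closure N.sector hρ
  · rw [mul_comm]
    exact N.sector.smul_mem_closure hr hρ

theorem mul_mem' (N : TensorModel n m S) {ρ : ℂ} (hρ : ρ ∈ closure S) (h0 : ρ ≠ 0) {r : ℝ} (hr : 0 < r) :
    ρ * r ∈ closure S \ {0} :=
  ⟨N.mul_mem hρ hr.le, mul_ne_zero h0 (by exact_mod_cast hr.ne')⟩

theorem re_exponent_pos {α : Set.powersetCard (Fin n) m} (h : α ≠ N.α₀) :
    0 < (-(N.ε : ℂ) * N.muDiff α).re := by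
  have := N.μ_order α h
  simp only [Complex.mul_re, Complex.neg_re, Complex.ofReal_re, Complex.neg_im,
    Complex.ofReal_im, neg_zero, zero_mul, sub_zero, muDiff]
  linarith

theorem kernel_eq {x : ℝ≥0} {t : ℝ} {ρ : closure S} (ht : t ∈ volterraSet N.ε x)
    (hρ : (ρ : ℂ) ≠ 0) : N.kernel x t ρ = N.hop (ρ * (x : ℝ)) * N.hinv (ρ * t) := by
  have ht0 : 0 < t := ht.1
  have hτ := N.mul_mem' ρ.2 hρ ht0
  rcases eq_or_lt_of_le (NNReal.coe_nonneg x) with hx | hx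
  · -- `x = 0`: only the component `α₀` survives
    have hx' : (x : ℝ) = 0 := hx.symm
    have h1 : (fun α => ((min (x : ℝ) t / max (x : ℝ) t : ℝ) : ℂ) ^ (-N.ε * N.muDiff α)) =
        Pi.single N.α₀ 1 := by
      funext α
      rw [hx', min_eq_left ht0.le, zero_div, Complex.ofReal_zero]
      by_cases hα : α = N.α₀
      · subst hα
        rw [muDiff_self]
        simp
      · rw [Pi.single_eq_of_ne hα, Complex.zero_cpow]
        intro h
        have := N.re_exponent_pos hα
        rw [h] at this
        simp at this
    have h2 : diagOp (Pi.single N.α₀ 1) * diagOp (fun α =>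
        Complex.exp (-(N.muDiff α * N.ℓ (ρ * t)))) =
        (diagOp (Pi.single N.α₀ 1) : Tensor n m →L[ℂ] Tensor n m) := by
      rw [← diagOp_mul]
      congr 1
      funext α
      by_cases hα : α = N.α₀
      · subst hα
        simp [muDiff_self]
      · simp [hα]
    rw [kernel, h1, hx', Complex.ofReal_zero, mul_zero, hop, if_pos rfl, N.hinv_eq hτ.2,
      mul_smul_comm]
    have h3 : N.omega 0 = 1 := if_pos rfl
    rw [h3, div_one, mul_assoc, mul_assoc, ← mul_assoc (diagOp (Pi.single N.α₀ 1)), h2]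
  · have hξ := N.mul_mem' ρ.2 hρ hx
    have hlog : ∀ {r : ℝ}, 0 < r → N.ℓ (ρ * r) = Real.log r + N.ℓ ρ := fun hr => by
      rw [mul_comm]
      exact N.logBranch.ofReal_mul N.sector hr ⟨ρ.2, hρ⟩
    rw [N.hop_eq hξ.2, N.hinv_eq hτ.2, smul_mul_smul_comm, kernel, div_eq_inv_mul, mul_assoc,
      mul_assoc, ← mul_assoc (diagOp _) (diagOp _), ← diagOp_mul]
    congr 4
    funext α
    rw [Pi.mul_apply, ← Complex.exp_add, hlog hx, hlog ht0]
    have hpos : 0 < min (x : ℝ) t / max (x : ℝ) t := div_pos (lt_min hx ht0) (lt_max_of_lt_left hx)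
    rw [Complex.cpow_def_of_ne_zero (by exact_mod_cast hpos.ne'), ← Complex.ofReal_log hpos.le]
    congr 1
    rcases N.sign with h | h
    · have hlt : t < x := by simpa [h] using ht.2
      rw [min_eq_right hlt.le, max_eq_left hlt.le, Real.log_div ht0.ne' hx.ne', h]
      push_cast
      ring
    · have hlt : (x : ℝ) < t := by simpa [h] using ht.2
      rw [min_eq_left hlt.le, max_eq_right hlt.le, Real.log_div hx.ne' ht0.ne', h]
      push_cast
      ring

end TensorModel

/-! ### Boundedness and continuity of the kernel -/

theorem diagOp_apply_eq_sum {n m : ℕ} (d : Set.powersetCard (Fin n) m → ℂ) (f : Tensor n m) :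
    diagOp d f = ∑ α, (d α * (tensorBasis n m).repr f α) • tensorBasis n m α := by
  conv_lhs => rw [← (tensorBasis n m).sum_repr f]
  simp only [map_sum, map_smul, diagOp_basis, smul_smul]
  exact Finset.sum_congr rfl fun α _ => by rw [mul_comm]

theorem norm_ofReal_cpow_le_one {u : ℝ} (h0 : 0 ≤ u) (h1 : u ≤ 1) {z : ℂ} (hz : 0 ≤ z.re) :
    ‖(u : ℂ) ^ z‖ ≤ 1 := by
  rcases h0.eq_or_lt with rfl | h
  · by_cases h : z = 0
    · simp [h]
    · rw [Complex.ofReal_zero, Complex.zero_cpow h]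
      simp
  · rw [Complex.norm_cpow_eq_rpow_re_of_pos h]
    exact Real.rpow_le_one h0 h1 hz

theorem exists_bound_of_entries_le {n : ℕ} {E : Type*} [NormedAddCommGroup E]
    {f : Matrix (Fin n) (Fin n) ℂ → E} (hf : Continuous f) (K : ℝ) :
    ∃ L : ℝ, 0 ≤ L ∧ ∀ X : Matrix (Fin n) (Fin n) ℂ, (∀ i j, ‖X i j‖ ≤ K) → ‖f X‖ ≤ L := by
  have hc : IsCompact (Set.pi univ fun _ : Fin n => Set.pi univ fun _ : Fin n =>
      Metric.closedBall (0 : ℂ) K) :=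
    isCompact_univ_pi fun _ => isCompact_univ_pi fun _ => isCompact_closedBall _ _
  have hf' : Continuous fun X : Fin n → Fin n → ℂ => f (Matrix.of X) := hf
  obtain ⟨L, hL⟩ := hc.exists_bound_of_continuousOn hf'.continuousOn
  refine ⟨max L 0, le_max_right _ _, fun X hX => le_max_of_le_left ?_⟩
  exact hL X fun i _ j _ => by simpa using hX i j

namespace TensorModel

variable {n m : ℕ} {S : Set ℂ} (N : TensorModel n m S)

/-- The permutation matrix `(𝔣₁, …, 𝔣_n)`, the limit of `ehat` at infinity. -/
def perm : Matrix (Fin n) (Fin n) ℂ := colMatrix fun k => Pi.single (N.σ k) 1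

theorem perm_apply (i j : Fin n) : N.perm i j = if i = N.σ j then 1 else 0 := by
  simp [perm, colMatrix, Pi.single_apply]

theorem norm_perm_le (i j : Fin n) : ‖N.perm i j‖ ≤ 1 := by
  rw [perm_apply]
  split_ifs <;> simp

theorem perm_transpose_mul : N.permᵀ * N.perm = 1 := by
  ext i j
  simp only [Matrix.mul_apply, Matrix.transpose_apply, perm_apply, Matrix.one_apply]
  simp [eq_comm]

theorem perm_mul_transpose : N.perm * N.permᵀ = 1 := mul_eq_one_comm.1 N.perm_transpose_mul

theorem norm_ehat_le {ξ : ℂ} (hξ : ξ ∈ closure S) (h : 1 ≤ ‖ξ‖) (i j : Fin n) :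
    ‖N.ehat ξ i j‖ ≤ 1 + |N.K| := by
  have h1 := N.ehat_sub_le ξ hξ h i j
  have h2 : N.K * ‖ξ‖⁻¹ ≤ |N.K| := by
    have h3 : ‖ξ‖⁻¹ ≤ 1 := inv_le_one_of_one_le₀ h
    have h4 : 0 ≤ ‖ξ‖⁻¹ := by positivity
    calc N.K * ‖ξ‖⁻¹ ≤ |N.K| * ‖ξ‖⁻¹ := by gcongr; exact le_abs_self _
      _ ≤ |N.K| := mul_le_of_le_one_right (abs_nonneg _) h3
  have h3 := norm_add_le (N.perm i j) (N.ehat ξ i j - N.perm i j)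
  rw [add_sub_cancel] at h3
  have h4 := N.norm_perm_le i j
  have h5 : ‖N.ehat ξ i j - N.perm i j‖ ≤ N.K * ‖ξ‖⁻¹ := h1
  linarith

/-- Bounds at infinity for the compounds of `ehat` and its inverse, with the rate of convergence
to the permutation matrix. -/
theorem exists_ehat_bound : ∃ L : ℝ, 0 ≤ L ∧ ‖compound m N.permᵀ‖ ≤ L ∧ ‖compound m N.perm‖ ≤ L ∧
    ∀ ξ ∈ closure S, 1 ≤ ‖ξ‖ →
      ‖compound m (N.ehat ξ)‖ ≤ L ∧ ‖compound m (N.einv ξ)‖ ≤ L ∧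
      ‖compound m (N.ehat ξ) - compound m N.perm‖ ≤ L * ‖ξ‖⁻¹ := by
  obtain ⟨L₁, hL₁, h1, h2⟩ := exists_compound_bound n m (1 + |N.K|)
  have hadj₀ : Continuous fun X : Matrix (Fin n) (Fin n) ℂ => N.d⁻¹ • X.adjugate := by
    have h : Continuous fun X : Matrix (Fin n) (Fin n) ℂ => X.adjugate :=
      continuous_id.matrix_adjugate
    fun_prop
  have hadj : Continuous fun X : Matrix (Fin n) (Fin n) ℂ =>
      compound m (N.d⁻¹ • X.adjugate) :=
    continuous_compound.comp hadj₀
  obtain ⟨L₂, hL₂, h3⟩ := exists_bound_of_entries_le hadj (1 + |N.K|)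
  have hperm : ∀ i j, ‖N.perm i j‖ ≤ 1 + |N.K| := fun i j =>
    (N.norm_perm_le i j).trans (by linarith [abs_nonneg N.K])
  refine ⟨L₁ + L₂ + L₁ * |N.K|, by positivity, ?_, ?_, fun ξ hξ h => ⟨?_, ?_, ?_⟩⟩
  · have := h1 N.permᵀ (fun i j => hperm j i)
    have : 0 ≤ L₁ * |N.K| := by positivity
    linarith
  · have := h1 N.perm hperm
    have : 0 ≤ L₁ * |N.K| := by positivity
    linarith
  · have := h1 _ (N.norm_ehat_le hξ h)
    have : 0 ≤ L₁ * |N.K| := by positivity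
    linarith
  · have h4 := h3 _ (N.norm_ehat_le hξ h)
    have : 0 ≤ L₁ * |N.K| := by positivity
    have h5 : ‖compound m (N.einv ξ)‖ ≤ L₂ := h4
    linarith
  · have h0 : 0 ≤ ‖ξ‖⁻¹ := by positivity
    have h4 := h2 _ _ (N.norm_ehat_le hξ h) hperm (|N.K| * ‖ξ‖⁻¹) (by positivity) fun i j =>
      (N.ehat_sub_le ξ hξ h i j).trans (by gcongr; exact le_abs_self _)
    refine h4.trans ?_
    rw [← mul_assoc]
    gcongr
    linarith

theorem norm_expOp_apply_le {ζ : ℂ} {f : Tensor n m} (h : ∀ α, (tensorBasis n m).repr f α = 0 ∨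
    (ζ * N.rDiff α).re ≤ 0) : ‖N.expOp ζ f‖ ≤ ‖f‖ := by
  have := norm_diagOp_apply_le (d := fun α => Complex.exp (ζ * N.rDiff α)) (K := 1) (f := f)
    fun α => (h α).imp id fun h => by
      rw [Complex.norm_exp]
      exact Real.exp_le_one_iff.2 h
  rwa [one_mul] at this

theorem norm_expOp_le {ζ : ℂ} (h : ∀ α, (ζ * N.rDiff α).re ≤ 0) : ‖N.expOp ζ‖ ≤ 1 :=
  ContinuousLinearMap.opNorm_le_bound _ zero_le_one fun f => by
    rw [one_mul]
    exact N.norm_expOp_apply_le fun α => Or.inr (h α)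

theorem re_sub_le {x : ℝ} {t : ℝ} {ρ : ℂ} (hρ : ρ ∈ closure S) (ht : N.ε * t < N.ε * x)
    (α : Set.powersetCard (Fin n) m) : ((ρ * x - ρ * t) * N.rDiff α).re ≤ 0 := by
  have h1 : N.ε * (ρ * N.rDiff α).re ≤ 0 := N.R_order ρ hρ α
  have h2 : (ρ * x - ρ * t) * N.rDiff α = ((x - t : ℝ) : ℂ) * (ρ * N.rDiff α) := by
    push_cast
    ring
  rw [h2, Complex.re_ofReal_mul]
  rcases N.sign with h | h <;> rw [h] at h1 ht <;> nlinarith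

theorem hop_mul_hinv_eq {ξ τ : ℂ} (hξ : ξ ∈ closure S) (h1 : 1 < ‖ξ‖) (hτ : τ ∈ closure S)
    (h2 : 1 < ‖τ‖) : N.hop ξ * N.hinv τ =
      compound m (N.ehat ξ) * N.expOp (ξ - τ) * compound m (N.einv τ) := by
  rw [N.hop_eq_expOp hξ h1, N.hinv_eq_expOp hτ h2]
  calc _ = compound m (N.ehat ξ) * N.expOp ξ * (compound m N.trans' * compound m N.trans) *
        N.expOp (-τ) * compound m (N.einv τ) := by simp only [mul_assoc]
    _ = _ := by
      rw [← compound_mul, N.trans'_mul, compound_one, mul_one, sub_eq_add_neg, N.expOp_add]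
      simp only [mul_assoc]

theorem isCompact_small : IsCompact (closure S ∩ Metric.closedBall 0 2) :=
  (isCompact_closedBall _ _).inter_left isClosed_closure

/-- Near the origin the powers of `min(x,t) / max(x,t)` have exponents with nonnegative real part. -/
theorem exists_kernel_bound_small : ∃ C : ℝ, 0 ≤ C ∧ ∀ (x : ℝ≥0) (t : ℝ) (ρ : closure S), 0 < t →
    ‖(ρ : ℂ) * (x : ℝ)‖ ≤ 2 → ‖(ρ : ℂ) * t‖ ≤ 2 → ‖N.kernel x t ρ‖ ≤ C := by
  have hK := isCompact_small (S := S)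
  have hsub : closure S ∩ Metric.closedBall 0 2 ⊆ closure S := inter_subset_left
  obtain ⟨C₁, h1⟩ := hK.exists_bound_of_continuousOn (N.continuousOn_omega.mono hsub)
  obtain ⟨C₂, h2⟩ := hK.exists_bound_of_continuousOn
    ((N.continuousOn_omega.inv₀ fun ξ hξ => N.omega_ne_zero hξ).mono hsub)
  obtain ⟨C₃, h3⟩ := hK.exists_bound_of_continuousOn
    ((continuous_compound (m := m)).comp N.chat_continuous).continuousOn
  obtain ⟨C₄, h4⟩ := hK.exists_bound_of_continuousOn
    ((continuous_compound (m := m)).comp N.chat_continuous.matrix_adjugate).continuousOn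
  refine ⟨|C₁| * |C₂| * (|C₃| * 1 * |C₄|), by positivity, fun x t ρ ht hx hτ => ?_⟩
  have hξm : (ρ : ℂ) * (x : ℝ) ∈ closure S ∩ Metric.closedBall 0 2 :=
    ⟨N.mul_mem ρ.2 x.2, by simpa using hx⟩
  have hτm : (ρ : ℂ) * t ∈ closure S ∩ Metric.closedBall 0 2 :=
    ⟨N.mul_mem ρ.2 ht.le, by simpa using hτ⟩
  have hx0 : (0 : ℝ) ≤ x := x.2
  have hd : ‖(diagOp (fun α => ((min (x : ℝ) t / max (x : ℝ) t : ℝ) : ℂ) ^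
      (-N.ε * N.muDiff α)) : Tensor n m →L[ℂ] Tensor n m)‖ ≤ 1 := by
    refine norm_diagOp_le zero_le_one fun α => norm_ofReal_cpow_le_one (by positivity) ?_ ?_
    · exact div_le_one_of_le₀ (min_le_max) (by positivity)
    · by_cases hα : α = N.α₀
      · simp [hα, muDiff_self]
      · exact (N.re_exponent_pos hα).le
  rw [kernel, norm_smul, norm_div, div_eq_mul_inv, ← norm_inv]
  refine mul_le_mul (mul_le_mul ((h1 _ hτm).trans (le_abs_self _))
    ((h2 _ hξm).trans (le_abs_self _)) (norm_nonneg _) (abs_nonneg _)) ?_ (norm_nonneg _)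
    (by positivity)
  refine (norm_mul_le _ _).trans (mul_le_mul ((norm_mul_le _ _).trans (mul_le_mul
    ((h3 _ hξm).trans (le_abs_self _)) hd (norm_nonneg _) (abs_nonneg _)))
    ((h4 _ hτm).trans (le_abs_self _)) (norm_nonneg _) (by positivity))

/-- At infinity the exponentials `exp((ρx - ρt)(R_α - R_{α₀}))` are bounded on the Volterra set. -/
theorem exists_kernel_bound_large : ∃ C : ℝ, 0 ≤ C ∧ ∀ (x : ℝ≥0) (t : ℝ) (ρ : closure S),
    t ∈ volterraSet N.ε x → 1 < ‖(ρ : ℂ) * (x : ℝ)‖ → 1 < ‖(ρ : ℂ) * t‖ →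
      ‖N.kernel x t ρ‖ ≤ C := by
  obtain ⟨L, hL, -, -, hb⟩ := N.exists_ehat_bound
  refine ⟨L * 1 * L, by positivity, fun x t ρ ht hx hτ => ?_⟩
  have hρ : (ρ : ℂ) ≠ 0 := fun h => by rw [h, zero_mul, norm_zero] at hx; linarith
  have hξm := N.mul_mem ρ.2 (NNReal.coe_nonneg x)
  have hτm := N.mul_mem ρ.2 ht.1.le
  rw [N.kernel_eq ht hρ, N.hop_mul_hinv_eq hξm hx hτm hτ]
  exact (norm_mul_le _ _).trans (mul_le_mul ((norm_mul_le _ _).trans (mul_le_mul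
    (hb _ hξm hx.le).1 (N.norm_expOp_le fun α => N.re_sub_le ρ.2 ht.2 α) (norm_nonneg _) hL))
    (hb _ hτm hτ.le).2.1 (norm_nonneg _) (by positivity))

/-- The kernel is multiplicative, being a quotient of values of `H`. -/
theorem kernel_mul {x s : ℝ≥0} {t : ℝ} {ρ : closure S} (hρ : (ρ : ℂ) ≠ 0)
    (hs : (s : ℝ) ∈ volterraSet N.ε x) (ht : t ∈ volterraSet N.ε s) :
    N.kernel x t ρ = N.kernel x s ρ * N.kernel s t ρ := by
  have ht' : t ∈ volterraSet N.ε x := ⟨ht.1, ht.2.trans hs.2⟩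
  rw [N.kernel_eq ht' hρ, N.kernel_eq hs hρ, N.kernel_eq ht hρ, mul_assoc, ← mul_assoc (N.hinv _),
    N.hinv_mul_hop (N.mul_mem' ρ.2 hρ hs.1), one_mul]

theorem exists_kernel_bound : ∃ C : ℝ, 0 < C ∧ ∀ (x : ℝ≥0) (t : ℝ) (ρ : closure S),
    t ∈ volterraSet N.ε x → ‖N.kernel x t ρ‖ ≤ C := by
  obtain ⟨C₁, hC₁, h1⟩ := N.exists_kernel_bound_small
  obtain ⟨C₂, hC₂, h2⟩ := N.exists_kernel_bound_large
  refine ⟨1 + C₁ + C₂ + C₁ * C₂, by positivity, fun x t ρ ht => ?_⟩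
  have hpos : 0 ≤ C₁ * C₂ := by positivity
  by_cases hsm : ‖(ρ : ℂ) * (x : ℝ)‖ ≤ 2 ∧ ‖(ρ : ℂ) * t‖ ≤ 2
  · have := h1 x t ρ ht.1 hsm.1 hsm.2
    linarith
  by_cases hla : 1 < ‖(ρ : ℂ) * (x : ℝ)‖ ∧ 1 < ‖(ρ : ℂ) * t‖
  · have := h2 x t ρ ht hla.1 hla.2
    linarith
  -- otherwise pass through the point with `|ρ s| = 2`
  have hρ : (ρ : ℂ) ≠ 0 := fun h => hsm (by simp [h])
  have hρn : 0 < ‖(ρ : ℂ)‖ := norm_pos_iff.2 hρ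
  have hx0 : (0 : ℝ) ≤ x := x.2
  have ht0 : 0 < t := ht.1
  set s : ℝ≥0 := ⟨2 / ‖(ρ : ℂ)‖, by positivity⟩ with hs
  have hs' : (s : ℝ) = 2 / ‖(ρ : ℂ)‖ := rfl
  have hs0 : (0 : ℝ) < s := by rw [hs']; positivity
  have hns : ‖(ρ : ℂ) * (s : ℝ)‖ = 2 := by
    rw [norm_mul, Complex.norm_real, Real.norm_of_nonneg hs0.le, hs']
    field_simp
  have hnx : ‖(ρ : ℂ) * (x : ℝ)‖ = ‖(ρ : ℂ)‖ * x := by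
    rw [norm_mul, Complex.norm_real, Real.norm_of_nonneg hx0]
  have hnt : ‖(ρ : ℂ) * t‖ = ‖(ρ : ℂ)‖ * t := by
    rw [norm_mul, Complex.norm_real, Real.norm_of_nonneg ht0.le]
  have hns' : ‖(ρ : ℂ)‖ * s = 2 := by rw [hs']; field_simp
  rw [hnx, hnt] at hsm hla
  have hJ := ht.2
  rcases N.sign with hε | hε
  · have hlt : t < x := by simpa [hε] using ht.2
    have hlt' : ‖(ρ : ℂ)‖ * t < ‖(ρ : ℂ)‖ * x := mul_lt_mul_of_pos_left hlt hρn
    have hxl : 2 < ‖(ρ : ℂ)‖ * x := by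
      by_contra! h
      exact hsm ⟨h, hlt'.le.trans h⟩
    have htl : ‖(ρ : ℂ)‖ * t ≤ 1 := by
      by_contra! h
      exact hla ⟨h.trans hlt', h⟩
    have h3 : (s : ℝ) < x := by
      refine lt_of_mul_lt_mul_left ?_ hρn.le
      rw [hns']; exact hxl
    have h4 : t < s := by
      refine lt_of_mul_lt_mul_left ?_ hρn.le
      rw [hns']; linarith
    have hs1 : (s : ℝ) ∈ volterraSet N.ε x := ⟨hs0, by simpa [hε] using h3⟩
    have hs2 : t ∈ volterraSet N.ε s := ⟨ht0, by simpa [hε] using h4⟩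
    rw [N.kernel_mul hρ hs1 hs2]
    have h5 := h2 x s ρ hs1 (by rw [hnx]; linarith) (by rw [hns]; norm_num)
    have h6 := h1 s t ρ ht0 hns.le (by rw [hnt]; linarith)
    refine (norm_mul_le _ _).trans ((mul_le_mul h5 h6 (norm_nonneg _) hC₂).trans ?_)
    linarith
  · have hlt : (x : ℝ) < t := by simpa [hε] using ht.2
    have hlt' : ‖(ρ : ℂ)‖ * x < ‖(ρ : ℂ)‖ * t := mul_lt_mul_of_pos_left hlt hρn
    have htl : 2 < ‖(ρ : ℂ)‖ * t := by
      by_contra! h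
      exact hsm ⟨hlt'.le.trans h, h⟩
    have hxl : ‖(ρ : ℂ)‖ * x ≤ 1 := by
      by_contra! h
      exact hla ⟨h, h.trans hlt'⟩
    have h3 : (x : ℝ) < s := by
      refine lt_of_mul_lt_mul_left ?_ hρn.le
      rw [hns']; linarith
    have h4 : (s : ℝ) < t := by
      refine lt_of_mul_lt_mul_left ?_ hρn.le
      rw [hns']; exact htl
    have hs1 : (s : ℝ) ∈ volterraSet N.ε x := ⟨hs0, by simpa [hε] using h3⟩
    have hs2 : t ∈ volterraSet N.ε s := ⟨ht0, by simpa [hε] using h4⟩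
    rw [N.kernel_mul hρ hs1 hs2]
    have h5 := h1 x s ρ hs0 (by rw [hnx]; linarith) hns.le
    have h6 := h2 s t ρ hs2 (by rw [hns]; norm_num) (by rw [hnt]; linarith)
    refine (norm_mul_le _ _).trans ((mul_le_mul h5 h6 (norm_nonneg _) hC₁).trans ?_)
    linarith

theorem continuous_kernel_aux {Z : Type*} [TopologicalSpace Z] {z₀ : Z} {ξ τ : Z → closure S}
    {u : Z → ℝ} (hξ : ContinuousAt ξ z₀) (hτ : ContinuousAt τ z₀) (hu : ContinuousAt u z₀) :
    ContinuousAt (fun z => (N.omega (τ z) / N.omega (ξ z)) •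
      (compound m (N.chat (ξ z)) *
        (diagOp (fun α => ((u z : ℝ) : ℂ) ^ (-N.ε * N.muDiff α)) : Tensor n m →L[ℂ] Tensor n m) *
        compound m (N.chat (τ z)).adjugate)) z₀ := by
  have ho : Continuous fun ξ : closure S => N.omega ξ :=
    continuousOn_iff_continuous_domRestrict.1 N.continuousOn_omega
  have hch : Continuous fun ξ : closure S => compound m (N.chat ξ) :=
    (continuous_compound (m := m)).comp (N.chat_continuous.comp continuous_subtype_val)
  have hca : Continuous fun ξ : closure S => compound m (N.chat ξ).adjugate :=
    (continuous_compound (m := m)).comp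
      ((N.chat_continuous.comp continuous_subtype_val).matrix_adjugate)
  have hd : ContinuousAt (fun z => (diagOp (fun α => ((u z : ℝ) : ℂ) ^ (-N.ε * N.muDiff α)) :
      Tensor n m →L[ℂ] Tensor n m)) z₀ := by
    refine continuous_diagOp.continuousAt.comp (continuousAt_pi.2 fun α => ?_)
    by_cases hα : α = N.α₀
    · subst hα
      simp only [muDiff_self, mul_zero, Complex.cpow_zero]
      exact continuousAt_const
    · exact (Complex.continuousAt_ofReal_cpow_const (u z₀) _
        (Or.inl (N.re_exponent_pos hα))).comp hu
  have hq : ContinuousAt (fun z => N.omega (τ z) / N.omega (ξ z)) z₀ :=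
    (ho.continuousAt.comp hτ).div (ho.continuousAt.comp hξ) (N.omega_ne_zero (ξ z₀).2)
  exact hq.smul (((hch.continuousAt.comp hξ).mul hd).mul (hca.continuousAt.comp hτ))

theorem exists_isVolterraKernel : ∃ C : ℝ, IsVolterraKernel N.ε C N.kernel := by
  obtain ⟨C, hC, hb⟩ := N.exists_kernel_bound
  refine ⟨C, N.sign, hC, hb, fun x t ρ ht => ?_, fun x ρ t ht => ?_⟩
  · have ht0 : 0 < t := ht.1
    refine N.continuous_kernel_aux (z₀ := (x, ρ))
      (ξ := fun z : ℝ≥0 × closure S => ⟨z.2 * (z.1 : ℝ), N.mul_mem z.2.2 z.1.2⟩)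
      (τ := fun z : ℝ≥0 × closure S => ⟨z.2 * t, N.mul_mem z.2.2 ht0.le⟩)
      (u := fun z : ℝ≥0 × closure S => min (z.1 : ℝ) t / max (z.1 : ℝ) t) ?_ ?_ ?_
    · exact Continuous.continuousAt (by fun_prop)
    · exact Continuous.continuousAt (by fun_prop)
    · exact Continuous.continuousAt (Continuous.div (by fun_prop) (by fun_prop) fun z =>
        (lt_max_of_lt_right ht0).ne')
  · have ht0 : 0 < t := ht.1
    have hx0 : (0 : ℝ) ≤ x := x.2
    refine ContinuousAt.continuousWithinAt ?_
    have h1 := N.continuous_kernel_aux (z₀ := t)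
      (ξ := fun _ : ℝ => ⟨ρ * (x : ℝ), N.mul_mem ρ.2 x.2⟩)
      (τ := fun t : ℝ => ⟨ρ * (max t 0 : ℝ), N.mul_mem ρ.2 (le_max_right _ _)⟩)
      (u := fun t : ℝ => min (x : ℝ) t / max (x : ℝ) t) continuousAt_const
      (Continuous.continuousAt (by fun_prop)) (ContinuousAt.div (Continuous.continuousAt
        (by fun_prop)) (Continuous.continuousAt (by fun_prop)) (lt_max_of_lt_right ht0).ne')
    -- `max t 0` only serves to define the point `ρ t` of the closed sector for all real `t`
    refine h1.congr ?_
    filter_upwards [lt_mem_nhds ht0] with r hr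
    rw [kernel]
    simp only [max_eq_left (le_of_lt hr)]

/-! ### The free term -/

/-- The free term `H(ξ) v₀` of the Volterra equation for the remainder. -/
def free (ξ : ℂ) : Tensor n m := N.hop ξ N.v₀

theorem continuousOn_free : ContinuousOn N.free (closure S) := by
  intro ξ hξ
  by_cases h : ξ = 0
  · subst h
    have h0 : N.free 0 = (1 : ℂ) • compound m (N.chat 0) (∑ α,
        ((Pi.single N.α₀ 1 : Set.powersetCard (Fin n) m → ℂ) α *
          (tensorBasis n m).repr N.v₀ α) • tensorBasis n m α) := by
      rw [free, hop, if_pos rfl, mul_apply_eq_comp, diagOp_apply_eq_sum, one_smul]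
    rw [← continuousWithinAt_sdiff_self, ContinuousWithinAt, h0]
    have hev : (fun ξ => (N.omega ξ)⁻¹ • compound m (N.chat ξ) (∑ α,
        (Complex.exp (N.muDiff α * N.ℓ ξ) * (tensorBasis n m).repr N.v₀ α) •
          tensorBasis n m α)) =ᶠ[𝓝[closure S \ {0}] 0] N.free := by
      filter_upwards [self_mem_nhdsWithin] with ζ hζ
      rw [free, N.hop_eq hζ.2, ← diagOp_apply_eq_sum]
      rfl
    refine Tendsto.congr' hev ?_
    have ho : Tendsto (fun ξ => (N.omega ξ)⁻¹) (𝓝[closure S \ {0}] 0) (𝓝 1) := by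
      have h1 : Tendsto (fun ξ => (N.omega ξ)⁻¹) (𝓝[closure S \ {0}] 0) (𝓝 (N.omega 0)⁻¹) :=
        ((N.continuousOn_omega 0 hξ).mono sdiff_subset).tendsto.inv₀ (N.omega_ne_zero hξ)
      have h2 : N.omega 0 = 1 := if_pos rfl
      rwa [h2, inv_one] at h1
    have hch : Tendsto (fun ξ => compound m (N.chat ξ)) (𝓝[closure S \ {0}] 0)
        (𝓝 (compound m (N.chat 0))) :=
      (((continuous_compound (m := m)).comp N.chat_continuous).tendsto 0).mono_left
        nhdsWithin_le_nhds
    have happ : ∀ {g : ℂ → Tensor n m} {y : Tensor n m}, Tendsto g (𝓝[closure S \ {0}] 0) (𝓝 y) →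
        Tendsto (fun ξ => compound m (N.chat ξ) (g ξ)) (𝓝[closure S \ {0}] 0)
          (𝓝 (compound m (N.chat 0) y)) := fun hg =>
      ((isBoundedBilinearMap_apply (𝕜 := ℂ) (E := Tensor n m)
        (F := Tensor n m)).continuous.tendsto (_, _)).comp (hch.prodMk_nhds hg)
    refine ho.smul (happ (tendsto_finsetSum _ fun α _ => Tendsto.smul_const ?_ _))
    by_cases hα : α = N.α₀
    · subst hα
      simp only [muDiff_self, zero_mul, Complex.exp_zero, Pi.single_eq_same]
      exact tendsto_const_nhds
    · rw [Pi.single_eq_of_ne hα, zero_mul]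
      rcases N.v₀_zero with hε | hv
      · have h1 := N.re_exponent_pos hα
        rw [hε] at h1
        have h2 := (tendsto_power N.sector N.logBranch (μ := N.muDiff α) (by simpa using h1))
        simpa using h2.mul_const ((tensorBasis n m).repr N.v₀ α)
      · simp only [hv α hα, mul_zero]
        exact tendsto_const_nhds
  · have h1 : ContinuousWithinAt (fun ξ => (w N ξ)⁻¹ • compound m (N.cmat ξ) N.v₀)
        (closure S \ {0}) ξ := by
      refine ((N.w_continuousOn ξ ⟨hξ, h⟩).inv₀ (N.w_ne_zero ξ ⟨hξ, h⟩)).smul ?_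
      refine ContinuousWithinAt.clm_apply ?_ continuousWithinAt_const
      refine continuous_compound.continuousAt.comp_continuousWithinAt ?_
      refine ContinuousWithinAt.mul N.chat_continuous.continuousWithinAt ?_
      have hcd : Continuous fun v : Fin n → ℂ => Matrix.diagonal v := continuous_id.matrix_diagonal
      refine hcd.continuousAt.comp_continuousWithinAt (continuousWithinAt_pi.2 fun j => ?_)
      exact (continuousWithinAt_const.mul (N.logBranch.continuousOn ξ ⟨hξ, h⟩)).cexp
    have h2 : ContinuousWithinAt N.free (closure S \ {0}) ξ := by
      refine h1.congr (fun ζ hζ => ?_) ?_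
      · rw [free, hop, if_neg (show ¬ ζ = 0 from hζ.2)]
        rfl
      · rw [free, hop, if_neg h]
        rfl
    refine h2.mono_of_mem_nhdsWithin ?_
    exact inter_mem self_mem_nhdsWithin
      (mem_nhdsWithin_of_mem_nhds (isOpen_compl_singleton.mem_nhds h))

theorem exists_free_bound : ∃ B : ℝ, 0 ≤ B ∧ ∀ ξ ∈ closure S, ‖N.free ξ‖ ≤ B := by
  obtain ⟨L, hL, -, -, hb⟩ := N.exists_ehat_bound
  obtain ⟨C, hC⟩ := (isCompact_small (S := S)).exists_bound_of_continuousOn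
    (N.continuousOn_free.mono inter_subset_left)
  refine ⟨|C| + L * ‖compound m N.trans' N.v₀‖, by positivity, fun ξ hξ => ?_⟩
  by_cases h : ‖ξ‖ ≤ 2
  · have h1 := hC ξ ⟨hξ, by simpa using h⟩
    have h2 : 0 ≤ L * ‖compound m N.trans' N.v₀‖ := by positivity
    linarith [le_abs_self C]
  · have h1 : 1 < ‖ξ‖ := by linarith [not_le.1 h]
    have h2 : N.free ξ = compound m (N.ehat ξ) (N.expOp ξ (compound m N.trans' N.v₀)) := by
      rw [free, N.hop_eq_expOp hξ h1]
      rfl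
    rw [h2]
    have h3 : ‖compound m (N.ehat ξ) (N.expOp ξ (compound m N.trans' N.v₀))‖ ≤
        L * ‖compound m N.trans' N.v₀‖ :=
      ((compound m (N.ehat ξ)).le_opNorm _).trans (mul_le_mul (hb ξ hξ h1.le).1
        (N.norm_expOp_apply_le fun α => N.v₀_infty ξ hξ α) (norm_nonneg _) hL)
    linarith [abs_nonneg C]

end TensorModel

/-! ### The first iterate -/

/-- The sum of the absolute values of the entries of a matrix. -/
def entrySum {n : ℕ} (V : Matrix (Fin n) (Fin n) ℂ) : ℝ := ∑ i, ∑ j, ‖V i j‖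

theorem entrySum_nonneg {n : ℕ} (V : Matrix (Fin n) (Fin n) ℂ) : 0 ≤ entrySum V :=
  Finset.sum_nonneg fun _ _ => Finset.sum_nonneg fun _ _ => norm_nonneg _

theorem exists_derivation_bound (n m : ℕ) : ∃ L : ℝ, 0 ≤ L ∧
    ∀ V : Matrix (Fin n) (Fin n) ℂ, ‖derivation m V‖ ≤ L * entrySum V := by
  refine ⟨∑ i : Fin n, ∑ j : Fin n, ‖derivation m (Matrix.single i j (1 : ℂ))‖,
    Finset.sum_nonneg fun _ _ => Finset.sum_nonneg fun _ _ => norm_nonneg _, fun V => ?_⟩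
  rw [derivation_eq_sum, entrySum, Finset.mul_sum]
  refine (norm_sum_le _ _).trans (Finset.sum_le_sum fun i _ => ?_)
  rw [Finset.mul_sum]
  refine (norm_sum_le _ _).trans (Finset.sum_le_sum fun j _ => ?_)
  rw [norm_smul, mul_comm]
  refine mul_le_mul_of_nonneg_right ?_ (norm_nonneg _)
  refine (Finset.single_le_sum (f := fun j => ‖derivation m (Matrix.single i j (1 : ℂ))‖)
    (fun _ _ => norm_nonneg _) (Finset.mem_univ j)).trans ?_
  exact Finset.single_le_sum
    (f := fun i => ∑ j : Fin n, ‖derivation m (Matrix.single i j (1 : ℂ))‖)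
    (fun _ _ => Finset.sum_nonneg fun _ _ => norm_nonneg _) (Finset.mem_univ i)

theorem integrableOn_sum_smul {ι κ E : Type*} [Fintype ι] [Fintype κ] [NormedAddCommGroup E]
    [NormedSpace ℂ E] {f : ι → κ → ℝ → ℂ} {s : Set ℝ} (hf : ∀ i j, IntegrableOn (f i j) s)
    (v : ι → κ → E) : IntegrableOn (fun t => ∑ i, ∑ j, f i j t • v i j) s :=
  integrable_finsetSum _ fun i _ => integrable_finsetSum _ fun j _ =>
    Integrable.smul_const (hf i j) (v i j)

theorem integrableOn_derivation {n m : ℕ} {q : ℝ → Matrix (Fin n) (Fin n) ℂ}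
    (hq : ∀ i j, IntegrableOn (fun t => q t i j) (Ioi 0)) :
    IntegrableOn (fun t => derivation m (q t)) (Ioi 0) :=
  (integrableOn_sum_smul hq fun i j => derivation m (Matrix.single i j (1 : ℂ))).congr_fun
    (fun t _ => (derivation_eq_sum (q t)).symm) measurableSet_Ioi

theorem integrableOn_entrySum {n : ℕ} {q : ℝ → Matrix (Fin n) (Fin n) ℂ}
    (hq : ∀ i j, IntegrableOn (fun t => q t i j) (Ioi 0)) :
    IntegrableOn (fun t => entrySum (q t)) (Ioi 0) :=
  integrable_finsetSum _ fun i _ => integrable_finsetSum _ fun j _ => (hq i j).norm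

namespace TensorModel

variable {n m : ℕ} {S : Set ℂ} (N : TensorModel n m S)

/-- The coefficients of the free term with respect to `e`. -/
def coeff : Tensor n m := compound m N.trans' N.v₀

/-- The exponent `R_γ - R_{α₀} + R_i - R_j` belonging to `E_{ij}^{(m)} e_γ`, which is a combination of
the `e_β` with `R_β = R_γ + R_i - R_j`. -/
def shift (z : Fin n × Fin n × Set.powersetCard (Fin n) m) : ℂ :=
  N.rDiff z.2.2 + N.R z.1 - N.R z.2.1

/-- The vector `E_{ij}^{(m)} e_γ`. -/
def unitVec (z : Fin n × Fin n × Set.powersetCard (Fin n) m) : Tensor n m :=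
  derivation m (Matrix.single z.1 z.2.1 1) (tensorBasis n m z.2.2)

open Classical in
/-- The indices `(i, j, γ)` of the oscillating integrals that occur in the first iterate. Only those
with a nonzero coefficient are kept, since the others may have growing phases. -/
def phaseIndex : Finset (Fin n × Fin n × Set.powersetCard (Fin n) m) :=
  Finset.univ.filter fun z => z.1 ≠ z.2.1 ∧ (tensorBasis n m).repr N.coeff z.2.2 ≠ 0 ∧
    unitVec z ≠ 0

theorem expOp_unitVec (ζ : ℂ) (z : Fin n × Fin n × Set.powersetCard (Fin n) m) :
    N.expOp ζ (unitVec z) = Complex.exp (ζ * N.shift z) • unitVec z := by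
  obtain ⟨i, j, γ⟩ := z
  set s := ∑ j ∈ (N.α₀ : Finset (Fin n)), N.R j with hs
  have h1 : N.expOp ζ = Complex.exp (-(ζ * s)) •
      compound m (Matrix.diagonal fun j => Complex.exp (ζ * N.R j)) := by
    rw [compound_diagonal_exp, ← diagOp_smul, expOp]
    congr 1
    funext α
    rw [Pi.smul_apply, smul_eq_mul, ← Complex.exp_add, rDiff]
    congr 1
    ring
  have h2 := compound_mul_derivation (m := m) (diag_mul_diag' fun j => ζ * N.R j)
    (Matrix.single i j (1 : ℂ))
  have h3 : (Matrix.diagonal fun j => Complex.exp (ζ * N.R j)) * Matrix.single i j (1 : ℂ) *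
      (Matrix.diagonal fun j => Complex.exp (-(ζ * N.R j))) =
      Complex.exp (ζ * (N.R i - N.R j)) • Matrix.single i j (1 : ℂ) := by
    ext a b
    rw [Matrix.mul_diagonal, Matrix.diagonal_mul, Matrix.smul_apply, Matrix.single_apply]
    split_ifs with hab
    · obtain ⟨rfl, rfl⟩ := hab
      rw [mul_one, smul_eq_mul, mul_one, ← Complex.exp_add]
      congr 1
      ring
    · simp
  rw [h3, map_smul, smul_mul_assoc] at h2
  have h4 := congrArg (fun T => T (tensorBasis n m γ)) h2
  simp only [mul_apply_eq_comp, smul_apply, compound_diagonal_exp, diagOp_basis, map_smul,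
    smul_smul] at h4
  rw [h1, unitVec, shift, smul_apply, compound_diagonal_exp, h4, smul_smul, ← Complex.exp_add,
    ← Complex.exp_add]
  congr 2
  simp only [rDiff, hs]
  ring

theorem re_shift_le {z : Fin n × Fin n × Set.powersetCard (Fin n) m} (hz : unitVec z ≠ 0)
    {ρ : ℂ} (hρ : ρ ∈ closure S) : N.ε * (ρ * N.shift z).re ≤ 0 := by
  -- compare moduli in `expOp_unitVec` at a nonzero coordinate `β` of `E_{ij}^{(m)} e_γ`
  obtain ⟨β, hβ⟩ : ∃ β, (tensorBasis n m).repr (unitVec z) β ≠ 0 := by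
    by_contra! h
    exact hz ((tensorBasis n m).repr.map_eq_zero_iff.1 (Finsupp.ext h))
  have h1 := congrArg (fun f => (tensorBasis n m).repr f β) (N.expOp_unitVec ρ z)
  simp only [expOp, repr_diagOp, map_smul, Finsupp.smul_apply, smul_eq_mul] at h1
  have h2 := congrArg norm (mul_right_cancel₀ hβ h1)
  rw [Complex.norm_exp, Complex.norm_exp] at h2
  rw [← Real.exp_injective h2]
  exact N.R_order ρ hρ β

theorem re_rDiff_le {γ : Set.powersetCard (Fin n) m} (h : (tensorBasis n m).repr N.coeff γ ≠ 0)
    {ρ : ℂ} (hρ : ρ ∈ closure S) : (ρ * N.rDiff γ).re ≤ 0 :=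
  (N.v₀_infty ρ hρ γ).resolve_left h

/-- `H(ξ)` with respect to the exponential solutions and without their exponential factors; it equals
`∧^m ehat(ξ)` for `|ξ| > 1`. -/
def nop (ξ : ℂ) : Tensor n m →L[ℂ] Tensor n m :=
  N.hop ξ * compound m N.trans * N.expOp (-ξ)

theorem expOp_zero : N.expOp 0 = 1 := by
  rw [expOp, ← diagOp_one]
  congr 1
  funext α
  simp

theorem norm_expOp_le_exp {ζ : ℂ} (h : ‖ζ‖ ≤ 1) :
    ‖N.expOp ζ‖ ≤ Real.exp (∑ α, ‖N.rDiff α‖) := by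
  refine norm_diagOp_le (Real.exp_pos _).le fun α => ?_
  refine (Complex.norm_exp_le_exp_norm _).trans (Real.exp_le_exp.2 ?_)
  rw [norm_mul]
  refine (mul_le_of_le_one_left (norm_nonneg _) h).trans ?_
  exact Finset.single_le_sum (f := fun α => ‖N.rDiff α‖) (fun _ _ => norm_nonneg _)
    (Finset.mem_univ α)

/-- For `ε = -1` the exponent `Re μ_{α₀}` is the smallest one, so `H` is bounded near the origin. -/
theorem exists_hop_bound (hε : N.ε = -1) : ∃ C : ℝ, 0 ≤ C ∧
    ∀ ξ ∈ closure S, ‖ξ‖ ≤ 1 → ‖N.hop ξ‖ ≤ C := by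
  have hK : IsCompact (closure S ∩ Metric.closedBall 0 1) :=
    (isCompact_closedBall _ _).inter_left isClosed_closure
  obtain ⟨C₂, h2⟩ := hK.exists_bound_of_continuousOn
    ((N.continuousOn_omega.inv₀ fun ξ hξ => N.omega_ne_zero hξ).mono inter_subset_left)
  obtain ⟨C₃, h3⟩ := hK.exists_bound_of_continuousOn
    ((continuous_compound (m := m)).comp N.chat_continuous).continuousOn
  obtain ⟨C, hC⟩ := N.logBranch.im_bounded N.sector
  set D := Real.exp (∑ α, ‖N.muDiff α‖ * |C|) with hD
  refine ⟨‖N.hop 0‖ + |C₂| * (|C₃| * D), by positivity, fun ξ hξ h => ?_⟩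
  have hpos : 0 ≤ |C₂| * (|C₃| * D) := by positivity
  by_cases h0 : ξ = 0
  · rw [h0]
    linarith
  have hm : ξ ∈ closure S ∩ Metric.closedBall 0 1 := ⟨hξ, by simpa using h⟩
  have hd : ‖(diagOp fun α => Complex.exp (N.muDiff α * N.ℓ ξ) :
      Tensor n m →L[ℂ] Tensor n m)‖ ≤ D := by
    refine norm_diagOp_le (Real.exp_pos _).le fun α => ?_
    rw [Complex.norm_exp]
    refine Real.exp_le_exp.2 ?_
    have hre : (N.ℓ ξ).re ≤ 0 := by
      have : (N.ℓ ξ).re = Real.log ‖ξ‖ := by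
        conv_rhs => rw [← N.logBranch.exp_eq ξ ⟨hξ, h0⟩, Complex.norm_exp, Real.log_exp]
      rw [this]
      exact Real.log_nonpos (norm_nonneg _) h
    have hμ : 0 ≤ (N.muDiff α).re := by
      by_cases hα : α = N.α₀
      · simp [hα, muDiff_self]
      · have := N.re_exponent_pos hα
        rw [hε] at this
        simpa using this.le
    have him : -((N.muDiff α).im * (N.ℓ ξ).im) ≤ ‖N.muDiff α‖ * |C| := by
      refine (neg_le_abs _).trans ?_
      rw [abs_mul]
      exact mul_le_mul (Complex.abs_im_le_norm _) ((hC ξ ⟨hξ, h0⟩).trans (le_abs_self _))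
        (abs_nonneg _) (norm_nonneg _)
    have hs : ‖N.muDiff α‖ * |C| ≤ ∑ α, ‖N.muDiff α‖ * |C| :=
      Finset.single_le_sum (f := fun α => ‖N.muDiff α‖ * |C|)
      (fun _ _ => by positivity) (Finset.mem_univ α)
    rw [Complex.mul_re]
    have := mul_nonpos_of_nonneg_of_nonpos hμ hre
    linarith
  rw [N.hop_eq h0, norm_smul]
  have h4 : ‖(N.omega ξ)⁻¹‖ * ‖compound m (N.chat ξ) *
      diagOp fun α => Complex.exp (N.muDiff α * N.ℓ ξ)‖ ≤ |C₂| * (|C₃| * D) := by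
    refine mul_le_mul ((h2 _ hm).trans (le_abs_self _)) ?_ (norm_nonneg _) (abs_nonneg _)
    exact (norm_mul_le _ _).trans (mul_le_mul ((h3 _ hm).trans (le_abs_self _)) hd
      (norm_nonneg _) (abs_nonneg _))
  linarith [norm_nonneg (N.hop 0)]

theorem exists_nop_bound : ∃ C : ℝ, 0 ≤ C ∧
    ∀ ξ ∈ closure S, N.ε = -1 ∨ 1 < ‖ξ‖ → ‖N.nop ξ‖ ≤ C := by
  obtain ⟨L, hL, -, -, hb⟩ := N.exists_ehat_bound
  have hbig : ∀ ξ ∈ closure S, 1 < ‖ξ‖ → ‖N.nop ξ‖ ≤ L := by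
    intro ξ hξ h
    have h1 : N.nop ξ = compound m (N.ehat ξ) := by
      rw [nop, N.hop_eq_expOp hξ h]
      calc _ = compound m (N.ehat ξ) * (N.expOp ξ * (compound m N.trans' * compound m N.trans) *
            N.expOp (-ξ)) := by simp only [mul_assoc]
        _ = _ := by
          rw [← compound_mul, N.trans'_mul, compound_one, mul_one, ← N.expOp_add, add_neg_cancel,
            expOp_zero, mul_one]
    rw [h1]
    exact (hb ξ hξ h.le).1
  by_cases hε : N.ε = -1
  · obtain ⟨C, hC, hc⟩ := N.exists_hop_bound hε
    set D := C * ‖compound m N.trans‖ * Real.exp (∑ α, ‖N.rDiff α‖) with hD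
    have hD0 : 0 ≤ D := by positivity
    refine ⟨L + D, by positivity, fun ξ hξ _ => ?_⟩
    by_cases h : 1 < ‖ξ‖
    · linarith [hbig ξ hξ h]
    · have h1 := hc ξ hξ (not_lt.1 h)
      have h2 : ‖N.nop ξ‖ ≤ D :=
        (norm_mul_le _ _).trans (mul_le_mul ((norm_mul_le _ _).trans
          (mul_le_mul_of_nonneg_right h1 (norm_nonneg _)))
          (N.norm_expOp_le_exp (by rw [norm_neg]; exact not_lt.1 h)) (norm_nonneg _)
          (by positivity))
      linarith
  · exact ⟨L, hL, fun ξ hξ h => hbig ξ hξ (h.resolve_left hε)⟩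

/-- The integrand of the first iterate with `ehat` replaced by its limit. -/
def mainTerm (V : Matrix (Fin n) (Fin n) ℂ) (x t : ℝ) (ρ : ℂ) : Tensor n m :=
  N.nop (ρ * x) (N.expOp (ρ * x - ρ * t)
    (derivation m (N.permᵀ * V * N.perm) (N.expOp (ρ * t) N.coeff)))

theorem kernel_apply_free {x : ℝ≥0} {t : ℝ} {ρ : closure S} (ht : t ∈ volterraSet N.ε x)
    (h : 1 < ‖(ρ : ℂ) * t‖) (V : Matrix (Fin n) (Fin n) ℂ) :
    N.kernel x t ρ (derivation m V (N.free (ρ * t))) =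
      N.nop (ρ * (x : ℝ)) (N.expOp (ρ * (x : ℝ) - ρ * t)
        ((compound m (N.einv (ρ * t)) * derivation m V * compound m (N.ehat (ρ * t)))
          (N.expOp (ρ * t) N.coeff))) := by
  have hρ : (ρ : ℂ) ≠ 0 := fun h0 => by rw [h0, zero_mul, norm_zero] at h; linarith
  have hτ := N.mul_mem ρ.2 ht.1.le
  have h1 : N.nop (ρ * (x : ℝ)) * N.expOp (ρ * (x : ℝ) - ρ * t) =
      N.hop (ρ * (x : ℝ)) * compound m N.trans * N.expOp (-(ρ * t)) := by
    rw [nop, mul_assoc, ← N.expOp_add]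
    congr 2
    ring
  have h2 : N.free (ρ * t) = compound m (N.ehat (ρ * t)) (N.expOp (ρ * t) N.coeff) := by
    rw [free, N.hop_eq_expOp hτ h]
    rfl
  have h3 := congrArg (fun T => T ((compound m (N.einv (ρ * t)) * derivation m V *
    compound m (N.ehat (ρ * t))) (N.expOp (ρ * t) N.coeff))) h1
  rw [N.kernel_eq ht hρ, N.hinv_eq_expOp hτ h, h2]
  exact h3.symm

theorem perm_conj_apply (V : Matrix (Fin n) (Fin n) ℂ) (i j : Fin n) :
    (N.permᵀ * V * N.perm) i j = V (N.σ i) (N.σ j) := by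
  simp [Matrix.mul_apply, perm_apply, Matrix.transpose_apply]

open Classical in
theorem mainTerm_eq_sum (V : Matrix (Fin n) (Fin n) ℂ) (hV : ∀ i, V i i = 0) (x t : ℝ) (ρ : ℂ) :
    N.mainTerm V x t ρ = ∑ z ∈ N.phaseIndex,
      (V (N.σ z.1) (N.σ z.2.1) * Complex.exp (ρ * ((x - t) * N.shift z + t * N.rDiff z.2.2))) •
        ((tensorBasis n m).repr N.coeff z.2.2 • N.nop (ρ * x) (unitVec z)) := by
  have h1 : N.mainTerm V x t ρ = ∑ i, ∑ j, ∑ γ,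
      (V (N.σ i) (N.σ j) * Complex.exp (ρ * ((x - t) * N.shift (i, j, γ) + t * N.rDiff γ))) •
        ((tensorBasis n m).repr N.coeff γ • N.nop (ρ * x) (unitVec (i, j, γ))) := by
    have he : N.expOp (ρ * t) N.coeff = ∑ γ, (Complex.exp (ρ * t * N.rDiff γ) *
        (tensorBasis n m).repr N.coeff γ) • tensorBasis n m γ := diagOp_apply_eq_sum _ _
    have hd : derivation m (N.permᵀ * V * N.perm) (N.expOp (ρ * t) N.coeff) =
        ∑ i, ∑ j, V (N.σ i) (N.σ j) • derivation m (Matrix.single i j (1 : ℂ))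
          (N.expOp (ρ * t) N.coeff) := by
      rw [derivation_eq_sum, sum_apply]
      refine Finset.sum_congr rfl fun i _ => ?_
      rw [sum_apply]
      refine Finset.sum_congr rfl fun j _ => ?_
      rw [smul_apply, perm_conj_apply]
    rw [mainTerm, hd, he]
    simp only [map_sum, map_smul, Finset.smul_sum]
    refine Finset.sum_congr rfl fun i _ => Finset.sum_congr rfl fun j _ =>
      Finset.sum_congr rfl fun γ _ => ?_
    have hu : derivation m (Matrix.single i j (1 : ℂ)) (tensorBasis n m γ) = unitVec (i, j, γ) :=
      rfl
    rw [hu, N.expOp_unitVec, map_smul, smul_smul, smul_smul, smul_smul]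
    congr 1
    have hexp : Complex.exp (ρ * ((x - t) * N.shift (i, j, γ) + t * N.rDiff γ)) =
        Complex.exp (ρ * t * N.rDiff γ) * Complex.exp ((ρ * x - ρ * t) * N.shift (i, j, γ)) := by
      rw [← Complex.exp_add]
      congr 1
      ring
    rw [hexp]
    ring
  rw [h1, phaseIndex, Finset.sum_filter_of_ne]
  · simp only [Fintype.sum_prod_type]
  · intro z _ hz
    refine ⟨fun h => hz ?_, fun h => hz ?_, fun h => hz ?_⟩
    · rw [h, hV, zero_mul, zero_smul]
    · rw [h, zero_smul, smul_zero]
    · rw [h, map_zero, smul_zero, smul_zero]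

end TensorModel

theorem integrableOn_phase {ε : ℝ} (hε : ε = 1 ∨ ε = -1) {ρ a' a : ℂ}
    (h1 : ε * (ρ * a').re ≤ 0) (h2 : (ρ * a).re ≤ 0) {f : ℝ → ℂ} (hf : IntegrableOn f (Ioi 0))
    (x : ℝ) : IntegrableOn (fun t : ℝ => f t * Complex.exp (ρ * ((x - t) * a' + t * a)))
      (volterraSet ε x) := by
  have hf' : IntegrableOn f (volterraSet ε x) := IntegrableOn.mono_set hf (volterraSet_subset ε x)
  refine Integrable.mono hf' (hf'.1.mul (Continuous.aestronglyMeasurable (by fun_prop))) ?_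
  filter_upwards [self_mem_ae_restrict (measurableSet_volterraSet ε x)] with t ht
  rw [norm_mul]
  exact mul_le_of_le_one_right (norm_nonneg _) (norm_exp_phase_le_one hε h1 h2 ht.1.le ht.2.le)

/-- The bound for the error terms of the first iterate. -/
def remainderIntegral {n : ℕ} (q : ℝ → Matrix (Fin n) (Fin n) ℂ) (r : ℝ) : ℝ :=
  ∫ t in Ioi 0, min 1 (r * t)⁻¹ * entrySum (q t)

theorem integrableOn_min_mul {f : ℝ → ℝ} (hf : IntegrableOn f (Ioi 0)) {r : ℝ} (hr : 0 < r) :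
    IntegrableOn (fun t => min 1 (r * t)⁻¹ * f t) (Ioi 0) := by
  refine Integrable.mono hf (AEStronglyMeasurable.mul
    (Measurable.aestronglyMeasurable (by fun_prop)) hf.1) ?_
  filter_upwards [self_mem_ae_restrict measurableSet_Ioi] with t ht
  have ht : 0 < t := ht
  rw [norm_mul, Real.norm_of_nonneg (by positivity)]
  exact mul_le_of_le_one_left (norm_nonneg _) (min_le_left _ _)

theorem remainderIntegral_nonneg {n : ℕ} (q : ℝ → Matrix (Fin n) (Fin n) ℂ) {r : ℝ} (hr : 0 < r) :
    0 ≤ remainderIntegral q r :=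
  setIntegral_nonneg measurableSet_Ioi fun t ht => by
    have ht : 0 < t := ht
    have := entrySum_nonneg (q t)
    positivity

namespace TensorModel

variable {n m : ℕ} {S : Set ℂ} (N : TensorModel n m S)

/-- The free term as a family of functions of the spectral parameter. -/
def freeFamily (x : ℝ≥0) (ρ : closure S) : Tensor n m := N.free (ρ * (x : ℝ))

/-- The first iterate of the Volterra equation. -/
def firstIterate (q : ℝ → Matrix (Fin n) (Fin n) ℂ) (x : ℝ≥0) (ρ : closure S) : Tensor n m :=
  volterraOp N.ε N.kernel (fun t => derivation m (q t)) N.freeFamily x ρ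

theorem continuous_freeFamily : Continuous fun z : ℝ≥0 × closure S => N.freeFamily z.1 z.2 :=
  N.continuousOn_free.comp_continuous (f := fun z : ℝ≥0 × closure S => (z.2 : ℂ) * (z.1 : ℝ))
    (by fun_prop) fun z => N.mul_mem z.2.2 z.1.2

/-- The effect of a small change of `(A, B)` with `A = B⁻¹` on `A D B`. -/
theorem derivation_conj_sub {A B A₀ B₀ : Tensor n m →L[ℂ] Tensor n m} (h : A * B = 1)
    (h₀ : B₀ * A₀ = 1) (D : Tensor n m →L[ℂ] Tensor n m) :
    A * D * B - A₀ * D * B₀ = A * D * (B - B₀) - A * (B - B₀) * A₀ * D * B₀ := by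
  have h1 : A * (B - B₀) * A₀ = A₀ - A := by
    rw [mul_sub, sub_mul, h, one_mul, mul_assoc, h₀, mul_one]
  rw [h1]
  simp only [mul_sub, sub_mul]
  abel

/-- Replacing `ehat(ρt)` by its limit changes the integrand of the first iterate by
`O(min(1, 1/|ρt|) |q(t)|)`. -/
theorem exists_kernel_sub_mainTerm_le : ∃ C : ℝ, 0 ≤ C ∧
    ∀ (V : Matrix (Fin n) (Fin n) ℂ) (x : ℝ≥0) (t : ℝ) (ρ : closure S), (ρ : ℂ) ≠ 0 →
      t ∈ volterraSet N.ε x → N.ε = -1 ∨ 1 < ‖(ρ : ℂ) * (x : ℝ)‖ →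
      ‖N.kernel x t ρ (derivation m V (N.free (ρ * t))) - N.mainTerm V x t ρ‖ ≤
        C * (min 1 (‖(ρ : ℂ)‖ * t)⁻¹ * entrySum V) := by
  obtain ⟨L, hL, hA₀, hB₀, hb⟩ := N.exists_ehat_bound
  obtain ⟨Cn, hCn, hn⟩ := N.exists_nop_bound
  obtain ⟨Cκ, hCκ, hκ⟩ := N.exists_kernel_bound
  obtain ⟨B, hB, hf⟩ := N.exists_free_bound
  obtain ⟨Ld, hLd, hd⟩ := exists_derivation_bound n m
  set c := ‖N.coeff‖ with hc
  refine ⟨Cn * (L * Ld * L + L * L * L * Ld * L) * c + (Cκ * Ld * B + Cn * (L * Ld * L) * c),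
    by positivity, fun V x t ρ hρ ht hcase => ?_⟩
  have hσ := entrySum_nonneg V
  have ht0 : 0 < t := ht.1
  have hnt : ‖(ρ : ℂ) * t‖ = ‖(ρ : ℂ)‖ * t := by
    rw [norm_mul, Complex.norm_real, Real.norm_of_nonneg ht0.le]
  have hρn : 0 < ‖(ρ : ℂ)‖ := norm_pos_iff.2 hρ
  have hτ := N.mul_mem' ρ.2 hρ ht0
  have hnx := hn _ (N.mul_mem ρ.2 (NNReal.coe_nonneg x)) hcase
  have hD := hd V
  have he1 : ‖N.expOp (ρ * (x : ℝ) - ρ * t)‖ ≤ 1 :=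
    N.norm_expOp_le fun α => N.re_sub_le ρ.2 ht.2 α
  have he2 : ‖N.expOp (ρ * t) N.coeff‖ ≤ c :=
    N.norm_expOp_apply_le fun α => N.v₀_infty _ hτ.1 α
  have hconj : derivation m (N.permᵀ * V * N.perm) =
      compound m N.permᵀ * derivation m V * compound m N.perm := by
    have h1 := compound_mul_derivation (m := m) N.perm_mul_transpose V
    have h2 : compound m N.permᵀ * compound m N.perm = 1 := by
      rw [← compound_mul, N.perm_transpose_mul, compound_one]
    rw [h1, mul_assoc _ (compound m N.permᵀ) (compound m N.perm), h2, mul_one]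
  have happly : ∀ T : Tensor n m →L[ℂ] Tensor n m,
      ‖N.nop (ρ * (x : ℝ)) (N.expOp (ρ * (x : ℝ) - ρ * t) (T (N.expOp (ρ * t) N.coeff)))‖ ≤
        Cn * ‖T‖ * c := by
    intro T
    refine ((N.nop _).le_opNorm _).trans ?_
    rw [mul_assoc]
    refine mul_le_mul hnx (((N.expOp _).le_opNorm _).trans ?_) (norm_nonneg _) hCn
    refine (mul_le_of_le_one_left (norm_nonneg _) he1).trans ((T.le_opNorm _).trans ?_)
    exact mul_le_mul_of_nonneg_left he2 (norm_nonneg _)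
  by_cases h : 1 < ‖(ρ : ℂ) * t‖
  · obtain ⟨hB1, hA1, hAB⟩ := hb _ hτ.1 h.le
    have hinv : 0 ≤ ‖(ρ : ℂ) * t‖⁻¹ := by positivity
    have hmin : min 1 (‖(ρ : ℂ)‖ * t)⁻¹ = ‖(ρ : ℂ) * t‖⁻¹ := by
      rw [hnt, min_eq_right]
      rw [← hnt]
      exact inv_le_one_of_one_le₀ h.le
    have hdiff : N.kernel x t ρ (derivation m V (N.free (ρ * t))) - N.mainTerm V x t ρ =
        N.nop (ρ * (x : ℝ)) (N.expOp (ρ * (x : ℝ) - ρ * t)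
          ((compound m (N.einv (ρ * t)) * derivation m V * compound m (N.ehat (ρ * t)) -
            compound m N.permᵀ * derivation m V * compound m N.perm)
              (N.expOp (ρ * t) N.coeff))) := by
      rw [N.kernel_apply_free ht h, mainTerm, hconj, sub_apply, map_sub, map_sub]
    have hA₀B₀ : compound m N.perm * compound m N.permᵀ = 1 := by
      rw [← compound_mul, N.perm_mul_transpose, compound_one]
    have hAB1 : compound m (N.einv (ρ * t)) * compound m (N.ehat (ρ * t)) = 1 := by
      rw [← compound_mul, N.einv_mul_ehat hτ, compound_one]
    rw [hdiff, hmin, derivation_conj_sub hAB1 hA₀B₀]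
    refine (happly _).trans ?_
    set A := compound m (N.einv (ρ * t))
    set D := derivation m V
    set E := compound m (N.ehat (ρ * t)) - compound m N.perm
    have h1 : ‖A * D * E‖ ≤ L * (Ld * entrySum V) * (L * ‖(ρ : ℂ) * t‖⁻¹) :=
      (norm_mul_le _ _).trans (mul_le_mul ((norm_mul_le _ _).trans
        (mul_le_mul hA1 hD (norm_nonneg _) hL)) hAB (norm_nonneg _) (by positivity))
    have h2 : ‖A * E * compound m N.permᵀ * D * compound m N.perm‖ ≤
        L * (L * ‖(ρ : ℂ) * t‖⁻¹) * L * (Ld * entrySum V) * L :=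
      (norm_mul_le _ _).trans (mul_le_mul ((norm_mul_le _ _).trans (mul_le_mul
        ((norm_mul_le _ _).trans (mul_le_mul ((norm_mul_le _ _).trans
          (mul_le_mul hA1 hAB (norm_nonneg _) hL)) hA₀ (norm_nonneg _) (by positivity)))
          hD (norm_nonneg _) (by positivity))) hB₀ (norm_nonneg _) (by positivity))
    have h3 := (norm_sub_le _ _).trans (add_le_add h1 h2)
    have h4 : 0 ≤ (Cκ * Ld * B + Cn * (L * Ld * L) * c) * (‖(ρ : ℂ) * t‖⁻¹ * entrySum V) := by
      positivity
    calc _ ≤ Cn * (L * (Ld * entrySum V) * (L * ‖(ρ : ℂ) * t‖⁻¹) +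
          L * (L * ‖(ρ : ℂ) * t‖⁻¹) * L * (Ld * entrySum V) * L) * c := by gcongr
      _ ≤ Cn * (L * (Ld * entrySum V) * (L * ‖(ρ : ℂ) * t‖⁻¹) +
          L * (L * ‖(ρ : ℂ) * t‖⁻¹) * L * (Ld * entrySum V) * L) * c +
          (Cκ * Ld * B + Cn * (L * Ld * L) * c) * (‖(ρ : ℂ) * t‖⁻¹ * entrySum V) := by linarith
      _ = _ := by ring
  · have hmin : min 1 (‖(ρ : ℂ)‖ * t)⁻¹ = 1 := by
      rw [min_eq_left]
      rw [← hnt]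
      exact (one_le_inv₀ (norm_pos_iff.2 hτ.2)).2 (not_lt.1 h)
    rw [hmin, one_mul]
    have h1 : ‖N.kernel x t ρ (derivation m V (N.free (ρ * t)))‖ ≤
        Cκ * (Ld * entrySum V * B) :=
      ((N.kernel x t ρ).le_opNorm _).trans (mul_le_mul (hκ x t ρ ht)
        (((derivation m V).le_opNorm _).trans (mul_le_mul hD (hf _ hτ.1) (norm_nonneg _)
          (by positivity))) (norm_nonneg _) hCκ.le)
    have h2 : ‖N.mainTerm V x t ρ‖ ≤ Cn * (L * (Ld * entrySum V) * L) * c := by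
      refine (happly _).trans ?_
      rw [hconj]
      have : ‖compound m N.permᵀ * derivation m V * compound m N.perm‖ ≤
          L * (Ld * entrySum V) * L :=
        (norm_mul_le _ _).trans (mul_le_mul ((norm_mul_le _ _).trans
          (mul_le_mul hA₀ hD (norm_nonneg _) hL)) hB₀ (norm_nonneg _) (by positivity))
      gcongr
    have h3 := (norm_sub_le _ _).trans (add_le_add h1 h2)
    have h4 : 0 ≤ Cn * (L * Ld * L + L * L * L * Ld * L) * c * entrySum V := by positivity
    linarith

/-- The sum of the oscillating integrals that occur in the first iterate. -/
def phaseSum (q : ℝ → Matrix (Fin n) (Fin n) ℂ) (x : ℝ≥0) (ρ : closure S) : ℝ :=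
  ∑ z ∈ N.phaseIndex, ‖phaseIntegral N.ε (N.shift z) (N.rDiff z.2.2) ρ
    (fun t => q t (N.σ z.1) (N.σ z.2.1)) x‖

theorem phaseSum_nonneg (q : ℝ → Matrix (Fin n) (Fin n) ℂ) (x : ℝ≥0) (ρ : closure S) :
    0 ≤ N.phaseSum q x ρ := Finset.sum_nonneg fun _ _ => norm_nonneg _

theorem mem_phaseIndex {z : Fin n × Fin n × Set.powersetCard (Fin n) m} :
    z ∈ N.phaseIndex ↔ z.1 ≠ z.2.1 ∧ (tensorBasis n m).repr N.coeff z.2.2 ≠ 0 ∧ unitVec z ≠ 0 := by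
  simp [phaseIndex]

/-- The first iterate is a sum of oscillating integrals up to an error of the size
`∫ min(1, 1/|ρ t|) |q(t)| dt`. -/
theorem exists_firstIterate_le : ∃ C : ℝ, 0 ≤ C ∧
    ∀ q : ℝ → Matrix (Fin n) (Fin n) ℂ, (∀ i j, IntegrableOn (fun t => q t i j) (Ioi 0)) →
      (∀ i, (fun t => q t i i) =ᵐ[halfLine] 0) → ∀ (x : ℝ≥0) (ρ : closure S), (ρ : ℂ) ≠ 0 →
        ‖N.firstIterate q x ρ‖ ≤ C * (N.phaseSum q x ρ + remainderIntegral q ‖(ρ : ℂ)‖) := by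
  obtain ⟨C₁, hC₁, h1⟩ := N.exists_kernel_sub_mainTerm_le
  obtain ⟨Cn, hCn, hn⟩ := N.exists_nop_bound
  obtain ⟨Cκ, hker⟩ := N.exists_isVolterraKernel
  obtain ⟨B, hB, hf⟩ := N.exists_free_bound
  obtain ⟨Ld, hLd, hd⟩ := exists_derivation_bound n m
  have hCκ := hker.pos
  set M : ℝ := ∑ z : Fin n × Fin n × Set.powersetCard (Fin n) m,
    ‖(tensorBasis n m).repr N.coeff z.2.2‖ * (Cn * ‖unitVec z‖) with hM
  have hM0 : 0 ≤ M := Finset.sum_nonneg fun _ _ => by positivity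
  refine ⟨C₁ + M + Cκ * Ld * B, by positivity, fun q hq hdiag x ρ hρ => ?_⟩
  have hρn : 0 < ‖(ρ : ℂ)‖ := norm_pos_iff.2 hρ
  have hJ := volterraSet_subset N.ε (x : ℝ)
  have hJm := measurableSet_volterraSet N.ε (x : ℝ)
  have hR0 := remainderIntegral_nonneg q hρn
  have hP0 := N.phaseSum_nonneg q x ρ
  have hi := integrableOn_min_mul (integrableOn_entrySum hq) hρn
  have hQ := integrableOn_derivation (m := m) hq
  have hfam : N.firstIterate q x ρ =
      ∫ t in volterraSet N.ε x, N.kernel x t ρ (derivation m (q t) (N.free (ρ * t))) := by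
    refine setIntegral_congr_fun hJm fun t ht => ?_
    have ht0 : 0 ≤ t := ht.1.le
    simp only [freeFamily, Real.coe_toNNReal t ht0]
  have hmono : ∫ t in volterraSet N.ε x, min 1 (‖(ρ : ℂ)‖ * t)⁻¹ * entrySum (q t) ≤
      remainderIntegral q ‖(ρ : ℂ)‖ := by
    refine setIntegral_mono_set hi ?_ hJ.eventuallyLE
    filter_upwards [self_mem_ae_restrict measurableSet_Ioi] with t ht
    have ht : 0 < t := ht
    have := entrySum_nonneg (q t)
    simp only [Pi.zero_apply]
    positivity
  have hiJ : IntegrableOn (fun t => min 1 (‖(ρ : ℂ)‖ * t)⁻¹ * entrySum (q t))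
      (volterraSet N.ε x) := IntegrableOn.mono_set hi hJ
  by_cases hcase : N.ε = -1 ∨ 1 < ‖(ρ : ℂ) * (x : ℝ)‖
  · have hphase : ∀ z ∈ N.phaseIndex, IntegrableOn (fun t : ℝ =>
        q t (N.σ z.1) (N.σ z.2.1) *
          Complex.exp (ρ * (((x : ℝ) - t) * N.shift z + t * N.rDiff z.2.2)))
        (volterraSet N.ε x) := fun z hz => by
      obtain ⟨-, hz2, hz3⟩ := N.mem_phaseIndex.1 hz
      exact integrableOn_phase N.sign (N.re_shift_le hz3 ρ.2) (N.re_rDiff_le hz2 ρ.2) (hq _ _) x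
    have hmain : (fun t => N.mainTerm (q t) x t ρ) =ᵐ[volume.restrict (volterraSet N.ε x)]
        fun t => ∑ z ∈ N.phaseIndex, (q t (N.σ z.1) (N.σ z.2.1) *
          Complex.exp (ρ * (((x : ℝ) - t) * N.shift z + t * N.rDiff z.2.2))) •
        ((tensorBasis n m).repr N.coeff z.2.2 • N.nop (ρ * (x : ℝ)) (unitVec z)) := by
      have h := ae_all_iff.2 hdiag
      filter_upwards [ae_restrict_of_ae_restrict_of_subset hJ h] with t ht
      exact N.mainTerm_eq_sum (q t) ht x t ρ
    have hint : ∀ z ∈ N.phaseIndex, Integrable (fun t : ℝ => (q t (N.σ z.1) (N.σ z.2.1) *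
          Complex.exp (ρ * (((x : ℝ) - t) * N.shift z + t * N.rDiff z.2.2))) •
        ((tensorBasis n m).repr N.coeff z.2.2 • N.nop (ρ * (x : ℝ)) (unitVec z)))
        (volume.restrict (volterraSet N.ε x)) := fun z hz => Integrable.smul_const (hphase z hz) _
    have hmainint : IntegrableOn (fun t => N.mainTerm (q t) x t ρ) (volterraSet N.ε x) :=
      Integrable.congr (integrable_finsetSum _ hint) hmain.symm
    have hmaineq : ∫ t in volterraSet N.ε x, N.mainTerm (q t) x t ρ =
        ∑ z ∈ N.phaseIndex, phaseIntegral N.ε (N.shift z) (N.rDiff z.2.2) ρ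
          (fun t => q t (N.σ z.1) (N.σ z.2.1)) x •
          ((tensorBasis n m).repr N.coeff z.2.2 • N.nop (ρ * (x : ℝ)) (unitVec z)) := by
      rw [integral_congr_ae hmain, integral_finsetSum _ hint]
      exact Finset.sum_congr rfl fun z _ => integral_smul_const _ _
    have hkint : IntegrableOn (fun t => N.kernel x t ρ (derivation m (q t) (N.free (ρ * t))))
        (volterraSet N.ε x) := by
      have h := hker.integrableOn hQ (aestronglyMeasurable_family N.continuous_freeFamily ρ _)
        (fun t _ => hf _ (N.mul_mem ρ.2 (NNReal.coe_nonneg _))) x ρ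
      refine h.congr_fun (fun t ht => ?_) hJm
      have ht0 : 0 ≤ t := ht.1.le
      simp only [freeFamily, Real.coe_toNNReal t ht0]
    have hsplit : N.firstIterate q x ρ = (∫ t in volterraSet N.ε x,
        (N.kernel x t ρ (derivation m (q t) (N.free (ρ * t))) - N.mainTerm (q t) x t ρ)) +
        ∫ t in volterraSet N.ε x, N.mainTerm (q t) x t ρ := by
      rw [hfam, integral_sub hkint hmainint, sub_add_cancel]
    have hb1 : ‖∫ t in volterraSet N.ε x,
        (N.kernel x t ρ (derivation m (q t) (N.free (ρ * t))) - N.mainTerm (q t) x t ρ)‖ ≤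
        C₁ * remainderIntegral q ‖(ρ : ℂ)‖ := by
      refine (norm_integral_le_of_norm_le (Integrable.const_mul hiJ C₁) ?_).trans ?_
      · filter_upwards [self_mem_ae_restrict hJm] with t ht
        exact h1 (q t) x t ρ hρ ht hcase
      · rw [integral_const_mul]
        gcongr
    have hb2 : ‖∫ t in volterraSet N.ε x, N.mainTerm (q t) x t ρ‖ ≤ M * N.phaseSum q x ρ := by
      rw [hmaineq, phaseSum, Finset.mul_sum]
      refine (norm_sum_le _ _).trans (Finset.sum_le_sum fun z _ => ?_)
      rw [norm_smul, mul_comm]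
      refine mul_le_mul_of_nonneg_right ?_ (norm_nonneg _)
      rw [norm_smul]
      refine le_trans ?_ (Finset.single_le_sum (f := fun z =>
        ‖(tensorBasis n m).repr N.coeff z.2.2‖ * (Cn * ‖unitVec z‖))
        (fun _ _ => by positivity) (Finset.mem_univ z))
      refine mul_le_mul_of_nonneg_left (((N.nop _).le_opNorm _).trans ?_) (norm_nonneg _)
      exact mul_le_mul_of_nonneg_right
        (hn _ (N.mul_mem ρ.2 (NNReal.coe_nonneg x)) hcase) (norm_nonneg _)
    rw [hsplit]
    refine (norm_add_le _ _).trans ((add_le_add hb1 hb2).trans ?_)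
    have : 0 ≤ Cκ * Ld * B := by positivity
    nlinarith [mul_nonneg this hP0, mul_nonneg this hR0, mul_nonneg hC₁ hP0, mul_nonneg hM0 hR0]
  · -- `ε = 1` and `|ρ x| ≤ 1`, hence `|ρ t| ≤ 1` on the domain of integration
    push Not at hcase
    have hε : N.ε = 1 := N.sign.resolve_right hcase.1
    have hx := hcase.2
    rw [norm_mul, Complex.norm_real, Real.norm_of_nonneg (NNReal.coe_nonneg x)] at hx
    have hb : ‖N.firstIterate q x ρ‖ ≤ (Cκ * Ld * B) * remainderIntegral q ‖(ρ : ℂ)‖ := by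
      rw [hfam]
      refine (norm_integral_le_of_norm_le (Integrable.const_mul hiJ (Cκ * Ld * B)) ?_).trans ?_
      · filter_upwards [self_mem_ae_restrict hJm] with t ht
        have ht0 : 0 < t := ht.1
        have htx : t < x := by simpa [hε] using ht.2
        have hmin : min 1 (‖(ρ : ℂ)‖ * t)⁻¹ = 1 := by
          rw [min_eq_left]
          refine (one_le_inv₀ (by positivity)).2 (le_trans ?_ hx)
          gcongr
        rw [hmin, one_mul]
        have hD := hd (q t)
        refine ((N.kernel x t ρ).le_opNorm _).trans ?_
        calc _ ≤ Cκ * (Ld * entrySum (q t) * B) :=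
              mul_le_mul (hker.bound x t ρ ht) (((derivation m (q t)).le_opNorm _).trans
                (mul_le_mul hD (hf _ (N.mul_mem ρ.2 ht0.le)) (norm_nonneg _)
                  (mul_nonneg hLd (entrySum_nonneg _)))) (norm_nonneg _) hCκ.le
          _ = _ := by ring
      · rw [integral_const_mul]
        gcongr
    refine hb.trans ?_
    have h2 : 0 ≤ Cκ * Ld * B := by positivity
    nlinarith [mul_nonneg h2 hP0, mul_nonneg hC₁ hR0, mul_nonneg hC₁ hP0, mul_nonneg hM0 hR0,
      mul_nonneg hM0 hP0]

end TensorModel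

/-! ### Estimates of the first iterate -/

/-- Off-diagonal matrix functions with entries of finite `potentialSize`. -/
structure IsPotential {n : ℕ} (q : ℝ → Matrix (Fin n) (Fin n) ℂ) : Prop where
  aestronglyMeasurable : ∀ i j, AEStronglyMeasurable (fun t => q t i j) halfLine
  size_ne_top : ∀ i j, potentialSize (fun t => q t i j) ≠ ⊤
  diag : ∀ i, (fun t => q t i i) =ᵐ[halfLine] 0

/-- The sum of the sizes of the entries. -/
def matrixSize {n : ℕ} (q : ℝ → Matrix (Fin n) (Fin n) ℂ) : ℝ≥0∞ :=
  ∑ i, ∑ j, potentialSize fun t => q t i j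

theorem potentialSize_le_matrixSize {n : ℕ} (q : ℝ → Matrix (Fin n) (Fin n) ℂ) (i j : Fin n) :
    (potentialSize fun t => q t i j) ≤ matrixSize q :=
  (Finset.single_le_sum (f := fun j => potentialSize fun t => q t i j) (fun _ _ => zero_le)
    (Finset.mem_univ j)).trans
    (Finset.single_le_sum (f := fun i => ∑ j, potentialSize fun t => q t i j)
      (fun _ _ => zero_le) (Finset.mem_univ i))

theorem potentialSize_congr {f g : ℝ → ℂ} (h : f =ᵐ[halfLine] g) :
    potentialSize f = potentialSize g := by
  rw [potentialSize, potentialSize, eLpNorm_congr_ae h]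
  congr 1
  refine lintegral_congr_ae ?_
  filter_upwards [h] with t ht
  rw [ht]

theorem potentialSize_zero : potentialSize 0 = 0 := by
  simp [potentialSize]

theorem potentialSize_neg (f : ℝ → ℂ) : potentialSize (-f) = potentialSize f := by
  simp [potentialSize, eLpNorm_neg]

namespace IsPotential

variable {n : ℕ} {q g : ℝ → Matrix (Fin n) (Fin n) ℂ}

theorem integrableOn (hq : IsPotential q) (i j : Fin n) :
    IntegrableOn (fun t => q t i j) (Ioi 0) :=
  integrableOn_of_potentialSize (hq.aestronglyMeasurable i j) (hq.size_ne_top i j)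

theorem memLp (hq : IsPotential q) (i j : Fin n) : MemLp (fun t => q t i j) 2 halfLine :=
  memLp_two_of_potentialSize (hq.aestronglyMeasurable i j) (hq.size_ne_top i j)

theorem matrixSize_ne_top (hq : IsPotential q) : matrixSize q ≠ ⊤ :=
  ENNReal.sum_ne_top.2 fun i _ => ENNReal.sum_ne_top.2 fun j _ => hq.size_ne_top i j

theorem sub (hq : IsPotential q) (hg : IsPotential g) : IsPotential (q - g) := by
  refine ⟨fun i j => (hq.aestronglyMeasurable i j).sub (hg.aestronglyMeasurable i j),
    fun i j => ?_, fun i => ?_⟩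
  · have h := potentialSize_add_le (hq.aestronglyMeasurable i j) (hg.aestronglyMeasurable i j).neg
    rw [potentialSize_neg, ← sub_eq_add_neg] at h
    exact ne_top_of_le_ne_top (ENNReal.add_ne_top.2 ⟨hq.size_ne_top i j, hg.size_ne_top i j⟩) h
  · filter_upwards [hq.diag i, hg.diag i] with t h1 h2
    change q t i i - g t i i = 0
    rw [h1, h2]
    simp

end IsPotential

/-- Continuously differentiable functions cut off to a compact interval in `(0,∞)`, with zero
diagonal. -/
structure IsSmoothPotential {n : ℕ} (g : ℝ → Matrix (Fin n) (Fin n) ℂ) : Prop where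
  smooth : ∀ i j, ∃ (h : ℝ → ℂ) (c d : ℝ), ContDiff ℝ 1 h ∧ 0 < c ∧
    (fun t => g t i j) = (Icc c d).indicator h
  diag : ∀ t i, g t i i = 0

theorem IsPotential.exists_smooth_approx {n : ℕ} {q : ℝ → Matrix (Fin n) (Fin n) ℂ}
    (hq : IsPotential q) {η : ℝ≥0∞} (hη : η ≠ 0)
    (hηt : η ≠ ⊤) :
    ∃ g, IsPotential g ∧ IsSmoothPotential g ∧ matrixSize (q - g) ≤ η := by
  set η' := η / (n * n + 1 : ℝ≥0∞) with hη'
  have hη0 : η' ≠ 0 := ENNReal.div_ne_zero.2 ⟨hη, by finiteness⟩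
  have h : ∀ i j, ∃ (h : ℝ → ℂ) (c d : ℝ), ContDiff ℝ 1 h ∧ 0 < c ∧ (i = j → h = 0) ∧
      potentialSize ((fun t => q t i j) - (Icc c d).indicator h) ≤ η' := by
    intro i j
    by_cases hij : i = j
    · subst hij
      refine ⟨0, 1, 1, contDiff_const, one_pos, fun _ => rfl, ?_⟩
      have h1 : ((fun t => q t i i) - (Icc (1 : ℝ) 1).indicator (0 : ℝ → ℂ)) =ᵐ[halfLine] 0 := by
        filter_upwards [hq.diag i] with t ht
        rw [Pi.sub_apply, ht]
        simp
      rw [potentialSize_congr h1, potentialSize_zero]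
      exact zero_le
    · obtain ⟨h, c, d, h1, h2, h3⟩ := WeylTensor.exists_smooth_approx
        (hq.aestronglyMeasurable i j) (hq.size_ne_top i j) hη0
      exact ⟨h, c, d, h1, h2, fun h => absurd h hij, h3⟩
  choose h c d h1 h2 h3 h4 using h
  set g : ℝ → Matrix (Fin n) (Fin n) ℂ := fun t => Matrix.of fun i j =>
    (Icc (c i j) (d i j)).indicator (h i j) t with hg
  have hdiag : ∀ t i, g t i i = 0 := fun t i => by
    simp [hg, h3 i i rfl]
  have hmeas : ∀ i j, AEStronglyMeasurable (fun t => g t i j) halfLine := fun i j =>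
    (h1 i j).continuous.aestronglyMeasurable.indicator measurableSet_Icc
  refine ⟨g, ⟨hmeas, fun i j => ?_, fun i => Eventually.of_forall fun t => hdiag t i⟩,
    ⟨fun i j => ⟨h i j, c i j, d i j, h1 i j, h2 i j, rfl⟩, hdiag⟩, ?_⟩
  · have h5 := potentialSize_add_le (hq.aestronglyMeasurable i j)
      ((hq.aestronglyMeasurable i j).sub (hmeas i j)).neg
    rw [potentialSize_neg] at h5
    have h6 : ((fun t => q t i j) + -((fun t => q t i j) - fun t => g t i j)) =
        fun t => g t i j := by
      funext t
      simp
    have h7 : potentialSize ((fun t => q t i j) - fun t => g t i j) ≤ η' := h4 i j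
    have h8 : η' ≠ ⊤ := ENNReal.div_ne_top hηt (by positivity)
    rw [h6] at h5
    exact ne_top_of_le_ne_top
      (ENNReal.add_ne_top.2 ⟨hq.size_ne_top i j, ne_top_of_le_ne_top h8 h7⟩) h5
  · calc matrixSize (q - g) ≤ ∑ i : Fin n, ∑ j : Fin n, η' :=
        Finset.sum_le_sum fun i _ => Finset.sum_le_sum fun j _ => h4 i j
      _ = (n * n : ℝ≥0∞) * η' := by simp [mul_assoc]
      _ ≤ (n * n + 1 : ℝ≥0∞) * η' := mul_le_mul_left le_self_add _
      _ = η := ENNReal.mul_div_cancel (by positivity) (by finiteness)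

theorem lintegral_entrySum_le {n : ℕ} {q : ℝ → Matrix (Fin n) (Fin n) ℂ} (hq : IsPotential q)
    {φ : ℝ → ℝ≥0∞} (hφ : Measurable φ)
    (hle : ∀ t, 0 < t → φ t ≤ ENNReal.ofReal (1 + t ^ (-(1 / 2) : ℝ))) :
    ∫⁻ t in Ioi 0, φ t * ENNReal.ofReal (entrySum (q t)) ≤ matrixSize q := by
  have h1 : ∀ t, φ t * ENNReal.ofReal (entrySum (q t)) = ∑ i, ∑ j, φ t * ‖q t i j‖ₑ := fun t => by
    have h0 : ENNReal.ofReal (entrySum (q t)) = ∑ i, ENNReal.ofReal (∑ j, ‖q t i j‖) :=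
      ENNReal.ofReal_sum_of_nonneg fun _ _ => Finset.sum_nonneg fun _ _ => norm_nonneg _
    rw [h0, Finset.mul_sum]
    refine Finset.sum_congr rfl fun i _ => ?_
    rw [ENNReal.ofReal_sum_of_nonneg fun _ _ => norm_nonneg _, Finset.mul_sum]
    exact Finset.sum_congr rfl fun j _ => by rw [ofReal_norm]
  have hm : ∀ i j, AEMeasurable (fun t => φ t * ‖q t i j‖ₑ) halfLine := fun i j =>
    hφ.aemeasurable.mul (hq.aestronglyMeasurable i j).enorm
  simp only [h1]
  rw [lintegral_finsetSum' _ fun i _ => Finset.aemeasurable_fun_sum _ fun j _ => hm i j]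
  refine Finset.sum_le_sum fun i _ => ?_
  rw [lintegral_finsetSum' _ fun j _ => hm i j]
  refine Finset.sum_le_sum fun j _ => le_add_right (setLIntegral_mono' measurableSet_Ioi ?_)
  exact fun t ht => mul_le_mul_left (hle t ht) _

theorem integral_entrySum_le {n : ℕ} {q : ℝ → Matrix (Fin n) (Fin n) ℂ} (hq : IsPotential q) :
    ∫ t in Ioi 0, entrySum (q t) ≤ (matrixSize q).toReal := by
  rw [integral_eq_lintegral_of_nonneg_ae (Eventually.of_forall fun t => entrySum_nonneg _)
    (integrableOn_entrySum hq.integrableOn).1]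
  refine ENNReal.toReal_mono hq.matrixSize_ne_top ?_
  refine le_trans (lintegral_mono fun t => ?_) (lintegral_entrySum_le hq (φ := fun _ => 1)
    measurable_const fun t ht => ?_)
  · rw [one_mul]
  · rw [ENNReal.one_le_ofReal]
    have : 0 ≤ t ^ (-(1 / 2) : ℝ) := by positivity
    linarith

theorem eLpNorm_remainderIntegral_le {n : ℕ} {q : ℝ → Matrix (Fin n) (Fin n) ℂ}
    (hq : IsPotential q) :
    eLpNorm (fun s => remainderIntegral q s) 2 halfLine ≤ 2 * matrixSize q := by
  have hF : AEMeasurable (fun t => ENNReal.ofReal (entrySum (q t))) halfLine :=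
    (integrableOn_entrySum hq.integrableOn).1.aemeasurable.ennreal_ofReal
  have h1 := lintegral_remainder_sq_le hF one_pos
  have h2 : ∫⁻ t in Ioi 0, ENNReal.ofReal (t ^ (-(1 / 2) : ℝ)) * ENNReal.ofReal (entrySum (q t)) ≤
      matrixSize q := by
    refine lintegral_entrySum_le hq (by fun_prop) fun t ht => ENNReal.ofReal_le_ofReal ?_
    linarith
  refine (ENNReal.pow_le_pow_left_iff two_ne_zero).1 ?_
  rw [eLpNorm_two_sq]
  calc _ ≤ ∫⁻ s : ℝ in Ioi 0, (∫⁻ t in Ioi 0, ENNReal.ofReal (min 1 (s * (1 * t))⁻¹) *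
        ENNReal.ofReal (entrySum (q t))) ^ 2 := by
        refine setLIntegral_mono' measurableSet_Ioi fun s hs => ?_
        have hs : 0 < s := hs
        refine pow_le_pow_left₀ zero_le ((enorm_integral_le_lintegral_enorm _).trans ?_) 2
        refine setLIntegral_mono' measurableSet_Ioi fun t ht => ?_
        have ht : 0 < t := ht
        rw [enorm_mul, one_mul, Real.enorm_of_nonneg (by positivity),
          Real.enorm_of_nonneg (entrySum_nonneg _)]
    _ ≤ 2 * ENNReal.ofReal 1⁻¹ * matrixSize q ^ 2 := by
        refine h1.trans ?_
        gcongr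
    _ ≤ (2 * matrixSize q) ^ 2 := by
        rw [inv_one, ENNReal.ofReal_one, mul_one, mul_pow]
        gcongr
        norm_num

theorem aestronglyMeasurable_phaseIntegral {ε : ℝ} {a' a z : ℂ} {f : ℝ → ℂ}
    (hf : AEStronglyMeasurable f halfLine) (x : ℝ) :
    AEStronglyMeasurable (fun s : ℝ => phaseIntegral ε a' a (s * z) f x) halfLine := by
  have hf' : AEStronglyMeasurable f (volume.restrict (volterraSet ε x)) :=
    hf.mono_measure (Measure.restrict_mono (volterraSet_subset ε x) le_rfl)
  have h : AEStronglyMeasurable (fun y : ℝ × ℝ => f y.2 *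
      Complex.exp (y.1 * z * ((x - y.2) * a' + y.2 * a)))
      (halfLine.prod (volume.restrict (volterraSet ε x))) :=
    hf'.comp_snd.mul (Continuous.aestronglyMeasurable (by fun_prop))
  exact h.integral_prod_right'

theorem aestronglyMeasurable_remainderIntegral {n : ℕ} {q : ℝ → Matrix (Fin n) (Fin n) ℂ}
    (hq : ∀ i j, IntegrableOn (fun t => q t i j) (Ioi 0)) :
    AEStronglyMeasurable (fun s => remainderIntegral q s) halfLine := by
  have h : AEStronglyMeasurable (fun y : ℝ × ℝ => min 1 (y.1 * y.2)⁻¹ * entrySum (q y.2))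
      (halfLine.prod halfLine) :=
    AEStronglyMeasurable.mul (Measurable.aestronglyMeasurable (by fun_prop))
      (integrableOn_entrySum hq).1.comp_snd
  exact h.integral_prod_right'

namespace TensorModel

variable {n m : ℕ} {S : Set ℂ} (N : TensorModel n m S)

theorem shift_ne (N : TensorModel n m S) {z : Fin n × Fin n × Set.powersetCard (Fin n) m}
    (h : z.1 ≠ z.2.1) : N.shift z ≠ N.rDiff z.2.2 := by
  intro he
  rw [shift, add_sub_assoc] at he
  exact h (N.R_injective (sub_eq_zero.1 (left_eq_add.1 he.symm)))

theorem exists_eLpNorm_phaseSum_le {z : ℂ} (hz : z ∈ closure S) (h0 : z ≠ 0) :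
    ∃ K : ℝ≥0∞, K ≠ ⊤ ∧ ∀ q : ℝ → Matrix (Fin n) (Fin n) ℂ, IsPotential q → ∀ (x : ℝ≥0)
      (r : ℝ → closure S), (∀ s, 0 ≤ s → (r s : ℂ) = s * z) →
        eLpNorm (fun s => N.phaseSum q x (r s)) 2 halfLine ≤ K * matrixSize q := by
  have h : ∀ y ∈ N.phaseIndex, ∃ C : ℝ≥0, ∀ f : ℝ → ℂ, IntegrableOn f (Ioi 0) →
      MemLp f 2 halfLine → ∀ x : ℝ, 0 ≤ x →
        ∫⁻ s : ℝ in Ioi 0, ‖phaseIntegral N.ε (N.shift y) (N.rDiff y.2.2) (s * z) f x‖ₑ ^ 2 ≤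
          C * ∫⁻ t in Ioi 0, ‖f t‖ₑ ^ 2 := fun y hy => by
    obtain ⟨h1, h2, h3⟩ := N.mem_phaseIndex.1 hy
    exact exists_phaseIntegral_sq_le N.sign h0 (N.shift_ne h1) (N.re_shift_le h3 hz)
      (N.re_rDiff_le h2 hz)
  choose! C hC using h
  refine ⟨∑ y ∈ N.phaseIndex, ((C y : ℝ≥0∞) + 1),
    ENNReal.sum_ne_top.2 fun _ _ => by finiteness, fun q hq x r hr => ?_⟩
  have hae : (fun s => N.phaseSum q x (r s)) =ᵐ[halfLine] fun s => ∑ y ∈ N.phaseIndex,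
      ‖phaseIntegral N.ε (N.shift y) (N.rDiff y.2.2) (s * z)
        (fun t => q t (N.σ y.1) (N.σ y.2.1)) x‖ := by
    filter_upwards [self_mem_ae_restrict measurableSet_Ioi] with s hs
    rw [phaseSum, hr s (le_of_lt hs)]
  rw [eLpNorm_congr_ae hae, Finset.sum_mul, ← Finset.sum_fn]
  refine (eLpNorm_sum_le (fun y _ => (aestronglyMeasurable_phaseIntegral
    (hq.aestronglyMeasurable _ _) x).norm) one_le_two).trans (Finset.sum_le_sum fun y hy => ?_)
  rw [eLpNorm_norm]
  refine (ENNReal.pow_le_pow_left_iff two_ne_zero).1 ?_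
  rw [eLpNorm_two_sq]
  refine (hC y hy _ (hq.integrableOn _ _) (hq.memLp _ _) x x.2).trans ?_
  rw [← eLpNorm_two_sq, mul_pow]
  have h2 : eLpNorm (fun t => q t (N.σ y.1) (N.σ y.2.1)) 2 halfLine ≤ matrixSize q :=
    (le_add_left le_rfl).trans (potentialSize_le_matrixSize q (N.σ y.1) (N.σ y.2.1))
  have h3 : (C y : ℝ≥0∞) ≤ (C y + 1) ^ 2 := by
    have : (C y : ℝ≥0) ≤ (C y + 1) ^ 2 := by nlinarith [(C y).2, zero_le (a := C y)]
    exact_mod_cast this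
  gcongr

/-- Square integrability of the first iterate along rays. -/
theorem exists_eLpNorm_firstIterate_le {z : ℂ} (hz : z ∈ closure S) (h1 : ‖z‖ = 1) :
    ∃ K : ℝ≥0∞, K ≠ ⊤ ∧ ∀ q : ℝ → Matrix (Fin n) (Fin n) ℂ, IsPotential q → ∀ (x : ℝ≥0)
      (r : ℝ → closure S), (∀ s, 0 ≤ s → (r s : ℂ) = s * z) →
        eLpNorm (fun s => N.firstIterate q x (r s)) 2 halfLine ≤ K * matrixSize q := by
  have h0 : z ≠ 0 := fun h => by simp [h] at h1
  obtain ⟨K, hK, hle⟩ := N.exists_eLpNorm_phaseSum_le hz h0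
  obtain ⟨C, hC, hU⟩ := N.exists_firstIterate_le
  refine ⟨ENNReal.ofReal C * (K + 2), by finiteness, fun q hq x r hr => ?_⟩
  have hae : ∀ᵐ s ∂halfLine, ‖N.firstIterate q x (r s)‖ ≤ C * ‖N.phaseSum q x (r s) +
      remainderIntegral q s‖ := by
    filter_upwards [self_mem_ae_restrict measurableSet_Ioi] with s hs
    have hs : 0 < s := hs
    have hrs := hr s hs.le
    have hne : (r s : ℂ) ≠ 0 := by
      rw [hrs]
      exact mul_ne_zero (by exact_mod_cast hs.ne') h0
    have hn : ‖(r s : ℂ)‖ = s := by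
      rw [hrs, norm_mul, h1, mul_one, Complex.norm_real, Real.norm_of_nonneg hs.le]
    have := hU q hq.integrableOn hq.diag x (r s) hne
    rw [hn] at this
    exact this.trans (mul_le_mul_of_nonneg_left (Real.le_norm_self _) hC)
  refine (eLpNorm_le_mul_eLpNorm_of_ae_le_mul hae 2).trans ?_
  rw [mul_assoc]
  refine mul_le_mul_right ?_ _
  have hm : AEStronglyMeasurable (fun s => N.phaseSum q x (r s)) halfLine := by
    have hae : (fun s => N.phaseSum q x (r s)) =ᵐ[halfLine] fun s => ∑ y ∈ N.phaseIndex,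
        ‖phaseIntegral N.ε (N.shift y) (N.rDiff y.2.2) (s * z)
          (fun t => q t (N.σ y.1) (N.σ y.2.1)) x‖ := by
      filter_upwards [self_mem_ae_restrict measurableSet_Ioi] with s hs
      rw [phaseSum, hr s (le_of_lt hs)]
    refine AEStronglyMeasurable.congr ?_ hae.symm
    exact Finset.aestronglyMeasurable_fun_sum _ fun y _ =>
      (aestronglyMeasurable_phaseIntegral (hq.aestronglyMeasurable _ _) x).norm
  refine (eLpNorm_add_le hm (aestronglyMeasurable_remainderIntegral hq.integrableOn)
    one_le_two).trans ?_
  rw [add_mul]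
  exact add_le_add (hle q hq x r hr) (eLpNorm_remainderIntegral_le hq)

/-- For a smooth potential the oscillating integrals are `O(1/|ρ|)` uniformly in `x`. -/
theorem exists_phaseSum_le_of_smooth {g : ℝ → Matrix (Fin n) (Fin n) ℂ} (hg : IsPotential g)
    (hgs : IsSmoothPotential g) : ∃ D : ℝ, 0 ≤ D ∧ ∀ (x : ℝ≥0) (ρ : closure S), (ρ : ℂ) ≠ 0 →
      N.phaseSum g x ρ ≤ D * min 1 ‖(ρ : ℂ)‖⁻¹ := by
  have h : ∀ y ∈ N.phaseIndex, ∃ D : ℝ, 0 ≤ D ∧ ∀ (x : ℝ≥0) (ρ : closure S), (ρ : ℂ) ≠ 0 →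
      ‖phaseIntegral N.ε (N.shift y) (N.rDiff y.2.2) ρ
        (fun t => g t (N.σ y.1) (N.σ y.2.1)) x‖ ≤ D * min 1 ‖(ρ : ℂ)‖⁻¹ := fun y hy => by
    obtain ⟨h1, h2, h3⟩ := N.mem_phaseIndex.1 hy
    obtain ⟨f, c, d, hf, hc, he⟩ := hgs.smooth (N.σ y.1) (N.σ y.2.1)
    obtain ⟨C, hC, hle⟩ := exists_phaseIntegral_le_inv N.sign (N.shift_ne h1) hf
      (c := c) (d := d) hc.le
    set A := ∫ t in Ioi 0, ‖g t (N.σ y.1) (N.σ y.2.1)‖ with hA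
    have hA0 : 0 ≤ A := integral_nonneg fun _ => norm_nonneg _
    refine ⟨A + C, by positivity, fun x ρ hρ => ?_⟩
    have e1 := norm_phaseIntegral_le N.sign (N.re_shift_le h3 ρ.2) (N.re_rDiff_le h2 ρ.2)
      (hg.integrableOn (N.σ y.1) (N.σ y.2.1)) x
    have e2 := hle ρ hρ (N.re_shift_le h3 ρ.2) (N.re_rDiff_le h2 ρ.2) x x.2
    rw [← he] at e2
    have hinv : 0 ≤ ‖(ρ : ℂ)‖⁻¹ := by positivity
    rcases min_cases 1 ‖(ρ : ℂ)‖⁻¹ with ⟨h, -⟩ | ⟨h, -⟩ <;> rw [h]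
    · linarith
    · nlinarith
  choose! D hD hle using h
  refine ⟨∑ y ∈ N.phaseIndex, D y, Finset.sum_nonneg hD, fun x ρ hρ => ?_⟩
  rw [phaseSum, Finset.sum_mul]
  exact Finset.sum_le_sum fun y hy => hle y hy x ρ hρ

theorem firstIterate_sub {q g : ℝ → Matrix (Fin n) (Fin n) ℂ} (hq : IsPotential q)
    (hg : IsPotential g) (x : ℝ≥0) (ρ : closure S) :
    N.firstIterate (q - g) x ρ = N.firstIterate q x ρ - N.firstIterate g x ρ := by
  obtain ⟨C, hκ⟩ := N.exists_isVolterraKernel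
  obtain ⟨B, hB, hf⟩ := N.exists_free_bound
  have h := volterraOp_sub_left hκ (integrableOn_derivation (m := m) hq.integrableOn)
    (integrableOn_derivation (m := m) hg.integrableOn) N.continuous_freeFamily
    (fun x ρ => hf _ (N.mul_mem ρ.2 (NNReal.coe_nonneg x))) x ρ
  rw [firstIterate, firstIterate, firstIterate, ← h]
  congr 1
  funext t
  exact map_sub _ _ _

theorem exists_firstIterate_le_size : ∃ C : ℝ, 0 ≤ C ∧
    ∀ q : ℝ → Matrix (Fin n) (Fin n) ℂ, IsPotential q → ∀ (x : ℝ≥0) (ρ : closure S),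
      ‖N.firstIterate q x ρ‖ ≤ C * (matrixSize q).toReal := by
  obtain ⟨C, hκ⟩ := N.exists_isVolterraKernel
  obtain ⟨B, hB, hf⟩ := N.exists_free_bound
  obtain ⟨L, hL, hd⟩ := exists_derivation_bound n m
  have hC := hκ.pos
  refine ⟨C * (L * B), by positivity, fun q hq x ρ => ?_⟩
  refine (hκ.norm_volterraOp_le_bound (integrableOn_derivation (m := m) hq.integrableOn)
    N.continuous_freeFamily (fun x ρ => hf _ (N.mul_mem ρ.2 (NNReal.coe_nonneg x))) x ρ).trans ?_
  have h1 : ∫ t in Ioi 0, ‖derivation m (q t)‖ ≤ L * (matrixSize q).toReal := by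
    refine (integral_mono (integrableOn_derivation (m := m) hq.integrableOn).norm
      ((integrableOn_entrySum hq.integrableOn).const_mul L) fun t => hd (q t)).trans ?_
    rw [integral_const_mul]
    exact mul_le_mul_of_nonneg_left (integral_entrySum_le hq) hL
  calc _ ≤ C * (L * (matrixSize q).toReal * B) := by gcongr
    _ = _ := by ring

theorem continuous_firstIterate {q : ℝ → Matrix (Fin n) (Fin n) ℂ} (hq : IsPotential q) :
    Continuous fun z : ℝ≥0 × closure S => N.firstIterate q z.1 z.2 := by
  obtain ⟨C, hκ⟩ := N.exists_isVolterraKernel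
  obtain ⟨B, hB, hf⟩ := N.exists_free_bound
  exact hκ.continuous_volterraOp (integrableOn_derivation (m := m) hq.integrableOn)
    N.continuous_freeFamily (fun x ρ => hf _ (N.mul_mem ρ.2 (NNReal.coe_nonneg x)))

theorem tendsto_norm_closure (S : Set ℂ) :
    Tendsto (fun ρ : closure S => ‖(ρ : ℂ)‖) (cocompact (closure S)) atTop :=
  (tendsto_norm_cocompact_atTop).comp
    isClosed_closure.isClosedEmbedding_subtypeVal.tendsto_cocompact

/-- The first iterate vanishes at infinity uniformly in `x`, by approximation with smooth
potentials. -/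
theorem firstIterate_vanishing {q : ℝ → Matrix (Fin n) (Fin n) ℂ} (hq : IsPotential q) (η : ℝ)
    (hη : 0 < η) : ∀ᶠ ρ in cocompact (closure S), ∀ x, ‖N.firstIterate q x ρ‖ ≤ η := by
  obtain ⟨C, hC, h1⟩ := N.exists_firstIterate_le_size
  obtain ⟨C', hC', h2⟩ := N.exists_firstIterate_le
  set δ := η / 2 / (C + 1) with hδ
  have hδ0 : 0 < δ := by positivity
  obtain ⟨g, hg, hgs, hgq⟩ := hq.exists_smooth_approx (η := ENNReal.ofReal δ)
    (by simpa using hδ0) ENNReal.ofReal_ne_top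
  obtain ⟨D, hD, h3⟩ := N.exists_phaseSum_le_of_smooth hg hgs
  have hlim : Tendsto (fun r : ℝ => C' * (D * r⁻¹ + remainderIntegral g r)) atTop (𝓝 0) := by
    have e1 := tendsto_remainder (integrableOn_entrySum hg.integrableOn)
    simp only [abs_of_nonneg (entrySum_nonneg _)] at e1
    have e2 := ((tendsto_inv_atTop_zero (𝕜 := ℝ)).const_mul D).add e1
    simpa [remainderIntegral] using e2.const_mul C'
  have hev : ∀ᶠ r : ℝ in atTop, C' * (D * r⁻¹ + remainderIntegral g r) < η / 2 ∧ 0 < r :=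
    (hlim.eventually (gt_mem_nhds (half_pos hη))).and (eventually_gt_atTop 0)
  filter_upwards [(tendsto_norm_closure S).eventually hev] with ρ hρ x
  obtain ⟨h4, h5⟩ := hρ
  have h6 : ‖N.firstIterate g x ρ‖ ≤ η / 2 := by
    refine (h2 g hg.integrableOn hg.diag x ρ (norm_pos_iff.1 h5)).trans (le_trans ?_ h4.le)
    have := (h3 x ρ (norm_pos_iff.1 h5)).trans
      (mul_le_mul_of_nonneg_left (min_le_right _ _) hD)
    gcongr
  have h7 : ‖N.firstIterate (q - g) x ρ‖ ≤ η / 2 := by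
    refine (h1 _ (hq.sub hg) x ρ).trans ?_
    have : (matrixSize (q - g)).toReal ≤ δ := ENNReal.toReal_le_of_le_ofReal hδ0.le hgq
    calc C * (matrixSize (q - g)).toReal ≤ (C + 1) * δ := by gcongr; linarith
      _ = η / 2 := by rw [hδ]; field_simp
  have h8 : N.firstIterate q x ρ = N.firstIterate (q - g) x ρ + N.firstIterate g x ρ := by
    rw [N.firstIterate_sub hq hg, sub_add_cancel]
  rw [h8]
  exact (norm_add_le _ _).trans (by linarith)

/-- For a smooth potential the first iterate along a ray is dominated, uniformly in `x`, by a
square integrable function. -/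
theorem firstIterate_continuous_right_of_smooth {g : ℝ → Matrix (Fin n) (Fin n) ℂ}
    (hg : IsPotential g) (hgs : IsSmoothPotential g) {z : ℂ} (h1 : ‖z‖ = 1)
    {r : ℝ → closure S} (hrc : Continuous r) (hr : ∀ s, 0 ≤ s → (r s : ℂ) = s * z) (x₀ : ℝ≥0) :
    Tendsto (fun x => eLpNorm (fun s => N.firstIterate g x (r s) - N.firstIterate g x₀ (r s)) 2
      halfLine) (𝓝 x₀) (𝓝 0) := by
  obtain ⟨C, hC, h2⟩ := N.exists_firstIterate_le
  obtain ⟨D, hD, h3⟩ := N.exists_phaseSum_le_of_smooth hg hgs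
  have hcont := N.continuous_firstIterate hg
  have h0 : z ≠ 0 := fun h => by simp [h] at h1
  refine tendsto_eLpNorm_two_of_dominated
    (G := fun s => C * (D * min 1 (s * 1)⁻¹ + remainderIntegral g s)) ?_ ?_ ?_ ?_
  · exact fun x => (hcont.comp (continuous_const.prodMk hrc)).aestronglyMeasurable
  · intro x
    filter_upwards [self_mem_ae_restrict measurableSet_Ioi] with s hs
    have hs : 0 < s := hs
    have hrs := hr s hs.le
    have hne : (r s : ℂ) ≠ 0 := by
      rw [hrs]
      exact mul_ne_zero (by exact_mod_cast hs.ne') h0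
    have hn : ‖(r s : ℂ)‖ = s := by
      rw [hrs, norm_mul, h1, mul_one, Complex.norm_real, Real.norm_of_nonneg hs.le]
    have e1 := h2 g hg.integrableOn hg.diag x (r s) hne
    have e2 := h3 x (r s) hne
    rw [hn] at e1 e2
    rw [mul_one]
    exact e1.trans (by gcongr)
  · have hm1 : AEStronglyMeasurable (fun s : ℝ => min 1 (s * 1)⁻¹) halfLine :=
      Measurable.aestronglyMeasurable (by fun_prop)
    have e1 : eLpNorm (fun s : ℝ => min 1 (s * 1)⁻¹) 2 halfLine ≠ ⊤ := by
      have e2 := lintegral_min_sq_le one_pos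
      have e3 : eLpNorm (fun s : ℝ => min 1 (s * 1)⁻¹) 2 halfLine ^ 2 ≠ ⊤ := by
        rw [eLpNorm_two_sq]
        refine ne_top_of_le_ne_top (by finiteness) (le_trans (le_of_eq ?_) e2)
        refine setLIntegral_congr_fun measurableSet_Ioi fun s hs => ?_
        have hs : 0 < s := hs
        rw [Real.enorm_of_nonneg (by positivity)]
      exact fun h => e3 (by rw [h]; rfl)
    have e4 : MemLp (fun s : ℝ => min 1 (s * 1)⁻¹) 2 halfLine := ⟨hm1, lt_top_iff_ne_top.2 e1⟩
    have e5 : MemLp (fun s => remainderIntegral g s) 2 halfLine :=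
      ⟨aestronglyMeasurable_remainderIntegral hg.integrableOn,
        lt_of_le_of_lt (eLpNorm_remainderIntegral_le hg)
          (lt_top_iff_ne_top.2 (ENNReal.mul_ne_top (by finiteness) hg.matrixSize_ne_top))⟩
    exact (((e4.const_mul D).add e5).const_mul C).2.ne
  · refine Eventually.of_forall fun s => ?_
    exact (hcont.comp (continuous_id.prodMk continuous_const)).tendsto x₀

/-- Continuity in `x` of the first iterate in `L₂` of a ray, by approximation with smooth potentials
in the norm that controls the first iterate in `L₂` uniformly in `x`. -/
theorem firstIterate_continuous_right {q : ℝ → Matrix (Fin n) (Fin n) ℂ}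
    (hq : IsPotential q) {z : ℂ} (hz : z ∈ closure S) (h1 : ‖z‖ = 1)
    {r : ℝ → closure S} (hrc : Continuous r) (hr : ∀ s, 0 ≤ s → (r s : ℂ) = s * z) (x₀ : ℝ≥0) :
    Tendsto (fun x => eLpNorm (fun s => N.firstIterate q x (r s) - N.firstIterate q x₀ (r s)) 2
      halfLine) (𝓝 x₀) (𝓝 0) := by
  obtain ⟨K, hK, hle⟩ := N.exists_eLpNorm_firstIterate_le hz h1
  rw [ENNReal.tendsto_nhds_zero]
  intro η hη
  rcases eq_or_ne η ⊤ with rfl | hηt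
  · exact Eventually.of_forall fun _ => le_top
  set δ := η / 3 / (K + 1) with hδ
  have hη3 : η / 3 ≠ 0 := ENNReal.div_ne_zero.2 ⟨hη.ne', by finiteness⟩
  have hδ0 : δ ≠ 0 := ENNReal.div_ne_zero.2 ⟨hη3, by finiteness⟩
  have hδt : δ ≠ ⊤ := ENNReal.div_ne_top (ENNReal.div_ne_top hηt (by norm_num)) (by positivity)
  obtain ⟨g, hg, hgs, hgq⟩ := hq.exists_smooth_approx hδ0 hδt
  have hsmall : ∀ x, eLpNorm (fun s => N.firstIterate (q - g) x (r s)) 2 halfLine ≤ η / 3 := by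
    intro x
    refine (hle _ (hq.sub hg) x r hr).trans ?_
    calc K * matrixSize (q - g) ≤ (K + 1) * δ := mul_le_mul' le_self_add hgq
      _ = η / 3 := ENNReal.mul_div_cancel (by positivity) (by finiteness)
  have hmeas : ∀ {q' : ℝ → Matrix (Fin n) (Fin n) ℂ}, IsPotential q' → ∀ x,
      AEStronglyMeasurable (fun s => N.firstIterate q' x (r s)) halfLine := fun hq' x =>
    ((N.continuous_firstIterate hq').comp (continuous_const.prodMk hrc)).aestronglyMeasurable
  filter_upwards [ENNReal.tendsto_nhds_zero.1
    (N.firstIterate_continuous_right_of_smooth hg hgs h1 hrc hr x₀) (η / 3)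
    (pos_iff_ne_zero.2 hη3)] with x hx
  have heq : (fun s => N.firstIterate q x (r s) - N.firstIterate q x₀ (r s)) =
      ((fun s => N.firstIterate (q - g) x (r s)) +
        fun s => N.firstIterate g x (r s) - N.firstIterate g x₀ (r s)) -
        fun s => N.firstIterate (q - g) x₀ (r s) := by
    funext s
    simp only [Pi.add_apply, Pi.sub_apply, N.firstIterate_sub hq hg]
    abel
  rw [heq]
  have hm1 := hmeas (hq.sub hg) x
  have hm2 := (hmeas hg x).sub (hmeas hg x₀)
  refine (eLpNorm_sub_le (hm1.add hm2) (hmeas (hq.sub hg) x₀) one_le_two).trans ?_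
  refine (add_le_add ((eLpNorm_add_le hm1 hm2 one_le_two).trans
    (add_le_add (hsmall x) hx)) (hsmall x₀)).trans ?_
  rw [ENNReal.add_thirds]

end TensorModel

/-! ### The fundamental tensors of a model -/

theorem isPotential_potential {n : ℕ} {p : ℝ≥0∞} [Fact (1 ≤ p)] (hp : 2 < p) (q : Xp n p) :
    IsPotential (potential q) :=
  ⟨aestronglyMeasurable_potential q, potentialSize_potential_ne_top hp q, potential_diag q⟩

theorem exists_matrixSize_potential_le {n : ℕ} {p : ℝ≥0∞} [Fact (1 ≤ p)] (hp : 2 < p) :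
    ∃ C : ℝ≥0∞, C ≠ ⊤ ∧ ∀ q : Xp n p, matrixSize (potential q) ≤ C * ‖q‖ₑ := by
  obtain ⟨C, hC, h⟩ := exists_potentialSize_potential_le (n := n) hp
  refine ⟨n * (n * C), by finiteness, fun q => ?_⟩
  calc matrixSize (potential q) ≤ ∑ i : Fin n, ∑ j : Fin n, C * ‖q‖ₑ :=
        Finset.sum_le_sum fun i _ => Finset.sum_le_sum fun j _ => h q i j
    _ = _ := by simp [mul_assoc]

theorem integrableOn_const_smul {E : Type*} [NormedAddCommGroup E] [NormedSpace ℂ E] {f : ℝ → E}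
    {s : Set ℝ} (c : ℂ) (hf : IntegrableOn f s) : IntegrableOn (fun t => c • f t) s :=
  Integrable.smul c hf

namespace TensorModel

variable {n m : ℕ} {S : Set ℂ} (N : TensorModel n m S) {p : ℝ≥0∞} [Fact (1 ≤ p)]

/-- Solutions of the Volterra equations for the remainders, for all potentials simultaneously. -/
theorem exists_remainder (hp : 2 < p) :
    ∃ T : Xp n p → ℝ≥0 →ᵇ C₀(closure S, Tensor n m), IsRemainder T ∧
      ∀ q x ρ, T q x ρ = N.firstIterate (potential q) x ρ +
        volterraOp N.ε N.kernel (fun t => derivation m (potential q t))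
          (fun x ρ => T q x ρ) x ρ := by
  have hP := isPotential_potential (n := n) hp
  obtain ⟨C, hκ⟩ := N.exists_isVolterraKernel
  obtain ⟨B, hB, hf⟩ := N.exists_free_bound
  obtain ⟨L, hL, hd⟩ := exists_derivation_bound n m
  obtain ⟨Cp, hCp, hsize⟩ := exists_matrixSize_potential_le (n := n) hp
  have hQ : ∀ q : Xp n p, IntegrableOn (fun t => derivation m (potential q t)) (Ioi 0) :=
    fun q => integrableOn_derivation (hP q).integrableOn
  have hQsub : ∀ q q' : Xp n p, (fun t => derivation m (potential (q - q') t)) =ᵐ[halfLine]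
      (fun t => derivation m (potential q t)) - fun t => derivation m (potential q' t) := by
    intro q q'
    filter_upwards [potential_sub q q'] with t ht
    rw [ht, map_sub]
    rfl
  have hQL : ∀ q : Xp n p, ∫ t in Ioi 0, ‖derivation m (potential q t)‖ ≤
      (L * Cp.toReal) * ‖q‖ := by
    intro q
    refine (integral_mono (hQ q).norm
      ((integrableOn_entrySum (hP q).integrableOn).const_mul L) fun t => hd _).trans ?_
    rw [integral_const_mul, mul_assoc]
    refine mul_le_mul_of_nonneg_left ((integral_entrySum_le (hP q)).trans ?_) hL
    have h1 := ENNReal.toReal_mono (by finiteness) (hsize q)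
    rwa [ENNReal.toReal_mul, toReal_enorm] at h1
  obtain ⟨T, hTc, hTeq, hTsq⟩ := hκ.exists_family hQ hQsub (L := L * Cp.toReal) (by positivity)
    hQL N.continuous_freeFamily (fun x ρ => hf _ (N.mul_mem ρ.2 (NNReal.coe_nonneg x)))
    fun q η hη => N.firstIterate_vanishing (hP q) η hη
  refine ⟨T, isRemainder_of_isSquareFamily N.sector hTc fun z hz => ?_, hTeq⟩
  have hz0 : (0 : ℝ) < ‖z‖ := norm_pos_iff.2 hz.2
  have hu : z / ‖z‖ ∈ closure S := by
    have := N.mul_mem hz.1 (inv_nonneg.2 hz0.le)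
    rwa [Complex.ofReal_inv, ← div_eq_mul_inv] at this
  have hu1 : ‖z / ‖z‖‖ = 1 := by
    rw [norm_div, Complex.norm_real, norm_norm, div_self hz0.ne']
  have hr : ∀ s : ℝ, 0 ≤ s → (rayPath N.sector hz.1 s : ℂ) = s * (z / ‖z‖) :=
    fun s hs => rayPath_coe N.sector hz.1 hs
  obtain ⟨K, hK, hKle⟩ := N.exists_eLpNorm_firstIterate_le hu hu1
  refine hTsq _ (continuous_rayPath N.sector hz.1) ⟨K * Cp, by finiteness, fun q x => ?_⟩
    fun q x₀ => N.firstIterate_continuous_right (hP q) hu hu1 (continuous_rayPath N.sector hz.1)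
      hr x₀
  refine (hKle _ (hP q) x _ hr).trans ?_
  rw [mul_assoc]
  exact mul_le_mul_right (hsize q) K

/-- `Y` solves the Volterra equation of the model with free term `∧^m c(ρ x) v₀`, and is bounded
by the weight. -/
structure IsTensorSolution (q : ℝ → Matrix (Fin n) (Fin n) ℂ) (ρ : ℂ) (Y : ℝ → Tensor n m) :
    Prop where
  integrable : ∀ x : ℝ, 0 < x → IntegrableOn (fun t : ℝ => compound m (N.cmat (ρ * x))
    (compound m (N.cinv (ρ * t)) (derivation m (q t) (Y t)))) (volterraSet N.ε x)
  equation : ∀ x : ℝ, 0 < x → Y x = compound m (N.cmat (ρ * x)) N.v₀ +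
    ∫ t in volterraSet N.ε x, compound m (N.cmat (ρ * x))
      (compound m (N.cinv (ρ * t)) (derivation m (q t) (Y t)))
  bounded : ∃ M : ℝ, ∀ x : ℝ, 0 < x → ‖Y x‖ ≤ M * ‖w N (ρ * x)‖

theorem compound_cmat_cinv_smul {x : ℝ≥0} (hx : 0 < x) {t : ℝ} {ρ : closure S}
    (hρ : (ρ : ℂ) ≠ 0) (ht : t ∈ volterraSet N.ε x) (D : Tensor n m →L[ℂ] Tensor n m)
    (f : Tensor n m) :
    compound m (N.cmat (ρ * (x : ℝ))) (compound m (N.cinv (ρ * t)) (D (w N (ρ * t) • f))) =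
      w N (ρ * (x : ℝ)) • N.kernel x t ρ (D f) := by
  have hξ := N.mul_mem' ρ.2 hρ (NNReal.coe_pos.2 hx)
  rw [N.kernel_eq ht hρ, hop, if_neg (show ¬ ((ρ : ℂ) * (x : ℝ)) = 0 from hξ.2), hinv]
  simp only [mul_apply_eq_comp, smul_apply, map_smul, smul_smul]
  rw [mul_left_comm, mul_inv_cancel₀ (N.w_ne_zero _ hξ), mul_one]

theorem compound_cmat_v₀ {x : ℝ≥0} (hx : 0 < x) {ρ : closure S} (hρ : (ρ : ℂ) ≠ 0) :
    compound m (N.cmat (ρ * (x : ℝ))) N.v₀ = w N (ρ * (x : ℝ)) • N.freeFamily x ρ := by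
  have hξ := N.mul_mem' ρ.2 hρ (NNReal.coe_pos.2 hx)
  rw [freeFamily, free, hop, if_neg (show ¬ ((ρ : ℂ) * (x : ℝ)) = 0 from hξ.2), smul_apply,
    smul_smul, mul_inv_cancel₀ (N.w_ne_zero _ hξ), one_smul]

/-- The solution of the model exists and is unique: division by the weight turns it into a bounded
solution of the Volterra equation, and the difference of two of those vanishes by Grönwall. -/
theorem isTensorSolution_iff {q : ℝ → Matrix (Fin n) (Fin n) ℂ} (hq : IsPotential q)
    {T : ℝ≥0 →ᵇ C₀(closure S, Tensor n m)}
    (hT : ∀ x ρ, T x ρ = N.firstIterate q x ρ +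
      volterraOp N.ε N.kernel (fun t => derivation m (q t)) (fun x ρ => T x ρ) x ρ)
    {ρ : closure S} (hρ : (ρ : ℂ) ≠ 0) (Y : ℝ → Tensor n m) :
    N.IsTensorSolution q ρ Y ↔ ∀ x : ℝ≥0, 0 < x →
      Y x = compound m (N.cmat (ρ * (x : ℝ))) N.v₀ + w N (ρ * (x : ℝ)) • T x ρ := by
  obtain ⟨C, hκ⟩ := N.exists_isVolterraKernel
  obtain ⟨B, hB, hf⟩ := N.exists_free_bound
  have hQ := integrableOn_derivation (m := m) hq.integrableOn
  have hfc := N.continuous_freeFamily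
  have hfB : ∀ x ρ, ‖N.freeFamily x ρ‖ ≤ B := fun x ρ =>
    hf _ (N.mul_mem ρ.2 (NNReal.coe_nonneg x))
  have hTc := continuous_eval_zeroAtInfty T
  have hTB := norm_eval_zeroAtInfty_le T
  have hw0 : ∀ {t : ℝ}, 0 < t → w N (ρ * t) ≠ 0 := fun ht => N.w_ne_zero _ (N.mul_mem' ρ.2 hρ ht)
  -- the solution divided by the weight
  set u : ℝ≥0 → closure S → Tensor n m := fun x ρ => N.freeFamily x ρ + T x ρ with hu
  have huc : Continuous fun z : ℝ≥0 × closure S => u z.1 z.2 := hfc.add hTc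
  have huB : ∀ x ρ, ‖u x ρ‖ ≤ B + ‖T‖ := fun x ρ =>
    (norm_add_le _ _).trans (add_le_add (hfB x ρ) (hTB x ρ))
  have hueq : ∀ x ρ, u x ρ = N.freeFamily x ρ +
      volterraOp N.ε N.kernel (fun t => derivation m (q t)) u x ρ := by
    intro x ρ
    have h1 := volterraOp_add hκ hQ hfc hTc hfB hTB x ρ
    change N.freeFamily x ρ + T x ρ = _
    rw [hT x ρ]
    exact congrArg _ h1.symm
  constructor
  · intro hY x hx
    obtain ⟨M, hM⟩ := hY.bounded
    set v : ℝ≥0 → closure S → Tensor n m := fun x _ => (w N (ρ * (x : ℝ)))⁻¹ • Y x with hv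
    have hYv : ∀ {t : ℝ}, 0 < t → Y t = w N (ρ * t) • v t.toNNReal ρ := fun {t} ht => by
      simp only [hv, Real.coe_toNNReal t ht.le]
      rw [smul_smul, mul_inv_cancel₀ (hw0 ht), one_smul]
    have hint : ∀ x : ℝ≥0, 0 < x → EqOn (fun t : ℝ => compound m (N.cmat (ρ * (x : ℝ)))
        (compound m (N.cinv (ρ * t)) (derivation m (q t) (Y t))))
        (fun t => w N (ρ * (x : ℝ)) • N.kernel x t ρ (derivation m (q t) (v t.toNNReal ρ)))
        (volterraSet N.ε x) := by
      intro x hx t ht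
      simp only []
      rw [hYv ht.1, N.compound_cmat_cinv_smul hx hρ ht]
    have hveq : ∀ x, 0 < x → v x ρ = N.freeFamily x ρ +
        volterraOp N.ε N.kernel (fun t => derivation m (q t)) v x ρ := by
      intro x hx
      have h1 := hY.equation x (NNReal.coe_pos.2 hx)
      rw [setIntegral_congr_fun (measurableSet_volterraSet N.ε x) (hint x hx), integral_smul,
        N.compound_cmat_v₀ hx hρ, ← smul_add] at h1
      change (w N (ρ * (x : ℝ)))⁻¹ • Y x = _
      rw [h1, smul_smul, inv_mul_cancel₀ (hw0 (NNReal.coe_pos.2 hx)), one_smul]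
      rfl
    have hvint : ∀ x : ℝ≥0, 0 < x → IntegrableOn
        (fun t => N.kernel x t ρ (derivation m (q t) (v t.toNNReal ρ))) (volterraSet N.ε x) := by
      intro x hx
      have h1 : IntegrableOn (fun t => (w N (ρ * (x : ℝ)))⁻¹ • w N (ρ * (x : ℝ)) •
          N.kernel x t ρ (derivation m (q t) (v t.toNNReal ρ))) (volterraSet N.ε x) :=
        integrableOn_const_smul _ ((hY.integrable x (NNReal.coe_pos.2 hx)).congr_fun (hint x hx)
          (measurableSet_volterraSet N.ε x))
      refine h1.congr_fun (fun t _ => ?_) (measurableSet_volterraSet N.ε x)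
      exact inv_smul_smul₀ (hw0 (NNReal.coe_pos.2 hx)) _
    have hvB : ∀ x : ℝ≥0, 0 < x → ‖v x ρ‖ ≤ M := by
      intro x hx
      have hx' := NNReal.coe_pos.2 hx
      have h1 := hM x hx'
      have h2 := norm_pos_iff.2 (hw0 hx')
      change ‖(w N (ρ * (x : ℝ)))⁻¹ • Y x‖ ≤ M
      rw [norm_smul, norm_inv, inv_mul_le_iff₀ h2, mul_comm]
      exact h1
    have hdiff : ∀ x : ℝ≥0, 0 < x → ‖(v - u) x ρ‖ ≤
        gronwallConst C (fun t => derivation m (q t)) * 0 := by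
      refine hκ.norm_le_of_eq_add hQ (v := 0) (B := M + (B + ‖T‖)) le_rfl
        (fun x _ => by simp) (fun x hx => ?_) fun x hx => ?_
      · exact (norm_sub_le _ _).trans (add_le_add (hvB x hx) (huB x ρ))
      · have h1 := hκ.integrableOn hQ (aestronglyMeasurable_family huc ρ _)
          (fun t _ => huB _ _) x ρ
        have h2 : volterraOp N.ε N.kernel (fun t => derivation m (q t)) (v - u) x ρ =
            volterraOp N.ε N.kernel (fun t => derivation m (q t)) v x ρ -
              volterraOp N.ε N.kernel (fun t => derivation m (q t)) u x ρ := by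
          unfold volterraOp
          rw [← integral_sub (hvint x hx) h1]
          simp
        rw [h2]
        change v x ρ - u x ρ = 0 + _
        rw [hveq x hx, hueq x ρ, zero_add]
        abel
    have h1 := hdiff x hx
    rw [mul_zero] at h1
    have h2 : v x ρ = u x ρ := sub_eq_zero.1 (norm_le_zero_iff.1 h1)
    have h3 := hYv (NNReal.coe_pos.2 hx)
    rw [Real.toNNReal_coe, h2] at h3
    rw [h3, N.compound_cmat_v₀ hx hρ, ← smul_add]
  · intro hY
    have hYu : ∀ {t : ℝ}, 0 < t → Y t = w N (ρ * t) • u t.toNNReal ρ := fun {t} ht => by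
      have h1 := hY t.toNNReal (Real.toNNReal_pos.2 ht)
      rw [N.compound_cmat_v₀ (Real.toNNReal_pos.2 ht) hρ, Real.coe_toNNReal t ht.le,
        ← smul_add] at h1
      exact h1
    have hint : ∀ x : ℝ≥0, 0 < x → EqOn
        (fun t => w N (ρ * (x : ℝ)) • N.kernel x t ρ (derivation m (q t) (u t.toNNReal ρ)))
        (fun t : ℝ => compound m (N.cmat (ρ * (x : ℝ)))
          (compound m (N.cinv (ρ * t)) (derivation m (q t) (Y t)))) (volterraSet N.ε x) := by
      intro x hx t ht
      simp only []
      rw [hYu ht.1, N.compound_cmat_cinv_smul hx hρ ht]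
    refine ⟨fun x hx => ?_, fun x hx => ?_, ⟨B + ‖T‖, fun x hx => ?_⟩⟩
    · lift x to ℝ≥0 using hx.le
      have hx' := NNReal.coe_pos.1 hx
      have h1 := hκ.integrableOn hQ (aestronglyMeasurable_family huc ρ _)
        (fun t _ => huB _ _) x ρ
      have h2 : IntegrableOn (fun t => w N (ρ * (x : ℝ)) •
          N.kernel x t ρ (derivation m (q t) (u t.toNNReal ρ))) (volterraSet N.ε x) :=
        integrableOn_const_smul _ h1
      exact h2.congr_fun (hint x hx')
        (measurableSet_volterraSet N.ε x)
    · lift x to ℝ≥0 using hx.le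
      have hx' := NNReal.coe_pos.1 hx
      rw [← setIntegral_congr_fun (measurableSet_volterraSet N.ε x) (hint x hx'), integral_smul,
        N.compound_cmat_v₀ hx' hρ, ← smul_add, hYu hx, Real.toNNReal_coe, hueq x ρ]
      rfl
    · rw [hYu hx, norm_smul, mul_comm]
      exact mul_le_mul_of_nonneg_right (huB _ _) (norm_nonneg _)

end TensorModel

/-! ### The transition matrix of the unperturbed system -/

theorem sum_eigenvalues_eq_trace {n : ℕ} {A : Matrix (Fin n) (Fin n) ℂ} {μ : Fin n → ℂ}
    {h : Fin n → Fin n → ℂ} (hμ : Function.Injective μ)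
    (hh : ∀ k, h k ≠ 0 ∧ A *ᵥ h k = μ k • h k) : ∑ j, μ j = A.trace := by
  have hl : LinearIndependent ℂ h :=
    Module.End.eigenvectors_linearIndependent' (Matrix.toLin' A) μ hμ h fun i =>
      ⟨Module.End.mem_eigenspace_iff.2 (by rw [Matrix.toLin'_apply]; exact (hh i).2), (hh i).1⟩
  have hu : IsUnit (colMatrix h) := Matrix.linearIndependent_cols_iff_isUnit.1 hl
  have hAH : A * colMatrix h = colMatrix h * Matrix.diagonal μ := by
    ext i k
    have := congrFun (hh k).2 i
    rw [Matrix.mul_diagonal, Matrix.mul_apply]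
    simp only [colMatrix, Matrix.of_apply]
    rw [mul_comm]
    exact this
  have hd := (Matrix.isUnit_iff_isUnit_det _).1 hu
  have hA : A = colMatrix h * Matrix.diagonal μ * (colMatrix h)⁻¹ := by
    rw [← hAH, Matrix.mul_assoc, Matrix.mul_nonsing_inv _ hd, Matrix.mul_one]
  rw [hA, Matrix.trace_mul_comm, ← Matrix.mul_assoc, Matrix.nonsing_inv_mul _ hd, Matrix.one_mul,
    Matrix.trace_diagonal]

theorem hasDerivAt_mul_apply {n : ℕ} {P Q : ℂ → Matrix (Fin n) (Fin n) ℂ}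
    {P' Q' : Matrix (Fin n) (Fin n) ℂ} {x : ℂ}
    (hP : ∀ i j, HasDerivAt (fun x => P x i j) (P' i j) x)
    (hQ : ∀ i j, HasDerivAt (fun x => Q x i j) (Q' i j) x) (i k : Fin n) :
    HasDerivAt (fun x => (P x * Q x) i k) ((P' * Q x + P x * Q') i k) x := by
  have h := HasDerivAt.fun_sum (u := Finset.univ) fun j _ => (hP i j).fun_mul (hQ j k)
  simpa only [Matrix.mul_apply, Matrix.add_apply, Finset.sum_add_distrib] using h

theorem differentiableAt_adjugate {n : ℕ} {P : ℂ → Matrix (Fin n) (Fin n) ℂ} {x : ℂ}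
    (hP : ∀ i j, DifferentiableAt ℂ (fun x => P x i j) x) (i j : Fin n) :
    DifferentiableAt ℂ (fun x => (P x).adjugate i j) x := by
  simp only [Matrix.adjugate_apply, Matrix.det_apply']
  refine DifferentiableAt.fun_sum fun τ _ => DifferentiableAt.const_mul ?_ _
  refine DifferentiableAt.fun_finsetProd fun l _ => ?_
  by_cases h : τ l = j
  · simp [Matrix.updateRow_apply, h]
  · simpa [Matrix.updateRow_apply, h] using hP (τ l) l

/-- Two fundamental matrices of a linear system differ by a constant matrix. -/
theorem adjugate_mul_eq_of_solution {n : ℕ} {U : Set ℂ} (hU : IsOpen U) (hUc : IsPreconnected U)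
    {C E X : ℂ → Matrix (Fin n) (Fin n) ℂ} (hdet : ∀ x ∈ U, (C x).det = 1)
    (hC : ∀ x ∈ U, ∀ i j, HasDerivAt (fun x => C x i j) ((X x * C x) i j) x)
    (hE : ∀ x ∈ U, ∀ i j, HasDerivAt (fun x => E x i j) ((X x * E x) i j) x)
    {x y : ℂ} (hx : x ∈ U) (hy : y ∈ U) : (C x).adjugate * E x = (C y).adjugate * E y := by
  have hD : ∀ x ∈ U, ∀ i j, HasDerivAt (fun x => ((C x).adjugate * E x) i j) 0 x := by
    intro x hx
    set P' : Matrix (Fin n) (Fin n) ℂ := Matrix.of fun i j =>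
      deriv (fun x => (C x).adjugate i j) x with hP'
    have hP : ∀ i j, HasDerivAt (fun x => (C x).adjugate i j) (P' i j) x := fun i j =>
      (differentiableAt_adjugate (fun i j => (hC x hx i j).differentiableAt) i j).hasDerivAt
    -- differentiate `adj(C) C = 1`
    have h1 : P' * C x + (C x).adjugate * (X x * C x) = 0 := by
      ext i j
      have e1 := hasDerivAt_mul_apply hP (hC x hx) i j
      have e2 : (fun x => ((C x).adjugate * C x) i j) =ᶠ[𝓝 x]
          fun _ => (1 : Matrix (Fin n) (Fin n) ℂ) i j := by
        filter_upwards [hU.mem_nhds hx] with z hz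
        rw [Matrix.adjugate_mul, hdet z hz, one_smul]
      exact e1.unique ((hasDerivAt_const x _).congr_of_eventuallyEq e2)
    have h2 : C x * (C x).adjugate = 1 := by rw [Matrix.mul_adjugate, hdet x hx, one_smul]
    have h3 : P' = -((C x).adjugate * X x) := by
      have h4 := congrArg (· * (C x).adjugate) h1
      simp only [Matrix.add_mul, Matrix.mul_assoc, h2, Matrix.mul_one, Matrix.zero_mul] at h4
      exact eq_neg_of_add_eq_zero_left h4
    intro i j
    have h5 := hasDerivAt_mul_apply hP (hE x hx) i j
    have h6 : P' * E x + (C x).adjugate * (X x * E x) = 0 := by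
      rw [h3, Matrix.neg_mul, Matrix.mul_assoc, neg_add_cancel]
    rw [h6] at h5
    exact h5
  ext i j
  exact hU.is_const_of_deriv_eq_zero hUc
    (fun z hz => (hD z hz i j).differentiableAt.differentiableWithinAt)
    (fun z hz => (hD z hz i j).deriv) hx hy

/-- The matrix with columns `𝔢_{σ(1)}, …, 𝔢_{σ(n)}` is invertible. -/
theorem det_colMatrix_single_ne_zero {n : ℕ} (σ : Equiv.Perm (Fin n)) :
    (colMatrix fun k => (Pi.single (σ k) 1 : Fin n → ℂ)).det ≠ 0 := by
  set P := colMatrix fun k => (Pi.single (σ k) 1 : Fin n → ℂ) with hP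
  have h : Pᵀ * P = 1 := by
    ext i j
    simp only [Matrix.mul_apply, Matrix.transpose_apply, hP, colMatrix, Matrix.of_apply,
      Pi.single_apply, Matrix.one_apply]
    simp [eq_comm]
  intro h0
  have := congrArg Matrix.det h
  rw [Matrix.det_mul, h0, mul_zero, Matrix.det_one] at this
  exact zero_ne_one this

section Setting

variable {n : ℕ} {A : Matrix (Fin n) (Fin n) ℂ} {μ b : Fin n → ℂ} {S : Set ℂ}
  {σ : Equiv.Perm (Fin n)} {ℓ : ℂ → ℂ} {h : Fin n → Fin n → ℂ}
  {c e : Fin n → ℂ → Fin n → ℂ}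

theorem IsSolution.continuousOn {y : ℂ → Fin n → ℂ} (hy : IsSolution A b S y) :
    ContinuousOn y (closure S \ {0}) := fun x hx =>
  (hy x hx).continuousWithinAt.mono sdiff_subset

theorem IsSolution.hasDerivAt (hS : IsOpenSector S) {y : Fin n → ℂ → Fin n → ℂ}
    (hy : ∀ k, IsSolution A b S (y k)) {x : ℂ} (hx : x ∈ S) (i j : Fin n) :
    HasDerivAt (fun x => (colMatrix fun k => y k x) i j)
      (((x⁻¹ • A + Matrix.diagonal b) * colMatrix fun k => y k x) i j) x := by
  have h1 := ((hy j) x (hS.subset_diff hx)).hasDerivAt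
    (mem_of_superset (hS.isOpen.mem_nhds hx) subset_closure)
  exact hasDerivAt_pi.1 h1 i

theorem continuousOn_colMatrix {y : Fin n → ℂ → Fin n → ℂ} (hy : ∀ k, IsSolution A b S (y k)) :
    ContinuousOn (fun x => colMatrix fun k => y k x) (closure S \ {0}) := by
  refine continuousOn_pi.2 fun i => continuousOn_pi.2 fun j => ?_
  exact (continuous_apply i).comp_continuousOn (hy j).continuousOn

/-- Identities between functions that are continuous on `S̄ ∖ {0}` extend from `S`. -/
theorem IsOpenSector.eqOn_diff (hS : IsOpenSector S) {Z : Type*} [TopologicalSpace Z] [T2Space Z]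
    {f g : ℂ → Z} (hf : ContinuousOn f (closure S \ {0})) (hg : ContinuousOn g (closure S \ {0}))
    (hfg : EqOn f g S) : EqOn f g (closure S \ {0}) :=
  hfg.of_subset_closure hf hg hS.subset_diff sdiff_subset

/-- The transition matrix from the fundamental system at the origin to the one at infinity. -/
theorem exists_transition (hS : IsOpenSector S) (hc : ∀ k, IsSolution A b S (c k))
    (he : ∀ k, IsSolution A b S (e k))
    (hdet : ∀ x ∈ closure S \ {0}, (colMatrix fun k => c k x).det = 1) :
    ∃ T : Matrix (Fin n) (Fin n) ℂ, ∀ x ∈ closure S \ {0},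
      (colMatrix fun k => c k x) * T = colMatrix fun k => e k x := by
  obtain ⟨x₀, hx₀⟩ := hS.nonempty
  refine ⟨(colMatrix fun k => c k x₀).adjugate * colMatrix fun k => e k x₀,
    hS.eqOn_diff ?_ (continuousOn_colMatrix he) fun x hx => ?_⟩
  · exact (continuousOn_colMatrix hc).mul continuousOn_const
  · have h1 := adjugate_mul_eq_of_solution hS.isOpen hS.isPreconnected
      (C := fun x => colMatrix fun k => c k x) (E := fun x => colMatrix fun k => e k x)
      (X := fun x => x⁻¹ • A + Matrix.diagonal b)
      (fun x hx => hdet x (hS.subset_diff hx))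
      (fun x hx => IsSolution.hasDerivAt hS hc hx) (fun x hx => IsSolution.hasDerivAt hS he hx)
      hx₀ hx
    change (colMatrix fun k => c k x) * ((colMatrix fun k => c k x₀).adjugate *
      colMatrix fun k => e k x₀) = _
    rw [h1, ← Matrix.mul_assoc, Matrix.mul_adjugate, hdet x (hS.subset_diff hx), one_smul,
      Matrix.one_mul]

/-- The fundamental matrix at infinity without its exponential factors. -/
def reducedInfty (b : Fin n → ℂ) (σ : Equiv.Perm (Fin n)) (e : Fin n → ℂ → Fin n → ℂ) (x : ℂ) :
    Matrix (Fin n) (Fin n) ℂ :=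
  colMatrix fun k => Complex.exp (-(x * b (σ k))) • e k x

theorem reducedInfty_mul_diagonal (x : ℂ) : (reducedInfty b σ e x) *
    (Matrix.diagonal fun j => Complex.exp (x * b (σ j))) = colMatrix fun k => e k x := by
  ext i j
  rw [Matrix.mul_diagonal]
  simp only [reducedInfty, colMatrix, Matrix.of_apply, Pi.smul_apply, smul_eq_mul]
  rw [mul_right_comm, ← Complex.exp_add]
  simp

/-- Removing the exponential factors does not change the determinant, because `∑ bⱼ = 0`. -/
theorem det_reducedInfty (hb : ∑ j, b j = 0) (x : ℂ) :
    (reducedInfty b σ e x).det = (colMatrix fun k => e k x).det := by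
  rw [← reducedInfty_mul_diagonal (b := b) (σ := σ), Matrix.det_mul, Matrix.det_diagonal,
    ← Complex.exp_sum, ← Finset.mul_sum, Equiv.sum_comp σ b, hb, mul_zero, Complex.exp_zero,
    mul_one]

theorem IsInftySystem.exists_bound (he : IsInftySystem A b S σ e) :
    ∃ K : ℝ, ∀ x ∈ closure S, 1 ≤ ‖x‖ → ∀ i j,
      ‖reducedInfty b σ e x i j - (colMatrix fun k => Pi.single (σ k) 1) i j‖ ≤ K * ‖x‖⁻¹ := by
  choose M hM using he.asymp
  refine ⟨∑ k, |M k|, fun x hx h1 i j => ?_⟩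
  have h2 := (norm_le_pi_norm (Complex.exp (-(x * b (σ j))) • e j x - Pi.single (σ j) 1) i).trans
    (hM j x hx h1)
  refine h2.trans (mul_le_mul_of_nonneg_right ((le_abs_self _).trans ?_) (by positivity))
  exact Finset.single_le_sum (f := fun k => |M k|) (fun _ _ => abs_nonneg _) (Finset.mem_univ j)

/-- The transition matrix is invertible: its determinant is the limit of the determinant of the
fundamental matrix at infinity. -/
theorem det_transition_ne_zero (hS : IsOpenSector S) (he : IsInftySystem A b S σ e)
    (hb : ∑ j, b j = 0) (hdet : ∀ x ∈ closure S \ {0}, (colMatrix fun k => c k x).det = 1)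
    {T : Matrix (Fin n) (Fin n) ℂ} (hT : ∀ x ∈ closure S \ {0},
      (colMatrix fun k => c k x) * T = colMatrix fun k => e k x) :
    T.det ≠ 0 ∧ ∀ x ∈ closure S \ {0}, (reducedInfty b σ e x).det = T.det := by
  have h1 : ∀ x ∈ closure S \ {0}, (reducedInfty b σ e x).det = T.det := fun x hx => by
    rw [det_reducedInfty hb, ← hT x hx, Matrix.det_mul, hdet x hx, one_mul]
  refine ⟨?_, h1⟩
  obtain ⟨x₀, hx₀⟩ := hS.nonempty
  have hx₀' := hS.subset_diff hx₀
  have hn : 0 < ‖x₀‖ := norm_pos_iff.2 hx₀'.2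
  obtain ⟨K, hK⟩ := he.exists_bound
  have hnorm : Tendsto (fun s : ℝ => ‖(s : ℂ) * x₀‖) atTop atTop := by
    have : Tendsto (fun s : ℝ => |s| * ‖x₀‖) atTop atTop :=
      tendsto_abs_atTop_atTop.atTop_mul_const hn
    refine this.congr fun s => ?_
    rw [norm_mul, Complex.norm_real, Real.norm_eq_abs]
  have hlim : Tendsto (fun s : ℝ => reducedInfty b σ e (s * x₀)) atTop
      (𝓝 (colMatrix fun k => Pi.single (σ k) 1)) := by
    refine tendsto_pi_nhds.2 fun i => tendsto_pi_nhds.2 fun j => ?_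
    rw [tendsto_iff_norm_sub_tendsto_zero]
    have h2 : Tendsto (fun s : ℝ => K * ‖(s : ℂ) * x₀‖⁻¹) atTop (𝓝 0) := by
      simpa using (tendsto_inv_atTop_zero.comp hnorm).const_mul K
    refine squeeze_zero' (Eventually.of_forall fun _ => norm_nonneg _) ?_ h2
    filter_upwards [eventually_gt_atTop 0, hnorm.eventually_ge_atTop 1] with s hs hs1
    exact hK _ (hS.smul_mem_closure hs hx₀'.1) hs1 i j
  have hd : Continuous fun M : Matrix (Fin n) (Fin n) ℂ => M.det := continuous_id.matrix_det
  have h3 := (hd.tendsto _).comp hlim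
  have h4 : Tendsto (fun _ : ℝ => T.det) atTop
      (𝓝 (colMatrix fun k => (Pi.single (σ k) 1 : Fin n → ℂ)).det) := by
    refine h3.congr' ?_
    filter_upwards [eventually_gt_atTop 0] with s hs
    exact h1 _ ⟨hS.smul_mem_closure hs hx₀'.1, mul_ne_zero (by exact_mod_cast hs.ne') hx₀'.2⟩
  rw [tendsto_nhds_unique tendsto_const_nhds h4]
  exact det_colMatrix_single_ne_zero σ

/-- The holomorphic factor of the fundamental matrix at the origin, which is unimodular since the
eigenvalues of `A` add up to its trace, zero. -/
theorem IsZeroSystem.exists_chat (hA : ConditionA A μ) (hS : IsOpenSector S)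
    (hc : IsZeroSystem A μ b S ℓ h c) :
    ∃ chat : ℂ → Matrix (Fin n) (Fin n) ℂ, Continuous chat ∧ chat 0 = colMatrix h ∧
      (∀ ξ ∈ closure S, (chat ξ).det = 1) ∧ ∀ ξ ∈ closure S \ {0},
        chat ξ * Matrix.diagonal (fun j => Complex.exp (μ j * ℓ ξ)) = colMatrix fun k => c k ξ := by
  choose f hf hf0 hfc using hc.power
  have hμ : ∑ j, μ j = 0 := by
    rw [sum_eigenvalues_eq_trace (fun i j hij => hA.re_strictMono.injective (congrArg Complex.re hij))
      hc.eigenvector, Matrix.trace]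
    exact Finset.sum_eq_zero fun i _ => hA.offDiag i
  set chat : ℂ → Matrix (Fin n) (Fin n) ℂ := fun ξ => colMatrix fun k => f k ξ with hchat
  have hcont : Continuous chat := continuous_pi fun i => continuous_pi fun j =>
    (continuous_apply i).comp (hf j).continuous
  have hmul : ∀ ξ ∈ closure S \ {0},
      chat ξ * Matrix.diagonal (fun j => Complex.exp (μ j * ℓ ξ)) = colMatrix fun k => c k ξ := by
    intro ξ hξ
    ext i j
    rw [Matrix.mul_diagonal]
    simp only [hchat, colMatrix, Matrix.of_apply, hfc j ξ hξ, Pi.smul_apply, smul_eq_mul]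
    rw [mul_comm]
  refine ⟨chat, hcont, ?_, ?_, hmul⟩
  · simp only [hchat, hf0]
  · have hcl : IsClosed {ξ | (chat ξ).det = 1} := isClosed_eq hcont.matrix_det continuous_const
    refine hcl.closure_subset_iff.2 fun ξ hξ => ?_
    have h1 := congrArg Matrix.det (hmul ξ (hS.subset_diff hξ))
    rw [Matrix.det_mul, Matrix.det_diagonal, ← Complex.exp_sum, ← Finset.sum_mul, hμ, zero_mul,
      Complex.exp_zero, mul_one] at h1
    exact h1.trans (hc.det_eq_one ξ (hS.subset_diff hξ))

end Setting

/-! ### Extremal multi-indices -/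

theorem sum_le_sum_of_threshold {ι : Type*} [DecidableEq ι] {s t : Finset ι} {f : ι → ℝ} {a : ℝ}
    (hcard : s.card = t.card) (h1 : ∀ j, j ∉ t → f j ≤ a) (h2 : ∀ j ∈ t, a ≤ f j) :
    ∑ j ∈ s, f j ≤ ∑ j ∈ t, f j := by
  rw [← Finset.sum_inter_add_sum_sdiff s t f, ← Finset.sum_inter_add_sum_sdiff t s f,
    Finset.inter_comm]
  refine add_le_add le_rfl ?_
  refine (Finset.sum_le_card_nsmul _ _ a fun j hj => h1 j (Finset.mem_sdiff.1 hj).2).trans ?_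
  rw [Finset.card_sdiff_comm hcard]
  exact Finset.card_nsmul_le_sum _ _ a fun j hj => h2 j (Finset.mem_sdiff.1 hj).1

theorem sum_lt_sum_of_threshold {ι : Type*} [DecidableEq ι] {s t : Finset ι} {f : ι → ℝ} {a : ℝ}
    (hcard : s.card = t.card) (h1 : ∀ j, j ∉ t → f j < a) (h2 : ∀ j ∈ t, a ≤ f j) (hst : s ≠ t) :
    ∑ j ∈ s, f j < ∑ j ∈ t, f j := by
  rw [← Finset.sum_inter_add_sum_sdiff s t f, ← Finset.sum_inter_add_sum_sdiff t s f,
    Finset.inter_comm]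
  refine add_lt_add_of_le_of_lt le_rfl ?_
  have hne : (s \ t).Nonempty := Finset.sdiff_nonempty.2 fun h =>
    hst (Finset.eq_of_subset_of_card_le h hcard.ge)
  refine (Finset.sum_lt_sum_of_nonempty hne fun j hj =>
    h1 j (Finset.mem_sdiff.1 hj).2).trans_le ?_
  rw [Finset.sum_const, Finset.card_sdiff_comm hcard]
  exact Finset.card_nsmul_le_sum _ _ a fun j hj => h2 j (Finset.mem_sdiff.1 hj).1

theorem coe_tailIndex {n : ℕ} (k : Fin n) : (tailIndex k : Finset (Fin n)) = Finset.Ici k := rfl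

theorem coe_headIndex {n : ℕ} (k : Fin n) : (headIndex k : Finset (Fin n)) = Finset.Iic k := rfl

theorem sum_le_sum_tailIndex {n : ℕ} {f : Fin n → ℝ} (hf : Monotone f) (k : Fin n)
    (α : Set.powersetCard (Fin n) (n - k)) :
    ∑ j ∈ (α : Finset (Fin n)), f j ≤ ∑ j ∈ (tailIndex k : Finset (Fin n)), f j := by
  refine sum_le_sum_of_threshold (a := f k) (α.2.trans (tailIndex k).2.symm) (fun j hj => ?_)
    fun j hj => ?_ <;> rw [coe_tailIndex, Finset.mem_Ici] at hj
  · exact hf (not_le.1 hj).le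
  · exact hf hj

theorem sum_lt_sum_tailIndex {n : ℕ} {f : Fin n → ℝ} (hf : StrictMono f) (k : Fin n)
    {α : Set.powersetCard (Fin n) (n - k)} (hα : α ≠ tailIndex k) :
    ∑ j ∈ (α : Finset (Fin n)), f j < ∑ j ∈ (tailIndex k : Finset (Fin n)), f j := by
  refine sum_lt_sum_of_threshold (a := f k) (α.2.trans (tailIndex k).2.symm) (fun j hj => ?_)
    (fun j hj => ?_) fun h => hα (Subtype.ext h) <;> rw [coe_tailIndex, Finset.mem_Ici] at hj
  · exact hf (not_le.1 hj)
  · exact hf.monotone hj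

theorem sum_headIndex_le_sum {n : ℕ} {f : Fin n → ℝ} (hf : Monotone f) (k : Fin n)
    (α : Set.powersetCard (Fin n) (k + 1)) :
    ∑ j ∈ (headIndex k : Finset (Fin n)), f j ≤ ∑ j ∈ (α : Finset (Fin n)), f j := by
  rw [← neg_le_neg_iff, ← Finset.sum_neg_distrib, ← Finset.sum_neg_distrib]
  refine sum_le_sum_of_threshold (a := -f k) (α.2.trans (headIndex k).2.symm) (fun j hj => ?_)
    fun j hj => ?_ <;> rw [coe_headIndex, Finset.mem_Iic] at hj
  · exact neg_le_neg (hf (not_le.1 hj).le)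
  · exact neg_le_neg (hf hj)

theorem sum_headIndex_lt_sum {n : ℕ} {f : Fin n → ℝ} (hf : StrictMono f) (k : Fin n)
    {α : Set.powersetCard (Fin n) (k + 1)} (hα : α ≠ headIndex k) :
    ∑ j ∈ (headIndex k : Finset (Fin n)), f j < ∑ j ∈ (α : Finset (Fin n)), f j := by
  rw [← neg_lt_neg_iff, ← Finset.sum_neg_distrib, ← Finset.sum_neg_distrib]
  refine sum_lt_sum_of_threshold (a := -f k) (α.2.trans (headIndex k).2.symm) (fun j hj => ?_)
    (fun j hj => ?_) fun h => hα (Subtype.ext h) <;> rw [coe_headIndex, Finset.mem_Iic] at hj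
  · exact neg_lt_neg (hf (not_le.1 hj))
  · exact neg_le_neg (hf.monotone hj)

/-! ### The models of the two families of tensors -/

namespace TensorModel

variable {n m : ℕ} {S : Set ℂ} (N : TensorModel n m S)

/-- Near the origin the weight is comparable to `ξ^{μ_{α₀}}`. -/
theorem exists_weight_bound : ∃ K : ℝ, 0 ≤ K ∧ ∀ ξ ∈ closure S \ {0}, ‖ξ‖ ≤ 1 →
    ‖w N ξ‖ ≤ K * ‖Complex.exp ((∑ j ∈ (N.α₀ : Finset (Fin n)), N.μ j) * N.ℓ ξ)‖ ∧
    ‖Complex.exp ((∑ j ∈ (N.α₀ : Finset (Fin n)), N.μ j) * N.ℓ ξ)‖ ≤ K * ‖w N ξ‖ := by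
  have hK : IsCompact (closure S ∩ Metric.closedBall 0 1) :=
    (isCompact_closedBall _ _).inter_left isClosed_closure
  obtain ⟨C₁, h1⟩ := hK.exists_bound_of_continuousOn (N.continuousOn_omega.mono inter_subset_left)
  obtain ⟨C₂, h2⟩ := hK.exists_bound_of_continuousOn
    ((N.continuousOn_omega.inv₀ fun ξ hξ => N.omega_ne_zero hξ).mono inter_subset_left)
  refine ⟨|C₁| + |C₂|, by positivity, fun ξ hξ h => ?_⟩
  have hm : ξ ∈ closure S ∩ Metric.closedBall 0 1 := ⟨hξ.1, by simpa using h⟩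
  set E := Complex.exp ((∑ j ∈ (N.α₀ : Finset (Fin n)), N.μ j) * N.ℓ ξ) with hE
  have hE0 : 0 < ‖E‖ := norm_pos_iff.2 (Complex.exp_ne_zero _)
  have hw0 : 0 < ‖w N ξ‖ := norm_pos_iff.2 (N.w_ne_zero ξ hξ)
  have ho : N.omega ξ = w N ξ / E := if_neg (show ¬ ξ = 0 from hξ.2)
  have e1 := h1 ξ hm
  have e2 : ‖(N.omega ξ)⁻¹‖ ≤ C₂ := h2 ξ hm
  rw [ho, norm_div, div_le_iff₀ hE0] at e1
  rw [ho, inv_div, norm_div, div_le_iff₀ hw0] at e2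
  constructor
  · refine e1.trans (mul_le_mul_of_nonneg_right ?_ hE0.le)
    linarith [le_abs_self C₁, abs_nonneg C₂]
  · refine e2.trans (mul_le_mul_of_nonneg_right ?_ hw0.le)
    linarith [le_abs_self C₂, abs_nonneg C₁]

/-- The growth condition on the tensors is boundedness by the weight. -/
theorem hasGrowth_iff {b : Fin n → ℂ} {σ : Equiv.Perm (Fin n)} (hR : N.R = fun j => b (σ j))
    {ρ : closure S} (hρ : (ρ : ℂ) ≠ 0) (Y : ℝ → Tensor n m) :
    HasGrowth N.μ b σ N.ℓ N.α₀ ρ Y ↔ ∃ M : ℝ, ∀ x : ℝ, 0 < x → ‖Y x‖ ≤ M * ‖w N (ρ * x)‖ := by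
  obtain ⟨K, hK, hw⟩ := N.exists_weight_bound
  have hbig : ∀ x : ℝ, 0 < x → 1 < ‖(ρ : ℂ) * x‖ → w N (ρ * x) =
      Complex.exp (ρ * x * ∑ j ∈ (N.α₀ : Finset (Fin n)), b (σ j)) := fun x hx h => by
    rw [N.w_infty _ (N.mul_mem ρ.2 hx.le) h, hR]
  constructor
  · rintro ⟨M, hM⟩
    refine ⟨|M| * K + |M|, fun x hx => ?_⟩
    have h0 : 0 ≤ |M| * K * ‖w N (ρ * x)‖ := by positivity
    have h0' : 0 ≤ |M| * ‖w N (ρ * x)‖ := by positivity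
    obtain ⟨h1, h2⟩ := hM x hx
    rcases le_or_gt ‖(ρ : ℂ) * x‖ 1 with h | h
    · have h3 := (hw _ (N.mul_mem' ρ.2 hρ hx) h).2
      have h4 := (h1 h).trans (mul_le_mul (le_abs_self M) h3 (norm_nonneg _) (abs_nonneg _))
      linarith
    · have h3 := h2 h
      rw [← hbig x hx h] at h3
      have h4 := h3.trans (mul_le_mul_of_nonneg_right (le_abs_self M) (norm_nonneg _))
      linarith
  · rintro ⟨M, hM⟩
    refine ⟨|M| * K + |M|, fun x hx => ⟨fun h => ?_, fun h => ?_⟩⟩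
    · have h3 := (hw _ (N.mul_mem' ρ.2 hρ hx) h).1
      have h4 := (hM x hx).trans (mul_le_mul (le_abs_self M) h3 (norm_nonneg _) (abs_nonneg _))
      have : 0 ≤ |M| * ‖Complex.exp ((∑ j ∈ (N.α₀ : Finset (Fin n)), N.μ j) * N.ℓ (ρ * x))‖ := by
        positivity
      linarith
    · rw [← hbig x hx h]
      have h4 := (hM x hx).trans (mul_le_mul_of_nonneg_right (le_abs_self M) (norm_nonneg _))
      have : 0 ≤ |M| * K * ‖w N (ρ * x)‖ := by positivity
      linarith

theorem green_eq_compound {h : Fin n → Fin n → ℂ} {c : Fin n → ℂ → Fin n → ℂ}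
    (hh : (colMatrix h).det = 1)
    (hcm : ∀ ξ ∈ closure S \ {0}, N.cmat ξ = colMatrix fun k => c k ξ)
    (hdet : ∀ ξ ∈ closure S \ {0}, (colMatrix fun k => c k ξ).det = 1)
    {ρ : closure S} (hρ : (ρ : ℂ) ≠ 0) {x t : ℝ} (hx : 0 < x) (ht : 0 < t) (f : Tensor n m) :
    green h c ρ x t f = compound m (N.cmat (ρ * x)) (compound m (N.cinv (ρ * t)) f) := by
  have hξ := N.mul_mem' ρ.2 hρ hx
  have hτ := N.mul_mem' ρ.2 hρ ht
  have h1 : (colMatrix fun k => c k (ρ * t)).adjugate = N.cinv (ρ * t) := by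
    have h2 := N.cinv_mul_cmat hτ.1
    rw [hcm _ hτ] at h2
    calc _ = N.cinv (ρ * t) * (colMatrix fun k => c k (ρ * t)) *
          (colMatrix fun k => c k (ρ * t)).adjugate := by rw [h2, Matrix.one_mul]
      _ = _ := by rw [Matrix.mul_assoc, Matrix.mul_adjugate, hdet _ hτ, one_smul, Matrix.mul_one]
  rw [green_eq hh (hdet _ hτ), h1, hcm _ hξ]

theorem IsTensorSolution.congr_ae {q q' : ℝ → Matrix (Fin n) (Fin n) ℂ} (h : q =ᵐ[halfLine] q')
    {ρ : ℂ} {Y : ℝ → Tensor n m} (hY : N.IsTensorSolution q ρ Y) :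
    N.IsTensorSolution q' ρ Y := by
  have h1 : ∀ x : ℝ, (fun t : ℝ => compound m (N.cmat (ρ * x))
      (compound m (N.cinv (ρ * t)) (derivation m (q t) (Y t))))
      =ᵐ[volume.restrict (volterraSet N.ε x)] fun t => compound m (N.cmat (ρ * x))
      (compound m (N.cinv (ρ * t)) (derivation m (q' t) (Y t))) := fun x => by
    filter_upwards [ae_restrict_of_ae_restrict_of_subset (volterraSet_subset N.ε x) h] with t ht
    rw [ht]
  refine ⟨fun x hx => (hY.integrable x hx).congr (h1 x), fun x hx => ?_, hY.bounded⟩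
  rw [hY.equation x hx, integral_congr_ae (h1 x)]

end TensorModel

section Setting

variable {n : ℕ} {A : Matrix (Fin n) (Fin n) ℂ} {μ b : Fin n → ℂ} {S : Set ℂ}
  {σ : Equiv.Perm (Fin n)} {ℓ : ℂ → ℂ} {h : Fin n → Fin n → ℂ}
  {c e : Fin n → ℂ → Fin n → ℂ} {W : Fin n → ℂ → ℂ}

theorem monotone_re_mul (hσ : ∀ x ∈ S, StrictMono fun k => (b (σ k) * x).re) {x : ℂ}
    (hx : x ∈ closure S) : Monotone fun k => (x * b (σ k)).re := by
  intro i j hij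
  have hcl : IsClosed {x : ℂ | (x * b (σ i)).re ≤ (x * b (σ j)).re} :=
    isClosed_le (by fun_prop) (by fun_prop)
  refine hcl.closure_subset_iff.2 (fun y hy => ?_) hx
  have := (hσ y hy).monotone hij
  change (y * b (σ i)).re ≤ (y * b (σ j)).re
  simpa only [mul_comm y] using this

theorem IsWeight.prodWeight_zero {m : ℕ} (hW : IsWeight μ b S σ ℓ W)
    (α : Set.powersetCard (Fin n) m) :
    Tendsto (fun ξ => prodWeight W α ξ / Complex.exp ((∑ j ∈ (α : Finset (Fin n)), μ j) * ℓ ξ))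
      (𝓝[closure S \ {0}] 0) (𝓝 1) := by
  have h1 := tendsto_finsetProd (α : Finset (Fin n)) fun j _ => hW.at_zero j
  rw [Finset.prod_const_one] at h1
  refine h1.congr fun ξ => ?_
  rw [Finset.prod_div_distrib, ← Complex.exp_sum, Finset.sum_mul]
  rfl

/-- The model with given direction, multi-index, and free term. The coefficients `v T` of the free
term may depend on the transition matrix `T`, as they do for the tensors `F_k`. -/
theorem exists_tensorModel (hA : ConditionA A μ) (hB : ConditionB b) (hS : IsOpenSector S)
    (hℓ : IsLogBranch S ℓ) (hc : IsZeroSystem A μ b S ℓ h c) (he : IsInftySystem A b S σ e)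
    (hW : IsWeight μ b S σ ℓ W) {m : ℕ} {ε : ℝ} (hε : ε = 1 ∨ ε = -1)
    (α₀ : Set.powersetCard (Fin n) m) (v : Matrix (Fin n) (Fin n) ℂ → Tensor n m)
    (hμ : ∀ α, α ≠ α₀ → ε * ((∑ j ∈ (α : Finset (Fin n)), μ j) -
      ∑ j ∈ (α₀ : Finset (Fin n)), μ j).re < 0)
    (hR : ∀ ξ ∈ closure S, ∀ α : Set.powersetCard (Fin n) m,
      ε * (ξ * ((∑ j ∈ (α : Finset (Fin n)), b (σ j)) -
        ∑ j ∈ (α₀ : Finset (Fin n)), b (σ j))).re ≤ 0)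
    (hv : ∀ T, ε = -1 ∨ ∀ α, α ≠ α₀ → (tensorBasis n m).repr (v T) α = 0)
    (hv' : ∀ T T', T' * T = 1 → ∀ ξ ∈ closure S, ∀ α : Set.powersetCard (Fin n) m,
      (tensorBasis n m).repr (compound m T' (v T)) α = 0 ∨
        (ξ * ((∑ j ∈ (α : Finset (Fin n)), b (σ j)) -
          ∑ j ∈ (α₀ : Finset (Fin n)), b (σ j))).re ≤ 0) :
    ∃ (N : TensorModel n m S) (T : Matrix (Fin n) (Fin n) ℂ), N.ε = ε ∧ N.α₀ = α₀ ∧ N.μ = μ ∧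
      N.ℓ = ℓ ∧ (N.R = fun j => b (σ j)) ∧ TensorModel.w N = prodWeight W α₀ ∧ N.v₀ = v T ∧
      (∀ ξ ∈ closure S \ {0}, N.cmat ξ = colMatrix fun k => c k ξ) ∧
      (∀ ξ ∈ closure S \ {0}, (colMatrix fun k => c k ξ) * T = colMatrix fun k => e k ξ) ∧
      (colMatrix h).det = 1 := by
  obtain ⟨chat, hchat, hchat0, hchatdet, hchatmul⟩ := hc.exists_chat hA hS
  obtain ⟨T, hT⟩ := exists_transition hS hc.solution he.solution hc.det_eq_one
  obtain ⟨hT0, hTd⟩ := det_transition_ne_zero hS he hB.sum_eq_zero hc.det_eq_one hT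
  obtain ⟨K, hK⟩ := he.exists_bound
  have hTu : IsUnit T.det := isUnit_iff_ne_zero.2 hT0
  obtain ⟨x₀, hx₀⟩ := hS.nonempty
  have h0 : (0 : ℂ) ∈ closure S := zero_mem_closure hS (subset_closure hx₀)
  let N : TensorModel n m S :=
    { ε := ε
      sign := hε
      sector := hS
      μ := μ
      ℓ := ℓ
      logBranch := hℓ
      α₀ := α₀
      chat := chat
      chat_continuous := hchat
      chat_det := hchatdet
      R := fun j => b (σ j)
      R_injective := hB.injective.comp σ.injective
      σ := σ
      trans := T
      trans' := T⁻¹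
      trans_mul := Matrix.mul_nonsing_inv T hTu
      ehat := reducedInfty b σ e
      ehat_eq := fun ξ hξ => by
        rw [hchatmul ξ hξ, hT ξ hξ, reducedInfty_mul_diagonal]
      d := T.det
      d_ne_zero := hT0
      ehat_det := hTd
      K := K
      ehat_sub_le := hK
      w := prodWeight W α₀
      w_continuousOn := continuousOn_finsetProd _ fun j _ => hW.continuousOn j
      w_ne_zero := fun ξ hξ => Finset.prod_ne_zero_iff.2 fun j _ => hW.ne_zero j ξ hξ
      w_zero := hW.prodWeight_zero α₀
      w_infty := fun ξ hξ h1 => by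
        rw [prodWeight, Finset.mul_sum, Complex.exp_sum]
        exact Finset.prod_congr rfl fun j _ => by rw [hW.at_infty j ξ hξ h1, mul_comm]
      v₀ := v T
      μ_order := hμ
      R_order := hR
      v₀_zero := hv T
      v₀_infty := hv' T T⁻¹ (Matrix.nonsing_inv_mul T hTu) }
  exact ⟨N, T, rfl, rfl, rfl, rfl, rfl, rfl, rfl, hchatmul, hT, hchat0 ▸ hchatdet 0 h0⟩

theorem repr_tensorBasis_of_ne {m : ℕ} {α β : Set.powersetCard (Fin n) m} (h : α ≠ β) :
    (tensorBasis n m).repr (tensorBasis n m β) α = 0 := by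
  rw [Module.Basis.repr_self, Finsupp.single_apply, if_neg h.symm]

/-- The model of the tensors `T_k`: the free term is `c_k ∧ ⋯ ∧ c_n`, and `α₀ = (k, …, n)` is the
largest multi-index at both ends. -/
theorem exists_tensorModel_tail (hA : ConditionA A μ) (hB : ConditionB b) (hS : IsOpenSector S)
    (hσ : ∀ x ∈ S, StrictMono fun k => (b (σ k) * x).re)
    (hℓ : IsLogBranch S ℓ) (hc : IsZeroSystem A μ b S ℓ h c) (he : IsInftySystem A b S σ e)
    (hW : IsWeight μ b S σ ℓ W) (k : Fin n) :
    ∃ (N : TensorModel n (n - k) S) (T : Matrix (Fin n) (Fin n) ℂ), N.ε = 1 ∧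
      N.α₀ = tailIndex k ∧ N.μ = μ ∧
      N.ℓ = ℓ ∧ (N.R = fun j => b (σ j)) ∧ TensorModel.w N = prodWeight W (tailIndex k) ∧
      N.v₀ = tensorBasis n (n - k) (tailIndex k) ∧
      (∀ ξ ∈ closure S \ {0}, N.cmat ξ = colMatrix fun k => c k ξ) ∧
      (∀ ξ ∈ closure S \ {0}, (colMatrix fun k => c k ξ) * T = colMatrix fun k => e k ξ) ∧
      (colMatrix h).det = 1 := by
  have hR : ∀ ξ ∈ closure S, ∀ α : Set.powersetCard (Fin n) (n - k),
      (ξ * ((∑ j ∈ (α : Finset (Fin n)), b (σ j)) -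
        ∑ j ∈ (tailIndex k : Finset (Fin n)), b (σ j))).re ≤ 0 := fun ξ hξ α => by
    have h1 := sum_le_sum_tailIndex (monotone_re_mul hσ hξ) k α
    rw [mul_sub, Complex.sub_re, Finset.mul_sum, Finset.mul_sum, Complex.re_sum, Complex.re_sum]
    linarith
  refine exists_tensorModel hA hB hS hℓ hc he hW (Or.inl rfl) (tailIndex k)
    (fun _ => tensorBasis n (n - k) (tailIndex k)) (fun α hα => ?_) (fun ξ hξ α => ?_)
    (fun _ => Or.inr fun α hα => repr_tensorBasis_of_ne hα) fun _ _ _ ξ hξ α => Or.inr (hR ξ hξ α)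
  · have h1 := sum_lt_sum_tailIndex hA.re_strictMono k hα
    rw [Complex.sub_re, Complex.re_sum, Complex.re_sum]
    linarith
  · rw [one_mul]
    exact hR ξ hξ α

/-- The model of the tensors `F_k`: the free term is `e_1 ∧ ⋯ ∧ e_k`, and `α₀ = (1, …, k)` is the
smallest multi-index at both ends. -/
theorem exists_tensorModel_head (hA : ConditionA A μ) (hB : ConditionB b) (hS : IsOpenSector S)
    (hσ : ∀ x ∈ S, StrictMono fun k => (b (σ k) * x).re)
    (hℓ : IsLogBranch S ℓ) (hc : IsZeroSystem A μ b S ℓ h c) (he : IsInftySystem A b S σ e)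
    (hW : IsWeight μ b S σ ℓ W) (k : Fin n) :
    ∃ (N : TensorModel n (k + 1) S) (T : Matrix (Fin n) (Fin n) ℂ), N.ε = -1 ∧
      N.α₀ = headIndex k ∧ N.μ = μ ∧
      N.ℓ = ℓ ∧ (N.R = fun j => b (σ j)) ∧ TensorModel.w N = prodWeight W (headIndex k) ∧
      N.v₀ = compound (k + 1) T (tensorBasis n (k + 1) (headIndex k)) ∧
      (∀ ξ ∈ closure S \ {0}, N.cmat ξ = colMatrix fun k => c k ξ) ∧
      (∀ ξ ∈ closure S \ {0}, (colMatrix fun k => c k ξ) * T = colMatrix fun k => e k ξ) ∧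
      (colMatrix h).det = 1 := by
  refine exists_tensorModel hA hB hS hℓ hc he hW (Or.inr rfl) (headIndex k)
    (fun T => compound (k + 1) T (tensorBasis n (k + 1) (headIndex k))) (fun α hα => ?_)
    (fun ξ hξ α => ?_) (fun _ => Or.inl rfl) fun T T' hT ξ hξ α => ?_
  · have h1 := sum_headIndex_lt_sum hA.re_strictMono k hα
    rw [Complex.sub_re, Complex.re_sum, Complex.re_sum]
    linarith
  · have h1 := sum_headIndex_le_sum (monotone_re_mul hσ hξ) k α
    rw [mul_sub, Complex.sub_re, Finset.mul_sum, Finset.mul_sum, Complex.re_sum, Complex.re_sum]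
    linarith
  · have h1 : compound (k + 1) T' (compound (k + 1) T (tensorBasis n (k + 1) (headIndex k))) =
        tensorBasis n (k + 1) (headIndex k) := by
      rw [← mul_apply_eq_comp, ← compound_mul, hT, compound_one]
      rfl
    rw [h1]
    by_cases hα : α = headIndex k
    · right
      rw [hα, sub_self, mul_zero, Complex.zero_re]
    · exact Or.inl (repr_tensorBasis_of_ne hα)

theorem potential_neg {p : ℝ≥0∞} [Fact (1 ≤ p)] (q : Xp n p) :
    potential (-q) =ᵐ[halfLine] fun t => -potential q t := by
  have h := potential_sub 0 q
  have h0 := potential_sub q q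
  rw [zero_sub] at h
  rw [sub_self] at h0
  filter_upwards [h, h0] with t h1 h2
  rw [h1, h2, sub_self, zero_sub]

theorem IsRemainder.comp_neg {p : ℝ≥0∞} [Fact (1 ≤ p)] {V : Type} [NormedAddCommGroup V]
    [NormedSpace ℂ V] {f : Xp n p → ℝ≥0 →ᵇ C₀(closure S, V)} (hf : IsRemainder f) :
    IsRemainder fun q => f (-q) := by
  refine ⟨hf.1.comp continuous_neg, fun z hz => ?_⟩
  obtain ⟨g, hg, hgf⟩ := hf.2 z hz
  exact ⟨fun q => g (-q), hg.comp continuous_neg, fun q => hgf (-q)⟩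

end Setting

end

end WeylTensor

theorem theorem1 {n : ℕ} {p : ℝ≥0∞} [Fact (1 ≤ p)] (hp : 2 < p)
    (A : Matrix (Fin n) (Fin n) ℂ) (μ b : Fin n → ℂ)
    (hA : WeylTensor.ConditionA A μ) (hB : WeylTensor.ConditionB b)
    (S : Set ℂ) (hS : WeylTensor.IsOpenSector S) (hSb : S ⊆ (WeylTensor.stokesLines b)ᶜ)
    (σ : Equiv.Perm (Fin n)) (hσ : ∀ x ∈ S, StrictMono fun k => (b (σ k) * x).re)
    (ℓ : ℂ → ℂ) (hℓ : WeylTensor.IsLogBranch S ℓ)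
    (h : Fin n → Fin n → ℂ) (c : Fin n → ℂ → Fin n → ℂ)
    (hc : WeylTensor.IsZeroSystem A μ b S ℓ h c)
    (e : Fin n → ℂ → Fin n → ℂ) (he : WeylTensor.IsInftySystem A b S σ e)
    (W : Fin n → ℂ → ℂ) (hW : WeylTensor.IsWeight μ b S σ ℓ W) (k : Fin n) :
    (∃ That : WeylTensor.Xp n p → ℝ≥0 →ᵇ C₀(closure S, WeylTensor.Tensor n (n - k)),
      WeylTensor.IsRemainder That ∧
      ∀ (q : WeylTensor.Xp n p) (ρ : closure S), (ρ : ℂ) ≠ 0 →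
        ∀ Y : ℝ → WeylTensor.Tensor n (n - k),
          WeylTensor.IsTensorT μ b σ ℓ h c k q ρ Y ↔
            ∀ x : ℝ≥0, 0 < x → Y x =
              WeylTensor.wedge (fun j => c j (ρ * (x : ℝ))) (WeylTensor.tailIndex k) +
                WeylTensor.prodWeight W (WeylTensor.tailIndex k) (ρ * (x : ℝ)) • That q x ρ) ∧
    (∃ Fhat : WeylTensor.Xp n p → ℝ≥0 →ᵇ C₀(closure S, WeylTensor.Tensor n (k + 1)),
      WeylTensor.IsRemainder Fhat ∧
      ∀ (q : WeylTensor.Xp n p) (ρ : closure S), (ρ : ℂ) ≠ 0 →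
        ∀ Y : ℝ → WeylTensor.Tensor n (k + 1),
          WeylTensor.IsTensorF μ b σ ℓ h c e k q ρ Y ↔
            ∀ x : ℝ≥0, 0 < x → Y x =
              WeylTensor.wedge (fun j => e j (ρ * (x : ℝ))) (WeylTensor.headIndex k) +
                WeylTensor.prodWeight W (WeylTensor.headIndex k) (ρ * (x : ℝ)) • Fhat q x ρ) := by
  open WeylTensor in
  constructor
  · obtain ⟨N, -, hε, hα, rfl, rfl, hR, hw, hv, hcm, -, hh⟩ :=
      exists_tensorModel_tail hA hB hS hσ hℓ hc he hW k
    obtain ⟨T, hT, hTeq⟩ := N.exists_remainder hp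
    refine ⟨T, hT, fun q ρ hρ Y => ?_⟩
    have hg := N.hasGrowth_iff hR hρ Y
    rw [hα] at hg
    have hfree : ∀ x : ℝ, 0 < x → compound (n - k) (N.cmat (ρ * x)) N.v₀ =
        wedge (fun j => c j (ρ * x)) (tailIndex k) := fun x hx => by
      rw [hcm _ (N.mul_mem' ρ.2 hρ hx), hv, wedge_eq_compound]
    have hset : ∀ x : ℝ, volterraSet N.ε x = Ioo 0 x := fun x => by
      rw [hε, volterraSet_one]
    have hgreen : ∀ x : ℝ, 0 < x → EqOn
        (fun t => green h c ρ x t (tensorDeriv (potential q t) (n - k) (Y t)))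
        (fun t : ℝ => compound (n - k) (N.cmat (ρ * x)) (compound (n - k) (N.cinv (ρ * t))
          (derivation (n - k) (potential q t) (Y t)))) (Ioo 0 x) := fun x hx t ht =>
      N.green_eq_compound hh hcm hc.det_eq_one hρ hx ht.1 _
    have hiff : IsTensorT N.μ b σ N.ℓ h c k q ρ Y ↔ N.IsTensorSolution (potential q) ρ Y := by
      constructor
      · intro hY
        refine ⟨fun x hx => ?_, fun x hx => ?_, hg.1 hY.growth⟩
        · rw [hset]
          exact (hY.integrable x hx).congr_fun (hgreen x hx) measurableSet_Ioo
        · rw [hset, hY.equation x hx, hfree x hx,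
            setIntegral_congr_fun measurableSet_Ioo (hgreen x hx)]
      · intro hY
        refine ⟨fun x hx => ?_, fun x hx => ?_, hg.2 hY.bounded⟩
        · have h1 := hY.integrable x hx
          rw [hset] at h1
          exact h1.congr_fun (hgreen x hx).symm measurableSet_Ioo
        · rw [hY.equation x hx, hset, hfree x hx,
            setIntegral_congr_fun measurableSet_Ioo (hgreen x hx)]
    rw [hiff, N.isTensorSolution_iff (isPotential_potential hp q) (hTeq q) hρ]
    refine forall_congr' fun x => forall_congr' fun hx => ?_
    rw [hfree x (NNReal.coe_pos.2 hx), hw]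
  · obtain ⟨N, E, hε, hα, rfl, rfl, hR, hw, hv, hcm, hE, hh⟩ :=
      exists_tensorModel_head hA hB hS hσ hℓ hc he hW k
    obtain ⟨T, hT, hTeq⟩ := N.exists_remainder hp
    -- the minus sign in the equation for `F_k` is absorbed into the potential
    refine ⟨fun q => T (-q), hT.comp_neg, fun q ρ hρ Y => ?_⟩
    have hg := N.hasGrowth_iff hR hρ Y
    rw [hα] at hg
    have hfree : ∀ x : ℝ, 0 < x → compound (k + 1) (N.cmat (ρ * x)) N.v₀ =
        wedge (fun j => e j (ρ * x)) (headIndex k) := fun x hx => by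
      have hξ := N.mul_mem' ρ.2 hρ hx
      rw [hcm _ hξ, hv, wedge_eq_compound, ← hE _ hξ, compound_mul]
      rfl
    have hset : ∀ x : ℝ, 0 < x → volterraSet N.ε x = Ioi x := fun x hx => by
      rw [hε, volterraSet_neg_one hx.le]
    have hgreen : ∀ x : ℝ, 0 < x → EqOn
        (fun t => -green h c ρ x t (tensorDeriv (potential q t) (k + 1) (Y t)))
        (fun t : ℝ => compound (k + 1) (N.cmat (ρ * x)) (compound (k + 1) (N.cinv (ρ * t))
          (derivation (k + 1) (-potential q t) (Y t)))) (Ioi x) := fun x hx t ht => by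
      have h1 := N.green_eq_compound hh hcm hc.det_eq_one hρ hx (hx.trans ht)
        (derivation (k + 1) (potential q t) (Y t))
      simp only [map_neg, neg_apply]
      rw [← h1]
      rfl
    have hiff : IsTensorF N.μ b σ N.ℓ h c e k q ρ Y ↔
        N.IsTensorSolution (potential (-q)) ρ Y := by
      have hiff' : IsTensorF N.μ b σ N.ℓ h c e k q ρ Y ↔
          N.IsTensorSolution (fun t => -potential q t) ρ Y := by
        constructor
        · intro hY
          refine ⟨fun x hx => ?_, fun x hx => ?_, hg.1 hY.growth⟩
          · rw [hset x hx]
            have h1 : IntegrableOn (fun t => -green h c ρ x t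
              (tensorDeriv (potential q t) (k + 1) (Y t))) (Ioi x) := (hY.integrable x hx).neg
            exact h1.congr_fun (hgreen x hx) measurableSet_Ioi
          · rw [hset x hx, hY.equation x hx, hfree x hx,
              ← setIntegral_congr_fun measurableSet_Ioi (hgreen x hx), integral_neg,
              sub_eq_add_neg]
        · intro hY
          refine ⟨fun x hx => ?_, fun x hx => ?_, hg.2 hY.bounded⟩
          · have h1 := hY.integrable x hx
            rw [hset x hx] at h1
            have h2 : IntegrableOn (fun t => -green h c ρ x t
              (tensorDeriv (potential q t) (k + 1) (Y t))) (Ioi x) :=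
              h1.congr_fun (hgreen x hx).symm measurableSet_Ioi
            exact integrable_neg_iff.1 h2
          · rw [hY.equation x hx, hset x hx, hfree x hx,
              ← setIntegral_congr_fun measurableSet_Ioi (hgreen x hx), integral_neg,
              sub_eq_add_neg]
      rw [hiff']
      exact ⟨fun hY => hY.congr_ae N (potential_neg q).symm, fun hY => hY.congr_ae N
        (potential_neg q)⟩
    rw [hiff, N.isTensorSolution_iff (isPotential_potential hp (-q)) (hTeq (-q)) hρ]
    refine forall_congr' fun x => forall_congr' fun hx => ?_
    rw [hfree x (NNReal.coe_pos.2 hx), hw]
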